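/- **Setting.** Let $0<g<\tfrac23$, $q=e^{i\pi g}$ (and $q^x=e^{i\pi g x}$), $\mathbf e_1=(\tfrac12,-\tfrac{\sqrt3}2)$, $\mathbf e_2=(-1,0)$, $\mathbf e_3=(\tfrac12,\tfrac{\sqrt3}2)$, $\mathbf w_1=(1,\tfrac1{\sqrt3})$, $\mathbf w_2=(0,-\tfrac2{\sqrt3})$, $\mathbf w_3=(-1,\tfrac1{\sqrt3})$; $\mathbf a\mathbf b$ is the bilinear scalar product. For $\mathbf p\in\mathbb C^2$ put $z_j=e^{2\pi i\,\mathbf w_j\mathbf p}$. Let $\mathcal F_{\mathbf p}$ be the Fock module with highest weight vector $|\mathbf p\rangle$ over the Heisenberg algebra $[X_a,P_b]=\frac{ig}2\delta_{ab}$, $[b_{a,n},b_{b,m}]=\frac{ng}2\delta_{n+m,0}\delta_{ab}$ ($a,b=1,2$), and let $$V_i(u)=q^{1/2}\,e^{-2\sum_{n\ge1}\frac{\mathbf e_i\mathbf b_{-n}}n e^{inu}}\;e^{-2i\,\mathbf e_i(\mathbf X+\mathbf Pu)}\;e^{\,2\sum_{n\ge1}\frac{\mathbf e_i\mathbf b_{n}}n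 e^{-inu}}$$ be the vertex operators, with values in the completion by levels. A product $V_{i_1}(u_1)\cdots V_{i_n}(u_n)|\mathbf p\rangle$ is the limit $r\to1^-$ (component by component) of the product with $r^{L}$ inserted between neighbouring factors, $L$ being the level operator. Put $$\mathbf G_1=z_1J_{312}+z_2J_{123}+z_3J_{231},\qquad J_{ijk}=\int_{2\pi\ge u_1\ge u_2\ge u_3\ge0}V_i(u_1)V_j(u_2)V_k(u_3)\,du_1du_2du_3 .$$ Consider representations of two independent $q$-oscillator algebras ($m=1,2$), $[\mathcal H_m,\mathbf a_m^\pm]=\pm\mathbf a_m^\pm$, $q\,\mathbf a_m^+\mathbf a_m^--q^{-1}\mathbf a_m^-\mathbf a_m^+=(q-q^{-1})^{-1}$, on spaces with a basis of joint eigenvectors of $\mathcal H_1,\mathcal H_2$. Let $$\rho_t(y_1)=q^{1/2}t(q-q^{-1})q^{-\mathcal H_2}\mathbf a_1^-\mathbf a_2^+,\quad \rho_t(y_2)=\mathbf a_2^-,\quad\rho_t(y_3)=\mathbf a_1^+q^{\mathcal H_2},$$ $$\rho_t(h_1)=-\mathcal H_1+\mathcal H_2,\quad\rho_t(h_2)=-\mathcal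 H_1-2\mathcal H_2,\quad\rho_t(h_3)=2\mathcal H_1+\mathcal H_2 .$$ For $(i,j,k)$ a cyclic permutation of $(1,2,3)$ let $\rho_i(t)=\rho_t\circ\tau^{1-i}$ and $\bar\rho_i(t)=\rho_{-t}\circ\tau^{1-i}\circ\sigma_{jk}$, where $\tau$ maps $y_s,h_s$ to $y_{s+1},h_{s+1}$ (indices mod 3) and $\sigma_{jk}$ exchanges the indices $j,k$. Let $\mathbf h=\frac23(\mathbf e_1h_1+\mathbf e_2h_2+\mathbf e_3h_3)$ and $$\mathcal D=\{\mathbf p\in\mathbb C^2:\ \mathrm{Im}\,\mathbf e_1\mathbf p<0,\ \mathrm{Im}\,\mathbf e_3\mathbf p<0\}.$$ For $\mathbf p\in\mathcal D$ and any representation for which $Z_i=\mathrm{Tr}_{\rho_i}e^{2\pi i\mathbf p\mathbf h}$ and the traces below converge absolutely and $Z_i\neq0$, define on $|\mathbf p\rangle$ $$\mathbf A_i(t)=1+\sum_{n\ge1}\ \sum_{\sigma\in\{1,2,3\}^{3n}}Z_i^{-1}\mathrm{Tr}_{\rho_i(t)}\!\big(e^{2\pi i\mathbf p\mathbf h}y_{\sigma_1}\cdots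 y_{\sigma_{3n}}\big)\int_{2\pi\ge u_1\ge\cdots\ge u_{3n}\ge0}V_{\sigma_1}(u_1)\cdots V_{\sigma_{3n}}(u_{3n})\,d^{3n}u ,$$ a formal power series in $t$, and $\overline{\mathbf A}_i(t)$ in the same way with $\bar\rho_i(t)$. With $s=i\,(g^{-1}\Gamma(1-g))^3t$, the numbers $H_n^{(i)(vac)}$, $\overline H_n^{(i)(vac)}$ are defined by $\log A_i^{(vac)}(t)=-\sum_{n\ge1}s^nH^{(i)(vac)}_n$, $\log\overline A_i^{(vac)}(t)=-\sum_{n\ge1}s^n\overline H^{(i)(vac)}_n$, where $A_i^{(vac)}(t)$, $\overline A_i^{(vac)}(t)$ are the vacuum-to-vacuum matrix elements of $\mathbf A_i(t)$, $\overline{\mathbf A}_i(t)$. **Theorem.** (0) For every permutation $(i,j,k)$ of $(1,2,3)$ and all $\mathbf p$ the products $V_i(u_1)V_j(u_2)V_k(u_3)|\mathbf p\rangle$ exist for $2\pi>u_1>u_2>u_3>0$, and their components are integrable over $2\pi\ge u_1\ge u_2\ge u_3\ge0$. For every $i$ there is a representation of the above kind which can be used for all $\mathbf p\in\mathcal D$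 in the definition of $\mathbf A_i$, and one for $\overline{\mathbf A}_i$. For each such representation $|\mathbf p\rangle$ is an eigenvector of the coefficients of $t$ in $\mathbf A_i(t)$ and $\overline{\mathbf A}_i(t)$. (1) For all $\mathbf p\in\mathbb C^2$, $\mathbf G_1|\mathbf p\rangle=G_1^{(vac)}|\mathbf p\rangle$, where, the integral being absolutely convergent, $$G_1^{(vac)}=z_2\int_0^{2\pi}du_3\int_{u_3}^{u_3+2\pi}du_1\int_{u_3}^{u_1}du_2\ \frac{e^{-2i\mathbf p(\mathbf e_1u_1+\mathbf e_2u_2+\mathbf e_3u_3)}}{\big[(2\sin\frac{u_1-u_2}2)(2\sin\frac{u_1-u_3}2)(2\sin\frac{u_2-u_3}2)\big]^g}.$$ (2) For $\mathrm{Re}\,x>-g$, $\mathrm{Re}\,y>-g$, with an absolutely convergent integral and series, $$J(x,y):=\int_0^1\frac{d\omega_1}{\omega_1}\int_0^1\frac{d\omega_2}{\omega_2}\frac{\omega_1^{x+g}\omega_2^{y+g}}{(1-\omega_1)^g(1-\omega_2)^g(1-\omega_1\omega_2)^g}=\frac{\Gamma(g+x)\Gamma(g+y)\Gamma^2(1-g)}{\Gamma(1+x)\Gamma(1+y)}\;{}_3F_2\!\left({g,\,g+x,\,g+y\atop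 1+x,\,1+y};1\right),$$ and $J$ continues analytically to the connected open set of all $(x,y)\in\mathbb C^2$ with $g+x,\,g+y\notin\{0,-1,-2,\dots\}$, by the regularised form $\Gamma(g+x)\Gamma(g+y)\Gamma(1-g)^2\sum_{n\ge0}\frac{(g)_n(g+x)_n(g+y)_n}{n!\,\Gamma(1+x+n)\Gamma(1+y+n)}$ of the right-hand side. Write $J_{ij}=J(2\mathbf e_i\mathbf p,-2\mathbf e_j\mathbf p)$ with this continuation. (3) For every cyclic permutation $(i,j,k)$ of $(1,2,3)$ and all $\mathbf p$ for which $J_{kj}$ and $J_{ij}$ are defined, $$G_1^{(vac)}=-2\pi q^{-3/2}\big[q(q^2z_i-z_j)J_{kj}-(q^2z_j-z_k)J_{ij}\big].$$ (4) For every cyclic permutation $(i,j,k)$ of $(1,2,3)$, every $\mathbf p\in\mathcal D$ and every representation admitted in the definition, $$H_1^{(i)(vac)}=-\frac{\pi g^3J_{kj}}{\Gamma^3(1-g)\sin(\pi g)},\qquad \overline H_1^{(i)(vac)}=\frac{\pi g^3J_{jk}}{\Gamma^3(1-g)\sin(\pi g)} ,$$ and the right-hand sides are the analytic continuations of the left-hand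 sides from $\mathcal D$ to the connected open set of all $\mathbf p\in\mathbb C^2$ for which $J_{kj}$ (respectively $J_{jk}$) is defined. (5) For $\mathbf p=(p,0)$ and all $p\in\mathbb C$ (with $1/\Gamma=0$ at the poles of $\Gamma$), $$G_1^{(vac)}=\frac{4\pi^3\,\Gamma^2(1-g)\,\Gamma(1-\frac{3g}2)}{\Gamma(1-\frac g2)\Gamma(1-g+p)\Gamma(1-g-p)\Gamma(1-\frac g2+p)\Gamma(1-\frac g2-p)} ,$$ and $H_1^{(1)(vac)}(p,0)$ is given for $\mathrm{Im}\,p<0$, and by analytic continuation in $p$ for all $p$ with $g+p,\ \frac g2+p\notin\{0,-1,-2,\dots\}$, by $$H_1^{(1)(vac)}=-\frac{\pi}{2\sin(\pi g)}\,\frac{g^3\,\Gamma(1-\frac{3g}2)}{\Gamma(1-\frac g2)\Gamma(1-g)}\,\frac{\Gamma(g+p)\Gamma(\frac g2+p)}{\Gamma(1-g+p)\Gamma(1-\frac g2+p)} .$$ -/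

import Mathlib

noncomputable section

namespace W3

/-! Vectors, scalar products and the parameter `q`.  The indices `1, 2, 3` of the roots are written
`0, 1, 2 : Fin 3`, so that `(i, i + 1, i + 2)` runs over the cyclic permutations. -/

/-- The vectors `e₁, e₂, e₃`. -/
def e : Fin 3 → Fin 2 → ℝ :=
  ![![1 / 2, -(√3 / 2)], ![-1, 0], ![1 / 2, √3 / 2]]

/-- The vectors `w₁, w₂, w₃`. -/
def w : Fin 3 → Fin 2 → ℝ :=
  ![![1, 1 / √3], ![0, -(2 / √3)], ![-1, 1 / √3]]

/-- The (bilinear) scalar product of a real vector and the vacuum parameter `p ∈ ℂ²`. -/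
def dot (a : Fin 2 → ℝ) (p : Fin 2 → ℂ) : ℂ := ∑ k, (a k : ℂ) * p k

/-- `q ^ x = exp (i π g x)`, where `q = exp (i π g)`. -/
def qpow (g : ℝ) (x : ℂ) : ℂ := Complex.exp (Complex.I * Real.pi * g * x)

/-- The eigenvalue of `z_j = exp (2 π i w_j P)` at momentum `p`. -/
def z (j : Fin 3) (p : Fin 2 → ℂ) : ℂ := Complex.exp (2 * Real.pi * Complex.I * dot (w j) p)

/-! Fock modules and vertex operators. -/

/-- The index `(a, n)` labels the oscillator pair `b_{a, -(n+1)}`, `b_{a, n+1}`.  In the Fock module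
over `|p⟩`, realised as the polynomials in variables `x_{a, n}`, the operator `b_{a, -(n+1)}` is
multiplication by `x_{a, n}` and `b_{a, n+1}` is `((n+1) g / 2) ∂/∂x_{a, n}`;
the highest weight vector is `1`. -/
abbrev Osc : Type := Fin 2 × ℕ

/-- The Fock module, as a vector space. -/
abbrev Fock : Type := MvPolynomial Osc ℂ

/-- The completion of the Fock module (the product of its level subspaces). -/
abbrev FockHat : Type := MvPowerSeries Osc ℂ

/-- The vector with the given components in the monomial basis. -/
def ofCoeffs (f : (Osc →₀ ℕ) → ℂ) : FockHat := f

theorem coeff_ofCoeffs (f : (Osc →₀ ℕ) → ℂ) (m : Osc →₀ ℕ) :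
    MvPowerSeries.coeff m (ofCoeffs f) = f m := rfl

/-- The highest weight vector. -/
def vacuum : FockHat := 1

/-- The level (eigenvalue of `L₀` minus that of the vacuum) of a basis monomial. -/
def level (m : Osc →₀ ℕ) : ℕ := m.sum fun κ k => k * (κ.2 + 1)

/-- The exponential series of the linear form `∑ c_κ x_κ`. -/
def expLinear (c : Osc → ℂ) : FockHat :=
  ofCoeffs fun m => m.prod fun κ k => c κ ^ k / (k.factorial : ℂ)

/-- `exp (-2 ∑_{n ≥ 1} (e_i b_{-n}) e^{inu} / n)`. -/
def creationExp (i : Fin 3) (u : ℝ) : FockHat :=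
  expLinear fun κ => -2 * (e i κ.1 : ℂ) / ((κ.2 : ℂ) + 1) *
    Complex.exp (Complex.I * ((κ.2 : ℂ) + 1) * u)

/-- `exp (2 ∑_{n ≥ 1} (e_i b_n) e^{-inu} / n)`, which is `exp (∑ d_κ ∂/∂x_κ)` with
`d_{a, n} = g (e_i)_a e^{-i (n+1) u}`, that is, the shift `x_κ ↦ x_κ + d_κ`. -/
def annihilationExp (g : ℝ) (i : Fin 3) (u : ℝ) : Fock →ₐ[ℂ] Fock :=
  MvPolynomial.aeval fun κ => MvPolynomial.X κ + MvPolynomial.C ((g : ℂ) * (e i κ.1 : ℂ) *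
    Complex.exp (-(Complex.I * ((κ.2 : ℂ) + 1) * u)))

/-- The vertex operator `V_i(u) = q^{1/2} :exp (-2 e_i φ(u)):` on the Fock module over `|p⟩`, with
values in the completed Fock module over `|p - g e_i⟩`.  As `[X, P] = i g / 2` in each component
and `e_i e_i = 1`, the zero mode factor is
`exp (-2i e_i (X + P u)) = exp (-2i e_i X) exp (-2i u e_i P + i g u)`,
and `exp (-2i e_i X)` is the shift `|p⟩ ↦ |p - g e_i⟩`. -/
def vertexOp (g : ℝ) (i : Fin 3) (u : ℝ) (p : Fin 2 → ℂ) (f : Fock) : FockHat :=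
  (qpow g (1 / 2) * Complex.exp (-(2 * Complex.I * u * dot (e i) p) + Complex.I * g * u)) •
    (creationExp i u * (annihilationExp g i u f : FockHat))

/-- A product of vertex operators is given as the list of the pairs `(i, u)`, in the order in
which the operators are written, the leftmost first.  This is the momentum reached from `|p⟩`. -/
def momentum (g : ℝ) (p : Fin 2 → ℂ) : List (Fin 3 × ℝ) → Fin 2 → ℂ
  | [] => p
  | (i, _) :: l => fun k => momentum g p l k - g * e i k

/-- The regularised product `V_{i₁}(u₁) r^L V_{i₂}(u₂) r^L ⋯ r^L V_{iₙ}(uₙ) |p⟩`, `0 < r < 1`, where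
`L` is the level operator; each product is a sum over the basis of intermediate states. -/
def regProduct (g : ℝ) (p : Fin 2 → ℂ) (r : ℝ) : List (Fin 3 × ℝ) → FockHat
  | [] => vacuum
  | (i, u) :: l => ofCoeffs fun m => ∑' m' : Osc →₀ ℕ,
      ((r : ℂ) ^ level m' * MvPowerSeries.coeff m' (regProduct g p r l)) *
        MvPowerSeries.coeff m (vertexOp g i u (momentum g p l) (MvPolynomial.monomial m' 1))

/-- The vector `V_{i₁}(u₁) ⋯ V_{iₙ}(uₙ) |p⟩`: the limit `r → 1` of the regularised product. -/
def vertexProduct (g : ℝ) (p : Fin 2 → ℂ) (l : List (Fin 3 × ℝ)) : FockHat :=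
  ofCoeffs fun m => Filter.limUnder (nhdsWithin (1 : ℝ) (Set.Iio 1))
    fun r => MvPowerSeries.coeff m (regProduct g p r l)

/-- All the sums over intermediate states in `regProduct` converge. -/
def RegSummable (g : ℝ) (p : Fin 2 → ℂ) (r : ℝ) : List (Fin 3 × ℝ) → Prop
  | [] => True
  | (i, u) :: l => RegSummable g p r l ∧ ∀ m : Osc →₀ ℕ, Summable fun m' : Osc →₀ ℕ =>
      ((r : ℂ) ^ level m' * MvPowerSeries.coeff m' (regProduct g p r l)) *
        MvPowerSeries.coeff m (vertexOp g i u (momentum g p l) (MvPolynomial.monomial m' 1))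

/-- The product of vertex operators, applied to `|p⟩`, is well defined. -/
def ProductConverges (g : ℝ) (p : Fin 2 → ℂ) (l : List (Fin 3 × ℝ)) : Prop :=
  (∀ r : ℝ, 0 < r → r < 1 → RegSummable g p r l) ∧
  ∀ m : Osc →₀ ℕ, ∃ c : ℂ, Filter.Tendsto
    (fun r : ℝ => MvPowerSeries.coeff m (regProduct g p r l))
    (nhdsWithin (1 : ℝ) (Set.Iio 1)) (nhds c)

/-- The ordered domain `2π ≥ u₁ ≥ ⋯ ≥ uₙ ≥ 0`. -/
def orderedDomain (n : ℕ) : Set (Fin n → ℝ) :=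
  {u | Antitone u ∧ ∀ a, u a ∈ Set.Icc 0 (2 * Real.pi)}

/-- The word `V_{σ₁}(u₁) ⋯ V_{σₙ}(uₙ)`. -/
def word {n : ℕ} (σ : Fin n → Fin 3) (u : Fin n → ℝ) : List (Fin 3 × ℝ) :=
  List.ofFn fun a => (σ a, u a)

/-- The ordered integral of `V_{σ₁}(u₁) ⋯ V_{σₙ}(uₙ)`, applied to `|p⟩`. -/
def orderedIntegral (g : ℝ) (p : Fin 2 → ℂ) {n : ℕ} (σ : Fin n → Fin 3) : FockHat :=
  ofCoeffs fun m => ∫ u in orderedDomain n, MvPowerSeries.coeff m (vertexProduct g p (word σ u))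

/-- `G_n |p⟩`, for the nonlocal integral of motion
`G_n = z₁ J⁽ⁿ⁾₃₁₂ + z₂ J⁽ⁿ⁾₁₂₃ + z₃ J⁽ⁿ⁾₂₃₁`, `n ≥ 1`, where `J⁽ⁿ⁾_{ijk}` is the ordered integral of
the product of `n` blocks `V_i V_j V_k`; its total charge is `0`, so that the `z_i` act at
momentum `p`. -/
def nonlocalG (g : ℝ) (p : Fin 2 → ℂ) (n : ℕ) : FockHat :=
  ∑ i : Fin 3, z i p • orderedIntegral g p
    (fun a : Fin (3 * n) => i + 2 + Fin.ofNat 3 (a : ℕ))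

/-- The vacuum eigenvalue of `G₁`. -/
def G1vac (g : ℝ) (p : Fin 2 → ℂ) : ℂ := MvPowerSeries.coeff 0 (nonlocalG g p 1)

/-! The `q`-oscillator representations and the operators `A_i(t)`. -/

/-- The diagonal operator with the given eigenvalues. -/
def diagOp {ι : Type} (f : ι → ℂ) : Module.End ℂ (ι →₀ ℂ) :=
  Finsupp.lsum ℂ fun v => f v • Finsupp.lsingle v

/-- A representation of two independent `q`-oscillator algebras with generators
`a_m^±`, `H_m` (`m = 1, 2`), on a space with a basis of joint eigenvectors of `H₁, H₂`. -/
structure OscRep (g : ℝ) (ι : Type) where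
  H : Fin 2 → ι → ℂ
  ap : Fin 2 → Module.End ℂ (ι →₀ ℂ)
  am : Fin 2 → Module.End ℂ (ι →₀ ℂ)
  H_ap : ∀ m l, diagOp (H m) * ap l - ap l * diagOp (H m) = if m = l then ap l else 0
  H_am : ∀ m l, diagOp (H m) * am l - am l * diagOp (H m) = if m = l then -am l else 0
  osc : ∀ m, qpow g 1 • (ap m * am m) - qpow g (-1) • (am m * ap m) =
    (qpow g 1 - qpow g (-1))⁻¹ • (1 : Module.End ℂ (ι →₀ ℂ))
  ap_ap : Commute (ap 0) (ap 1)
  am_am : Commute (am 0) (am 1)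
  ap_am : ∀ m l, m ≠ l → Commute (ap m) (am l)

/-- The homomorphism `ρ_t` on the generators `y₁, y₂, y₃`. -/
def rhoY {g : ℝ} {ι : Type} (π : OscRep g ι) (t : ℂ) : Fin 3 → Module.End ℂ (ι →₀ ℂ) :=
  ![(qpow g (1 / 2) * t * (qpow g 1 - qpow g (-1))) •
      (diagOp (fun v => qpow g (-(π.H 1 v))) * π.am 0 * π.ap 1),
    π.am 1,
    π.ap 0 * diagOp (fun v => qpow g (π.H 1 v))]

/-- The homomorphism `ρ_t` on the generators `h₁, h₂, h₃` (eigenvalues). -/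
def rhoH {g : ℝ} {ι : Type} (π : OscRep g ι) : Fin 3 → ι → ℂ :=
  ![fun v => -π.H 0 v + π.H 1 v, fun v => -π.H 0 v - 2 * π.H 1 v, fun v => 2 * π.H 0 v + π.H 1 v]

/-- The permutation of the generators of the Borel subalgebra which precedes `ρ_{±t}`:
`τ^{-i+1}` for `A_i`, and `τ^{-i+1} σ_{jk}` for `Ā_i` (`bar = true`), where `τ : s ↦ s + 1` and
`(i, j, k)` is cyclic. -/
def relabel (bar : Bool) (i s : Fin 3) : Fin 3 :=
  (if bar then Equiv.swap (i + 1) (i + 2) s else s) - i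

/-- The eigenvalues of `exp (2π i p h)`, `h = (2/3) (e₁ h₁ + e₂ h₂ + e₃ h₃)`, in the
representation of the Borel subalgebra defined by `ρ_i` (or by `ρ̄_i`). -/
def twist {g : ℝ} {ι : Type} (π : OscRep g ι) (bar : Bool) (i : Fin 3) (p : Fin 2 → ℂ) (v : ι) :
    ℂ :=
  Complex.exp (2 * Real.pi * Complex.I *
    ((2 / 3) * ∑ s : Fin 3, dot (e s) p * rhoH π (relabel bar i s) v))

/-- The product `y_{σ₁} ⋯ y_{σₙ}` in the representation `ρ_i(1)` (or `ρ̄_i(1)`). -/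
def yWord {g : ℝ} {ι : Type} (π : OscRep g ι) (bar : Bool) (i : Fin 3) {n : ℕ}
    (σ : Fin n → Fin 3) : Module.End ℂ (ι →₀ ℂ) :=
  (List.ofFn fun a => rhoY π (if bar then -1 else 1) (relabel bar i (σ a))).prod

/-- The diagonal matrix elements of `exp (2π i p h) y_{σ₁} ⋯ y_{σₙ}`. -/
def diagTerm {g : ℝ} {ι : Type} (π : OscRep g ι) (bar : Bool) (i : Fin 3) (p : Fin 2 → ℂ) {n : ℕ}
    (σ : Fin n → Fin 3) (v : ι) : ℂ :=
  twist π bar i p v * yWord π bar i σ (Finsupp.single v 1) v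

/-- The normalising trace `Z_i` (or `Z̄_i`). -/
def Z {g : ℝ} {ι : Type} (π : OscRep g ι) (bar : Bool) (i : Fin 3) (p : Fin 2 → ℂ) : ℂ :=
  ∑' v, twist π bar i p v

/-- The representation `π` may be used in the definition of `A_i(t)` (or `Ā_i(t)`) at `p`:
all the traces converge, and the normalising trace does not vanish. -/
def Admissible {g : ℝ} {ι : Type} (π : OscRep g ι) (bar : Bool) (i : Fin 3) (p : Fin 2 → ℂ) :
    Prop :=
  Summable (twist π bar i p) ∧ Z π bar i p ≠ 0 ∧
  ∀ (n : ℕ) (σ : Fin n → Fin 3), Summable (diagTerm π bar i p σ)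

/-- The coefficient `a_n(σ₁, …, σₙ)` at `t = 1`. -/
def aCoeff {g : ℝ} {ι : Type} (π : OscRep g ι) (bar : Bool) (i : Fin 3) (p : Fin 2 → ℂ) {n : ℕ}
    (σ : Fin n → Fin 3) : ℂ :=
  (Z π bar i p)⁻¹ * ∑' v, diagTerm π bar i p σ v

/-- The coefficient of `t ^ n` in `A_i(t) |p⟩` (or `Ā_i(t) |p⟩`), for `n ≥ 1`.  A word of length `3n`
has a nonzero coefficient only if it has total charge zero; it then contains the generator
proportional to `t` exactly `n` times. -/
def aState {g : ℝ} {ι : Type} (π : OscRep g ι) (bar : Bool) (i : Fin 3) (p : Fin 2 → ℂ) (n : ℕ) :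
    FockHat :=
  ∑ σ : Fin (3 * n) → Fin 3, aCoeff π bar i p σ • orderedIntegral g p σ

/-- The vacuum eigenvalue of `A_i(t)` (or `Ā_i(t)`), as a power series in `t`. -/
def Avac {g : ℝ} {ι : Type} (π : OscRep g ι) (bar : Bool) (i : Fin 3) (p : Fin 2 → ℂ) :
    PowerSeries ℂ :=
  PowerSeries.mk fun n =>
    if n = 0 then 1 else MvPowerSeries.coeff 0 (aState π bar i p n)

/-- The ratio `s / t = i (g⁻¹ Γ(1 - g))³`. -/
def sRatio (g : ℝ) : ℂ := Complex.I * ((g : ℂ)⁻¹ * Complex.Gamma (1 - g)) ^ 3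

/-- The vacuum eigenvalues `H_n^{(i)(vac)}` (or `H̄_n^{(i)(vac)}`), defined by
`log A_i(t) = -∑_{n ≥ 1} s ^ n H_n^{(i)}`. -/
def Hvac {g : ℝ} {ι : Type} (π : OscRep g ι) (bar : Bool) (i : Fin 3) (n : ℕ) (p : Fin 2 → ℂ) :
    ℂ :=
  -(PowerSeries.coeff n (PowerSeries.logOf (Avac π bar i p)) / sRatio g ^ n)

/-- The domain `Im e₁ p < 0`, `Im e₃ p < 0`. -/
def pDomain : Set (Fin 2 → ℂ) := {p | (dot (e 0) p).im < 0 ∧ (dot (e 2) p).im < 0}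

/-! The hypergeometric integral. -/

/-- `a` is not a pole of the Gamma function. -/
def NotPole (a : ℂ) : Prop := ∀ n : ℕ, a ≠ -(n : ℂ)

/-- The integrand of `J(x, y)`, on the unit square. -/
def jIntegrand (g : ℝ) (x y : ℂ) (ω : ℝ × ℝ) : ℂ :=
  ((ω.1 : ℂ) ^ (x + g) * (ω.2 : ℂ) ^ (y + g) /
    (((1 - ω.1) ^ g * (1 - ω.2) ^ g * (1 - ω.1 * ω.2) ^ g : ℝ) : ℂ)) / (ω.1 : ℂ) / (ω.2 : ℂ)

/-- The unit square. -/
def unitSquare : Set (ℝ × ℝ) := Set.Ioo 0 1 ×ˢ Set.Ioo 0 1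

/-- The integral `J(x, y)`. -/
def jIntegral (g : ℝ) (x y : ℂ) : ℂ := ∫ ω in unitSquare, jIntegrand g x y ω

/-- The terms of the series `₃F₂(a, b, c; d, f; 1)`. -/
def threeFTwoTerm (a b c d f : ℂ) (n : ℕ) : ℂ :=
  (ascPochhammer ℂ n).eval a * (ascPochhammer ℂ n).eval b * (ascPochhammer ℂ n).eval c /
    ((ascPochhammer ℂ n).eval d * (ascPochhammer ℂ n).eval f * (n.factorial : ℂ))

/-- `J(x, y)` outside the domain of convergence of the integral:
`Γ(g+x) Γ(g+y) Γ(1-g)² / (Γ(1+x) Γ(1+y)) · ₃F₂(g, g+x, g+y; 1+x, 1+y; 1)`, written with the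
regularised series, so that `1 + x` and `1 + y` may be nonpositive integers. -/
def J (g : ℝ) (x y : ℂ) : ℂ :=
  Complex.Gamma (g + x) * Complex.Gamma (g + y) * Complex.Gamma (1 - g) ^ 2 *
    Complex.regularizedHGFun {(g : ℂ), g + x, g + y} {1 + x, 1 + y} 1

/-- `J_{ij} = J(2 e_i p, -2 e_j p)`. -/
def Jij (g : ℝ) (p : Fin 2 → ℂ) (i j : Fin 3) : ℂ := J g (2 * dot (e i) p) (-(2 * dot (e j) p))

/-- The set of all `p` for which `J_{ij}` is defined. -/
def regularSet (g : ℝ) (i j : Fin 3) : Set (Fin 2 → ℂ) :=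
  {p | NotPole (g + 2 * dot (e i) p) ∧ NotPole (g - 2 * dot (e j) p)}

/-- `F` on the connected open set `Ω` is an analytic continuation of `f` on the nonempty open
set `D ⊆ Ω`. -/
def IsAnalyticContinuation {E : Type} [NormedAddCommGroup E] [NormedSpace ℂ E] (f F : E → ℂ)
    (D Ω : Set E) : Prop :=
  IsOpen D ∧ D.Nonempty ∧ D ⊆ Ω ∧ IsOpen Ω ∧ IsPreconnected Ω ∧ AnalyticOnNhd ℂ F Ω ∧
    Set.EqOn F f D

/-! The Coulomb-type triple integral. -/

/-- The integrand of the triple integral. -/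
def coulombIntegrand (g : ℝ) (p : Fin 2 → ℂ) (u₁ u₂ u₃ : ℝ) : ℂ :=
  Complex.exp (-(2 * Complex.I * (dot (e 0) p * u₁ + dot (e 1) p * u₂ + dot (e 2) p * u₃))) /
    (((2 * Real.sin ((u₁ - u₂) / 2)) * (2 * Real.sin ((u₁ - u₃) / 2)) *
      (2 * Real.sin ((u₂ - u₃) / 2))) ^ g : ℝ)

/-- The domain `0 ≤ u₃ ≤ 2π`, `u₃ ≤ u₁ ≤ u₃ + 2π`, `u₃ ≤ u₂ ≤ u₁` of the triple integral. -/
def coulombDomain : Set (Fin 3 → ℝ) :=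
  {u | 0 ≤ u 2 ∧ u 2 ≤ 2 * Real.pi ∧ u 2 ≤ u 0 ∧ u 0 ≤ u 2 + 2 * Real.pi ∧ u 2 ≤ u 1 ∧ u 1 ≤ u 0}

/-- The triple integral. -/
def coulombIntegral (g : ℝ) (p : Fin 2 → ℂ) : ℂ :=
  ∫ u₃ in (0 : ℝ)..(2 * Real.pi), ∫ u₁ in u₃..(u₃ + 2 * Real.pi), ∫ u₂ in u₃..u₁,
    coulombIntegrand g p u₁ u₂ u₃

end W3

end

/-! Vertex operators and `r^L` map a coherent state `exp (∑ c_κ x_κ)` to a multiple of a coherent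
state, so every regularised product is a scalar times a coherent state (`regProduct_eq`). As `e_i
e_j = -1/2` for `i ≠ j`, each pair of different letters contributes a factor `(1 - R e^{iθ})^{-g}`.
For three different letters the phases of these factors cancel in the limit `r → 1` against those of
the zero modes. What remains is a plane wave times the weight `∏ (2 sin)^{-g}`, which is cyclically
symmetric.

Carrying the last operator of a word around the circle to the front changes only the plane wave, by
a ratio of two of the `z_j`. The three rotations of a word, weighted with these ratios, therefore
fill up one domain, the cyclically ordered triples of angles. Integration over the common rotation
removes every component of positive level and leaves `2π K` times the vacuum, where `K(α, β)`
(`triInt`) is an integral over a triangle of angle differences (`orderedIntegral_cyclic`). This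
gives the eigenvector property of `G₁` and the triple integral.

The link with `J` is an integral over the square `(0, 2π)²` of `e^{i(g+α)φ + i(g+β)ψ} [(1 -
e^{iφ})(1 - e^{iψ})(1 - e^{i(φ+ψ)})]^{-g}`. The line `φ + ψ = 2π` cuts the square into two
triangles, which give `K(α, β)` and `K(-α, -β)` with explicit phases. The binomial expansion of the
last factor makes every term a product of two circle integrals, and the sum is the series of `J(α,
β)` times two elementary factors (`triInt_add_reflect`). By a change of the base vertex
(`triInt_rotate`) the relations for two different `J` contain the same two integrals. Eliminating
one of them expresses `G₁` through `J`, first where a common factor does not vanish and then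
everywhere by continuity.

In the first coefficient of `A_i` only the six words with three different letters survive. Normal
ordering, cyclicity of the twisted trace and the oscillator relations give their traces
(`tr_number`). The two cyclic classes of words contribute `K(α, β)` and `K(-α, -β)` in just the
ratio of `triInt_add_reflect`, and the denominators of the trace cancel the elementary factors, so
that a single `J` remains (`aState_one`).

At `p = (p, 0)` the series is that of `J(p, 2p)`, which is well-poised. It is summed by Dixon's
theorem, proved by telescoping in `a → a + 2` and the limit `a → ∞` (`tsum_dixonTerm`), and
continued by the identity theorem. The bound `g < 2/3` is integrability where all three angles meet.
-/

noncomputable section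

namespace W3

open MeasureTheory Filter Topology Set

/-! The binomial series and termwise integration. -/

/-- The coefficients `(b)_n / n!` of the binomial series `(1 - z) ^ (-b)`. -/
def binom (b : ℝ) (n : ℕ) : ℝ := (ascPochhammer ℝ n).eval b / n.factorial

theorem binom_zero (b : ℝ) : binom b 0 = 1 := by simp [binom]

theorem binom_succ (b : ℝ) (n : ℕ) : binom b (n + 1) = binom b n * ((b + n) / (n + 1)) := by
  have h : (n.factorial : ℝ) ≠ 0 := by positivity
  have h' : (n : ℝ) + 1 ≠ 0 := by positivity
  simp only [binom, ascPochhammer_succ_right, Nat.factorial_succ, Polynomial.eval_mul,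
    Polynomial.eval_add, Polynomial.eval_X, Polynomial.eval_natCast]
  push_cast
  field_simp

theorem binom_pos {b : ℝ} (hb : 0 < b) (n : ℕ) : 0 < binom b n := by
  induction n with
  | zero => simp [binom_zero]
  | succ n ih => rw [binom_succ]; positivity

/-- The ratio of consecutive coefficients is `(b + n)/(n + 1) ≤ 1`. This lets a tail of a series be
compared with the full series at shifted parameters. -/
theorem binom_antitone {b : ℝ} (hb : 0 < b) (hb1 : b ≤ 1) : Antitone (binom b) := by
  refine antitone_nat_of_succ_le fun n => ?_
  rw [binom_succ]
  refine mul_le_of_le_one_right (binom_pos hb n).le ?_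
  rw [div_le_one (by positivity)]
  linarith

theorem ringChoose_eq_binom (b : ℝ) (n : ℕ) :
    Ring.choose (b + n - 1) n = binom b n := by
  have h1 : Ring.choose (b + n - 1) n = Ring.multichoose b n := by
    rw [Ring.choose]; congr 1; ring
  have h2 := Ring.factorial_nsmul_multichoose_eq_ascPochhammer b n
  rw [Polynomial.ascPochhammer_smeval_eq_eval, nsmul_eq_mul] at h2
  rw [h1, binom, ← h2]
  field_simp

theorem ringChoose_eq_binom_complex (b : ℝ) (n : ℕ) :
    Ring.choose ((b : ℂ) + n - 1) n = (binom b n : ℂ) := by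
  have := ringChoose_eq_binom b n
  rw [← this, Complex.ofReal_choose]
  push_cast; rfl

theorem ofReal_binom (b : ℝ) (n : ℕ) :
    (binom b n : ℂ) = (ascPochhammer ℂ n).eval (b : ℂ) / n.factorial := by
  rw [binom, Complex.ofReal_div, Complex.ofReal_natCast]
  congr 1
  induction n with
  | zero => simp
  | succ n ih => simp [ascPochhammer_succ_right, ih]

theorem hasSum_binom_complex (b : ℝ) {z : ℂ} (hz : ‖z‖ < 1) :
    HasSum (fun n => (binom b n : ℂ) * z ^ n) ((1 - z) ^ (-(b : ℂ))) := by
  have h := (Complex.one_div_one_sub_cpow_hasFPowerSeriesOnBall_zero (b : ℂ)).hasSum (y := z)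
    (by simpa [enorm_eq_nnnorm, ← NNReal.coe_lt_coe] using hz)
  simp only [zero_add, one_div, ← Complex.cpow_neg] at h
  refine h.congr_fun fun n => ?_
  rw [FormalMultilinearSeries.ofScalars_apply_eq, ringChoose_eq_binom_complex, smul_eq_mul]

theorem hasSum_binom {b t : ℝ} (ht : |t| < 1) :
    HasSum (fun n => binom b n * t ^ n) ((1 - t) ^ (-b)) := by
  have h := hasSum_binom_complex b (z := (t : ℂ)) (by simpa using ht)
  have h1 : 0 ≤ 1 - t := by linarith [(abs_lt.1 ht).2]
  have e : (1 - (t : ℂ)) ^ (-(b : ℂ)) = (((1 - t) ^ (-b) : ℝ) : ℂ) := by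
    rw [Complex.ofReal_cpow h1]; push_cast; rfl
  rw [e] at h
  exact_mod_cast h

/-- Termwise integration of a binomial series inside the interval of convergence. -/
theorem hasSum_integral_binom {X : Type*} [MeasurableSpace X] {μ : Measure X} {b : ℝ} (hb : 0 < b)
    {w : X → ℂ} {t : X → ℝ} (hw : AEStronglyMeasurable w μ) (ht : Measurable t)
    (h01 : ∀ᵐ x ∂μ, 0 ≤ t x ∧ t x < 1)
    (hint : Integrable (fun x => w x * ((1 - t x) ^ (-b) : ℝ)) μ) :
    HasSum (fun n => (binom b n : ℂ) * ∫ x, w x * (t x : ℂ) ^ n ∂μ)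
      (∫ x, w x * ((1 - t x) ^ (-b) : ℝ) ∂μ) := by
  -- Since `t ≥ 0` and the coefficients are positive, the norms of the terms add up to the norm of
  -- the integrand itself, so `hint` is all that domination needs.
  have key := hasSum_integral_of_dominated_convergence (μ := μ)
    (F := fun n x => (binom b n : ℂ) * (w x * (t x : ℂ) ^ n))
    (f := fun x => w x * ((1 - t x) ^ (-b) : ℝ))
    (fun n x => ‖w x‖ * (binom b n * t x ^ n))
    (fun n => (hw.mul ((Complex.measurable_ofReal.comp ht).pow_const n).aestronglyMeasurable).const_mul _)
    (fun n => ?_) ?_ ?_ ?_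
  · simpa only [integral_const_mul] using key
  · filter_upwards [h01] with x hx
    rw [norm_mul, norm_mul, norm_pow, Complex.norm_real, Complex.norm_real,
      Real.norm_of_nonneg (binom_pos hb n).le, Real.norm_of_nonneg hx.1]
    exact le_of_eq (by ring)
  · filter_upwards [h01] with x hx
    exact (hasSum_binom (abs_lt.2 ⟨by linarith, hx.2⟩)).summable.mul_left _
  · refine hint.norm.congr ?_
    filter_upwards [h01] with x hx
    rw [tsum_mul_left, (hasSum_binom (abs_lt.2 ⟨by linarith, hx.2⟩)).tsum_eq, norm_mul,
      Complex.norm_real, Real.norm_of_nonneg (Real.rpow_nonneg (by linarith) _)]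
  · filter_upwards [h01] with x hx
    have h := hasSum_binom (b := b) (t := t x) (abs_lt.2 ⟨by linarith, hx.2⟩)
    have h2 := (Complex.hasSum_ofReal.2 h).mul_left (w x)
    refine h2.congr_fun fun n => ?_
    push_cast; ring

/-- The absolutely convergent version of `hasSum_integral_binom`. -/
theorem summable_integral_norm_binom {X : Type*} [MeasurableSpace X] {μ : Measure X} {b : ℝ}
    (hb : 0 < b) {w : X → ℂ} {t : X → ℝ} (hw : AEStronglyMeasurable w μ) (ht : Measurable t)
    (h01 : ∀ᵐ x ∂μ, 0 ≤ t x ∧ t x < 1)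
    (hint : Integrable (fun x => w x * ((1 - t x) ^ (-b) : ℝ)) μ) :
    Summable (fun n => binom b n * ‖∫ x, w x * (t x : ℂ) ^ n ∂μ‖) := by
  have h1 : AEStronglyMeasurable (fun x => ((‖w x‖ : ℝ) : ℂ)) μ :=
    Complex.continuous_ofReal.comp_aestronglyMeasurable hw.norm
  -- With `w` replaced by its norm, the integrals in the expansion become those of the norms of the
  -- terms, which bound the series in question.
  have h := hasSum_integral_binom (μ := μ) hb (w := fun x => ((‖w x‖ : ℝ) : ℂ)) h1 ht h01 (by
    refine (Complex.ofRealCLM.integrable_comp hint.norm).congr ?_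
    filter_upwards [h01] with x hx
    simp only [Complex.ofRealCLM_apply]
    rw [norm_mul, Complex.norm_real, Real.norm_of_nonneg (Real.rpow_nonneg (by linarith) _)]
    push_cast; rfl)
  refine Summable.of_nonneg_of_le (fun n => mul_nonneg (binom_pos hb n).le (norm_nonneg _))
    (fun n => ?_) h.summable.norm
  rw [norm_mul, Complex.norm_real, Real.norm_of_nonneg (binom_pos hb n).le]
  refine mul_le_mul_of_nonneg_left ?_ (binom_pos hb n).le
  refine (norm_integral_le_integral_norm _).trans (le_of_eq ?_)
  have : ∫ x, ((‖w x‖ : ℝ) : ℂ) * (t x : ℂ) ^ n ∂μ = ((∫ x, ‖w x * (t x : ℂ) ^ n‖ ∂μ : ℝ) : ℂ) := by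
    rw [← integral_complex_ofReal]
    refine integral_congr_ae ?_
    filter_upwards [h01] with x hx
    rw [norm_mul, norm_pow, Complex.norm_real, Real.norm_of_nonneg hx.1]
    push_cast; rfl
  rw [this, Complex.norm_real, Real.norm_of_nonneg (integral_nonneg fun _ => norm_nonneg _)]

theorem one_sub_mem_slitPlane {z : ℂ} (hz : z ≠ 1) (hz' : ‖z‖ ≤ 1) :
    1 - z ∈ Complex.slitPlane := by
  rw [Complex.mem_slitPlane_iff]
  by_contra! h
  have h1 : z.im = 0 := by simpa using h.2
  have h2 : 1 ≤ z.re := by simpa using h.1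
  have h3 : z.re ≤ 1 := (Complex.re_le_norm z).trans hz'
  exact hz (Complex.ext (by simp; linarith) (by simpa using h1))

/-- Both `|1 - z| - |1 - r z|` and `|1 - r z|` compare with `1 - r`. The bound dominates `|1 - r
t|^{-b}` uniformly in `r` by a multiple of its value at `r = 1`. -/
theorem norm_one_sub_le_two_mul {z : ℂ} (hz : ‖z‖ ≤ 1) {r : ℝ} (hr0 : 0 ≤ r) (hr1 : r ≤ 1) :
    ‖1 - z‖ ≤ 2 * ‖1 - r * z‖ := by
  have h1 : ‖1 - z‖ ≤ ‖1 - r * z‖ + (1 - r) := by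
    have : 1 - z = (1 - r * z) + -((1 - r : ℝ) * z) := by push_cast; ring
    rw [this]
    refine (norm_add_le _ _).trans ?_
    rw [norm_neg, norm_mul, Complex.norm_real, Real.norm_of_nonneg (by linarith)]
    nlinarith [norm_nonneg z]
  have h2 : 1 - r ≤ ‖1 - r * z‖ := by
    have := norm_sub_norm_le (1 : ℂ) (r * z)
    rw [norm_one, norm_mul, Complex.norm_real, Real.norm_of_nonneg hr0] at this
    nlinarith [norm_nonneg z]
  linarith

/-- Termwise integration of a binomial series on the boundary of the disc of convergence, by Abel
summation. -/
theorem hasSum_integral_binom_boundary {X : Type*} [MeasurableSpace X] {μ : Measure X} {b : ℝ}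
    (hb : 0 < b) {w t : X → ℂ} (hw : Integrable w μ) (ht : Measurable t)
    (h01 : ∀ᵐ x ∂μ, ‖t x‖ ≤ 1 ∧ t x ≠ 1)
    (hint : Integrable (fun x => w x * (1 - t x) ^ (-(b : ℂ))) μ)
    (hsum : Summable fun n => binom b n * ‖∫ x, w x * t x ^ n ∂μ‖) :
    HasSum (fun n => (binom b n : ℂ) * ∫ x, w x * t x ^ n ∂μ)
      (∫ x, w x * (1 - t x) ^ (-(b : ℂ)) ∂μ) := by
  have hs : Summable (fun n => (binom b n : ℂ) * ∫ x, w x * t x ^ n ∂μ) := by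
    refine Summable.of_norm (hsum.congr fun n => ?_)
    rw [norm_mul, Complex.norm_real, Real.norm_of_nonneg (binom_pos hb n).le]
  have inner : ∀ r ∈ Ioo (0 : ℝ) 1, HasSum
      (fun n => ((binom b n : ℂ) * ∫ x, w x * t x ^ n ∂μ) * (r : ℂ) ^ n)
      (∫ x, w x * (1 - r * t x) ^ (-(b : ℂ)) ∂μ) := by
    intro r hr
    have hr' : |r| < 1 := by rw [abs_of_pos hr.1]; exact hr.2
    have key := hasSum_integral_of_dominated_convergence (μ := μ)
      (F := fun n x => (binom b n : ℂ) * (r : ℂ) ^ n * (w x * t x ^ n))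
      (f := fun x => w x * (1 - r * t x) ^ (-(b : ℂ)))
      (fun n x => ‖w x‖ * (binom b n * r ^ n))
      (fun n => (hw.1.mul (ht.pow_const n).aestronglyMeasurable).const_mul _)
      (fun n => ?_) ?_ ?_ ?_
    · simp only [integral_const_mul] at key
      refine key.congr_fun fun n => ?_
      ring
    · filter_upwards [h01] with x hx
      rw [norm_mul, norm_mul, norm_mul, norm_pow, norm_pow, Complex.norm_real, Complex.norm_real,
        Real.norm_of_nonneg (binom_pos hb n).le, Real.norm_of_nonneg hr.1.le]
      have : ‖t x‖ ^ n ≤ 1 := pow_le_one₀ (norm_nonneg _) hx.1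
      have h2 : 0 ≤ binom b n * r ^ n * ‖w x‖ :=
        mul_nonneg (mul_nonneg (binom_pos hb n).le (pow_nonneg hr.1.le n)) (norm_nonneg _)
      nlinarith
    · exact .of_forall fun x => (hasSum_binom hr').summable.mul_left _
    · simp_rw [tsum_mul_left]
      exact hw.norm.mul_const _
    · filter_upwards [h01] with x hx
      have hlt : ‖(r : ℂ) * t x‖ < 1 := by
        rw [norm_mul, Complex.norm_real, Real.norm_of_nonneg hr.1.le]
        nlinarith [hr.1, hr.2, hx.1, norm_nonneg (t x)]
      refine ((hasSum_binom_complex b hlt).mul_left (w x)).congr_fun fun n => ?_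
      rw [mul_pow]; ring
  -- The integral is continuous up to the boundary `r = 1`, with the integrable majorant `2^b` times
  -- the limiting integrand.
  have lim1 : Tendsto (fun r : ℝ => ∫ x, w x * (1 - r * t x) ^ (-(b : ℂ)) ∂μ)
      (𝓝[<] (1 : ℝ)) (𝓝 (∫ x, w x * (1 - t x) ^ (-(b : ℂ)) ∂μ)) := by
    refine tendsto_integral_filter_of_dominated_convergence
      (fun x => 2 ^ b * ‖w x * (1 - t x) ^ (-(b : ℂ))‖) ?_ ?_ (hint.norm.const_mul _) ?_
    · refine .of_forall fun r => hw.1.mul (Measurable.aestronglyMeasurable ?_)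
      fun_prop
    · filter_upwards [Ioo_mem_nhdsLT (zero_lt_one' ℝ)] with r hr
      filter_upwards [h01] with x hx
      have hle := norm_one_sub_le_two_mul hx.1 hr.1.le hr.2.le
      have hpos : 0 < ‖1 - t x‖ := norm_pos_iff.2 (sub_ne_zero.2 (Ne.symm hx.2))
      rw [norm_mul, norm_mul, ← Complex.ofReal_neg, Complex.norm_cpow_real, Complex.norm_cpow_real]
      have h2 : ‖1 - r * t x‖ ^ (-b) ≤ (‖1 - t x‖ / 2) ^ (-b) :=
        Real.rpow_le_rpow_of_nonpos (by positivity) (by linarith) (by linarith)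
      rw [Real.div_rpow hpos.le (by norm_num), Real.rpow_neg (by norm_num : (0 : ℝ) ≤ 2),
        div_inv_eq_mul] at h2
      calc ‖w x‖ * ‖1 - r * t x‖ ^ (-b) ≤ ‖w x‖ * (‖1 - t x‖ ^ (-b) * 2 ^ b) := by gcongr
        _ = _ := by ring
    · filter_upwards [h01] with x hx
      refine Tendsto.const_mul _ ?_
      have hc : ContinuousAt (fun r : ℝ => (1 - r * t x) ^ (-(b : ℂ))) 1 := by
        refine ContinuousAt.cpow (by fun_prop) continuousAt_const ?_
        simpa using one_sub_mem_slitPlane hx.2 hx.1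
      have := hc.tendsto
      simp only [Complex.ofReal_one, one_mul] at this
      exact this.mono_left nhdsWithin_le_nhds
  -- Abel's theorem gives the same limit for the series, whose convergence at `r = 1` is the
  -- assumption `hsum`.
  have lim2 := Complex.tendsto_tsum_powerSeries_nhdsWithin_lt hs.hasSum.tendsto_sum_nat
  have lim2' : Tendsto (fun r : ℝ => ∫ x, w x * (1 - r * t x) ^ (-(b : ℂ)) ∂μ)
      (𝓝[<] (1 : ℝ)) (𝓝 (∑' n, (binom b n : ℂ) * ∫ x, w x * t x ^ n ∂μ)) := by
    have := (Filter.tendsto_map'_iff.1 lim2)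
    refine this.congr' ?_
    filter_upwards [Ioo_mem_nhdsLT (zero_lt_one' ℝ)] with r hr
    exact (inner r hr).tsum_eq
  rw [tendsto_nhds_unique lim1 lim2']
  exact hs.hasSum

/-! The Beta integral. -/

theorem betaIntegrand_eq {u : ℂ} {v t : ℝ} (ht : t ∈ Ioo (0 : ℝ) 1) :
    (t : ℂ) ^ (u - 1) * ((1 - t) ^ (v - 1) : ℝ) = (t : ℂ) ^ (u - 1) * (1 - (t : ℂ)) ^ ((v : ℂ) - 1) := by
  rw [Complex.ofReal_cpow (by linarith [ht.2])]
  push_cast; rfl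

theorem integrableOn_beta {u : ℂ} {v : ℝ} (hu : 0 < u.re) (hv : 0 < v) :
    IntegrableOn (fun t : ℝ => (t : ℂ) ^ (u - 1) * ((1 - t) ^ (v - 1) : ℝ)) (Ioo 0 1) := by
  have h := Complex.betaIntegral_convergent hu (v := (v : ℂ)) (by simpa using hv)
  rw [intervalIntegrable_iff_integrableOn_Ioo_of_le zero_le_one] at h
  exact h.congr_fun (fun t ht => (betaIntegrand_eq ht).symm) measurableSet_Ioo

theorem integral_beta {u : ℂ} {v : ℝ} (hu : 0 < u.re) (hv : 0 < v) :
    ∫ t in Ioo (0 : ℝ) 1, (t : ℂ) ^ (u - 1) * ((1 - t) ^ (v - 1) : ℝ) =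
      Complex.Gamma u * Complex.Gamma v / Complex.Gamma (u + v) := by
  rw [← Complex.betaIntegral_eq_Gamma_mul_div u v hu (by simpa using hv), Complex.betaIntegral,
    intervalIntegral.integral_of_le zero_le_one, integral_Ioc_eq_integral_Ioo]
  exact setIntegral_congr_fun measurableSet_Ioo fun t ht => betaIntegrand_eq ht

end W3

end

noncomputable section

namespace W3

open MeasureTheory Filter Topology Set

/-! The integral `J(x, y)` as a series. -/

/-- The ratio `Γ(g + x + n) / Γ(1 + x + n)`. -/
def gammaRatio (g : ℝ) (x : ℂ) (n : ℕ) : ℂ :=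
  Complex.Gamma (g + x + n) / Complex.Gamma (1 + x + n)

theorem gammaRatio_add (g : ℝ) (x : ℂ) (n N : ℕ) :
    gammaRatio g x (n + N) = gammaRatio g (x + N) n := by
  simp only [gammaRatio]
  push_cast
  congr 2 <;> ring

theorem integral_beta_pow {g : ℝ} (hg1 : g < 1) {x : ℂ} (hx : -g < x.re) (n : ℕ) :
    ∫ t in Ioo (0 : ℝ) 1, ((t : ℂ) ^ (x + g - 1) * ((1 - t) ^ (-g) : ℝ)) * (t : ℂ) ^ n =
      Complex.Gamma (1 - g) * gammaRatio g x n := by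
  have hn : (0 : ℝ) ≤ n := n.cast_nonneg
  have h := integral_beta (u := g + x + n) (v := 1 - g) (by simp; linarith) (by linarith)
  have e : ∀ t ∈ Ioo (0 : ℝ) 1, ((t : ℂ) ^ (x + g - 1) * ((1 - t) ^ (-g) : ℝ)) * (t : ℂ) ^ n =
      (t : ℂ) ^ (g + x + n - 1) * ((1 - t) ^ ((1 - g) - 1) : ℝ) := by
    intro t ht
    have : (t : ℂ) ≠ 0 := by exact_mod_cast ht.1.ne'
    rw [show (g + x + n - 1 : ℂ) = (x + g - 1) + n by ring, Complex.cpow_add _ _ this,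
      Complex.cpow_natCast, show (1 - g) - 1 = -g by ring]
    ring
  rw [setIntegral_congr_fun measurableSet_Ioo e, h, gammaRatio]
  push_cast
  rw [show (g + x + n + (1 - g) : ℂ) = 1 + x + n by ring]
  ring

theorem integrableOn_beta' {b : ℝ} (hb : b < 1) {u : ℂ} (hu : 0 < u.re) :
    IntegrableOn (fun t : ℝ => (t : ℂ) ^ (u - 1) * ((1 - t) ^ (-b) : ℝ)) (Ioo 0 1) := by
  simpa using integrableOn_beta (v := 1 - b) hu (by linarith)

/-- The factor of the integrand of `J(x, y)` which factorises. -/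
def jWeight (g : ℝ) (x y : ℂ) (ω : ℝ × ℝ) : ℂ :=
  ((ω.1 : ℂ) ^ (x + g - 1) * ((1 - ω.1) ^ (-g) : ℝ)) *
    ((ω.2 : ℂ) ^ (y + g - 1) * ((1 - ω.2) ^ (-g) : ℝ))

theorem measurableSet_unitSquare : MeasurableSet unitSquare :=
  measurableSet_Ioo.prod measurableSet_Ioo

theorem jIntegrand_eq (g : ℝ) (x y : ℂ) {ω : ℝ × ℝ} (h : ω ∈ unitSquare) :
    jIntegrand g x y ω = jWeight g x y ω * ((1 - ω.1 * ω.2) ^ (-g) : ℝ) := by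
  obtain ⟨⟨h1, h2⟩, h3, h4⟩ := h
  have e1 : (ω.1 : ℂ) ≠ 0 := by exact_mod_cast h1.ne'
  have e2 : (ω.2 : ℂ) ≠ 0 := by exact_mod_cast h3.ne'
  have h5 : ω.1 * ω.2 < 1 := by nlinarith
  rw [jIntegrand, jWeight, Complex.cpow_sub _ _ e1, Complex.cpow_sub _ _ e2,
    Complex.cpow_one, Complex.cpow_one,
    Real.rpow_neg (by linarith), Real.rpow_neg (by linarith), Real.rpow_neg (by linarith)]
  push_cast
  rw [div_eq_mul_inv, div_eq_mul_inv, div_eq_mul_inv, div_eq_mul_inv, div_eq_mul_inv, mul_inv,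
    mul_inv]
  ring

/-- The exponent is divided evenly between the bounds `1 - ab ≥ 1 - a` and `1 - ab ≥ 1 - b`. Each
variable of `J` then carries the singularity `(1 - ω)^{-3g/2}`, which is integrable because `g <
2/3`. -/
theorem rpow_one_sub_mul_le {g a b : ℝ} (hg : 0 < g) (ha : a ∈ Ioo (0 : ℝ) 1)
    (hb : b ∈ Ioo (0 : ℝ) 1) :
    (1 - a * b) ^ (-g) ≤ (1 - a) ^ (-(g / 2)) * (1 - b) ^ (-(g / 2)) := by
  obtain ⟨a0, a1⟩ := ha
  obtain ⟨b0, b1⟩ := hb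
  have h1 : 1 - a ≤ 1 - a * b := by nlinarith
  have h2 : 1 - b ≤ 1 - a * b := by nlinarith
  have h3 : 0 < 1 - a := by linarith
  have h4 : 0 < 1 - b := by linarith
  have h5 : (1 - a * b) ^ (-g) = (1 - a * b) ^ (-(g / 2)) * (1 - a * b) ^ (-(g / 2)) := by
    rw [← Real.rpow_add (by linarith)]; congr 1; ring
  rw [h5]
  exact mul_le_mul (Real.rpow_le_rpow_of_nonpos h3 h1 (by linarith))
    (Real.rpow_le_rpow_of_nonpos h4 h2 (by linarith)) (Real.rpow_nonneg (by linarith) _)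
    (Real.rpow_nonneg (by linarith) _)

theorem restrict_unitSquare : (volume : Measure (ℝ × ℝ)).restrict unitSquare =
    ((volume : Measure ℝ).restrict (Ioo 0 1)).prod ((volume : Measure ℝ).restrict (Ioo 0 1)) := by
  rw [Measure.prod_restrict]; rfl

theorem measurable_jWeight (g : ℝ) (x y : ℂ) : Measurable (jWeight g x y) := by
  unfold jWeight
  fun_prop

theorem integrableOn_jWeight_mul {g : ℝ} (hg0 : 0 < g) (hg1 : g < 2 / 3) {x y : ℂ}
    (hx : -g < x.re) (hy : -g < y.re) :
    IntegrableOn (fun ω => jWeight g x y ω * ((1 - ω.1 * ω.2) ^ (-g) : ℝ)) unitSquare := by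
  have hx' := integrableOn_beta' (b := 3 * g / 2) (by linarith) (u := x + g) (by simp; linarith)
  have hy' := integrableOn_beta' (b := 3 * g / 2) (by linarith) (u := y + g) (by simp; linarith)
  have hp := Integrable.mul_prod hx' hy'
  rw [← restrict_unitSquare] at hp
  refine hp.mono ((measurable_jWeight g x y).mul (by fun_prop)).aestronglyMeasurable ?_
  refine (ae_restrict_iff' measurableSet_unitSquare).2 (.of_forall fun ω h => ?_)
  have hb := rpow_one_sub_mul_le hg0 h.1 h.2
  obtain ⟨⟨h1, h2⟩, h3, h4⟩ := h
  have p1 : 0 < 1 - ω.1 := by linarith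
  have p2 : 0 < 1 - ω.2 := by linarith
  have h5 : 0 < 1 - ω.1 * ω.2 := by nlinarith
  simp only [jWeight, norm_mul, Complex.norm_real]
  rw [Real.norm_of_nonneg (Real.rpow_nonneg p1.le _), Real.norm_of_nonneg (Real.rpow_nonneg p2.le _),
    Real.norm_of_nonneg (Real.rpow_nonneg h5.le _), Real.norm_of_nonneg (Real.rpow_nonneg p1.le _),
    Real.norm_of_nonneg (Real.rpow_nonneg p2.le _),
    show -(3 * g / 2) = -g + -(g / 2) by ring, Real.rpow_add p1, Real.rpow_add p2]
  set A := ‖(ω.1 : ℂ) ^ (x + g - 1)‖ * (1 - ω.1) ^ (-g) * (‖(ω.2 : ℂ) ^ (y + g - 1)‖ * (1 - ω.2) ^ (-g))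
    with hA
  calc A * (1 - ω.1 * ω.2) ^ (-g)
      ≤ A * ((1 - ω.1) ^ (-(g / 2)) * (1 - ω.2) ^ (-(g / 2))) :=
        mul_le_mul_of_nonneg_left hb (by positivity)
    _ = _ := by rw [hA]; ring

theorem integrableOn_jIntegrand {g : ℝ} (hg0 : 0 < g) (hg1 : g < 2 / 3) {x y : ℂ}
    (hx : -g < x.re) (hy : -g < y.re) : IntegrableOn (jIntegrand g x y) unitSquare :=
  (integrableOn_jWeight_mul hg0 hg1 hx hy).congr_fun
    (fun _ h => (jIntegrand_eq g x y h).symm) measurableSet_unitSquare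

theorem integral_jWeight_mul_pow {g : ℝ} (hg1 : g < 1) {x y : ℂ} (hx : -g < x.re)
    (hy : -g < y.re) (n : ℕ) :
    ∫ ω in unitSquare, jWeight g x y ω * ((ω.1 * ω.2 : ℝ) : ℂ) ^ n =
      Complex.Gamma (1 - g) ^ 2 * (gammaRatio g x n * gammaRatio g y n) := by
  rw [restrict_unitSquare]
  have : ∀ ω : ℝ × ℝ, jWeight g x y ω * ((ω.1 * ω.2 : ℝ) : ℂ) ^ n =
      (((ω.1 : ℂ) ^ (x + g - 1) * ((1 - ω.1) ^ (-g) : ℝ)) * (ω.1 : ℂ) ^ n) *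
      (((ω.2 : ℂ) ^ (y + g - 1) * ((1 - ω.2) ^ (-g) : ℝ)) * (ω.2 : ℂ) ^ n) := by
    intro ω
    rw [jWeight]
    push_cast
    ring
  simp_rw [this]
  rw [integral_prod_mul (fun t : ℝ => ((t : ℂ) ^ (x + g - 1) * ((1 - t) ^ (-g) : ℝ)) * (t : ℂ) ^ n)
    (fun t : ℝ => ((t : ℂ) ^ (y + g - 1) * ((1 - t) ^ (-g) : ℝ)) * (t : ℂ) ^ n),
    integral_beta_pow hg1 hx, integral_beta_pow hg1 hy]
  ring

theorem ae_unitSquare_mul : ∀ᵐ ω ∂(volume : Measure (ℝ × ℝ)).restrict unitSquare,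
    0 ≤ ω.1 * ω.2 ∧ ω.1 * ω.2 < 1 := by
  refine (ae_restrict_iff' measurableSet_unitSquare).2 (.of_forall fun ω h => ?_)
  obtain ⟨⟨h1, h2⟩, h3, h4⟩ := h
  constructor <;> nlinarith

theorem hasSum_jIntegral {g : ℝ} (hg0 : 0 < g) (hg1 : g < 2 / 3) {x y : ℂ}
    (hx : -g < x.re) (hy : -g < y.re) :
    HasSum (fun n => (binom g n : ℂ) *
      (Complex.Gamma (1 - g) ^ 2 * (gammaRatio g x n * gammaRatio g y n))) (jIntegral g x y) := by
  have h := hasSum_integral_binom hg0 (μ := (volume : Measure (ℝ × ℝ)).restrict unitSquare)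
    (w := jWeight g x y) (t := fun ω => ω.1 * ω.2) (measurable_jWeight g x y).aestronglyMeasurable
    (by fun_prop) ae_unitSquare_mul (integrableOn_jWeight_mul hg0 hg1 hx hy)
  simp_rw [integral_jWeight_mul_pow (by linarith : g < 1) hx hy] at h
  rwa [jIntegral, setIntegral_congr_fun measurableSet_unitSquare (fun _ h => jIntegrand_eq g x y h)]

theorem Gamma_one_sub_ne_zero {g : ℝ} (hg : g < 1) : Complex.Gamma (1 - g) ≠ 0 :=
  Complex.Gamma_ne_zero_of_re_pos (by simpa using hg)

/-- Absolute convergence of the series is read off from that of the integral, without asymptotics of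
the Gamma function. -/
theorem summable_gammaRatio_of_re {g : ℝ} (hg0 : 0 < g) (hg1 : g < 2 / 3) {x y : ℂ}
    (hx : -g < x.re) (hy : -g < y.re) :
    Summable (fun n => binom g n * ‖gammaRatio g x n * gammaRatio g y n‖) := by
  have h := summable_integral_norm_binom hg0 (μ := (volume : Measure (ℝ × ℝ)).restrict unitSquare)
    (w := jWeight g x y) (t := fun ω => ω.1 * ω.2) (measurable_jWeight g x y).aestronglyMeasurable
    (by fun_prop) ae_unitSquare_mul (integrableOn_jWeight_mul hg0 hg1 hx hy)
  simp_rw [integral_jWeight_mul_pow (by linarith : g < 1) hx hy] at h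
  have h0 : ‖Complex.Gamma (1 - g) ^ 2‖ ≠ 0 :=
    norm_ne_zero_iff.2 (pow_ne_zero _ (Gamma_one_sub_ne_zero (by linarith)))
  refine (h.mul_right (‖Complex.Gamma (1 - g) ^ 2‖⁻¹)).congr fun n => ?_
  rw [norm_mul (Complex.Gamma (1 - g) ^ 2)]
  field_simp

/-- Dropping `N` terms shifts `x` and `y` by `N` into the half plane of convergence, and the
binomial coefficients only decrease under the shift. -/
theorem summable_gammaRatio {g : ℝ} (hg0 : 0 < g) (hg1 : g < 2 / 3) (x y : ℂ) :
    Summable (fun n => binom g n * ‖gammaRatio g x n * gammaRatio g y n‖) := by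
  obtain ⟨N, hN⟩ := exists_nat_gt (max (-x.re) (-y.re))
  have h1 := (le_max_left _ _).trans_lt hN
  have h2 := (le_max_right _ _).trans_lt hN
  rw [← summable_nat_add_iff N]
  refine Summable.of_nonneg_of_le (fun n => mul_nonneg (binom_pos hg0 _).le (norm_nonneg _))
    (fun n => ?_) (summable_gammaRatio_of_re hg0 hg1 (x := x + N) (y := y + N)
      (by simp; linarith) (by simp; linarith))
  rw [gammaRatio_add, gammaRatio_add]
  exact mul_le_mul_of_nonneg_right (binom_antitone hg0 (by linarith) (by omega)) (norm_nonneg _)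

/-- In the Beta integral `|t^x| ≤ 1` for `Re x ≥ 0`. The bound is uniform in `x` and serves as the
majorant in the proof of analyticity. -/
theorem norm_gammaRatio_le {g : ℝ} (hg0 : 0 < g) (hg1 : g < 1) {x : ℂ} (hx : 0 ≤ x.re) (n : ℕ) :
    ‖gammaRatio g x n‖ ≤ ‖gammaRatio g 0 n‖ := by
  have hG : 0 < ‖Complex.Gamma (1 - g)‖ := norm_pos_iff.2 (Gamma_one_sub_ne_zero hg1)
  refine le_of_mul_le_mul_left ?_ hG
  rw [← norm_mul, ← norm_mul, ← integral_beta_pow hg1 (by linarith : -g < x.re),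
    ← integral_beta_pow hg1 (by simpa using hg0 : -g < (0 : ℂ).re)]
  have e : ∫ t in Ioo (0 : ℝ) 1, ((t : ℂ) ^ ((0 : ℂ) + g - 1) * ((1 - t) ^ (-g) : ℝ)) * (t : ℂ) ^ n =
      ((∫ t in Ioo (0 : ℝ) 1, (t ^ (g - 1) * (1 - t) ^ (-g)) * t ^ n : ℝ) : ℂ) := by
    rw [← integral_complex_ofReal]
    refine setIntegral_congr_fun measurableSet_Ioo fun t ht => ?_
    simp only [zero_add]
    push_cast
    rw [Complex.ofReal_cpow ht.1.le]
    push_cast; rfl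
  rw [e, Complex.norm_real, Real.norm_of_nonneg (setIntegral_nonneg measurableSet_Ioo fun t ht => by
    have := ht.1; have : 0 ≤ 1 - t := by linarith [ht.2]
    positivity)]
  refine norm_integral_le_of_norm_le ?_ ?_
  · have := (integrableOn_beta' hg1 (u := ((g + n : ℝ) : ℂ)) (by simp; positivity)).norm
    refine Integrable.congr this ?_
    refine (ae_restrict_iff' measurableSet_Ioo).2 (.of_forall fun t ht => ?_)
    have h1 : 0 ≤ 1 - t := by linarith [ht.2]
    simp only [norm_mul]
    rw [← Complex.ofReal_one, ← Complex.ofReal_sub, ← Complex.ofReal_cpow ht.1.le, Complex.norm_real,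
      Complex.norm_real, Real.norm_of_nonneg (Real.rpow_nonneg ht.1.le _),
      Real.norm_of_nonneg (Real.rpow_nonneg h1 _), show g + n - 1 = (g - 1) + n by ring,
      Real.rpow_add ht.1, Real.rpow_natCast]
    ring
  · refine (ae_restrict_iff' measurableSet_Ioo).2 (.of_forall fun t ht => ?_)
    have h1 : 0 ≤ 1 - t := by linarith [ht.2]
    rw [norm_mul, norm_mul, Complex.norm_real, Real.norm_of_nonneg (Real.rpow_nonneg h1 _),
      Complex.norm_cpow_eq_rpow_re_of_pos ht.1, norm_pow, Complex.norm_real,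
      Real.norm_of_nonneg ht.1.le]
    have h2 : t ^ (x + g - 1).re ≤ t ^ (g - 1) :=
      Real.rpow_le_rpow_of_exponent_ge ht.1 ht.2.le (by simp; linarith)
    have := ht.1.le
    gcongr

/-! The continuation of `J`. -/

theorem Gamma_mul_ascPochhammer {z : ℂ} (hz : NotPole z) (n : ℕ) :
    Complex.Gamma z * (ascPochhammer ℂ n).eval z = Complex.Gamma (z + n) := by
  rw [← Complex.Gamma_add_nat_div_Gamma_eq z hz, mul_div_cancel₀ _ (Complex.Gamma_ne_zero hz)]

/-- `Γ(g + x)` is absorbed by the Pochhammer symbol, which requires that it be no pole. For `1 + x`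
no condition is needed: `Complex.Gamma` is `0` at its poles, so that division by it is the entire
function `1/Γ`. -/
theorem J_eq_tsum (g : ℝ) {x y : ℂ} (hx : NotPole (g + x)) (hy : NotPole (g + y)) :
    J g x y = ∑' n, (binom g n : ℂ) *
      (Complex.Gamma (1 - g) ^ 2 * (gammaRatio g x n * gammaRatio g y n)) := by
  rw [J, Complex.regularizedHGFun, FormalMultilinearSeries.sum, ← tsum_mul_left]
  congr 1; ext n
  rw [Complex.regularizedHGFunSeries, FormalMultilinearSeries.ofScalars_apply_eq,
    Complex.regularizedHGFunCoeff, ofReal_binom]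
  simp only [Multiset.insert_eq_cons, Multiset.map_cons, Multiset.map_singleton,
    Multiset.prod_cons, Multiset.prod_singleton, one_pow, smul_eq_mul, mul_one, gammaRatio]
  rw [← Gamma_mul_ascPochhammer hx, ← Gamma_mul_ascPochhammer hy]
  simp only [div_eq_mul_inv, mul_inv]
  ring

theorem hasSum_J {g : ℝ} (hg0 : 0 < g) (hg1 : g < 2 / 3) {x y : ℂ} (hx : NotPole (g + x))
    (hy : NotPole (g + y)) : HasSum (fun n => (binom g n : ℂ) *
      (Complex.Gamma (1 - g) ^ 2 * (gammaRatio g x n * gammaRatio g y n))) (J g x y) := by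
  rw [J_eq_tsum g hx hy]
  refine Summable.hasSum (Summable.of_norm ?_)
  refine ((summable_gammaRatio hg0 hg1 x y).mul_left ‖Complex.Gamma (1 - g) ^ 2‖).congr fun n => ?_
  simp only [norm_mul]
  rw [Complex.norm_real, Real.norm_of_nonneg (binom_pos hg0 _).le]
  ring

theorem notPole_of_re_pos {z : ℂ} (hz : 0 < z.re) : NotPole z := by
  rintro n rfl
  have : (0 : ℝ) ≤ n := n.cast_nonneg
  simp at hz; linarith

theorem notPole_of_im_ne_zero {z : ℂ} (hz : z.im ≠ 0) : NotPole z := by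
  rintro n rfl
  simp at hz

theorem jIntegral_eq_J {g : ℝ} (hg0 : 0 < g) (hg1 : g < 2 / 3) {x y : ℂ}
    (hx : -g < x.re) (hy : -g < y.re) : jIntegral g x y = J g x y :=
  (hasSum_jIntegral hg0 hg1 hx hy).unique (hasSum_J hg0 hg1
    (notPole_of_re_pos (by simp; linarith)) (notPole_of_re_pos (by simp; linarith)))

theorem hasSum_threeFTwoTerm {g : ℝ} (hg0 : 0 < g) (hg1 : g < 2 / 3) {x y : ℂ}
    (hx : -g < x.re) (hy : -g < y.re) :
    Summable (threeFTwoTerm g (g + x) (g + y) (1 + x) (1 + y)) ∧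
    jIntegral g x y = Complex.Gamma (g + x) * Complex.Gamma (g + y) * Complex.Gamma (1 - g) ^ 2 /
          (Complex.Gamma (1 + x) * Complex.Gamma (1 + y)) *
          ∑' n, threeFTwoTerm g (g + x) (g + y) (1 + x) (1 + y) n := by
  have p1 : NotPole (g + x) := notPole_of_re_pos (by simp; linarith)
  have p2 : NotPole (g + y) := notPole_of_re_pos (by simp; linarith)
  have p3 : NotPole (1 + x) := notPole_of_re_pos (by simp; linarith)
  have p4 : NotPole (1 + y) := notPole_of_re_pos (by simp; linarith)
  set C := Complex.Gamma (g + x) * Complex.Gamma (g + y) * Complex.Gamma (1 - g) ^ 2 /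
          (Complex.Gamma (1 + x) * Complex.Gamma (1 + y)) with hC
  have n1 := Complex.Gamma_ne_zero p1
  have n2 := Complex.Gamma_ne_zero p2
  have n3 := Complex.Gamma_ne_zero p3
  have n4 := Complex.Gamma_ne_zero p4
  have n5 := Gamma_one_sub_ne_zero (show g < 1 by linarith)
  have hC0 : C ≠ 0 := by rw [hC]; positivity
  have h := hasSum_jIntegral hg0 hg1 hx hy
  have e : ∀ n, (binom g n : ℂ) * (Complex.Gamma (1 - g) ^ 2 * (gammaRatio g x n * gammaRatio g y n))
      = C * threeFTwoTerm g (g + x) (g + y) (1 + x) (1 + y) n := by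
    intro n
    rw [threeFTwoTerm, ofReal_binom, gammaRatio, gammaRatio, ← Gamma_mul_ascPochhammer p1,
      ← Gamma_mul_ascPochhammer p2, ← Gamma_mul_ascPochhammer p3, ← Gamma_mul_ascPochhammer p4, hC]
    simp only [div_eq_mul_inv, mul_inv]
    ring
  simp_rw [e] at h
  have hs := (summable_mul_left_iff hC0).1 h.summable
  exact ⟨hs, by rw [← h.tsum_eq, tsum_mul_left]⟩

end W3

end

noncomputable section

namespace W3

open MeasureTheory Filter Topology Set

/-! Analyticity of `J` in two variables, by a pairing of analytic functions with values in `ℓ²`. -/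

/-- The bilinear pairing `∑ u_n v_n` on `ℓ²`. -/
def ellTwoPairing : lp (fun _ : ℕ => ℂ) 2 →L[ℂ] lp (fun _ : ℕ => ℂ) 2 →L[ℂ] ℂ :=
  (innerSL ℂ).comp ((starₗᵢ ℂ : lp (fun _ : ℕ => ℂ) 2 ≃ₗᵢ⋆[ℂ] lp (fun _ : ℕ => ℂ) 2) :
    lp (fun _ : ℕ => ℂ) 2 →L⋆[ℂ] lp (fun _ : ℕ => ℂ) 2)

theorem ellTwoPairing_apply (u v : lp (fun _ : ℕ => ℂ) 2) :
    ellTwoPairing u v = ∑' n, u n * v n := by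
  have : ellTwoPairing u v = inner ℂ (star u) v := rfl
  rw [this, lp.inner_eq_tsum]
  congr 1; ext n
  simp [mul_comm]

/-- The sum is the bilinear pairing of `G(x)` and `G(y)`, where `G(x)` is the sequence `√(c n) f n
x` in `ℓ²`. `G` is a uniform limit of its truncations and hence holomorphic in one variable; joint
analyticity follows by composition with a continuous bilinear map. -/
theorem analyticOnNhd_tsum_mul {U : Set ℂ} (hU : IsOpen U) {c M : ℕ → ℝ} {f : ℕ → ℂ → ℂ}
    (hc : ∀ n, 0 ≤ c n) (hf : ∀ n, DifferentiableOn ℂ (f n) U) (hM : ∀ n, ∀ x ∈ U, ‖f n x‖ ≤ M n)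
    (hs : Summable fun n => c n * M n ^ 2) :
    AnalyticOnNhd ℂ (fun v : ℂ × ℂ => ∑' n, (c n : ℂ) * (f n v.1 * f n v.2)) (U ×ˢ U) := by
  set a : ℕ → ℂ → ℂ := fun n x => (√(c n) : ℂ) * f n x with ha
  have hbd : ∀ n, ∀ x ∈ U, ‖a n x‖ ^ 2 ≤ c n * M n ^ 2 := by
    intro n x hx
    have h1 := hM n x hx
    simp only [ha, norm_mul, mul_pow, Complex.norm_real, Real.norm_of_nonneg (Real.sqrt_nonneg _),
      Real.sq_sqrt (hc n)]
    have := hc n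
    gcongr
  have hmem : ∀ x ∈ U, Memℓp (fun n => a n x) 2 := by
    intro x hx
    refine memℓp_gen ?_
    refine Summable.of_nonneg_of_le (fun n => by positivity) (fun n => ?_) hs
    simpa using hbd n x hx
  classical
  set G : ℂ → lp (fun _ : ℕ => ℂ) 2 := fun x => if h : x ∈ U then ⟨_, hmem x h⟩ else 0 with hG
  have hGa : ∀ x ∈ U, ∀ n, G x n = a n x := fun x hx n => by simp [hG, hx]
  set P : ℕ → ℂ → lp (fun _ : ℕ => ℂ) 2 := fun N x =>
    ∑ n ∈ Finset.range N, a n x • lp.single 2 n (1 : ℂ) with hP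
  have hPa : ∀ N x n, P N x n = if n < N then a n x else 0 := by
    intro N x n
    simp only [hP, lp.coeFn_sum, Finset.sum_apply, lp.coeFn_smul, Pi.smul_apply, lp.single_apply,
      smul_eq_mul, Pi.single_apply]
    simp
  -- The distance of `G` from its truncations is bounded by the tail of the majorant, independently
  -- of `x`.
  have htail : Tendsto (fun N => √(∑' n, c (n + N) * M (n + N) ^ 2)) atTop (𝓝 0) := by
    have := (tendsto_sum_nat_add (fun n => c n * M n ^ 2)).sqrt
    simpa using this
  have hle : ∀ N, ∀ x ∈ U, ‖G x - P N x‖ ≤ √(∑' n, c (n + N) * M (n + N) ^ 2) := by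
    intro N x hx
    have hs' := (summable_nat_add_iff N).2 hs
    have hnn : 0 ≤ ∑' n, c (n + N) * M (n + N) ^ 2 :=
      tsum_nonneg fun n => mul_nonneg (hc _) (sq_nonneg _)
    refine lp.norm_le_of_tsum_le (by norm_num) (Real.sqrt_nonneg _) ?_
    have e : ∀ n, ‖(G x - P N x) n‖ ^ (2 : ENNReal).toReal =
        if n < N then 0 else ‖a n x‖ ^ 2 := by
      intro n
      have : (G x - P N x) n = G x n - P N x n := rfl
      rw [this, hGa x hx, hPa]
      split_ifs <;> simp
    simp_rw [e]
    have hsum : Summable fun n => if n < N then 0 else ‖a n x‖ ^ 2 := by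
      refine Summable.of_nonneg_of_le (fun n => ?_) (fun n => ?_) hs
      · split_ifs <;> positivity
      · split_ifs
        · exact mul_nonneg (hc _) (sq_nonneg _)
        · exact hbd n x hx
    rw [← hsum.sum_add_tsum_nat_add N, Finset.sum_eq_zero, zero_add]
    · rw [show (√(∑' n, c (n + N) * M (n + N) ^ 2)) ^ (2 : ENNReal).toReal =
        ∑' n, c (n + N) * M (n + N) ^ 2 by simp [Real.sq_sqrt hnn]]
      refine ((summable_nat_add_iff N).2 hsum).tsum_le_tsum (fun n => ?_) hs'
      rw [if_neg (by omega)]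
      exact hbd _ x hx
    · intro n hn
      rw [if_pos (Finset.mem_range.1 hn)]
  have hdiff : DifferentiableOn ℂ G U := by
    refine TendstoLocallyUniformlyOn.differentiableOn (F := P) (φ := atTop) ?_
      (.of_forall fun N => ?_) hU
    · refine TendstoUniformlyOn.tendstoLocallyUniformlyOn ?_
      rw [Metric.tendstoUniformlyOn_iff]
      intro ε hε
      filter_upwards [htail.eventually (gt_mem_nhds hε)] with N hN x hx
      rw [dist_eq_norm]
      exact (hle N x hx).trans_lt hN
    · refine DifferentiableOn.fun_sum fun n _ => ?_
      exact ((hf n).const_mul _).smul_const _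
  have hGan : AnalyticOnNhd ℂ G U := hdiff.analyticOnNhd hU
  have key : AnalyticOnNhd ℂ (fun v : ℂ × ℂ => ellTwoPairing (G v.1) (G v.2)) (U ×ˢ U) := by
    intro v hv
    exact (ellTwoPairing.analyticAt_bilinear (G v.1, G v.2)).comp₂
      ((hGan v.1 hv.1).comp analyticAt_fst) ((hGan v.2 hv.2).comp analyticAt_snd)
  refine key.congr (hU.prod hU) fun v hv => ?_
  simp only [ellTwoPairing_apply]
  congr 1; ext n
  rw [hGa _ hv.1, hGa _ hv.2]
  simp only [ha]
  have : ((√(c n) : ℝ) : ℂ) * (√(c n) : ℝ) = c n := by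
    rw [← Complex.ofReal_mul, Real.mul_self_sqrt (hc n)]
  linear_combination (f n v.1 * f n v.2) * this

theorem isClosed_neg_natCast : IsClosed (range fun n : ℕ => -(n : ℂ)) := by
  have h : IsClosedEmbedding (fun n : ℕ => -(((n : ℝ)) : ℂ)) :=
    (Homeomorph.neg ℂ).isClosedEmbedding.comp
      (Complex.isometry_ofReal.isClosedEmbedding.comp Nat.isClosedEmbedding_coe_real)
  simpa using h.isClosed_range

theorem isOpen_notPole : IsOpen {z : ℂ | NotPole z} := by
  have : {z : ℂ | NotPole z} = (range fun n : ℕ => -(n : ℂ))ᶜ := by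
    ext z; simp [NotPole, eq_comm]
  rw [this]
  exact isClosed_neg_natCast.isOpen_compl

theorem countable_not_notPole (c : ℂ) : {z : ℂ | ¬ NotPole (c + z)}.Countable := by
  refine (countable_range fun n : ℕ => -(n : ℂ) - c).mono fun z hz => ?_
  simp only [NotPole, mem_ofPred_eq, not_forall, not_not] at hz
  obtain ⟨n, hn⟩ := hz
  exact ⟨n, by simp [← hn]⟩

/-- The plane has real dimension two, so a countable set does not disconnect it. The excluded poles
always form such a set. -/
theorem isPreconnected_compl_countable {s : Set ℂ} (hs : s.Countable) : IsPreconnected sᶜ :=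
  (hs.isConnected_compl_of_one_lt_rank (by simp [Complex.rank_real_complex])).isPreconnected

theorem isPreconnected_notPole (c : ℂ) : IsPreconnected {z : ℂ | NotPole (c + z)} := by
  have := isPreconnected_compl_countable (countable_not_notPole c)
  simpa [compl_ofPred] using this

/-- The domain of the continuation of `J`. -/
def jDomain (g : ℝ) : Set (ℂ × ℂ) := {v | NotPole (g + v.1) ∧ NotPole (g + v.2)}

theorem isOpen_jDomain (g : ℝ) : IsOpen (jDomain g) :=
  (isOpen_notPole.preimage (by fun_prop : Continuous fun v : ℂ × ℂ => (g : ℂ) + v.1)).inter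
    (isOpen_notPole.preimage (by fun_prop : Continuous fun v : ℂ × ℂ => (g : ℂ) + v.2))

theorem isPreconnected_jDomain (g : ℝ) : IsPreconnected (jDomain g) :=
  (isPreconnected_notPole g).prod (isPreconnected_notPole g)

theorem NotPole.add_natCast {z : ℂ} (h : NotPole z) (n : ℕ) : NotPole (z + n) := by
  intro m hm
  refine h (m + n) ?_
  push_cast
  linear_combination hm

theorem differentiableAt_gammaRatio {g : ℝ} {x : ℂ} (hx : NotPole (g + x)) (n : ℕ) :
    DifferentiableAt ℂ (fun x => gammaRatio g x n) x := by
  unfold gammaRatio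
  simp only [div_eq_mul_inv]
  refine DifferentiableAt.mul ?_ ?_
  · exact (Complex.differentiableAt_Gamma _ (hx.add_natCast n)).comp x (f := fun x => (g : ℂ) + x + n)
      (by fun_prop)
  · exact (Complex.differentiable_one_div_Gamma _).comp x (f := fun x => (1 : ℂ) + x + n)
      (by fun_prop)

theorem analyticAt_gammaRatio {g : ℝ} {x : ℂ} (hx : NotPole (g + x)) (n : ℕ) :
    AnalyticAt ℂ (fun x => gammaRatio g x n) x := by
  have h : IsOpen {x : ℂ | NotPole (g + x)} := isOpen_notPole.preimage (by fun_prop)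
  exact DifferentiableOn.analyticAt (s := {x : ℂ | NotPole (g + x)})
    (fun y hy => (differentiableAt_gammaRatio hy n).differentiableWithinAt) (h.mem_nhds hx)

/-- Near a given point finitely many terms are analytic one by one. The rest, after a shift by a
large `N`, has its arguments in the right half plane, where `gammaRatio g 0` is a majorant. -/
theorem analyticOnNhd_J {g : ℝ} (hg0 : 0 < g) (hg1 : g < 2 / 3) :
    AnalyticOnNhd ℂ (fun v : ℂ × ℂ => J g v.1 v.2) (jDomain g) := by
  intro v hv
  obtain ⟨N, hN⟩ := exists_nat_gt (max (-v.1.re) (-v.2.re))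
  have h1 := (le_max_left _ _).trans_lt hN
  have h2 := (le_max_right _ _).trans_lt hN
  have tail := analyticOnNhd_tsum_mul (U := {x : ℂ | 0 < x.re})
    (isOpen_lt continuous_const Complex.continuous_re)
    (c := fun n => binom g (n + N)) (f := fun n x => gammaRatio g x n)
    (M := fun n => ‖gammaRatio g 0 n‖) (fun n => (binom_pos hg0 _).le)
    (fun n x hx => (differentiableAt_gammaRatio (notPole_of_re_pos
      (by have : 0 < x.re := hx
          simp; linarith)) n).differentiableWithinAt)
    (fun n x hx => norm_gammaRatio_le hg0 (by linarith) (le_of_lt hx) n) (by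
      refine Summable.of_nonneg_of_le (fun n => mul_nonneg (binom_pos hg0 _).le (sq_nonneg _))
        (fun n => ?_) (summable_gammaRatio hg0 hg1 0 0)
      rw [norm_mul, ← sq]
      exact mul_le_mul_of_nonneg_right (binom_antitone hg0 (by linarith) (by omega)) (sq_nonneg _))
  have tail' : AnalyticAt ℂ (fun v : ℂ × ℂ => ∑' n, (binom g (n + N) : ℂ) *
      (gammaRatio g (v.1 + N) n * gammaRatio g (v.2 + N) n)) v := by
    have hmem : (v.1 + N, v.2 + N) ∈ {x : ℂ | 0 < x.re} ×ˢ {x : ℂ | 0 < x.re} :=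
      ⟨by simp; linarith, by simp; linarith⟩
    exact (tail _ hmem).comp (f := fun v : ℂ × ℂ => (v.1 + (N : ℂ), v.2 + (N : ℂ)))
      ((analyticAt_fst.add analyticAt_const).prod (analyticAt_snd.add analyticAt_const))
  have head : AnalyticAt ℂ (fun v : ℂ × ℂ => ∑ n ∈ Finset.range N, (binom g n : ℂ) *
      (gammaRatio g v.1 n * gammaRatio g v.2 n)) v := by
    refine Finset.analyticAt_fun_sum _ fun n _ => analyticAt_const.mul ?_
    exact ((analyticAt_gammaRatio hv.1 n).comp (f := Prod.fst) analyticAt_fst).mul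
      ((analyticAt_gammaRatio hv.2 n).comp (f := Prod.snd) analyticAt_snd)
  refine ((analyticAt_const (v := Complex.Gamma (1 - g) ^ 2)).mul (head.add tail')).congr ?_
  filter_upwards [(isOpen_jDomain g).mem_nhds hv] with u hu
  have hs := hasSum_J hg0 hg1 hu.1 hu.2
  rw [← hs.tsum_eq, ← hs.summable.sum_add_tsum_nat_add N, Pi.mul_apply, Pi.add_apply, mul_add,
    Finset.mul_sum, ← tsum_mul_left]
  congr 1
  · exact Finset.sum_congr rfl fun n _ => by ring
  · congr 1; ext n
    rw [gammaRatio_add, gammaRatio_add]; ring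

theorem isAnalyticContinuation_J {g : ℝ} (hg0 : 0 < g) (hg1 : g < 2 / 3) :
    IsAnalyticContinuation (E := ℂ × ℂ) (fun v => jIntegral g v.1 v.2)
      (fun v => J g v.1 v.2) {v | -g < v.1.re ∧ -g < v.2.re}
      {v | NotPole (g + v.1) ∧ NotPole (g + v.2)} := by
  refine ⟨?_, ⟨(0, 0), by simpa using hg0⟩, ?_, isOpen_jDomain g, isPreconnected_jDomain g,
    analyticOnNhd_J hg0 hg1, fun v hv => (jIntegral_eq_J hg0 hg1 hv.1 hv.2).symm⟩
  · exact (isOpen_lt continuous_const (Complex.continuous_re.comp continuous_fst)).inter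
      (isOpen_lt continuous_const (Complex.continuous_re.comp continuous_snd))
  · rintro v ⟨h1, h2⟩
    exact ⟨notPole_of_re_pos (by simp; linarith), notPole_of_re_pos (by simp; linarith)⟩

/-! The momentum domains. -/

theorem dot_sum (p : Fin 2 → ℂ) : dot (e 0) p + dot (e 1) p + dot (e 2) p = 0 := by
  simp [dot, e]
  ring

theorem continuous_dot (a : Fin 2 → ℝ) : Continuous (dot a) := by
  unfold dot; fun_prop

theorem analyticAt_dot (a : Fin 2 → ℝ) (p : Fin 2 → ℂ) : AnalyticAt ℂ (dot a) p := by
  have : dot a = fun p => ∑ k, (a k : ℂ) * p k := rfl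
  rw [this]
  refine Finset.analyticAt_fun_sum _ fun k _ => analyticAt_const.mul ?_
  exact (ContinuousLinearMap.proj (R := ℂ) (φ := fun _ : Fin 2 => ℂ) k).analyticAt p

theorem dot_smul_add (a : Fin 2 → ℝ) (s t : ℂ) (u v : Fin 2 → ℂ) :
    dot a (s • u + t • v) = s * dot a u + t * dot a v := by
  simp [dot]
  ring

/-- The dual basis of two different root vectors. -/
theorem exists_dual (i j : Fin 3) (hij : i ≠ j) : ∃ u v : Fin 2 → ℂ,
    dot (e i) u = 1 ∧ dot (e j) u = 0 ∧ dot (e i) v = 0 ∧ dot (e j) v = 1 ∧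
    ∀ p, p = dot (e i) p • u + dot (e j) p • v := by
  have h3 : (√3 : ℂ) * √3 = 3 := by
    rw [← Complex.ofReal_mul, Real.mul_self_sqrt (by norm_num)]; norm_num
  have h0 : (√3 : ℂ) ≠ 0 := by
    intro h; rw [h] at h3; norm_num at h3
  have h4 : (√3 : ℂ) ^ 2 = 3 := by rw [sq, h3]
  have aux : ∀ i j : Fin 3, i ≠ j → ∃ d : ℂ, d ≠ 0 ∧
      (e i 0 : ℂ) * e j 1 - (e i 1 : ℂ) * e j 0 = d := by
    intro i j hij
    refine ⟨_, ?_, rfl⟩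
    fin_cases i <;> fin_cases j <;> simp [e] at hij ⊢ <;> ring_nf <;> simp [h0]
  obtain ⟨d, hd, hdd⟩ := aux i j hij
  -- Cramer's rule, with `d` the determinant of the two root vectors.
  refine ⟨![e j 1 / d, -(e j 0) / d], ![-(e i 1) / d, e i 0 / d], ?_, ?_, ?_, ?_, ?_⟩
  · simp [dot]; field_simp; linear_combination hdd
  · simp [dot]; field_simp; ring
  · simp [dot]; field_simp; ring
  · simp [dot]; field_simp; linear_combination hdd
  · intro p
    ext k
    fin_cases k
    · simp [dot]; field_simp; linear_combination (-p 0) * hdd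
    · simp [dot]; field_simp; linear_combination (-p 1) * hdd

theorem isOpen_regularSet (g : ℝ) (i j : Fin 3) : IsOpen (regularSet g i j) := by
  have h1 := continuous_dot (e i)
  have h2 := continuous_dot (e j)
  exact (isOpen_notPole.preimage (by fun_prop : Continuous fun p => (g : ℂ) + 2 * dot (e i) p)).inter
    (isOpen_notPole.preimage (by fun_prop : Continuous fun p => (g : ℂ) - 2 * dot (e j) p))

/-- As `i ≠ j`, the numbers `2 e_i p` and `-2 e_j p` are linear coordinates, in which the set
becomes the product domain of `J`. -/
theorem isPreconnected_regularSet (g : ℝ) {i j : Fin 3} (hij : i ≠ j) :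
    IsPreconnected (regularSet g i j) := by
  obtain ⟨u, v, h1, h2, h3, h4, h5⟩ := exists_dual i j hij
  have : regularSet g i j = (fun x : ℂ × ℂ => (x.1 / 2) • u + (-x.2 / 2) • v) '' jDomain g := by
    ext p
    constructor
    · rintro ⟨ha, hb⟩
      refine ⟨(2 * dot (e i) p, -(2 * dot (e j) p)), ⟨ha, by simpa [sub_eq_add_neg] using hb⟩, ?_⟩
      conv_rhs => rw [h5 p]
      simp
    · rintro ⟨x, ⟨ha, hb⟩, rfl⟩
      constructor
      · simp only [dot_smul_add, h1, h3]
        convert ha using 1; ring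
      · simp only [dot_smul_add, h2, h4]
        convert hb using 1; ring
  rw [this]
  exact (isPreconnected_jDomain g).image _ (by fun_prop)

theorem analyticOnNhd_Jij {g : ℝ} (hg0 : 0 < g) (hg1 : g < 2 / 3) (i j : Fin 3) :
    AnalyticOnNhd ℂ (fun p => Jij g p i j) (regularSet g i j) := by
  intro p hp
  refine (analyticOnNhd_J hg0 hg1 (2 * dot (e i) p, -(2 * dot (e j) p))
    ⟨hp.1, by simpa [sub_eq_add_neg] using hp.2⟩).comp
    (f := fun p => (2 * dot (e i) p, -(2 * dot (e j) p))) ?_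
  exact (analyticAt_const.mul (analyticAt_dot _ p)).prod
    (analyticAt_const.mul (analyticAt_dot _ p)).neg

theorem isOpen_pDomain : IsOpen pDomain :=
  (isOpen_lt (Complex.continuous_im.comp (continuous_dot _)) continuous_const).inter
    (isOpen_lt (Complex.continuous_im.comp (continuous_dot _)) continuous_const)

theorem vec_mem_pDomain {p : ℂ} (hp : p.im < 0) : ![p, 0] ∈ pDomain := by
  constructor <;> simp [dot, e] <;> linarith

theorem pDomain_nonempty : pDomain.Nonempty :=
  ⟨![-Complex.I, 0], vec_mem_pDomain (by simp)⟩

theorem im_dot_neg_of_mem {p : Fin 2 → ℂ} (hp : p ∈ pDomain) {i : Fin 3} (hi : i ≠ 1) :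
    (dot (e i) p).im < 0 := by
  fin_cases i
  · exact hp.1
  · simp at hi
  · exact hp.2

theorem im_dot_pos_of_mem {p : Fin 2 → ℂ} (hp : p ∈ pDomain) : 0 < (dot (e 1) p).im := by
  have h := congrArg Complex.im (dot_sum p)
  simp at h
  have h1 := hp.1
  have h2 := hp.2
  linarith

theorem im_dot_ne_zero_of_mem {p : Fin 2 → ℂ} (hp : p ∈ pDomain) (i : Fin 3) :
    (dot (e i) p).im ≠ 0 := by
  by_cases hi : i = 1
  · rw [hi]; exact (im_dot_pos_of_mem hp).ne'
  · exact (im_dot_neg_of_mem hp hi).ne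

/-- The three scalar products add up to zero, hence none of them is real here, and the poles lie on
the real axis. -/
theorem pDomain_subset_regularSet (g : ℝ) (i j : Fin 3) : pDomain ⊆ regularSet g i j := by
  intro p hp
  have h1 := im_dot_ne_zero_of_mem hp i
  have h2 := im_dot_ne_zero_of_mem hp j
  exact ⟨notPole_of_im_ne_zero (by simpa using h1), notPole_of_im_ne_zero (by simpa using h2)⟩

end W3

end

noncomputable section

namespace W3

open MeasureTheory Filter Topology Set

/-! Integrals over the circle. -/

/-- `exp (i θ)`. -/
def cis (θ : ℝ) : ℂ := Complex.exp (Complex.I * θ)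

theorem norm_cis (θ : ℝ) : ‖cis θ‖ = 1 := by
  rw [cis, mul_comm]; exact Complex.norm_exp_ofReal_mul_I θ

theorem cis_add (a b : ℝ) : cis (a + b) = cis a * cis b := by
  rw [cis, cis, cis, ← Complex.exp_add]; push_cast; ring_nf

theorem cis_sub_two_pi (θ : ℝ) : cis (θ - 2 * Real.pi) = cis θ := by
  rw [cis, cis, ← Complex.exp_periodic (Complex.I * ((θ - 2 * Real.pi : ℝ) : ℂ))]
  congr 1; push_cast; ring

@[fun_prop]
theorem continuous_cis : Continuous cis := by unfold cis; fun_prop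

theorem one_sub_cis (θ : ℝ) :
    1 - cis θ = ((2 * Real.sin (θ / 2) : ℝ) : ℂ) *
      Complex.exp (((θ / 2 - Real.pi / 2 : ℝ) : ℂ) * Complex.I) := by
  have h1 : cis θ = Complex.exp (((θ / 2 : ℝ) : ℂ) * Complex.I) * Complex.exp (((θ / 2 : ℝ) : ℂ) * Complex.I) := by
    rw [cis, ← Complex.exp_add]; congr 1; push_cast; ring
  have h2 : Complex.exp (((θ / 2 - Real.pi / 2 : ℝ) : ℂ) * Complex.I) =
      Complex.exp (((θ / 2 : ℝ) : ℂ) * Complex.I) * (-Complex.I) := by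
    have : (-Complex.I) = Complex.exp (-(Real.pi / 2 * Complex.I)) := by
      rw [Complex.exp_neg, Complex.exp_pi_div_two_mul_I, Complex.inv_I]
    rw [this, ← Complex.exp_add]; congr 1; push_cast; ring
  rw [h1, h2, Complex.exp_mul_I]
  have h3 := Complex.cos_sq_add_sin_sq ((θ / 2 : ℝ) : ℂ)
  push_cast at h3 ⊢
  linear_combination (-1 : ℂ) * h3 + (Complex.sin (θ / 2) ^ 2) * Complex.I_sq

theorem norm_one_sub_cis (θ : ℝ) : ‖1 - cis θ‖ = |2 * Real.sin (θ / 2)| := by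
  rw [one_sub_cis, norm_mul, Complex.norm_exp_ofReal_mul_I, mul_one, Complex.norm_real,
    Real.norm_eq_abs]

theorem two_sin_half_pos {θ : ℝ} (h : θ ∈ Ioo 0 (2 * Real.pi)) : 0 < 2 * Real.sin (θ / 2) := by
  have := Real.sin_pos_of_pos_of_lt_pi (x := θ / 2) (by linarith [h.1]) (by linarith [h.2])
  linarith

theorem cis_ne_one {θ : ℝ} (h : θ ∈ Ioo 0 (2 * Real.pi)) : cis θ ≠ 1 := by
  intro h1
  have := norm_one_sub_cis θ
  rw [h1, sub_self, norm_zero, eq_comm, abs_eq_zero] at this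
  exact (two_sin_half_pos h).ne' this

/-- The argument `(θ - π)/2` of `1 - e^{iθ}` lies in `(-π/2, π/2)`, so the principal power splits
into modulus and phase. The powers of `q` in the relation between the triangle integrals and `J`
come from these phases. -/
theorem one_sub_cis_cpow {θ : ℝ} (h : θ ∈ Ioo 0 (2 * Real.pi)) (g : ℝ) :
    (1 - cis θ) ^ (-(g : ℂ)) = ((2 * Real.sin (θ / 2)) ^ (-g) : ℝ) *
      Complex.exp (-(Complex.I * g * (θ - Real.pi) / 2)) := by
  have hp := two_sin_half_pos h
  have hpi := Real.pi_pos
  have hne : (1 : ℂ) - cis θ ≠ 0 := sub_ne_zero.2 (Ne.symm (cis_ne_one h))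
  rw [Complex.cpow_def_of_ne_zero hne, one_sub_cis, Complex.log_ofReal_mul hp (Complex.exp_ne_zero _),
    Complex.log_exp (by simp; linarith [h.1, h.2]) (by simp; linarith [h.1, h.2]),
    Real.rpow_def_of_pos hp, Complex.ofReal_exp, ← Complex.exp_add]
  congr 1; push_cast; ring

theorem norm_cis_cpow (θ g : ℝ) : ‖(1 - cis θ) ^ (-(g : ℂ))‖ = ‖1 - cis θ‖ ^ (-g) := by
  rw [← Complex.ofReal_neg, Complex.norm_cpow_real]

/-- Jordan's inequality bounds the chord from below by `2/π` times the distance to the nearer end of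
the interval, so the singularity is of type `θ^{-s}` at either end. -/
theorem integrableOn_norm_one_sub_cis {s : ℝ} (hs0 : 0 < s) (hs1 : s < 1) :
    IntegrableOn (fun θ => ‖1 - cis θ‖ ^ (-s)) (Ioo 0 (2 * Real.pi)) := by
  have hpi := Real.pi_pos
  have i1 : IntegrableOn (fun θ : ℝ => θ ^ (-s)) (Ioo 0 (2 * Real.pi)) := by
    have := intervalIntegral.intervalIntegrable_rpow' (a := 0) (b := 2 * Real.pi) (r := -s) (by linarith)
    rwa [intervalIntegrable_iff_integrableOn_Ioo_of_le (by positivity)] at this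
  have i2 : IntegrableOn (fun θ : ℝ => (2 * Real.pi - θ) ^ (-s)) (Ioo 0 (2 * Real.pi)) := by
    have := (intervalIntegral.intervalIntegrable_rpow' (a := 0) (b := 2 * Real.pi) (r := -s)
      (by linarith)).comp_sub_left (2 * Real.pi)
    simp only [sub_zero, sub_self] at this
    replace this := this.symm
    rwa [intervalIntegrable_iff_integrableOn_Ioo_of_le (by positivity)] at this
  refine ((i1.add i2).const_mul ((2 / Real.pi) ^ (-s))).mono'
    (Measurable.aestronglyMeasurable (by fun_prop)) ?_
  refine (ae_restrict_iff' measurableSet_Ioo).2 (.of_forall fun θ h => ?_)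
  rw [Real.norm_of_nonneg (by positivity), norm_one_sub_cis, abs_of_pos (two_sin_half_pos h)]
  have h1 : 0 < θ := h.1
  have h2 : 0 < 2 * Real.pi - θ := by linarith [h.2]
  rw [Pi.add_apply, mul_add, ← Real.mul_rpow (by positivity) h1.le,
    ← Real.mul_rpow (by positivity) h2.le]
  rcases le_total θ Real.pi with hle | hle
  · have := Real.mul_le_sin (x := θ / 2) (by linarith) (by linarith)
    have h3 : 2 / Real.pi * θ ≤ 2 * Real.sin (θ / 2) := by linarith
    exact (Real.rpow_le_rpow_of_nonpos (by positivity) h3 (by linarith)).trans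
      (le_add_of_nonneg_right (by positivity))
  · have := Real.mul_le_sin (x := Real.pi - θ / 2) (by linarith) (by linarith)
    rw [Real.sin_pi_sub] at this
    have h3 : 2 / Real.pi * (2 * Real.pi - θ) ≤ 2 * Real.sin (θ / 2) := by linarith
    exact (Real.rpow_le_rpow_of_nonpos (by positivity) h3 (by linarith)).trans
      (le_add_of_nonneg_left (by positivity))

/-- The integrand of the one-dimensional circle integral. -/
def circleFun (g : ℝ) (y : ℂ) (φ : ℝ) : ℂ :=
  Complex.exp (Complex.I * y * φ) * (1 - cis φ) ^ (-(g : ℂ))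

theorem measurable_circleFun (g : ℝ) (y : ℂ) : Measurable (circleFun g y) := by
  unfold circleFun; fun_prop

theorem norm_exp_I_mul_le (y : ℂ) {φ : ℝ} (h : φ ∈ Ioo 0 (2 * Real.pi)) :
    ‖Complex.exp (Complex.I * y * φ)‖ ≤ Real.exp (|y.im| * (2 * Real.pi)) := by
  rw [Complex.norm_exp]
  refine Real.exp_le_exp.2 ?_
  have : (Complex.I * y * φ).re = -y.im * φ := by simp
  rw [this]
  have h1 : -y.im ≤ |y.im| := neg_le_abs _
  nlinarith [h.1, h.2, abs_nonneg y.im]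

theorem integrableOn_circleFun {g : ℝ} (hg0 : 0 < g) (hg1 : g < 1) (y : ℂ) :
    IntegrableOn (circleFun g y) (Ioo 0 (2 * Real.pi)) := by
  refine ((integrableOn_norm_one_sub_cis hg0 hg1).const_mul
    (Real.exp (|y.im| * (2 * Real.pi)))).mono' (measurable_circleFun g y).aestronglyMeasurable ?_
  refine (ae_restrict_iff' measurableSet_Ioo).2 (.of_forall fun θ h => ?_)
  rw [circleFun, norm_mul, norm_cis_cpow]
  exact mul_le_mul_of_nonneg_right (norm_exp_I_mul_le y h) (by positivity)

/-- The circle integral `∫ exp (i y φ) (1 - exp (i φ)) ^ (-g) dφ`. -/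
def circleInt (g : ℝ) (y : ℂ) : ℂ := ∫ φ in Ioo 0 (2 * Real.pi), circleFun g y φ

/-- The factor `∫ exp (i y φ) dφ · y`. -/
def circleFactor (y : ℂ) : ℂ := (Complex.exp (2 * Real.pi * Complex.I * y) - 1) / Complex.I

theorem circleFactor_add_natCast (y : ℂ) (n : ℕ) : circleFactor (y + n) = circleFactor y := by
  have : Complex.exp (2 * Real.pi * Complex.I * (y + n)) = Complex.exp (2 * Real.pi * Complex.I * y) := by
    rw [← Complex.exp_periodic.nat_mul n (2 * Real.pi * Complex.I * y)]
    congr 1; ring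
  rw [circleFactor, this, circleFactor]

theorem integral_exp_circle {y : ℂ} (hy : y ≠ 0) :
    ∫ φ in Ioo 0 (2 * Real.pi), Complex.exp (Complex.I * y * φ) = circleFactor y / y := by
  rw [← integral_Ioc_eq_integral_Ioo, ← intervalIntegral.integral_of_le (by positivity),
    integral_exp_mul_complex (mul_ne_zero Complex.I_ne_zero hy), circleFactor]
  have := Complex.I_ne_zero
  field_simp
  push_cast
  simp only [mul_zero, Complex.exp_zero]
  congr 2; ring

theorem exp_mul_cis_pow (y : ℂ) (φ : ℝ) (n : ℕ) :
    Complex.exp (Complex.I * y * φ) * cis φ ^ n = Complex.exp (Complex.I * (y + n) * φ) := by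
  rw [cis, ← Complex.exp_nat_mul, ← Complex.exp_add]; congr 1; ring

theorem integral_cpow_mul_pow {y : ℂ} (hy : 0 < y.re) (n : ℕ) :
    ∫ t in Ioo (0 : ℝ) 1, (t : ℂ) ^ (y - 1) * (t : ℂ) ^ n = (y + n)⁻¹ := by
  have hn : (0 : ℝ) ≤ n := n.cast_nonneg
  have e : ∀ t ∈ Ioo (0 : ℝ) 1, (t : ℂ) ^ (y - 1) * (t : ℂ) ^ n = (t : ℂ) ^ (y + n - 1) := by
    intro t ht
    have : (t : ℂ) ≠ 0 := by exact_mod_cast ht.1.ne'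
    rw [show y + n - 1 = (y - 1) + n by ring, Complex.cpow_add _ _ this, Complex.cpow_natCast]
  rw [setIntegral_congr_fun measurableSet_Ioo e, ← integral_Ioc_eq_integral_Ioo,
    ← intervalIntegral.integral_of_le zero_le_one, integral_cpow (Or.inl (by simp; linarith))]
  have h0 : y + n ≠ 0 := by
    intro h; have := congrArg Complex.re h; simp at this; linarith
  simp [h0]

theorem ae_Ioo01 : ∀ᵐ t ∂(volume : Measure ℝ).restrict (Ioo 0 1), 0 ≤ t ∧ t < 1 :=
  (ae_restrict_iff' measurableSet_Ioo).2 (.of_forall fun _ h => ⟨h.1.le, h.2⟩)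

/-- Expand both this integral and the Beta integral `∫ t^{y-1} (1-t)^{-g} dt`. The terms are
`circleFactor (y + n) / (y + n)` and `1 / (y + n)` with the same coefficients. The circle factor has
period 1, so it comes out as a common factor. -/
theorem circleInt_of_re_pos {g : ℝ} (hg0 : 0 < g) (hg1 : g < 1) {y : ℂ} (hy : 0 < y.re) :
    circleInt g y =
      circleFactor y * (Complex.Gamma (1 - g) * (Complex.Gamma y / Complex.Gamma (y + 1 - g))) := by
  have hm : AEStronglyMeasurable (fun t : ℝ => (t : ℂ) ^ (y - 1)) (volume.restrict (Ioo 0 1)) :=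
    (by fun_prop : Measurable (fun t : ℝ => (t : ℂ) ^ (y - 1))).aestronglyMeasurable
  have hs := hasSum_integral_binom hg0 (μ := volume.restrict (Ioo (0 : ℝ) 1))
    (w := fun t : ℝ => (t : ℂ) ^ (y - 1)) (t := fun t => t) hm measurable_id ae_Ioo01
    (integrableOn_beta' hg1 hy)
  have hn := summable_integral_norm_binom hg0 (μ := volume.restrict (Ioo (0 : ℝ) 1))
    (w := fun t : ℝ => (t : ℂ) ^ (y - 1)) (t := fun t => t) hm measurable_id ae_Ioo01
    (integrableOn_beta' hg1 hy)
  simp_rw [integral_cpow_mul_pow hy] at hs hn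
  have e := integral_beta (u := y) (v := 1 - g) hy (by linarith)
  simp only [sub_sub_cancel_left] at e
  rw [e] at hs
  have hyn : ∀ n : ℕ, y + n ≠ 0 := fun n h => by
    have := congrArg Complex.re h
    have hn : (0 : ℝ) ≤ n := n.cast_nonneg
    simp at this; linarith
  have hint : ∀ n : ℕ, ∫ φ in Ioo 0 (2 * Real.pi), Complex.exp (Complex.I * y * φ) * cis φ ^ n =
      circleFactor y * (y + n)⁻¹ := by
    intro n
    simp_rw [exp_mul_cis_pow]
    rw [integral_exp_circle (hyn n), circleFactor_add_natCast, div_eq_mul_inv]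
  have hb := hasSum_integral_binom_boundary hg0 (μ := volume.restrict (Ioo 0 (2 * Real.pi)))
    (w := fun φ : ℝ => Complex.exp (Complex.I * y * φ)) (t := cis)
    ((by fun_prop : Continuous fun φ : ℝ => Complex.exp (Complex.I * y * φ)).integrableOn_Icc.mono_set
      Ioo_subset_Icc_self) continuous_cis.measurable
    ((ae_restrict_iff' measurableSet_Ioo).2 (.of_forall fun φ h => ⟨(norm_cis φ).le, cis_ne_one h⟩))
    (integrableOn_circleFun hg0 hg1 y) (by
      simp_rw [hint]
      refine (hn.mul_left ‖circleFactor y‖).congr fun n => ?_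
      rw [norm_mul]; ring)
  simp_rw [hint] at hb
  have hs' := hs.mul_left (circleFactor y)
  have := hb.unique (hs'.congr_fun fun n => by ring)
  rw [circleInt]
  simp only [circleFun]
  rw [this]
  push_cast
  rw [← add_sub_assoc]
  ring

/-- The function `e^{iyφ} (1 - e^{iφ})^{1-g}` vanishes at both ends of the interval, as `g < 1`; its
derivative is the difference of the two integrands times `i`. -/
theorem circleInt_recurrence {g : ℝ} (hg0 : 0 < g) (hg1 : g < 1) (y : ℂ) :
    y * circleInt g y = (y + 1 - g) * circleInt g (y + 1) := by
  have hg1' : (1 - g : ℂ) ≠ 0 := by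
    rw [← Complex.ofReal_one, ← Complex.ofReal_sub]; exact_mod_cast (by linarith : 1 - g ≠ 0)
  have hre : 0 < (1 - g : ℂ).re := by simpa using hg1
  set F : ℝ → ℂ := fun φ => Complex.exp (Complex.I * y * φ) * (1 - cis φ) ^ (1 - g : ℂ) with hF
  have hcont : ContinuousOn F (Icc 0 (2 * Real.pi)) := by
    refine (Continuous.continuousOn (by fun_prop)).mul fun φ _ => ContinuousAt.continuousWithinAt ?_
    refine ContinuousAt.comp (f := fun φ => 1 - cis φ) (g := fun z : ℂ => z ^ (1 - g : ℂ))
      (Complex.continuousAt_cpow_const_of_re_pos (Or.inl ?_) hre) (by fun_prop)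
    have := (Complex.re_le_norm (cis φ)).trans (norm_cis φ).le
    simpa using this
  have hder : ∀ φ ∈ Ioo 0 (2 * Real.pi), HasDerivAt F
      (Complex.I * (y * circleFun g y φ - (y + 1 - g) * circleFun g (y + 1) φ)) φ := by
    intro φ hφ
    have hsl := one_sub_mem_slitPlane (cis_ne_one hφ) (norm_cis φ).le
    have hne : 1 - cis φ ≠ 0 := Complex.slitPlane_ne_zero hsl
    have d1 : HasDerivAt cis (Complex.I * cis φ) φ := by
      have : HasDerivAt (fun φ : ℝ => Complex.I * (φ : ℂ)) Complex.I φ := by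
        simpa using (Complex.ofRealCLM.hasDerivAt (x := φ)).const_mul Complex.I
      exact this.cexp.congr_deriv (mul_comm _ _)
    have d2 : HasDerivAt (fun φ : ℝ => Complex.exp (Complex.I * y * φ))
        (Complex.exp (Complex.I * y * φ) * (Complex.I * y)) φ := by
      have : HasDerivAt (fun φ : ℝ => Complex.I * y * (φ : ℂ)) (Complex.I * y) φ := by
        simpa using (Complex.ofRealCLM.hasDerivAt (x := φ)).const_mul (Complex.I * y)
      exact this.cexp
    have d3 : HasDerivAt (fun φ => (1 - cis φ) ^ (1 - g : ℂ))
        ((1 - g : ℂ) * (1 - cis φ) ^ (1 - g - 1 : ℂ) * (-(Complex.I * cis φ))) φ :=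
      HasDerivAt.comp (h := fun φ => 1 - cis φ) (h₂ := fun z : ℂ => z ^ (1 - g : ℂ)) φ
        (Complex.hasStrictDerivAt_cpow_const hsl).hasDerivAt (d1.const_sub 1)
    refine (d2.mul d3).congr_deriv ?_
    have e1 : (1 - cis φ) ^ (1 - g : ℂ) = (1 - cis φ) * (1 - cis φ) ^ (-(g : ℂ)) := by
      rw [sub_eq_add_neg (1 : ℂ) (g : ℂ), Complex.cpow_add _ _ hne, Complex.cpow_one]
    have e2 : Complex.exp (Complex.I * (y + 1) * φ) = Complex.exp (Complex.I * y * φ) * cis φ := by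
      rw [cis, ← Complex.exp_add]; congr 1; ring
    rw [circleFun, circleFun, e1, e2, show (1 - g - 1 : ℂ) = -g by ring]
    ring
  have hi := integrableOn_circleFun hg0 hg1
  have hint : IntegrableOn (fun φ => Complex.I * (y * circleFun g y φ -
      (y + 1 - g) * circleFun g (y + 1) φ)) (Ioo 0 (2 * Real.pi)) :=
    (((hi y).const_mul y).sub ((hi (y + 1)).const_mul (y + 1 - g))).const_mul Complex.I
  have key := intervalIntegral.integral_eq_sub_of_hasDerivAt_of_le (by positivity) hcont hder
    ((intervalIntegrable_iff_integrableOn_Ioo_of_le (by positivity)).2 hint)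
  have z0 : cis 0 = 1 := by simp [cis]
  have z1 : cis (2 * Real.pi) = 1 := by
    have := cis_sub_two_pi (2 * Real.pi)
    rw [← this, sub_self, z0]
  simp only [hF, z0, z1, sub_self, Complex.zero_cpow hg1', mul_zero] at key
  rw [intervalIntegral.integral_of_le (by positivity), integral_Ioc_eq_integral_Ioo,
    integral_const_mul, integral_sub ((hi y).const_mul y) ((hi (y + 1)).const_mul _),
    integral_const_mul, integral_const_mul] at key
  have := (mul_eq_zero.1 key).resolve_left Complex.I_ne_zero
  exact sub_eq_zero.1 this

/-- The recurrence carries the formula from the right half plane to the left in unit steps;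
`NotPole` guarantees that no step divides by zero. -/
theorem circleInt_eq {g : ℝ} (hg0 : 0 < g) (hg1 : g < 1) {y : ℂ} (hy : NotPole y) :
    circleInt g y =
      circleFactor y * (Complex.Gamma (1 - g) * (Complex.Gamma y / Complex.Gamma (y + 1 - g))) := by
  have main : ∀ N : ℕ, ∀ y : ℂ, NotPole y → 0 < y.re + N → circleInt g y =
      circleFactor y * (Complex.Gamma (1 - g) * (Complex.Gamma y / Complex.Gamma (y + 1 - g))) := by
    intro N
    induction N with
    | zero => intro y _ h; exact circleInt_of_re_pos hg0 hg1 (by simpa using h)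
    | succ N ih =>
      intro y hy h
      have hy0 : y ≠ 0 := by simpa using hy 0
      have h1 := ih (y + 1) (by simpa using hy.add_natCast 1) (by push_cast at h; simp; linarith)
      have hrec := circleInt_recurrence hg0 hg1 y
      have hE : circleFactor (y + 1) = circleFactor y := by simpa using circleFactor_add_natCast y 1
      refine mul_left_cancel₀ hy0 ?_
      rw [hrec, h1, hE, Complex.Gamma_add_one y hy0]
      -- Here the recurrence makes the left side vanish, and the right side vanishes because `Γ(0) =
      -- 0` by convention.
      by_cases h0 : y + 1 - g = 0
      · rw [h0, Complex.Gamma_zero]; simp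
      · rw [show y + 1 + 1 - g = (y + 1 - g) + 1 by ring, Complex.Gamma_add_one _ h0]
        field_simp
  obtain ⟨N, hN⟩ := exists_nat_gt (-y.re)
  exact main N y hy (by linarith)

end W3

end

noncomputable section

namespace W3

open MeasureTheory Filter Topology Set

/-! The integral over the triangle. -/

/-- The open square with side `2π`. -/
def angleSquare : Set (ℝ × ℝ) := Ioo 0 (2 * Real.pi) ×ˢ Ioo 0 (2 * Real.pi)

/-- The triangle `φ, ψ > 0`, `φ + ψ < 2π`. -/
def triangle : Set (ℝ × ℝ) := {x | 0 < x.1 ∧ 0 < x.2 ∧ x.1 + x.2 < 2 * Real.pi}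

/-- The weight `(2 sin (φ/2) · 2 sin (ψ/2) · 2 sin ((φ + ψ)/2)) ^ (-g)`. -/
def triWeight (g : ℝ) (x : ℝ × ℝ) : ℝ :=
  ((2 * Real.sin (x.1 / 2)) * (2 * Real.sin (x.2 / 2)) * (2 * Real.sin ((x.1 + x.2) / 2))) ^ (-g)

/-- The integrand of the triangle integral. -/
def triFun (g : ℝ) (α β : ℂ) (x : ℝ × ℝ) : ℂ :=
  Complex.exp (Complex.I * (α * x.1 + β * x.2)) * (triWeight g x : ℝ)

/-- The triangle integral. -/
def triInt (g : ℝ) (α β : ℂ) : ℂ := ∫ x in triangle, triFun g α β x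

theorem measurableSet_angleSquare : MeasurableSet angleSquare :=
  measurableSet_Ioo.prod measurableSet_Ioo

theorem measurableSet_triangle : MeasurableSet triangle := by
  have : IsOpen triangle := (isOpen_lt continuous_const continuous_fst).inter
    ((isOpen_lt continuous_const continuous_snd).inter
      (isOpen_lt (continuous_fst.add continuous_snd) continuous_const))
  exact this.measurableSet

theorem triangle_subset : triangle ⊆ angleSquare := fun x ⟨h1, h2, h3⟩ =>
  ⟨⟨h1, by linarith⟩, ⟨h2, by linarith⟩⟩

theorem restrict_angleSquare : (volume : Measure (ℝ × ℝ)).restrict angleSquare =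
    ((volume : Measure ℝ).restrict (Ioo 0 (2 * Real.pi))).prod
      ((volume : Measure ℝ).restrict (Ioo 0 (2 * Real.pi))) := by
  rw [Measure.prod_restrict]; rfl

/-- The inequality of the arithmetic and geometric means for the three products of pairs with
exponent `-3g/2`, whose geometric mean is `(xyz)^{-g}`. It leaves only two singular factors at a
time, each of exponent below 1 when `g < 2/3`. -/
theorem rpow_neg_mul_mul_le {g x y z : ℝ} (hx : 0 ≤ x) (hy : 0 ≤ y) (hz : 0 ≤ z) :
    x ^ (-g) * y ^ (-g) * z ^ (-g) ≤ x ^ (-(3 * g / 2)) * y ^ (-(3 * g / 2)) +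
      x ^ (-(3 * g / 2)) * z ^ (-(3 * g / 2)) + y ^ (-(3 * g / 2)) * z ^ (-(3 * g / 2)) := by
  have key := Real.geom_mean_le_arith_mean3_weighted (w₁ := 1 / 3) (w₂ := 1 / 3) (w₃ := 1 / 3)
    (p₁ := x ^ (-(3 * g / 2)) * y ^ (-(3 * g / 2))) (p₂ := x ^ (-(3 * g / 2)) * z ^ (-(3 * g / 2)))
    (p₃ := y ^ (-(3 * g / 2)) * z ^ (-(3 * g / 2))) (by norm_num) (by norm_num) (by norm_num)
    (by positivity) (by positivity) (by positivity) (by norm_num)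
  have e : ∀ t : ℝ, 0 ≤ t → (t ^ (-(3 * g / 2))) ^ (1 / 3 : ℝ) = t ^ (-(g / 2)) := by
    intro t ht
    rw [← Real.rpow_mul ht]; congr 1; ring
  have e2 : ∀ t : ℝ, 0 ≤ t → t ^ (-(g / 2)) * t ^ (-(g / 2)) = t ^ (-g) := by
    intro t ht
    rw [← sq, ← Real.rpow_natCast, ← Real.rpow_mul ht]; congr 1; push_cast; ring
  rw [Real.mul_rpow (by positivity) (by positivity), Real.mul_rpow (by positivity) (by positivity),
    Real.mul_rpow (by positivity) (by positivity), e x hx, e y hy, e z hz] at key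
  have : x ^ (-(g / 2)) * y ^ (-(g / 2)) * (x ^ (-(g / 2)) * z ^ (-(g / 2))) *
      (y ^ (-(g / 2)) * z ^ (-(g / 2))) = x ^ (-g) * y ^ (-g) * z ^ (-g) := by
    rw [← e2 x hx, ← e2 y hy, ← e2 z hz]; ring
  rw [this] at key
  refine key.trans ?_
  have h1 : 0 ≤ x ^ (-(3 * g / 2)) * y ^ (-(3 * g / 2)) := by positivity
  have h2 : 0 ≤ x ^ (-(3 * g / 2)) * z ^ (-(3 * g / 2)) := by positivity
  have h3 : 0 ≤ y ^ (-(3 * g / 2)) * z ^ (-(3 * g / 2)) := by positivity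
  linarith

/-- `|1 - exp (i θ)| ^ (-s)`. -/
def chordPow (s θ : ℝ) : ℝ := ‖1 - cis θ‖ ^ (-s)

theorem chordPow_nonneg (s θ : ℝ) : 0 ≤ chordPow s θ := by unfold chordPow; positivity

theorem measurable_chordPow (s : ℝ) : Measurable (chordPow s) := by
  unfold chordPow; fun_prop

/-- The sum of two angles of the square ranges over two periods, hence the interval up to `4π`. -/
theorem integrableOn_chordPow_four {s : ℝ} (hs0 : 0 < s) (hs1 : s < 1) :
    IntegrableOn (chordPow s) (Ioo 0 (4 * Real.pi)) := by
  have hpi := Real.pi_pos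
  have h1 : IntegrableOn (chordPow s) (Ioc 0 (2 * Real.pi)) :=
    (integrableOn_Ioc_iff_integrableOn_Ioo).2 (integrableOn_norm_one_sub_cis hs0 hs1)
  have h2 : IntegrableOn (chordPow s) (Ioc (2 * Real.pi) (4 * Real.pi)) := by
    have := (intervalIntegrable_iff_integrableOn_Ioc_of_le (by positivity)).2 h1
    have := this.comp_sub_right (2 * Real.pi)
    rw [intervalIntegrable_iff_integrableOn_Ioc_of_le (by linarith)] at this
    simp only [chordPow, cis_sub_two_pi] at this
    rw [zero_add, show 2 * Real.pi + 2 * Real.pi = 4 * Real.pi by ring] at this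
    exact this
  refine (h1.union h2).mono_set fun x hx => ?_
  rcases le_or_gt x (2 * Real.pi) with h | h
  · exact Or.inl ⟨hx.1, h⟩
  · exact Or.inr ⟨h, hx.2.le⟩

/-- The shear `(φ, ψ) ↦ (φ, φ + ψ)` preserves the measure and maps the square into a rectangle, on
which the function is a product. -/
theorem integrableOn_chordPow_fst_add {s : ℝ} (hs0 : 0 < s) (hs1 : s < 1) :
    IntegrableOn (fun x : ℝ × ℝ => chordPow s x.1 * chordPow s (x.1 + x.2)) angleSquare := by
  have hp := Integrable.mul_prod (integrableOn_norm_one_sub_cis hs0 hs1)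
    (integrableOn_chordPow_four hs0 hs1)
  rw [Measure.prod_restrict] at hp
  have hmp := measurePreserving_prod_add (volume : Measure ℝ) (volume : Measure ℝ)
  have := hmp.integrableOn_comp_preimage (MeasurableEquiv.shearAddRight ℝ).measurableEmbedding
    (f := fun x : ℝ × ℝ => chordPow s x.1 * chordPow s x.2)
    (s := Ioo 0 (2 * Real.pi) ×ˢ Ioo 0 (4 * Real.pi))
  refine (this.2 hp).mono_set fun x hx => ?_
  obtain ⟨⟨h1, h2⟩, h3, h4⟩ := hx
  exact ⟨⟨h1, h2⟩, by simp; linarith, by simp; linarith⟩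

theorem integrableOn_chordPow_mul {g : ℝ} (hg0 : 0 < g) (hg1 : g < 2 / 3) :
    IntegrableOn (fun x : ℝ × ℝ => chordPow g x.1 * chordPow g x.2 * chordPow g (x.1 + x.2))
      angleSquare := by
  set s := 3 * g / 2 with hs
  have hs0 : 0 < s := by positivity
  have hs1 : s < 1 := by linarith
  have i1 : IntegrableOn (fun x : ℝ × ℝ => chordPow s x.1 * chordPow s x.2) angleSquare := by
    have := Integrable.mul_prod (integrableOn_norm_one_sub_cis hs0 hs1)
      (integrableOn_norm_one_sub_cis hs0 hs1)
    rwa [← restrict_angleSquare] at this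
  have i2 := integrableOn_chordPow_fst_add hs0 hs1
  have i3 : IntegrableOn (fun x : ℝ × ℝ => chordPow s x.2 * chordPow s (x.1 + x.2)) angleSquare := by
    have h := i2
    rw [IntegrableOn, restrict_angleSquare] at h ⊢
    have := h.swap
    refine this.congr (.of_forall fun x => ?_)
    simp [Function.comp, add_comm]
  refine ((i1.add i2).add i3).mono' (Measurable.aestronglyMeasurable ?_) (.of_forall fun x => ?_)
  · have := measurable_chordPow g; fun_prop
  · rw [Real.norm_of_nonneg (mul_nonneg (mul_nonneg (chordPow_nonneg _ _) (chordPow_nonneg _ _))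
      (chordPow_nonneg _ _))]
    exact rpow_neg_mul_mul_le (norm_nonneg _) (norm_nonneg _) (norm_nonneg _)

theorem triWeight_eq {g : ℝ} {x : ℝ × ℝ} (hx : x ∈ triangle) :
    triWeight g x = chordPow g x.1 * chordPow g x.2 * chordPow g (x.1 + x.2) := by
  obtain ⟨h1, h2, h3⟩ := hx
  have p1 := two_sin_half_pos (θ := x.1) ⟨h1, by linarith⟩
  have p2 := two_sin_half_pos (θ := x.2) ⟨h2, by linarith⟩
  have p3 := two_sin_half_pos (θ := x.1 + x.2) ⟨by linarith, by linarith⟩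
  rw [triWeight, chordPow, chordPow, chordPow, norm_one_sub_cis, norm_one_sub_cis, norm_one_sub_cis,
    abs_of_pos p1, abs_of_pos p2, abs_of_pos p3, Real.mul_rpow (by positivity) (by positivity),
    Real.mul_rpow (by positivity) (by positivity)]

theorem measurable_triWeight (g : ℝ) : Measurable (triWeight g) := by
  unfold triWeight; fun_prop

theorem integrableOn_triWeight {g : ℝ} (hg0 : 0 < g) (hg1 : g < 2 / 3) :
    IntegrableOn (triWeight g) triangle :=
  ((integrableOn_chordPow_mul hg0 hg1).mono_set triangle_subset).congr_fun
    (fun _ hx => (triWeight_eq hx).symm) measurableSet_triangle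

theorem triWeight_nonneg {g : ℝ} {x : ℝ × ℝ} (hx : x ∈ triangle) : 0 ≤ triWeight g x := by
  rw [triWeight_eq hx]
  exact mul_nonneg (mul_nonneg (chordPow_nonneg _ _) (chordPow_nonneg _ _)) (chordPow_nonneg _ _)

theorem norm_exp_pair_le (α β : ℂ) {x : ℝ × ℝ} (hx : x ∈ angleSquare) :
    ‖Complex.exp (Complex.I * (α * x.1 + β * x.2))‖ ≤
      Real.exp ((|α.im| + |β.im|) * (2 * Real.pi)) := by
  have e : Complex.exp (Complex.I * (α * x.1 + β * x.2)) =
      Complex.exp (Complex.I * α * x.1) * Complex.exp (Complex.I * β * x.2) := by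
    rw [← Complex.exp_add]; congr 1; ring
  rw [e, norm_mul, add_mul, Real.exp_add]
  exact mul_le_mul (norm_exp_I_mul_le α hx.1) (norm_exp_I_mul_le β hx.2) (norm_nonneg _)
    (Real.exp_pos _).le

theorem measurable_triFun (g : ℝ) (α β : ℂ) : Measurable (triFun g α β) := by
  have := measurable_triWeight g
  unfold triFun; fun_prop

theorem integrableOn_triFun {g : ℝ} (hg0 : 0 < g) (hg1 : g < 2 / 3) (α β : ℂ) :
    IntegrableOn (triFun g α β) triangle := by
  refine ((integrableOn_triWeight hg0 hg1).const_mul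
    (Real.exp ((|α.im| + |β.im|) * (2 * Real.pi)))).mono'
    (measurable_triFun g α β).aestronglyMeasurable ?_
  refine (ae_restrict_iff' measurableSet_triangle).2 (.of_forall fun x hx => ?_)
  rw [triFun, norm_mul, Complex.norm_real, Real.norm_of_nonneg (triWeight_nonneg hx)]
  exact mul_le_mul_of_nonneg_right (norm_exp_pair_le α β (triangle_subset hx)) (triWeight_nonneg hx)

/-- Continuity is used to extend identities to those parameters at which a factor to be cancelled
vanishes. -/
theorem continuous_triInt {g : ℝ} (hg0 : 0 < g) (hg1 : g < 2 / 3) :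
    Continuous fun v : ℂ × ℂ => triInt g v.1 v.2 := by
  rw [continuous_iff_continuousAt]
  intro v
  unfold triInt
  have hc : ContinuousAt (fun v : ℂ × ℂ => |v.1.im| + |v.2.im|) v := by fun_prop
  refine continuousAt_of_dominated (bound := fun x =>
      Real.exp ((|v.1.im| + |v.2.im| + 1) * (2 * Real.pi)) * triWeight g x)
    (.of_forall fun u => (measurable_triFun g u.1 u.2).aestronglyMeasurable) ?_
    ((integrableOn_triWeight hg0 hg1).const_mul _) (.of_forall fun x => ?_)
  · filter_upwards [hc.eventually (gt_mem_nhds (lt_add_one _))] with u hu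
    refine (ae_restrict_iff' measurableSet_triangle).2 (.of_forall fun x hx => ?_)
    rw [triFun, norm_mul, Complex.norm_real, Real.norm_of_nonneg (triWeight_nonneg hx)]
    refine mul_le_mul_of_nonneg_right ?_ (triWeight_nonneg hx)
    refine (norm_exp_pair_le u.1 u.2 (triangle_subset hx)).trans (Real.exp_le_exp.2 ?_)
    exact mul_le_mul_of_nonneg_right hu.le (by positivity)
  · unfold triFun; fun_prop

theorem triInt_comm (g : ℝ) (α β : ℂ) : triInt g α β = triInt g β α := by
  have hmp : MeasurePreserving (Prod.swap : ℝ × ℝ → ℝ × ℝ) volume volume :=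
    Measure.measurePreserving_swap
  have := hmp.setIntegral_preimage_emb MeasurableEquiv.prodComm.measurableEmbedding
    (triFun g β α) triangle
  rw [triInt, triInt, ← this]
  have hset : Prod.swap ⁻¹' triangle = triangle := by
    ext x; simp only [triangle, mem_preimage, mem_ofPred_eq, Prod.fst_swap, Prod.snd_swap]
    rw [add_comm]; tauto
  rw [hset]
  congr 1; ext x
  simp only [triFun, triWeight, Prod.fst_swap, Prod.snd_swap]
  rw [add_comm x.2, add_comm (β * _), mul_comm (2 * Real.sin (x.2 / 2))]

/-- Change of the base vertex of the triangle. -/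
theorem triInt_rotate (g : ℝ) (α β : ℂ) :
    triInt g α β = Complex.exp (2 * Real.pi * Complex.I * β) * triInt g (α - β) (-β) := by
  -- The involution exchanges `ψ` with the third arc `2π - φ - ψ`. The weight is symmetric in the
  -- three arcs, since `sin (π - x) = sin x`.
  have hmp : MeasurePreserving (fun x : ℝ × ℝ => (x.1, 2 * Real.pi - (x.1 + x.2))) volume volume := by
    have h1 := measurePreserving_prod_add (volume : Measure ℝ) (volume : Measure ℝ)
    have h2 : MeasurePreserving (fun x : ℝ × ℝ => (x.1, 2 * Real.pi - x.2)) volume volume :=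
      (MeasurePreserving.id (volume : Measure ℝ)).prod
        (Measure.measurePreserving_sub_left (volume : Measure ℝ) (2 * Real.pi))
    exact h2.comp h1
  have hemb : MeasurableEmbedding (fun x : ℝ × ℝ => (x.1, 2 * Real.pi - (x.1 + x.2))) := by
    have hm : Measurable (fun x : ℝ × ℝ => (x.1, 2 * Real.pi - (x.1 + x.2))) := by fun_prop
    have hi : ∀ x : ℝ × ℝ, (x.1, 2 * Real.pi - (x.1 + (2 * Real.pi - (x.1 + x.2)))) = x := by
      intro x; ext
      · rfl
      · ring
    let E : (ℝ × ℝ) ≃ᵐ (ℝ × ℝ) :=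
      { toFun := fun x => (x.1, 2 * Real.pi - (x.1 + x.2))
        invFun := fun x => (x.1, 2 * Real.pi - (x.1 + x.2))
        left_inv := hi, right_inv := hi, measurable_toFun := hm, measurable_invFun := hm }
    exact E.measurableEmbedding
  have := hmp.setIntegral_preimage_emb hemb (triFun g α β) triangle
  rw [triInt, triInt, ← this, ← integral_const_mul]
  have hset : (fun x : ℝ × ℝ => (x.1, 2 * Real.pi - (x.1 + x.2))) ⁻¹' triangle = triangle := by
    ext x; simp only [triangle, mem_preimage, mem_ofPred_eq]
    constructor <;> rintro ⟨h1, h2, h3⟩ <;> refine ⟨h1, by linarith, by linarith⟩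
  rw [hset]
  congr 1; ext x
  simp only [triFun, triWeight]
  have s1 : Real.sin ((2 * Real.pi - (x.1 + x.2)) / 2) = Real.sin ((x.1 + x.2) / 2) := by
    rw [← Real.sin_pi_sub]; congr 1; ring
  have s2 : Real.sin ((x.1 + (2 * Real.pi - (x.1 + x.2))) / 2) = Real.sin (x.2 / 2) := by
    rw [← Real.sin_pi_sub]; congr 1; ring
  rw [s1, s2, ← mul_assoc (Complex.exp _), ← Complex.exp_add, mul_right_comm (2 * Real.sin (x.1 / 2))]
  congr 2
  push_cast; ring

/-- The integrand on the square. -/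
def squareFun (g : ℝ) (A B : ℂ) (x : ℝ × ℝ) : ℂ :=
  circleFun g A x.1 * circleFun g B x.2 * (1 - cis (x.1 + x.2)) ^ (-(g : ℂ))

theorem norm_squareFun_le (g : ℝ) (A B : ℂ) {x : ℝ × ℝ} (hx : x ∈ angleSquare) :
    ‖squareFun g A B x‖ ≤ Real.exp ((|A.im| + |B.im|) * (2 * Real.pi)) *
      (chordPow g x.1 * chordPow g x.2 * chordPow g (x.1 + x.2)) := by
  rw [squareFun, circleFun, circleFun, norm_mul, norm_mul, norm_mul, norm_mul, norm_cis_cpow,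
    norm_cis_cpow, norm_cis_cpow, add_mul, Real.exp_add]
  have h1 := norm_exp_I_mul_le A hx.1
  have h2 := norm_exp_I_mul_le B hx.2
  change _ * chordPow g x.1 * (_ * chordPow g x.2) * chordPow g (x.1 + x.2) ≤ _
  have c1 := chordPow_nonneg g x.1
  have c2 := chordPow_nonneg g x.2
  have c3 := chordPow_nonneg g (x.1 + x.2)
  calc _ ≤ Real.exp (|A.im| * (2 * Real.pi)) * chordPow g x.1 *
        (Real.exp (|B.im| * (2 * Real.pi)) * chordPow g x.2) * chordPow g (x.1 + x.2) := by gcongr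
    _ = _ := by ring

theorem measurable_squareFun (g : ℝ) (A B : ℂ) : Measurable (squareFun g A B) := by
  have := measurable_circleFun g A
  have := measurable_circleFun g B
  unfold squareFun; fun_prop

theorem integrableOn_squareFun {g : ℝ} (hg0 : 0 < g) (hg1 : g < 2 / 3) (A B : ℂ) :
    IntegrableOn (squareFun g A B) angleSquare := by
  refine ((integrableOn_chordPow_mul hg0 hg1).const_mul _).mono'
    (measurable_squareFun g A B).aestronglyMeasurable
    ((ae_restrict_iff' measurableSet_angleSquare).2 (.of_forall fun x hx =>
      norm_squareFun_le g A B hx))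

theorem ae_add_ne : ∀ᵐ x : ℝ × ℝ, x.1 + x.2 ≠ 2 * Real.pi := by
  have hmp := measurePreserving_prod_add (volume : Measure ℝ) (volume : Measure ℝ)
  have h : ∀ᵐ x : ℝ × ℝ, x.2 ≠ 2 * Real.pi := by
    have : ∀ᵐ t : ℝ, t ≠ 2 * Real.pi := by simp [ae_iff]
    exact Measure.quasiMeasurePreserving_snd.ae this
  exact hmp.quasiMeasurePreserving.ae h

theorem cis_add_ne_one {x : ℝ × ℝ} (hx : x ∈ angleSquare) (h : x.1 + x.2 ≠ 2 * Real.pi) :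
    cis (x.1 + x.2) ≠ 1 := by
  obtain ⟨⟨h1, h2⟩, h3, h4⟩ := hx
  rcases lt_or_gt_of_ne h with h | h
  · exact cis_ne_one ⟨by linarith, h⟩
  · rw [← cis_sub_two_pi]; exact cis_ne_one ⟨by linarith, by linarith⟩

theorem circleFun_mul_cis_pow (g : ℝ) (y : ℂ) (φ : ℝ) (n : ℕ) :
    circleFun g y φ * cis φ ^ n = circleFun g (y + n) φ := by
  rw [circleFun, circleFun, ← exp_mul_cis_pow]; ring

/-- Expand the factor that contains `φ + ψ`, by Abel summation because it has modulus one. Each term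
is a product of two circle integrals; their circle factors do not depend on `n`, and the remaining
Gamma quotients form the series of `J`. -/
theorem integral_squareFun {g : ℝ} (hg0 : 0 < g) (hg1 : g < 2 / 3) {α β : ℂ}
    (hα : NotPole (g + α)) (hβ : NotPole (g + β)) :
    ∫ x in angleSquare, squareFun g (g + α) (g + β) x =
      circleFactor (g + α) * circleFactor (g + β) * J g α β := by
  have hint : ∀ n : ℕ, ∫ x in angleSquare, circleFun g (g + α) x.1 * circleFun g (g + β) x.2 *
      cis (x.1 + x.2) ^ n = circleFactor (g + α) * circleFactor (g + β) *
        (Complex.Gamma (1 - g) ^ 2 * (gammaRatio g α n * gammaRatio g β n)) := by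
    intro n
    rw [restrict_angleSquare]
    have e : ∀ x : ℝ × ℝ, circleFun g (g + α) x.1 * circleFun g (g + β) x.2 * cis (x.1 + x.2) ^ n =
        circleFun g (g + α + n) x.1 * circleFun g (g + β + n) x.2 := by
      intro x
      rw [cis_add, mul_pow, ← circleFun_mul_cis_pow, ← circleFun_mul_cis_pow]; ring
    simp_rw [e]
    rw [integral_prod_mul (circleFun g (g + α + n)) (circleFun g (g + β + n))]
    change circleInt g _ * circleInt g _ = _
    rw [circleInt_eq hg0 (by linarith) (hα.add_natCast n),
      circleInt_eq hg0 (by linarith) (hβ.add_natCast n), circleFactor_add_natCast,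
      circleFactor_add_natCast, gammaRatio, gammaRatio,
      show (g : ℂ) + α + n + 1 - g = 1 + α + n by ring,
      show (g : ℂ) + β + n + 1 - g = 1 + β + n by ring]
    ring
  have hw : IntegrableOn (fun x : ℝ × ℝ => circleFun g (g + α) x.1 * circleFun g (g + β) x.2)
      angleSquare := by
    rw [IntegrableOn, restrict_angleSquare]
    exact (integrableOn_circleFun hg0 (by linarith) _).mul_prod
      (integrableOn_circleFun hg0 (by linarith) _)
  have hb := hasSum_integral_binom_boundary hg0
    (μ := (volume : Measure (ℝ × ℝ)).restrict angleSquare) hw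
    (t := fun x => cis (x.1 + x.2)) (by fun_prop) (by
      refine (ae_restrict_iff' measurableSet_angleSquare).2 ?_
      filter_upwards [ae_add_ne] with x hx hm
      exact ⟨(norm_cis _).le, cis_add_ne_one hm hx⟩)
    (integrableOn_squareFun hg0 hg1 _ _) (by
      simp_rw [hint]
      refine ((summable_gammaRatio hg0 hg1 α β).mul_left
        (‖circleFactor (g + α) * circleFactor (g + β)‖ * ‖Complex.Gamma (1 - g) ^ 2‖)).congr
        fun n => ?_
      rw [norm_mul _ (Complex.Gamma (1 - g) ^ 2 * _), norm_mul (Complex.Gamma (1 - g) ^ 2)]; ring)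
  simp_rw [hint] at hb
  have hJ := (hasSum_J hg0 hg1 hα hβ).mul_left (circleFactor (g + α) * circleFactor (g + β))
  exact hb.unique (hJ.congr_fun fun n => by ring)

/-- The shift of the exponents by `g` cancels the parts of the three phases linear in the angles;
the constant parts give `3 · iπg/2`. -/
theorem squareFun_of_mem_triangle {g : ℝ} {α β : ℂ} {x : ℝ × ℝ} (hx : x ∈ triangle) :
    squareFun g (g + α) (g + β) x = qpow g (3 / 2) * triFun g α β x := by
  obtain ⟨h1, h2, h3⟩ := hx
  have m1 : x.1 ∈ Ioo 0 (2 * Real.pi) := ⟨h1, by linarith⟩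
  have m2 : x.2 ∈ Ioo 0 (2 * Real.pi) := ⟨h2, by linarith⟩
  have m3 : x.1 + x.2 ∈ Ioo 0 (2 * Real.pi) := ⟨by linarith, by linarith⟩
  have p1 := two_sin_half_pos m1
  have p2 := two_sin_half_pos m2
  have p3 := two_sin_half_pos m3
  rw [squareFun, circleFun, circleFun, one_sub_cis_cpow m1, one_sub_cis_cpow m2,
    one_sub_cis_cpow m3, triFun, triWeight, Real.mul_rpow (mul_pos p1 p2).le p3.le,
    Real.mul_rpow p1.le p2.le, qpow]
  have key : Complex.exp (Complex.I * (g + α) * x.1) * Complex.exp (-(Complex.I * g * (x.1 - Real.pi) / 2)) *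
      (Complex.exp (Complex.I * (g + β) * x.2) * Complex.exp (-(Complex.I * g * (x.2 - Real.pi) / 2))) *
      Complex.exp (-(Complex.I * g * ((x.1 + x.2 : ℝ) - Real.pi) / 2)) =
      Complex.exp (Complex.I * Real.pi * g * (3 / 2)) * Complex.exp (Complex.I * (α * x.1 + β * x.2)) := by
    simp only [← Complex.exp_add]
    congr 1; push_cast; ring
  push_cast at key ⊢
  linear_combination ((((2 * Real.sin (x.1 / 2)) ^ (-g) : ℝ) : ℂ) *
    (((2 * Real.sin (x.2 / 2)) ^ (-g) : ℝ) : ℂ) *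
    (((2 * Real.sin ((x.1 + x.2) / 2)) ^ (-g) : ℝ) : ℂ)) * key

/-- The reflection of the square. -/
def reflect (x : ℝ × ℝ) : ℝ × ℝ := (2 * Real.pi - x.1, 2 * Real.pi - x.2)

/-- Above the diagonal the angle `φ + ψ` exceeds `2π` and is reduced by `2π` before the principal
power is taken. This raises the constant phase from `3 iπg/2` to `5 iπg/2`. -/
theorem squareFun_reflect {g : ℝ} {α β : ℂ} {x : ℝ × ℝ} (hx : x ∈ triangle) :
    squareFun g (g + α) (g + β) (reflect x) = qpow g (5 / 2) *
      Complex.exp (2 * Real.pi * Complex.I * (α + β)) * triFun g (-α) (-β) x := by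
  obtain ⟨h1, h2, h3⟩ := hx
  have m1 : 2 * Real.pi - x.1 ∈ Ioo 0 (2 * Real.pi) := ⟨by linarith, by linarith⟩
  have m2 : 2 * Real.pi - x.2 ∈ Ioo 0 (2 * Real.pi) := ⟨by linarith, by linarith⟩
  have m3 : 2 * Real.pi - x.1 + (2 * Real.pi - x.2) - 2 * Real.pi ∈ Ioo 0 (2 * Real.pi) :=
    ⟨by linarith, by linarith⟩
  have p1 := two_sin_half_pos (θ := x.1) ⟨h1, by linarith⟩
  have p2 := two_sin_half_pos (θ := x.2) ⟨h2, by linarith⟩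
  have p3 := two_sin_half_pos (θ := x.1 + x.2) ⟨by linarith, by linarith⟩
  have s1 : Real.sin ((2 * Real.pi - x.1) / 2) = Real.sin (x.1 / 2) := by
    rw [← Real.sin_pi_sub]; congr 1; ring
  have s2 : Real.sin ((2 * Real.pi - x.2) / 2) = Real.sin (x.2 / 2) := by
    rw [← Real.sin_pi_sub]; congr 1; ring
  have s3 : Real.sin ((2 * Real.pi - x.1 + (2 * Real.pi - x.2) - 2 * Real.pi) / 2) =
      Real.sin ((x.1 + x.2) / 2) := by
    rw [← Real.sin_pi_sub]; congr 1; ring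
  simp only [squareFun, circleFun, reflect]
  rw [← cis_sub_two_pi (2 * Real.pi - x.1 + _), one_sub_cis_cpow m1, one_sub_cis_cpow m2,
    one_sub_cis_cpow m3, s1, s2, s3, triFun, triWeight, Real.mul_rpow (mul_pos p1 p2).le p3.le,
    Real.mul_rpow p1.le p2.le, qpow]
  have key : Complex.exp (Complex.I * (g + α) * (2 * Real.pi - x.1 : ℝ)) *
      Complex.exp (-(Complex.I * g * ((2 * Real.pi - x.1 : ℝ) - Real.pi) / 2)) *
      (Complex.exp (Complex.I * (g + β) * (2 * Real.pi - x.2 : ℝ)) *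
        Complex.exp (-(Complex.I * g * ((2 * Real.pi - x.2 : ℝ) - Real.pi) / 2))) *
      Complex.exp (-(Complex.I * g * ((2 * Real.pi - x.1 + (2 * Real.pi - x.2) - 2 * Real.pi : ℝ) - Real.pi) / 2)) =
      Complex.exp (Complex.I * Real.pi * g * (5 / 2)) * Complex.exp (2 * Real.pi * Complex.I * (α + β)) *
      Complex.exp (Complex.I * ((-α) * x.1 + (-β) * x.2)) := by
    simp only [← Complex.exp_add]
    congr 1; push_cast; ring
  push_cast at key ⊢
  linear_combination ((((2 * Real.sin (x.1 / 2)) ^ (-g) : ℝ) : ℂ) *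
    (((2 * Real.sin (x.2 / 2)) ^ (-g) : ℝ) : ℂ) *
    (((2 * Real.sin ((x.1 + x.2) / 2)) ^ (-g) : ℝ) : ℂ)) * key

theorem measurePreserving_reflect : MeasurePreserving reflect volume volume :=
  (Measure.measurePreserving_sub_left (volume : Measure ℝ) (2 * Real.pi)).prod
    (Measure.measurePreserving_sub_left (volume : Measure ℝ) (2 * Real.pi))

theorem reflect_reflect (x : ℝ × ℝ) : reflect (reflect x) = x := by ext <;> simp [reflect]

theorem measurableEmbedding_reflect : MeasurableEmbedding reflect := by
  have hm : Measurable reflect := by unfold reflect; fun_prop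
  let E : (ℝ × ℝ) ≃ᵐ (ℝ × ℝ) :=
    { toFun := reflect, invFun := reflect, left_inv := reflect_reflect, right_inv := reflect_reflect
      measurable_toFun := hm, measurable_invFun := hm }
  exact E.measurableEmbedding

/-- The relation between the triangle integral, its reflection and `J`. -/
theorem triInt_add_reflect {g : ℝ} (hg0 : 0 < g) (hg1 : g < 2 / 3) {α β : ℂ}
    (hα : NotPole (g + α)) (hβ : NotPole (g + β)) :
    qpow g (3 / 2) * (triInt g α β + qpow g 1 * Complex.exp (2 * Real.pi * Complex.I * (α + β)) *
      triInt g (-α) (-β)) = circleFactor (g + α) * circleFactor (g + β) * J g α β := by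
  rw [← integral_squareFun hg0 hg1 hα hβ]
  -- The line `φ + ψ = 2π`, a null set, cuts the square into the triangle and its image under the
  -- point reflection.
  have hsplit : (angleSquare : Set (ℝ × ℝ)) =ᵐ[volume] (triangle ∪ reflect ⁻¹' triangle : Set (ℝ × ℝ)) := by
    filter_upwards [ae_add_ne] with x hx
    apply propext
    change x ∈ angleSquare ↔ x ∈ triangle ∪ reflect ⁻¹' triangle
    simp only [angleSquare, mem_prod, mem_Ioo, triangle, mem_union, mem_preimage, mem_ofPred_eq, reflect]
    constructor
    · rintro ⟨⟨h1, h2⟩, h3, h4⟩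
      rcases lt_or_gt_of_ne hx with h | h
      · exact Or.inl ⟨h1, h3, h⟩
      · exact Or.inr ⟨by linarith, by linarith, by linarith⟩
    · rintro (⟨h1, h2, h3⟩ | ⟨h1, h2, h3⟩) <;> refine ⟨⟨?_, ?_⟩, ?_, ?_⟩ <;> linarith
  have hsub : reflect ⁻¹' triangle ⊆ angleSquare := by
    rintro x ⟨h1, h2, h3⟩
    simp only [reflect] at h1 h2 h3
    refine ⟨⟨?_, ?_⟩, ?_, ?_⟩ <;> linarith
  have hdisj : Disjoint triangle (reflect ⁻¹' triangle) := by
    rw [Set.disjoint_left]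
    rintro x ⟨h1, h2, h3⟩ ⟨h4, h5, h6⟩
    simp only [reflect] at h4 h5 h6
    linarith
  have hi := integrableOn_squareFun hg0 hg1 (g + α) (g + β)
  rw [setIntegral_congr_set hsplit, setIntegral_union hdisj
    (measurableEmbedding_reflect.measurable measurableSet_triangle) (hi.mono_set triangle_subset)
    (hi.mono_set hsub)]
  have h1 : ∫ x in triangle, squareFun g (g + α) (g + β) x = qpow g (3 / 2) * triInt g α β := by
    rw [setIntegral_congr_fun measurableSet_triangle fun x hx => squareFun_of_mem_triangle hx,
      integral_const_mul, triInt]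
  have h2 : ∫ x in reflect ⁻¹' triangle, squareFun g (g + α) (g + β) x = qpow g (5 / 2) *
      Complex.exp (2 * Real.pi * Complex.I * (α + β)) * triInt g (-α) (-β) := by
    have := measurePreserving_reflect.setIntegral_preimage_emb measurableEmbedding_reflect
      (fun x => squareFun g (g + α) (g + β) (reflect x)) triangle
    simp only [reflect_reflect] at this
    rw [this, setIntegral_congr_fun measurableSet_triangle fun x hx => squareFun_reflect hx,
      integral_const_mul, triInt]
  rw [h1, h2, mul_add, show qpow g (5 / 2) = qpow g (3 / 2) * qpow g 1 by
    rw [qpow, qpow, qpow, ← Complex.exp_add]; congr 1; ring]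
  ring

end W3

end

noncomputable section

namespace W3

open MeasureTheory Filter Topology Set

/-! Exponential monomials. -/

/-- The monomial `∏ x_κ ^ {m_κ} / m_κ!`. -/
def expMon {ι R : Type*} [CommRing R] [Algebra ℂ R] (x : ι → R) (m : ι →₀ ℕ) : R :=
  m.prod fun κ k => (k.factorial : ℂ)⁻¹ • x κ ^ k

theorem expMon_zero {ι R : Type*} [CommRing R] [Algebra ℂ R] (x : ι → R) : expMon x 0 = 1 := by
  simp [expMon]

theorem inv_factorial_smul_add_pow {R : Type*} [CommRing R] [Algebra ℂ R] (x y : R) (k : ℕ) :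
    (k.factorial : ℂ)⁻¹ • (x + y) ^ k = ∑ q ∈ Finset.HasAntidiagonal.antidiagonal k,
      ((q.1.factorial : ℂ)⁻¹ • x ^ q.1) * ((q.2.factorial : ℂ)⁻¹ • y ^ q.2) := by
  rw [(Commute.all x y).add_pow', Finset.smul_sum]
  refine Finset.sum_congr rfl fun q hq => ?_
  rw [Finset.HasAntidiagonal.mem_antidiagonal] at hq
  rw [smul_mul_smul_comm, ← Nat.cast_smul_eq_nsmul ℂ, smul_smul]
  congr 1
  have h := Nat.choose_mul_factorial_mul_factorial (show q.1 ≤ k by omega)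
  rw [show k - q.1 = q.2 by omega] at h
  have h' : ((k.choose q.1 : ℕ) : ℂ) * q.1.factorial * q.2.factorial = k.factorial := by exact_mod_cast h
  have f1 : (q.1.factorial : ℂ) ≠ 0 := by exact_mod_cast q.1.factorial_ne_zero
  have f2 : (q.2.factorial : ℂ) ≠ 0 := by exact_mod_cast q.2.factorial_ne_zero
  have f3 : (k.factorial : ℂ) ≠ 0 := by exact_mod_cast k.factorial_ne_zero
  field_simp
  linear_combination h'

/-- The multinomial form of `exp (x + y) = exp x exp y`. -/
theorem expMon_add {ι R : Type*} [DecidableEq ι] [CommRing R] [Algebra ℂ R] (x y : ι → R) (m : ι →₀ ℕ) :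
    expMon (fun κ => x κ + y κ) m =
      ∑ p ∈ Finset.HasAntidiagonal.antidiagonal m, expMon x p.1 * expMon y p.2 := by
  have hsub : ∀ (z : ι → R) (a : ι →₀ ℕ), a ≤ m → expMon z a =
      ∏ κ ∈ m.support, ((a κ).factorial : ℂ)⁻¹ • z κ ^ a κ := by
    intro z a ha
    exact Finsupp.prod_of_support_subset _ (Finsupp.support_mono ha) _ (by simp)
  rw [hsub _ m le_rfl]
  simp_rw [inv_factorial_smul_add_pow]
  rw [Finset.prod_sum]
  -- A splitting of the multi-index `m` is the same as a splitting of every exponent on the support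
  -- of `m`; outside the support both parts are zero.
  refine Finset.sum_bij'
    (fun f _ => (Finsupp.indicator m.support fun a h => (f a h).1,
      Finsupp.indicator m.support fun a h => (f a h).2))
    (fun p _ => fun a _ => (p.1 a, p.2 a)) ?_ ?_ ?_ ?_ ?_
  · intro f hf
    rw [Finset.HasAntidiagonal.mem_antidiagonal]
    ext a
    simp only [Finsupp.add_apply, Finsupp.indicator_apply]
    split_ifs with h
    · have := Finset.mem_pi.1 hf a h
      exact Finset.HasAntidiagonal.mem_antidiagonal.1 this
    · simpa [eq_comm] using h
  · intro p hp
    rw [Finset.HasAntidiagonal.mem_antidiagonal] at hp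
    refine Finset.mem_pi.2 fun a h => ?_
    rw [Finset.HasAntidiagonal.mem_antidiagonal, ← hp]; rfl
  · intro f hf
    ext a h <;> simp [Finsupp.indicator_apply] at h ⊢ <;> simp [h]
  · intro p hp
    rw [Finset.HasAntidiagonal.mem_antidiagonal] at hp
    ext a
    · simp only [Finsupp.indicator_apply]
      split_ifs with h
      · rfl
      · have : m a = 0 := by simpa using h
        rw [← hp, Finsupp.add_apply] at this; omega
    · simp only [Finsupp.indicator_apply]
      split_ifs with h
      · rfl
      · have : m a = 0 := by simpa using h
        rw [← hp, Finsupp.add_apply] at this; omega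
  · intro f hf
    have hle : ∀ (h : ∀ a ∈ m.support, ℕ), (∀ a (ha : a ∈ m.support), h a ha ≤ m a) →
        Finsupp.indicator m.support h ≤ m := by
      intro h hh a
      rw [Finsupp.indicator_apply]
      split_ifs with ha
      · exact hh a ha
      · exact Nat.zero_le _
    have hf' := fun a ha => Finset.HasAntidiagonal.mem_antidiagonal.1 (Finset.mem_pi.1 hf a ha)
    rw [hsub x _ (hle _ fun a ha => by have := hf' a ha; omega),
      hsub y _ (hle _ fun a ha => by have := hf' a ha; omega), ← Finset.prod_mul_distrib,
      ← Finset.prod_attach m.support]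
    refine Finset.prod_congr rfl fun a _ => ?_
    simp [Finsupp.indicator_of_mem a.2]

/-- The sum over a box of multi-indices factorises over the variables. The boxes are cofinal among
the finite sets of multi-indices. -/
theorem sum_box_expMon {ι : Type*} (x : ι → ℂ) (s : Finset ι) (N : ℕ) :
    ∑ m ∈ s.finsupp (fun _ => Finset.range N), expMon x m =
      ∏ κ ∈ s, ∑ k ∈ Finset.range N, (k.factorial : ℂ)⁻¹ • x κ ^ k := by
  classical
  rw [Finset.prod_sum, Finset.finsupp, Finset.sum_map]
  refine Finset.sum_congr rfl fun f _ => ?_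
  simp only [Function.Embedding.coeFn_mk]
  rw [expMon, Finsupp.prod_of_support_subset _ (Finsupp.support_indicator_subset _ _) _ (by simp),
    ← Finset.prod_attach s]
  refine Finset.prod_congr rfl fun a _ => ?_
  simp [Finsupp.indicator_of_mem a.2]

theorem norm_expMon {ι : Type*} (x : ι → ℂ) (m : ι →₀ ℕ) :
    ((‖expMon x m‖ : ℝ) : ℂ) = expMon (fun κ => ((‖x κ‖ : ℝ) : ℂ)) m := by
  simp [expMon, Finsupp.prod, norm_prod]

/-- Every finite set of multi-indices lies in a box, and the sum of the norms over a box is at most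
`∏ exp |x_κ| ≤ exp (∑ |x_κ|)`. -/
theorem summable_norm_expMon {ι : Type*} {x : ι → ℂ} (hx : Summable fun κ => ‖x κ‖) :
    Summable fun m => ‖expMon x m‖ := by
  classical
  refine summable_of_sum_le (c := Real.exp (∑' κ, ‖x κ‖)) (fun m => norm_nonneg _) fun u => ?_
  set s : Finset ι := u.biUnion fun m => m.support
  set N : ℕ := (u.sup fun m => m.support.sup m) + 1
  have hu : u ⊆ s.finsupp (fun _ => Finset.range N) := by
    intro m hm
    rw [Finset.mem_finsupp_iff]
    refine ⟨fun a ha => Finset.mem_biUnion.2 ⟨m, hm, ha⟩, fun a _ => ?_⟩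
    rw [Finset.mem_range, Nat.lt_succ_iff]
    by_cases ha : a ∈ m.support
    · exact (Finset.le_sup (f := m) ha).trans (Finset.le_sup (f := fun m : ι →₀ ℕ => m.support.sup m) hm)
    · have : m a = 0 := by simpa using ha
      omega
  have hbox : ∑ m ∈ s.finsupp (fun _ => Finset.range N), ‖expMon x m‖ =
      ∏ κ ∈ s, ∑ k ∈ Finset.range N, ‖x κ‖ ^ k / k.factorial := by
    have h := sum_box_expMon (fun κ => ((‖x κ‖ : ℝ) : ℂ)) s N
    simp_rw [← norm_expMon] at h
    have h2 : ((∑ m ∈ s.finsupp (fun _ => Finset.range N), ‖expMon x m‖ : ℝ) : ℂ) =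
        ((∏ κ ∈ s, ∑ k ∈ Finset.range N, ‖x κ‖ ^ k / k.factorial : ℝ) : ℂ) := by
      push_cast
      rw [h]
      refine Finset.prod_congr rfl fun κ _ => Finset.sum_congr rfl fun k _ => ?_
      rw [smul_eq_mul, div_eq_inv_mul]
    exact_mod_cast h2
  calc ∑ m ∈ u, ‖expMon x m‖ ≤ ∑ m ∈ s.finsupp (fun _ => Finset.range N), ‖expMon x m‖ :=
        Finset.sum_le_sum_of_subset_of_nonneg hu fun _ _ _ => norm_nonneg _
    _ = ∏ κ ∈ s, ∑ k ∈ Finset.range N, ‖x κ‖ ^ k / k.factorial := hbox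
    _ ≤ ∏ κ ∈ s, Real.exp ‖x κ‖ := Finset.prod_le_prod (fun _ _ => by positivity)
        fun κ _ => Real.sum_le_exp_of_nonneg (norm_nonneg _) N
    _ = Real.exp (∑ κ ∈ s, ‖x κ‖) := (Real.exp_sum _ _).symm
    _ ≤ _ := Real.exp_le_exp.2 (hx.sum_le_tsum s fun _ _ => norm_nonneg _)

/-- Summability being known, the value can be computed along boxes, where the sum is a product of
partial exponential sums. -/
theorem hasSum_expMon {ι : Type*} {x : ι → ℂ} (hx : Summable fun κ => ‖x κ‖) :
    HasSum (expMon x) (Complex.exp (∑' κ, x κ)) := by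
  classical
  obtain ⟨A, hA⟩ := (summable_norm_expMon hx).of_norm
  have hbox : Tendsto (fun v : Finset ι × ℕ => v.1.finsupp (fun _ => Finset.range (v.2 + 1))) atTop atTop := by
    refine tendsto_atTop_finset_of_monotone ?_ ?_
    · intro v w hvw m hm
      rw [Finset.mem_finsupp_iff] at hm ⊢
      refine ⟨hm.1.trans hvw.1, fun a _ => ?_⟩
      by_cases h : a ∈ v.1
      · exact Finset.mem_range.2 ((Finset.mem_range.1 (hm.2 a h)).trans_le (Nat.succ_le_succ hvw.2))
      · by_cases ha : a ∈ m.support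
        · exact absurd (hm.1 ha) h
        · have h0 : m a = 0 := by simpa using ha
          rw [h0]
          exact Finset.mem_range.2 (Nat.succ_pos _)
    · intro m
      refine ⟨(m.support, m.support.sup m), ?_⟩
      rw [Finset.mem_finsupp_iff]
      exact ⟨subset_rfl, fun a ha => Finset.mem_range.2 (Nat.lt_succ_iff.2 (Finset.le_sup (f := m) ha))⟩
  have h1 := hA.comp hbox
  simp only [Function.comp_def, sum_box_expMon] at h1
  have h2 : ∀ s : Finset ι, Tendsto (fun N => ∏ κ ∈ s, ∑ k ∈ Finset.range (N + 1),
      (k.factorial : ℂ)⁻¹ • x κ ^ k) atTop (𝓝 (Complex.exp (∑ κ ∈ s, x κ))) := by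
    intro s
    rw [Complex.exp_sum]
    refine tendsto_finsetProd _ fun κ _ => ?_
    have h := (NormedSpace.exp_series_hasSum_exp' (𝕂 := ℂ) (x κ)).tendsto_sum_nat
    rw [← Complex.exp_eq_exp_ℂ] at h
    exact (tendsto_add_atTop_iff_nat 1).2 h
  have h3 : Tendsto (fun s : Finset ι => Complex.exp (∑ κ ∈ s, x κ)) atTop
      (𝓝 (Complex.exp (∑' κ, x κ))) :=
    (Complex.continuous_exp.tendsto _).comp hx.of_norm.hasSum
  -- The joint limit over boxes equals the iterated one: `N → ∞` for a fixed set of variables, then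
  -- the set of variables grows.
  have h4 : Tendsto (fun s : Finset ι => Complex.exp (∑ κ ∈ s, x κ)) atTop (𝓝 A) := by
    rw [Metric.tendsto_nhds]
    intro ε hε
    have := Metric.tendsto_nhds.1 h1 (ε / 2) (by positivity)
    rw [← prod_atTop_atTop_eq] at this
    filter_upwards [this.curry] with s hs
    have h5 := (h2 s).dist (tendsto_const_nhds (x := A))
    have := le_of_tendsto h5 (hs.mono fun N hN => hN.le)
    linarith
  rw [tendsto_nhds_unique h3 h4]
  exact hA

end W3

end

noncomputable section

namespace W3

open MeasureTheory Filter Topology Set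

/-! Products of vertex operators. -/

theorem coeff_expLinear (c : Osc → ℂ) (m : Osc →₀ ℕ) :
    MvPowerSeries.coeff m (expLinear c) = expMon c m := by
  rw [expLinear, coeff_ofCoeffs, expMon]
  simp [smul_eq_mul, div_eq_inv_mul]

theorem expLinear_zero : expLinear (fun _ => 0) = vacuum := by
  ext m
  rw [coeff_expLinear, vacuum, MvPowerSeries.coeff_one]
  split_ifs with h
  · rw [h, expMon_zero]
  · obtain ⟨κ, hκ⟩ := Finsupp.ne_iff.1 h
    rw [expMon, Finsupp.prod]
    refine Finset.prod_eq_zero (i := κ) (by simpa using hκ) ?_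
    rw [zero_pow (by simpa using hκ), smul_zero]

theorem expLinear_add (c d : Osc → ℂ) :
    expLinear (fun κ => c κ + d κ) = expLinear c * expLinear d := by
  ext m
  rw [coeff_expLinear, expMon_add, MvPowerSeries.coeff_mul]
  simp_rw [coeff_expLinear]

/-- The variable `(a, n)` has level `n + 1`; thus `r^L` maps a coherent state to the coherent state
with rescaled parameters. -/
theorem expMon_smul_mul (r : ℂ) (c : Osc → ℂ) (m : Osc →₀ ℕ) :
    r ^ level m * expMon c m = expMon (fun κ => r ^ (κ.2 + 1) * c κ) m := by
  rw [expMon, expMon, level, Finsupp.sum, Finsupp.prod, Finsupp.prod, ← Finset.prod_pow_eq_pow_sum,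
    ← Finset.prod_mul_distrib]
  refine Finset.prod_congr rfl fun κ _ => ?_
  simp only [smul_eq_mul]
  rw [mul_pow, ← pow_mul, mul_comm (m κ)]; ring

/-- The coefficients of the linear form in `creationExp`. -/
def creationCoeff (i : Fin 3) (u : ℝ) (κ : Osc) : ℂ :=
  -2 * (e i κ.1 : ℂ) / ((κ.2 : ℂ) + 1) * Complex.exp (Complex.I * ((κ.2 : ℂ) + 1) * u)

/-- The shifts in `annihilationExp`. -/
def annihilationCoeff (g : ℝ) (i : Fin 3) (u : ℝ) (κ : Osc) : ℂ :=
  (g : ℂ) * (e i κ.1 : ℂ) * Complex.exp (-(Complex.I * ((κ.2 : ℂ) + 1) * u))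

theorem creationExp_eq (i : Fin 3) (u : ℝ) : creationExp i u = expLinear (creationCoeff i u) := rfl

/-- The shift turns the divided power of `c x` into that of `c x + c d`, which `expMon_add` splits.
Summed over `m`, this says that a coherent state is an eigenvector of the annihilation part. -/
theorem expMon_mul_annihilationExp (g : ℝ) (i : Fin 3) (u : ℝ) (c : Osc → ℂ) (m : Osc →₀ ℕ) :
    expMon c m • annihilationExp g i u (MvPolynomial.monomial m 1) =
      ∑ q ∈ Finset.HasAntidiagonal.antidiagonal m,
        MvPolynomial.monomial q.1 (expMon c q.1 *
          expMon (fun κ => c κ * annihilationCoeff g i u κ) q.2) := by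
  have h1 : expMon c m • annihilationExp g i u (MvPolynomial.monomial m 1) =
      expMon (R := Fock) (fun κ => c κ • MvPolynomial.X κ +
        MvPolynomial.C (c κ * annihilationCoeff g i u κ)) m := by
    rw [annihilationExp, MvPolynomial.aeval_monomial, map_one, one_mul, expMon, expMon,
      Finsupp.prod, Finsupp.prod, Finsupp.prod, ← Finset.prod_smul]
    refine Finset.prod_congr rfl fun κ _ => ?_
    rw [show c κ • MvPolynomial.X κ + MvPolynomial.C (c κ * annihilationCoeff g i u κ) =
      c κ • (MvPolynomial.X κ + MvPolynomial.C (annihilationCoeff g i u κ) : Fock) by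
        rw [smul_add, ← MvPolynomial.C_mul', map_mul, MvPolynomial.smul_eq_C_mul,
          MvPolynomial.C_mul'], smul_pow, smul_smul]
    rfl
  rw [h1, expMon_add]
  refine Finset.sum_congr rfl fun q _ => ?_
  have h2 : expMon (R := Fock) (fun κ => c κ • MvPolynomial.X κ) q.1 =
      MvPolynomial.monomial q.1 (expMon c q.1) := by
    rw [MvPolynomial.monomial_eq, expMon, expMon, Finsupp.prod, Finsupp.prod, Finsupp.prod,
      map_prod, ← Finset.prod_mul_distrib]
    refine Finset.prod_congr rfl fun κ _ => ?_
    rw [smul_pow, smul_smul, MvPolynomial.smul_eq_C_mul, smul_eq_mul]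
  have h3 : expMon (R := Fock) (fun κ => MvPolynomial.C (c κ * annihilationCoeff g i u κ)) q.2 =
      MvPolynomial.C (expMon (fun κ => c κ * annihilationCoeff g i u κ) q.2) := by
    rw [expMon, expMon, Finsupp.prod, Finsupp.prod, map_prod]
    refine Finset.prod_congr rfl fun κ _ => ?_
    rw [MvPolynomial.smul_eq_C_mul, smul_eq_mul, ← map_pow, ← map_mul]
  rw [h2, h3, mul_comm, MvPolynomial.C_mul_monomial, mul_comm (expMon c q.1)]

/-- Only the finitely many `a ≤ m` contribute to the component `m`. -/
theorem hasSum_coeff_mul_monomial (φ : FockHat) (c : Osc → ℂ) (m : Osc →₀ ℕ) :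
    HasSum (fun a => expMon c a * MvPowerSeries.coeff m (φ * MvPowerSeries.monomial a (1 : ℂ)))
      (MvPowerSeries.coeff m (φ * expLinear c)) ∧
    Summable fun a => ‖expMon c a * MvPowerSeries.coeff m (φ * MvPowerSeries.monomial a (1 : ℂ))‖ := by
  set s : Finset (Osc →₀ ℕ) := (Finset.HasAntidiagonal.antidiagonal m).image Prod.snd
  have hs : ∀ a ∉ s, expMon c a * MvPowerSeries.coeff m (φ * MvPowerSeries.monomial a (1 : ℂ)) = 0 := by
    intro a ha
    rw [MvPowerSeries.coeff_mul_monomial, if_neg, mul_zero]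
    intro hle
    refine ha (Finset.mem_image.2 ⟨(m - a, a), ?_, rfl⟩)
    rw [Finset.HasAntidiagonal.mem_antidiagonal]
    exact tsub_add_cancel_of_le hle
  constructor
  · have h : HasSum (fun a => expMon c a *
        MvPowerSeries.coeff m (φ * MvPowerSeries.monomial a (1 : ℂ))) _ :=
      hasSum_sum_of_ne_finset_zero hs
    convert h using 1
    rw [MvPowerSeries.coeff_mul, Finset.sum_image]
    · refine Finset.sum_congr rfl fun q hq => ?_
      rw [Finset.HasAntidiagonal.mem_antidiagonal] at hq
      rw [MvPowerSeries.coeff_mul_monomial, if_pos (by rw [← hq]; exact le_add_self), coeff_expLinear,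
        ← hq, add_tsub_cancel_right]
      ring
    · rintro ⟨a, b⟩ hp ⟨a', b'⟩ hq (rfl : b = b')
      have h1 := Finset.HasAntidiagonal.mem_antidiagonal.1 hp
      have h2 := Finset.HasAntidiagonal.mem_antidiagonal.1 hq
      have : a = a' := add_right_cancel (h1.trans h2.symm)
      rw [this]
  · exact (hasSum_sum_of_ne_finset_zero (s := s) (L := SummationFilter.unconditional _)
      fun a ha => by rw [hs a ha, norm_zero]).summable

/-- The phase of a vertex operator. -/
def vertexPhase (g : ℝ) (i : Fin 3) (u : ℝ) (p : Fin 2 → ℂ) : ℂ :=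
  qpow g (1 / 2) * Complex.exp (-(2 * Complex.I * u * dot (e i) p) + Complex.I * g * u)

theorem coeff_vertexOp_monomial (g : ℝ) (i : Fin 3) (u : ℝ) (p : Fin 2 → ℂ) (c : Osc → ℂ)
    (m m' : Osc →₀ ℕ) :
    expMon c m' * MvPowerSeries.coeff m (vertexOp g i u p (MvPolynomial.monomial m' 1)) =
      vertexPhase g i u p * ∑ q ∈ Finset.HasAntidiagonal.antidiagonal m',
        (expMon c q.1 * MvPowerSeries.coeff m (creationExp i u * MvPowerSeries.monomial q.1 (1 : ℂ))) *
          expMon (fun κ => c κ * annihilationCoeff g i u κ) q.2 := by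
  have h : expMon c m' • (creationExp i u * ((annihilationExp g i u (MvPolynomial.monomial m' 1) : Fock) : FockHat)) =
      ∑ q ∈ Finset.HasAntidiagonal.antidiagonal m', (expMon c q.1 *
        expMon (fun κ => c κ * annihilationCoeff g i u κ) q.2) •
          (creationExp i u * MvPowerSeries.monomial q.1 (1 : ℂ)) := by
    rw [← mul_smul_comm, ← MvPolynomial.coe_smul, expMon_mul_annihilationExp]
    have hc : ∀ s : Finset ((Osc →₀ ℕ) × (Osc →₀ ℕ)), ∀ f : (Osc →₀ ℕ) × (Osc →₀ ℕ) → Fock,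
        ((∑ q ∈ s, f q : Fock) : FockHat) = ∑ q ∈ s, (f q : FockHat) := fun s f =>
      map_sum (MvPolynomial.coeToMvPowerSeries.ringHom (R := ℂ) (σ := Osc)) f s
    rw [hc, Finset.mul_sum]
    refine Finset.sum_congr rfl fun q _ => ?_
    rw [MvPolynomial.coe_monomial, ← mul_smul_comm]
    congr 1
    rw [← map_smul, smul_eq_mul, mul_one]
  have h2 := congrArg (MvPowerSeries.coeff m) h
  rw [map_smul, map_sum] at h2
  simp only [map_smul, smul_eq_mul] at h2
  rw [vertexOp, map_smul, smul_eq_mul, mul_left_comm, h2]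
  congr 1
  refine Finset.sum_congr rfl fun q _ => ?_
  ring

theorem hasSum_sum_antidiagonal {A : Type*} [AddCommMonoid A] [Finset.HasAntidiagonal A]
    {F G : A → ℂ} {a b : ℂ} (hF : HasSum F a) (hG : HasSum G b) (hF' : Summable fun n => ‖F n‖)
    (hG' : Summable fun n => ‖G n‖) :
    HasSum (fun n => ∑ q ∈ Finset.HasAntidiagonal.antidiagonal n, F q.1 * G q.2) (a * b) := by
  have hFG := summable_mul_of_summable_norm hF' hG'
  rw [← hF.tsum_eq, ← hG.tsum_eq,
    hF.summable.tsum_mul_tsum_eq_tsum_sum_antidiagonal hG.summable hFG]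
  exact (summable_sum_mul_antidiagonal_of_summable_mul hFG).hasSum

/-- The sum over intermediate states is the Cauchy product of a coherent state, multiplied by the
creation part, with the exponential series of `∑ c d`. The result is again a coherent state, which
makes iteration possible. -/
theorem hasSum_coeff_vertexOp (g : ℝ) (i : Fin 3) (u : ℝ) (p : Fin 2 → ℂ) {c : Osc → ℂ}
    (hc : Summable fun κ => ‖c κ * annihilationCoeff g i u κ‖) (m : Osc →₀ ℕ) :
    HasSum (fun m' => expMon c m' *
        MvPowerSeries.coeff m (vertexOp g i u p (MvPolynomial.monomial m' 1)))
      (vertexPhase g i u p * (expMon (fun κ => creationCoeff i u κ + c κ) m *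
        Complex.exp (∑' κ, c κ * annihilationCoeff g i u κ))) := by
  obtain ⟨hF, hF'⟩ := hasSum_coeff_mul_monomial (creationExp i u) c m
  rw [creationExp_eq, ← expLinear_add, coeff_expLinear, ← creationExp_eq] at hF
  have h := (hasSum_sum_antidiagonal hF (hasSum_expMon hc) hF' (summable_norm_expMon hc)).mul_left
    (vertexPhase g i u p)
  refine h.congr_fun fun m' => ?_
  exact coeff_vertexOp_monomial g i u p c m m'

/-- The exponent of the regularised product of vertex operators. -/
def stateCoeff (r : ℝ) : List (Fin 3 × ℝ) → Osc → ℂ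
  | [], _ => 0
  | (i, u) :: l, κ => creationCoeff i u κ + (r : ℂ) ^ (κ.2 + 1) * stateCoeff r l κ

/-- The scalar factor of the regularised product of vertex operators. -/
def stateConst (g : ℝ) (p : Fin 2 → ℂ) (r : ℝ) : List (Fin 3 × ℝ) → ℂ
  | [] => 1
  | (i, u) :: l => stateConst g p r l * (vertexPhase g i u (momentum g p l) *
      Complex.exp (∑' κ : Osc, (r : ℂ) ^ (κ.2 + 1) * stateCoeff r l κ * annihilationCoeff g i u κ))

theorem abs_e_le (i : Fin 3) (a : Fin 2) : |e i a| ≤ 1 := by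
  have h3 : √3 ≤ 2 := Real.sqrt_le_iff.2 ⟨by norm_num, by norm_num⟩
  have h0 := Real.sqrt_nonneg 3
  fin_cases i <;> fin_cases a <;> simp [e, abs_le] <;> (try constructor) <;> linarith

theorem norm_exp_I_mul (n : ℕ) (u : ℝ) : ‖Complex.exp (Complex.I * ((n : ℂ) + 1) * u)‖ = 1 := by
  rw [show Complex.I * ((n : ℂ) + 1) * u = ((((n : ℝ) + 1) * u : ℝ) : ℂ) * Complex.I by push_cast; ring]
  exact Complex.norm_exp_ofReal_mul_I _

theorem norm_creationCoeff_le (i : Fin 3) (u : ℝ) (κ : Osc) : ‖creationCoeff i u κ‖ ≤ 2 := by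
  have h1 : ‖((κ.2 : ℂ) + 1)‖ = (κ.2 : ℝ) + 1 := by
    rw [← Nat.cast_one, ← Nat.cast_add, Complex.norm_natCast]; push_cast; rfl
  rw [creationCoeff, norm_mul, norm_exp_I_mul, mul_one, norm_div, norm_mul, h1, Complex.norm_real,
    norm_neg, Complex.norm_ofNat, Real.norm_eq_abs, div_le_iff₀ (by positivity)]
  have := abs_e_le i κ.1
  have h2 : (0 : ℝ) ≤ κ.2 := Nat.cast_nonneg _
  linarith

theorem norm_annihilationCoeff_le (g : ℝ) (i : Fin 3) (u : ℝ) (κ : Osc) :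
    ‖annihilationCoeff g i u κ‖ ≤ |g| := by
  rw [annihilationCoeff, norm_mul, Complex.exp_neg, norm_inv, norm_exp_I_mul, norm_mul,
    Complex.norm_real, Complex.norm_real, inv_one, mul_one, Real.norm_eq_abs, Real.norm_eq_abs]
  exact mul_le_of_le_one_right (abs_nonneg _) (abs_e_le _ _)

theorem norm_stateCoeff_le {r : ℝ} (hr0 : 0 < r) (hr1 : r < 1) (l : List (Fin 3 × ℝ)) (κ : Osc) :
    ‖stateCoeff r l κ‖ ≤ 2 * l.length := by
  induction l with
  | nil => simp [stateCoeff]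
  | cons a l ih =>
    obtain ⟨i, u⟩ := a
    rw [stateCoeff, List.length_cons]
    refine (norm_add_le _ _).trans ?_
    rw [norm_mul, norm_pow, Complex.norm_real, Real.norm_eq_abs, abs_of_pos hr0]
    have h1 := norm_creationCoeff_le i u κ
    have h2 : r ^ (κ.2 + 1) ≤ 1 := pow_le_one₀ hr0.le hr1.le
    have h3 := mul_le_of_le_one_left (norm_nonneg (stateCoeff r l κ)) h2
    push_cast
    linarith

theorem summable_pow_osc {r : ℝ} (hr0 : 0 < r) (hr1 : r < 1) :
    Summable fun κ : Osc => r ^ (κ.2 + 1) := by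
  have : Summable fun n : ℕ => r ^ (n + 1) :=
    (summable_nat_add_iff 1).2 (summable_geometric_of_lt_one hr0.le hr1)
  have h2 := ((hasSum_fintype fun _ : Fin 2 => (1 : ℝ)).summable).mul_of_nonneg this
    (fun _ => zero_le_one) (fun n => by positivity)
  simpa using h2

theorem summable_stateCoeff (g : ℝ) {r : ℝ} (hr0 : 0 < r) (hr1 : r < 1) (l : List (Fin 3 × ℝ))
    (i : Fin 3) (u : ℝ) :
    Summable fun κ : Osc => ‖(r : ℂ) ^ (κ.2 + 1) * stateCoeff r l κ * annihilationCoeff g i u κ‖ := by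
  refine Summable.of_nonneg_of_le (fun _ => norm_nonneg _) (fun κ => ?_)
    ((summable_pow_osc hr0 hr1).mul_right (2 * l.length * |g|))
  rw [norm_mul, norm_mul, norm_pow, Complex.norm_real, Real.norm_eq_abs, abs_of_pos hr0, mul_assoc]
  gcongr
  · exact norm_stateCoeff_le hr0 hr1 l κ
  · exact norm_annihilationCoeff_le g i u κ

/-- Induction on the word: the regulator and the next operator both preserve coherent states. The
factors `r^{n+1}` with `r < 1` make all the contraction sums converge, since the coefficients are
bounded. -/
theorem regProduct_eq (g : ℝ) (p : Fin 2 → ℂ) {r : ℝ} (hr0 : 0 < r) (hr1 : r < 1)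
    (l : List (Fin 3 × ℝ)) :
    RegSummable g p r l ∧ regProduct g p r l = stateConst g p r l • expLinear (stateCoeff r l) := by
  induction l with
  | nil =>
    refine ⟨trivial, ?_⟩
    rw [regProduct, stateConst, one_smul, ← expLinear_zero]; rfl
  | cons a l ih =>
    obtain ⟨i, u⟩ := a
    have key : ∀ m, HasSum (fun m' : Osc →₀ ℕ =>
        ((r : ℂ) ^ level m' * MvPowerSeries.coeff m' (regProduct g p r l)) *
          MvPowerSeries.coeff m (vertexOp g i u (momentum g p l) (MvPolynomial.monomial m' 1)))
        (stateConst g p r ((i, u) :: l) * expMon (stateCoeff r ((i, u) :: l)) m) := by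
      intro m
      have h := (hasSum_coeff_vertexOp g i u (momentum g p l)
        (summable_stateCoeff g hr0 hr1 l i u) m).mul_left (stateConst g p r l)
      have hv : stateConst g p r ((i, u) :: l) * expMon (stateCoeff r ((i, u) :: l)) m =
          stateConst g p r l * (vertexPhase g i u (momentum g p l) *
            (expMon (fun κ => creationCoeff i u κ + (r : ℂ) ^ (κ.2 + 1) * stateCoeff r l κ) m *
              Complex.exp (∑' κ : Osc, (r : ℂ) ^ (κ.2 + 1) * stateCoeff r l κ *
                annihilationCoeff g i u κ))) := by
        simp only [stateConst]
        rw [show stateCoeff r ((i, u) :: l) = fun κ => creationCoeff i u κ +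
          (r : ℂ) ^ (κ.2 + 1) * stateCoeff r l κ from rfl]
        ring
      rw [hv]
      refine h.congr_fun fun m' => ?_
      rw [ih.2, map_smul, smul_eq_mul, coeff_expLinear, mul_left_comm, expMon_smul_mul, mul_assoc]
    refine ⟨⟨ih.1, fun m => (key m).summable⟩, ?_⟩
    ext m
    rw [regProduct, coeff_ofCoeffs, (key m).tsum_eq, map_smul, smul_eq_mul, coeff_expLinear]

end W3

end

/-! ### Contractions, and the limit `r → 1` for three different letters. -/

noncomputable section

namespace W3

open MeasureTheory Filter Topology Set

/-- The Gram matrix of the vectors `e_i`. -/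
theorem sum_e_mul_e {i j : Fin 3} (h : i ≠ j) : ∑ a, e i a * e j a = -(1 / 2) := by
  have h3 : √3 * √3 = 3 := Real.mul_self_sqrt (by norm_num)
  fin_cases i <;> fin_cases j <;> simp [e, Fin.sum_univ_two] at h ⊢ <;> nlinarith

theorem dot_sub_e (i j : Fin 3) (h : i ≠ j) (g : ℝ) (p : Fin 2 → ℂ) :
    dot (e i) (fun k => p k - g * e j k) = dot (e i) p + g / 2 := by
  have h1 : ((∑ a, e i a * e j a : ℝ) : ℂ) = ((-(1 / 2) : ℝ) : ℂ) := by rw [sum_e_mul_e h]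
  simp only [dot, Fin.sum_univ_two] at h1 ⊢
  push_cast at h1
  linear_combination (-(g : ℂ)) * h1

/-- The contraction of the oscillators of two vertex operators. -/
theorem hasSum_contraction (g : ℝ) {i j : Fin 3} (hij : i ≠ j) {R : ℝ} (hR0 : 0 < R) (hR1 : R < 1)
    (u v : ℝ) :
    HasSum (fun κ : Osc => (R : ℂ) ^ (κ.2 + 1) * creationCoeff j v κ * annihilationCoeff g i u κ)
      (-(g : ℂ) * Complex.log (1 - R * cis (v - u))) := by
  have hz : ‖(R : ℂ) * cis (v - u)‖ < 1 := by
    rw [norm_mul, norm_cis, mul_one, Complex.norm_real, Real.norm_eq_abs, abs_of_pos hR0]; exact hR1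
  -- The term of index 0 in the logarithmic series is a division by zero, hence 0. Dropping it
  -- matches the oscillator `(a, n)` with the power `n + 1`.
  have h1 := (hasSum_nat_add_iff' 1).2 (Complex.hasSum_taylorSeries_neg_log hz)
  simp only [Finset.range_one, Finset.sum_singleton, Nat.cast_zero, div_zero, sub_zero] at h1
  have hs : Summable fun κ : Osc =>
      (R : ℂ) ^ (κ.2 + 1) * creationCoeff j v κ * annihilationCoeff g i u κ := by
    refine Summable.of_norm_bounded ((summable_pow_osc hR0 hR1).mul_right (2 * |g|)) fun κ => ?_
    rw [norm_mul, norm_mul, norm_pow, Complex.norm_real, Real.norm_eq_abs, abs_of_pos hR0, mul_assoc]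
    gcongr
    · exact norm_creationCoeff_le j v κ
    · exact norm_annihilationCoeff_le g i u κ
  have hterm : ∀ (a : Fin 2) (n : ℕ), (R : ℂ) ^ (n + 1) * creationCoeff j v (a, n) *
      annihilationCoeff g i u (a, n) =
      (-2 * g * ((e i a : ℂ) * e j a)) * (((R : ℂ) * cis (v - u)) ^ (n + 1) / ((n + 1 : ℕ) : ℂ)) := by
    intro a n
    have hc : cis (v - u) ^ (n + 1) = Complex.exp (Complex.I * ((n : ℂ) + 1) * v) *
        Complex.exp (-(Complex.I * ((n : ℂ) + 1) * u)) := by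
      rw [cis, ← Complex.exp_nat_mul, ← Complex.exp_add]; congr 1; push_cast; ring
    rw [mul_pow, hc, creationCoeff, annihilationCoeff]
    have : ((n : ℂ) + 1) ≠ 0 := Nat.cast_add_one_ne_zero n
    push_cast
    field_simp
  have hfib : ∀ a : Fin 2, HasSum (fun n : ℕ => (R : ℂ) ^ (n + 1) * creationCoeff j v (a, n) *
      annihilationCoeff g i u (a, n)) ((-2 * g * ((e i a : ℂ) * e j a)) *
        (-Complex.log (1 - R * cis (v - u)))) := fun a => by
    simp_rw [hterm]
    exact h1.mul_left _
  have h2 := hs.hasSum.prod_fiberwise hfib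
  have h3 := h2.unique (hasSum_fintype _)
  have h4 := hs.hasSum
  rw [h3] at h4
  convert h4 using 1
  rw [← Finset.sum_mul, ← Finset.mul_sum]
  have h5 : ((∑ a, e i a * e j a : ℝ) : ℂ) = ((-(1 / 2) : ℝ) : ℂ) := by rw [sum_e_mul_e hij]
  push_cast at h5
  rw [h5]; ring

theorem norm_mul_cis_lt {R : ℝ} (hR0 : 0 < R) (hR1 : R < 1) (θ : ℝ) : 1 - (R : ℂ) * cis θ ≠ 0 := by
  intro h
  have h1 : ‖(R : ℂ) * cis θ‖ = 1 := by rw [← sub_eq_zero.1 h, norm_one]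
  rw [norm_mul, norm_cis, mul_one, Complex.norm_real, Real.norm_eq_abs, abs_of_pos hR0] at h1
  linarith

/-- The contribution of a contraction to the regularised product. -/
theorem exp_contraction (g : ℝ) {R : ℝ} (hR0 : 0 < R) (hR1 : R < 1) (θ : ℝ) :
    Complex.exp (-(g : ℂ) * Complex.log (1 - R * cis θ)) = (1 - R * cis θ) ^ (-(g : ℂ)) := by
  rw [Complex.cpow_def_of_ne_zero (norm_mul_cis_lt hR0 hR1 θ), mul_comm]

/-- Neighbouring operators are separated by one regulator `r^L`, the first and the last by two;
their contraction therefore contains `r²`. -/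
theorem stateConst_three (g : ℝ) (p : Fin 2 → ℂ) {r : ℝ} (hr0 : 0 < r) (hr1 : r < 1)
    {σ : Fin 3 → Fin 3} (hσ : Function.Injective σ) (u : Fin 3 → ℝ) :
    stateConst g p r (word σ u) = (vertexPhase g (σ 2) (u 2) p *
      vertexPhase g (σ 1) (u 1) (fun k => p k - g * e (σ 2) k) *
      vertexPhase g (σ 0) (u 0) (fun k => p k - g * e (σ 2) k - g * e (σ 1) k)) *
      ((1 - r * cis (u 2 - u 1)) ^ (-(g : ℂ)) * (1 - r * cis (u 1 - u 0)) ^ (-(g : ℂ)) *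
        (1 - (r ^ 2 : ℝ) * cis (u 2 - u 0)) ^ (-(g : ℂ))) := by
  have h01 : σ 0 ≠ σ 1 := fun h => absurd (hσ h) (by decide)
  have h02 : σ 0 ≠ σ 2 := fun h => absurd (hσ h) (by decide)
  have h12 : σ 1 ≠ σ 2 := fun h => absurd (hσ h) (by decide)
  have hr2 : 0 < r ^ 2 := by positivity
  have hr3 : r ^ 2 < 1 := by nlinarith
  have e1 : (∑' κ : Osc, (r : ℂ) ^ (κ.2 + 1) * stateCoeff r [] κ * annihilationCoeff g (σ 2) (u 2) κ) = 0 := by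
    simp [stateCoeff]
  have c12 := hasSum_contraction g h12 hr0 hr1 (u 1) (u 2)
  have c01 := hasSum_contraction g h01 hr0 hr1 (u 0) (u 1)
  have c02 := hasSum_contraction g h02 hr2 hr3 (u 0) (u 2)
  have e2 : (∑' κ : Osc, (r : ℂ) ^ (κ.2 + 1) * stateCoeff r [(σ 2, u 2)] κ *
      annihilationCoeff g (σ 1) (u 1) κ) = -(g : ℂ) * Complex.log (1 - r * cis (u 2 - u 1)) := by
    rw [← c12.tsum_eq]; simp [stateCoeff]
  have e3 : (∑' κ : Osc, (r : ℂ) ^ (κ.2 + 1) * stateCoeff r [(σ 1, u 1), (σ 2, u 2)] κ *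
      annihilationCoeff g (σ 0) (u 0) κ) = -(g : ℂ) * Complex.log (1 - r * cis (u 1 - u 0)) +
        -(g : ℂ) * Complex.log (1 - (r ^ 2 : ℝ) * cis (u 2 - u 0)) := by
    rw [← (c01.add c02).tsum_eq]
    congr 1; ext κ
    simp only [stateCoeff, mul_zero, add_zero]
    push_cast
    ring
  have hw : word σ u = [(σ 0, u 0), (σ 1, u 1), (σ 2, u 2)] := by
    simp [word, List.ofFn_succ]
  rw [hw]
  simp only [stateConst, momentum]
  rw [e1, e2, e3, Complex.exp_add, exp_contraction g hr0 hr1, exp_contraction g hr0 hr1,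
    exp_contraction g hr2 hr3, Complex.exp_zero]
  ring

/-- The scalar factor of a product of three different vertex operators. -/
def wordFun (g : ℝ) (p : Fin 2 → ℂ) (σ : Fin 3 → Fin 3) (u : Fin 3 → ℝ) : ℂ :=
  Complex.exp (-(2 * Complex.I * ∑ k, dot (e (σ k)) p * u k)) *
    ((((2 * Real.sin ((u 0 - u 1) / 2)) * (2 * Real.sin ((u 0 - u 2) / 2)) *
      (2 * Real.sin ((u 1 - u 2) / 2))) ^ (-g) : ℝ) : ℂ)

theorem one_sub_cis_neg_cpow {θ : ℝ} (h : θ ∈ Ioo 0 (2 * Real.pi)) (g : ℝ) :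
    (1 - cis (-θ)) ^ (-(g : ℂ)) = ((2 * Real.sin (θ / 2)) ^ (-g) : ℝ) *
      Complex.exp (-(Complex.I * g * (Real.pi - θ) / 2)) := by
  have h1 : 2 * Real.pi - θ ∈ Ioo 0 (2 * Real.pi) := ⟨by linarith [h.2], by linarith [h.1]⟩
  have h2 := one_sub_cis_cpow h1 g
  rw [show 2 * Real.pi - θ = -(θ - 2 * Real.pi) by ring] at h2
  have h3 : cis (-(θ - 2 * Real.pi)) = cis (-θ) := by
    rw [← cis_sub_two_pi (-(θ - 2 * Real.pi))]; congr 1; ring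
  rw [h3, show -(θ - 2 * Real.pi) / 2 = Real.pi - θ / 2 by ring, Real.sin_pi_sub] at h2
  rw [h2]
  congr 3
  push_cast; ring

theorem tendsto_contraction (g : ℝ) {θ : ℝ} (h : θ ∈ Ioo 0 (2 * Real.pi)) {f : ℝ → ℝ}
    (hf : Tendsto f (𝓝[<] 1) (𝓝 1)) :
    Tendsto (fun r => (1 - (f r : ℂ) * cis (-θ)) ^ (-(g : ℂ))) (𝓝[<] 1) (𝓝 ((1 - cis (-θ)) ^ (-(g : ℂ)))) := by
  have hne : cis (-θ) ≠ 1 := by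
    intro h1
    apply cis_ne_one h
    have h2 := cis_add θ (-θ)
    rw [h1, add_neg_cancel, mul_one, cis] at h2
    simpa using h2.symm
  have hs : (1 : ℂ) - cis (-θ) ∈ Complex.slitPlane := one_sub_mem_slitPlane hne (norm_cis _).le
  have h1 : Tendsto (fun r => 1 - (f r : ℂ) * cis (-θ)) (𝓝[<] 1) (𝓝 (1 - cis (-θ))) := by
    have := (((Complex.continuous_ofReal.tendsto 1).comp hf).mul_const (cis (-θ))).const_sub 1
    simpa using this
  exact (continuousAt_cpow_const hs).tendsto.comp h1

/-- The contractions leave the phase `-3πg/2 + g (u₀ - u₂)`. It is cancelled by the three factors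
`q^{1/2}`, the phases `e^{igu}` and the momentum shifts, each earlier letter raising `e_i p` by
`g/2`. The plane wave at the original `p` and a real weight remain. -/
theorem tendsto_stateConst (g : ℝ) (p : Fin 2 → ℂ) {σ : Fin 3 → Fin 3} (hσ : Function.Injective σ)
    {u : Fin 3 → ℝ} (hu : StrictAnti u) (hu' : ∀ a, u a ∈ Ioo 0 (2 * Real.pi)) :
    Tendsto (fun r => stateConst g p r (word σ u)) (𝓝[<] 1) (𝓝 (wordFun g p σ u)) := by
  have hr : Tendsto (fun r : ℝ => r) (𝓝[<] 1) (𝓝 1) := tendsto_id'.2 nhdsWithin_le_nhds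
  have hr2 : Tendsto (fun r : ℝ => r ^ 2) (𝓝[<] 1) (𝓝 1) := by simpa using hr.pow 2
  have l01 : u 1 < u 0 := hu (by decide)
  have l02 : u 2 < u 0 := hu (by decide)
  have l12 : u 2 < u 1 := hu (by decide)
  have m01 : u 0 - u 1 ∈ Ioo 0 (2 * Real.pi) := ⟨by linarith, by linarith [(hu' 0).2, (hu' 1).1]⟩
  have m02 : u 0 - u 2 ∈ Ioo 0 (2 * Real.pi) := ⟨by linarith, by linarith [(hu' 0).2, (hu' 2).1]⟩
  have m12 : u 1 - u 2 ∈ Ioo 0 (2 * Real.pi) := ⟨by linarith, by linarith [(hu' 1).2, (hu' 2).1]⟩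
  have t := (((tendsto_contraction g m12 hr).mul (tendsto_contraction g m01 hr)).mul
    (tendsto_contraction g m02 hr2)).const_mul ((vertexPhase g (σ 2) (u 2) p *
      vertexPhase g (σ 1) (u 1) (fun k => p k - g * e (σ 2) k) *
      vertexPhase g (σ 0) (u 0) (fun k => p k - g * e (σ 2) k - g * e (σ 1) k)))
  have hev : ∀ᶠ r : ℝ in 𝓝[<] 1, 0 < r ∧ r < 1 :=
    Ioo_mem_nhdsLT (show (0 : ℝ) < 1 by norm_num)
  refine (t.congr' ?_).trans_eq ?_
  · filter_upwards [hev] with r hr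
    rw [stateConst_three g p hr.1 hr.2 hσ]
    simp only [neg_sub]
  · have h01 : σ 0 ≠ σ 1 := fun h => absurd (hσ h) (by decide)
    have h02 : σ 0 ≠ σ 2 := fun h => absurd (hσ h) (by decide)
    have h12 : σ 1 ≠ σ 2 := fun h => absurd (hσ h) (by decide)
    congr 1
    have p1 := two_sin_half_pos m01
    have p2 := two_sin_half_pos m02
    have p3 := two_sin_half_pos m12
    rw [one_sub_cis_neg_cpow m01, one_sub_cis_neg_cpow m02, one_sub_cis_neg_cpow m12, wordFun,
      Real.mul_rpow (by positivity) p3.le, Real.mul_rpow p1.le p2.le]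
    simp only [vertexPhase, qpow]
    rw [dot_sub_e _ _ h12, dot_sub_e _ _ h01, dot_sub_e _ _ h02, Fin.sum_univ_three]
    set A := ((2 * Real.sin ((u 0 - u 1) / 2)) ^ (-g) : ℝ)
    set B := ((2 * Real.sin ((u 0 - u 2) / 2)) ^ (-g) : ℝ)
    set D := ((2 * Real.sin ((u 1 - u 2) / 2)) ^ (-g) : ℝ)
    push_cast
    have key : ∀ x1 x2 x3 x4 x5 x6 x7 y : ℂ, x1 + x2 + (x1 + x3) + (x1 + x4) + (x5 + x6 + x7) = y →
        Complex.exp x1 * Complex.exp x2 * (Complex.exp x1 * Complex.exp x3) * (Complex.exp x1 * Complex.exp x4) *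
          (D * Complex.exp x5 * (A * Complex.exp x6) * (B * Complex.exp x7)) = Complex.exp y * (A * B * D) := by
      intro x1 x2 x3 x4 x5 x6 x7 y h
      rw [← h]; simp only [Complex.exp_add]; ring
    apply key
    ring

theorem tendsto_stateCoeff (l : List (Fin 3 × ℝ)) (κ : Osc) :
    Tendsto (fun r => stateCoeff r l κ) (𝓝[<] 1) (𝓝 (l.map fun a => creationCoeff a.1 a.2 κ).sum) := by
  induction l with
  | nil => simp [stateCoeff]
  | cons a l ih =>
    obtain ⟨i, u⟩ := a
    have hr : Tendsto (fun r : ℝ => ((r : ℂ)) ^ (κ.2 + 1)) (𝓝[<] 1) (𝓝 1) := by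
      have : ContinuousAt (fun r : ℝ => (r : ℂ) ^ (κ.2 + 1)) 1 := by fun_prop
      simpa using this.tendsto.mono_left nhdsWithin_le_nhds
    simpa [stateCoeff] using (hr.mul ih).const_add (creationCoeff i u κ)

/-- The exponent of a product of vertex operators. -/
def wordCoeff (σ : Fin 3 → Fin 3) (u : Fin 3 → ℝ) (κ : Osc) : ℂ := ∑ k, creationCoeff (σ k) (u k) κ

theorem tendsto_regProduct (g : ℝ) (p : Fin 2 → ℂ) {σ : Fin 3 → Fin 3} (hσ : Function.Injective σ)
    {u : Fin 3 → ℝ} (hu : StrictAnti u) (hu' : ∀ a, u a ∈ Ioo 0 (2 * Real.pi)) (m : Osc →₀ ℕ) :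
    Tendsto (fun r => MvPowerSeries.coeff m (regProduct g p r (word σ u))) (𝓝[<] 1)
      (𝓝 (wordFun g p σ u * expMon (wordCoeff σ u) m)) := by
  have h1 : Tendsto (fun r => expMon (stateCoeff r (word σ u)) m) (𝓝[<] 1)
      (𝓝 (expMon (wordCoeff σ u) m)) := by
    refine tendsto_finsetProd _ fun κ _ => ?_
    have := tendsto_stateCoeff (word σ u) κ
    rw [show ((word σ u).map fun a => creationCoeff a.1 a.2 κ).sum = wordCoeff σ u κ by
      simp [word, List.ofFn_succ, wordCoeff, Fin.sum_univ_three, add_assoc]] at this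
    exact (this.pow _).const_smul _
  refine ((tendsto_stateConst g p hσ hu hu').mul h1).congr' ?_
  filter_upwards [Ioo_mem_nhdsLT (show (0 : ℝ) < 1 by norm_num)] with r hr
  rw [(regProduct_eq g p hr.1 hr.2 _).2, map_smul, smul_eq_mul, coeff_expLinear]

theorem productConverges (g : ℝ) (p : Fin 2 → ℂ) {σ : Fin 3 → Fin 3} (hσ : Function.Injective σ)
    {u : Fin 3 → ℝ} (hu : StrictAnti u) (hu' : ∀ a, u a ∈ Ioo 0 (2 * Real.pi)) :
    ProductConverges g p (word σ u) :=
  ⟨fun _ hr0 hr1 => (regProduct_eq g p hr0 hr1 _).1, fun m => ⟨_, tendsto_regProduct g p hσ hu hu' m⟩⟩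

theorem coeff_vertexProduct (g : ℝ) (p : Fin 2 → ℂ) {σ : Fin 3 → Fin 3} (hσ : Function.Injective σ)
    {u : Fin 3 → ℝ} (hu : StrictAnti u) (hu' : ∀ a, u a ∈ Ioo 0 (2 * Real.pi)) (m : Osc →₀ ℕ) :
    MvPowerSeries.coeff m (vertexProduct g p (word σ u)) =
      wordFun g p σ u * expMon (wordCoeff σ u) m := by
  rw [vertexProduct, coeff_ofCoeffs]
  exact (tendsto_regProduct g p hσ hu hu' m).limUnder_eq

end W3

end

noncomputable section

namespace W3

open MeasureTheory Filter Topology Set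

/-! Coordinates on the space of three angles. -/

/-- The last of three angles and the two successive differences. -/
def angleCoords : (Fin 3 → ℝ) ≃ᵐ ℝ × (ℝ × ℝ) where
  toFun u := (u 2, (u 0 - u 1, u 1 - u 2))
  invFun x := ![x.1 + x.2.1 + x.2.2, x.1 + x.2.2, x.1]
  left_inv u := by ext k; fin_cases k <;> simp; ring
  right_inv x := by ext <;> simp
  measurable_toFun := by dsimp only [Equiv.coe_fn_mk]; fun_prop
  measurable_invFun := by
    refine measurable_pi_iff.2 fun k => ?_
    fin_cases k <;> simp <;> fun_prop

/-- The map is a reordering of coordinates followed by shears, so its determinant has modulus one.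
-/
theorem measurePreserving_angleCoords : MeasurePreserving angleCoords volume volume := by
  have h1 := volume_preserving_piFinSuccAbove (fun _ : Fin 3 => ℝ) 2
  have h2 := (MeasurePreserving.id (volume : Measure ℝ)).prod (volume_preserving_finTwoArrow ℝ)
  have h3 : MeasurePreserving (fun x : ℝ × ℝ => (x.1 - x.2, x.2)) volume volume :=
    measurePreserving_sub_prod volume volume
  have h4 : MeasurePreserving (fun x : ℝ × (ℝ × ℝ) => (x.1, (x.2.1 - x.2.2, x.2.2 - x.1)))
      volume volume := by
    refine (MeasurePreserving.id (volume : Measure ℝ)).skew_product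
      (g := fun c (x : ℝ × ℝ) => (x.1 - x.2, x.2 - c)) (by unfold Function.uncurry; fun_prop) ?_
    refine Eventually.of_forall fun c => ?_
    have h5 := (measurePreserving_sub_right (volume : Measure (ℝ × ℝ)) (0, c)).comp h3
    have h6 : (fun x : ℝ × ℝ => (x.1 - x.2, x.2 - c)) =
        (fun x => x - (0, c)) ∘ fun x => (x.1 - x.2, x.2) := by ext x <;> simp
    change Measure.map (fun x : ℝ × ℝ => (x.1 - x.2, x.2 - c)) volume = volume
    rw [h6]; exact h5.map_eq
  exact h4.comp (h2.comp h1)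

/-- Rotation of three angles. -/
def rotateAngles : (Fin 3 → ℝ) ≃ᵐ (Fin 3 → ℝ) where
  toFun v := ![v 2 + 2 * Real.pi, v 0, v 1]
  invFun u := ![u 1, u 2, u 0 - 2 * Real.pi]
  left_inv u := by ext k; fin_cases k <;> simp
  right_inv u := by ext k; fin_cases k <;> simp
  measurable_toFun := by
    refine measurable_pi_iff.2 fun k => ?_
    fin_cases k <;> simp <;> fun_prop
  measurable_invFun := by
    refine measurable_pi_iff.2 fun k => ?_
    fin_cases k <;> simp <;> fun_prop

theorem measurePreserving_rotateAngles : MeasurePreserving rotateAngles volume volume := by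
  have h1 := volume_measurePreserving_piCongrLeft (fun _ : Fin 3 => ℝ) (Equiv.addRight (1 : Fin 3))
  have h2 := measurePreserving_add_right (volume : Measure (Fin 3 → ℝ)) ![2 * Real.pi, 0, 0]
  have h3 := h2.comp h1
  have h4 : (rotateAngles : (Fin 3 → ℝ) → Fin 3 → ℝ) = (fun x => x + ![2 * Real.pi, 0, 0]) ∘
      MeasurableEquiv.piCongrLeft (fun _ : Fin 3 => ℝ) (Equiv.addRight (1 : Fin 3)) := by
    ext v k
    have h5 : ∀ a : Fin 3, MeasurableEquiv.piCongrLeft (fun _ : Fin 3 => ℝ)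
        (Equiv.addRight (1 : Fin 3)) v (a + 1) = v a := fun a =>
      MeasurableEquiv.piCongrLeft_apply_apply (β := fun _ : Fin 3 => ℝ) (Equiv.addRight (1 : Fin 3)) v a
    have a0 := h5 2
    have a1 := h5 0
    have a2 := h5 1
    rw [show (2 : Fin 3) + 1 = 0 from rfl] at a0
    rw [show (0 : Fin 3) + 1 = 1 from rfl] at a1
    rw [show (1 : Fin 3) + 1 = 2 from rfl] at a2
    rw [Function.comp_apply]
    generalize MeasurableEquiv.piCongrLeft (fun _ : Fin 3 => ℝ) (Equiv.addRight (1 : Fin 3)) v = x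
      at a0 a1 a2
    fin_cases k
    · change v 2 + 2 * Real.pi = x 0 + 2 * Real.pi
      rw [a0]
    · change v 0 = x 1 + 0
      rw [a1, add_zero]
    · change v 1 = x 2 + 0
      rw [a2, add_zero]
  rw [h4]; exact h3

theorem ae_linear_ne {ℓ : (Fin 3 → ℝ) →ₗ[ℝ] ℝ} (hℓ : ℓ ≠ 0) (t : ℝ) : ∀ᵐ u : Fin 3 → ℝ, ℓ u ≠ t := by
  rw [ae_iff]
  simp only [ne_eq, not_not]
  by_cases h : ∃ u₀, ℓ u₀ = t
  · obtain ⟨u₀, h0⟩ := h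
    have h1 := Measure.addHaar_submodule (volume : Measure (Fin 3 → ℝ)) (LinearMap.ker ℓ)
      (by rwa [Ne, LinearMap.ker_eq_top])
    rw [← measure_preimage_add_right _ (-u₀)] at h1
    convert h1 using 2
    ext u
    simp [h0, add_neg_eq_zero]
  · convert measure_empty (μ := (volume : Measure (Fin 3 → ℝ)))
    exact eq_empty_of_forall_notMem fun u hu => h ⟨u, hu⟩

/-- Coinciding angles and boundary values lie on finitely many hyperplanes. Outside them strict and
weak inequalities agree, which allows passing between closed and open domains. -/
theorem ae_generic : ∀ᵐ u : Fin 3 → ℝ, (∀ a, u a ≠ 0 ∧ u a ≠ 2 * Real.pi) ∧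
    ∀ a b, a ≠ b → u a ≠ u b ∧ u a ≠ u b + 2 * Real.pi := by
  have h1 : ∀ a t, ∀ᵐ u : Fin 3 → ℝ, u a ≠ t := fun a t =>
    ae_linear_ne (ℓ := LinearMap.proj a) (fun h => by
      have := LinearMap.congr_fun h (Pi.single a 1); simp at this) t
  have h2 : ∀ a b t, a ≠ b → ∀ᵐ u : Fin 3 → ℝ, u a - u b ≠ t := fun a b t hab =>
    ae_linear_ne (ℓ := LinearMap.proj (R := ℝ) (φ := fun _ : Fin 3 => ℝ) a - LinearMap.proj b) (fun h => by
      have := LinearMap.congr_fun h (Pi.single a 1)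
      simp [LinearMap.sub_apply, Pi.single_eq_of_ne hab.symm] at this) t
  refine (ae_all_iff.2 fun a => (h1 a 0).and (h1 a _)).and
    (ae_all_iff.2 fun a => ae_all_iff.2 fun b => ?_)
  by_cases hab : a = b
  · exact Eventually.of_forall fun u h => absurd hab h
  · filter_upwards [h2 a b 0 hab, h2 a b (2 * Real.pi) hab] with u hu hu' _
    exact ⟨fun h => hu (sub_eq_zero.2 h), fun h => hu' (by rw [h]; ring)⟩

/-- The open ordered domain. -/
def simplex : Set (Fin 3 → ℝ) := {u | 0 < u 2 ∧ u 2 < u 1 ∧ u 1 < u 0 ∧ u 0 < 2 * Real.pi}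

/-- The cyclically ordered triples of angles. -/
def tube : Set (Fin 3 → ℝ) :=
  {u | 0 < u 2 ∧ u 2 < 2 * Real.pi ∧ u 2 < u 1 ∧ u 1 < u 0 ∧ u 0 < u 2 + 2 * Real.pi}

theorem simplex_strictAnti {u : Fin 3 → ℝ} (h : u ∈ simplex) :
    StrictAnti u ∧ ∀ a, u a ∈ Ioo 0 (2 * Real.pi) := by
  obtain ⟨h1, h2, h3, h4⟩ := h
  refine ⟨?_, fun a => ?_⟩
  · intro a b hab
    fin_cases a <;> fin_cases b <;> simp at hab ⊢ <;> linarith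
  · fin_cases a <;> simp <;> constructor <;> linarith

theorem mem_orderedDomain_three {u : Fin 3 → ℝ} : u ∈ orderedDomain 3 ↔
    0 ≤ u 2 ∧ u 2 ≤ u 1 ∧ u 1 ≤ u 0 ∧ u 0 ≤ 2 * Real.pi := by
  constructor
  · rintro ⟨h1, h2⟩
    exact ⟨(h2 2).1, h1 (by decide), h1 (by decide), (h2 0).2⟩
  · rintro ⟨h1, h2, h3, h4⟩
    refine ⟨?_, fun a => ?_⟩
    · intro a b hab
      fin_cases a <;> fin_cases b <;> simp at hab ⊢ <;> linarith
    · fin_cases a <;> simp <;> constructor <;> linarith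

theorem orderedDomain_ae_eq : orderedDomain 3 =ᵐ[volume] simplex := by
  filter_upwards [ae_generic] with u ⟨h1, h2⟩
  refine propext ?_
  change u ∈ orderedDomain 3 ↔ u ∈ simplex
  rw [mem_orderedDomain_three]
  refine ⟨fun ⟨a, b, c, d⟩ => ⟨a.lt_of_ne (h1 2).1.symm, b.lt_of_ne (h2 2 1 (by decide)).1,
    c.lt_of_ne (h2 1 0 (by decide)).1, d.lt_of_ne (h1 0).2⟩,
    fun ⟨a, b, c, d⟩ => ⟨a.le, b.le, c.le, d.le⟩⟩

theorem coulombDomain_ae_eq : coulombDomain =ᵐ[volume] tube := by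
  filter_upwards [ae_generic] with u ⟨h1, h2⟩
  refine propext ⟨fun ⟨a, b, c, d, e, f⟩ => ⟨a.lt_of_ne (h1 2).1.symm, b.lt_of_ne (h1 2).2,
    e.lt_of_ne (h2 2 1 (by decide)).1, f.lt_of_ne (h2 1 0 (by decide)).1,
    d.lt_of_ne (h2 0 2 (by decide)).2⟩, fun ⟨a, b, c, d, e⟩ =>
    ⟨a.le, b.le, (c.trans d).le, e.le, c.le, d.le⟩⟩

theorem measurableSet_lt_chain {a b c d a' b' c' d' : (Fin 3 → ℝ) → ℝ} (ha : Measurable a)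
    (ha' : Measurable a') (hb : Measurable b) (hb' : Measurable b') (hc : Measurable c)
    (hc' : Measurable c') (hd : Measurable d) (hd' : Measurable d') :
    MeasurableSet {u | a u < a' u ∧ b u < b' u ∧ c u < c' u ∧ d u < d' u} :=
  (measurableSet_lt ha ha').inter ((measurableSet_lt hb hb').inter
    ((measurableSet_lt hc hc').inter (measurableSet_lt hd hd')))

theorem measurableSet_simplex : MeasurableSet simplex :=
  measurableSet_lt_chain (by fun_prop) (by fun_prop) (by fun_prop)
    (by fun_prop) (by fun_prop) (by fun_prop) (by fun_prop) (by fun_prop)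

theorem tube_eq : tube = angleCoords ⁻¹' (Ioo 0 (2 * Real.pi) ×ˢ triangle) := by
  ext u
  simp only [tube, triangle, angleCoords, mem_ofPred_eq, mem_preimage, mem_prod, mem_Ioo,
    MeasurableEquiv.coe_mk, Equiv.coe_fn_mk]
  constructor
  · rintro ⟨a, b, c, d, e⟩; exact ⟨⟨a, b⟩, by linarith, by linarith, by linarith⟩
  · rintro ⟨⟨a, b⟩, c, d, e⟩; exact ⟨a, b, by linarith, by linarith, by linarith⟩

theorem measurableSet_tube : MeasurableSet tube := by
  rw [tube_eq]; exact angleCoords.measurable (measurableSet_Ioo.prod measurableSet_triangle)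

/-- The tube is, up to a null set, the disjoint union of three simplices. -/
theorem setIntegral_tube {F : (Fin 3 → ℝ) → ℂ} (hF : IntegrableOn F tube) :
    ∫ u in tube, F u = (∫ u in simplex, F u) + (∫ u in simplex, F (rotateAngles u)) +
      ∫ u in simplex, F (rotateAngles (rotateAngles u)) := by
  -- The cases are distinguished by the angles which have passed `2π`: none in `simplex`, only `u 0`
  -- in `S1`, both `u 0` and `u 1` in `S2`.
  set S1 : Set (Fin 3 → ℝ) := {u | 0 < u 0 - 2 * Real.pi ∧ u 0 - 2 * Real.pi < u 2 ∧ u 2 < u 1 ∧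
    u 1 < 2 * Real.pi}
  set S2 : Set (Fin 3 → ℝ) := {u | 0 < u 1 - 2 * Real.pi ∧ u 1 - 2 * Real.pi < u 0 - 2 * Real.pi ∧
    u 0 - 2 * Real.pi < u 2 ∧ u 2 < 2 * Real.pi}
  have hS1 : simplex = rotateAngles ⁻¹' S1 := by
    ext u
    simp [S1, simplex, rotateAngles]
  have hS2 : simplex = rotateAngles ⁻¹' (rotateAngles ⁻¹' S2) := by
    ext u
    simp [S2, simplex, rotateAngles]
  have i1 : ∫ u in simplex, F (rotateAngles u) = ∫ u in S1, F u := by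
    rw [hS1]
    exact measurePreserving_rotateAngles.setIntegral_preimage_emb rotateAngles.measurableEmbedding F S1
  have i2 : ∫ u in simplex, F (rotateAngles (rotateAngles u)) = ∫ u in S2, F u := by
    rw [hS2, measurePreserving_rotateAngles.setIntegral_preimage_emb
      rotateAngles.measurableEmbedding (fun u => F (rotateAngles u)) (rotateAngles ⁻¹' S2)]
    exact measurePreserving_rotateAngles.setIntegral_preimage_emb rotateAngles.measurableEmbedding F S2
  have m1 : MeasurableSet S1 := measurableSet_lt_chain (by fun_prop) (by fun_prop) (by fun_prop)
    (by fun_prop) (by fun_prop) (by fun_prop) (by fun_prop) (by fun_prop)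
  have m2 : MeasurableSet S2 := measurableSet_lt_chain (by fun_prop) (by fun_prop) (by fun_prop)
    (by fun_prop) (by fun_prop) (by fun_prop) (by fun_prop) (by fun_prop)
  have hpi := Real.pi_pos
  have s0 : simplex ⊆ tube := fun u ⟨a, b, c, d⟩ =>
    ⟨a, by linarith, b, c, by linarith⟩
  have s1 : S1 ⊆ tube := fun u ⟨a, b, c, d⟩ =>
    ⟨by linarith, by linarith, c, by linarith, by linarith⟩
  have s2 : S2 ⊆ tube := fun u ⟨a, b, c, d⟩ =>
    ⟨by linarith, by linarith, by linarith, by linarith, by linarith⟩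
  have hU : tube =ᵐ[volume] ((simplex ∪ S1) ∪ S2 : Set (Fin 3 → ℝ)) := by
    filter_upwards [ae_generic] with u ⟨h1, h2⟩
    refine propext ?_
    change u ∈ tube ↔ u ∈ (simplex ∪ S1) ∪ S2
    refine ⟨fun ⟨a, b, c, d, e⟩ => ?_, ?_⟩
    · rcases lt_or_gt_of_ne (h1 0).2 with h | h
      · exact Or.inl (Or.inl ⟨a, c, d, h⟩)
      · rcases lt_or_gt_of_ne (h1 1).2 with h' | h'
        · exact Or.inl (Or.inr ⟨by linarith, by linarith, c, h'⟩)
        · exact Or.inr ⟨by linarith, by linarith, by linarith, b⟩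
    · rintro ((h | h) | h)
      exacts [s0 h, s1 h, s2 h]
  have d1 : Disjoint simplex S1 := Set.disjoint_left.2 fun u ⟨_, _, _, d⟩ ⟨a, _⟩ => by linarith
  have d2 : Disjoint (simplex ∪ S1) S2 := Set.disjoint_left.2 fun u h ⟨a, b, _, _⟩ => by
    rcases h with ⟨_, _, _, d⟩ | ⟨_, _, _, d⟩ <;> linarith
  rw [setIntegral_congr_set hU, setIntegral_union d2 m2 ((hF.mono_set s0).union (hF.mono_set s1))
    (hF.mono_set s2), setIntegral_union d1 m1 (hF.mono_set s0) (hF.mono_set s1), i1, i2]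

end W3

end

noncomputable section

namespace W3

open MeasureTheory Filter Topology Set

/-! Ordered integrals of products of three vertex operators. -/

/-- The components of a product of three different vertex operators. -/
def wordTerm (g : ℝ) (p : Fin 2 → ℂ) (σ : Fin 3 → Fin 3) (m : Osc →₀ ℕ) (u : Fin 3 → ℝ) : ℂ :=
  wordFun g p σ u * expMon (wordCoeff σ u) m

/-- `wordTerm` as a function of the differences of the angles. -/
def wordTri (g : ℝ) (p : Fin 2 → ℂ) (σ : Fin 3 → Fin 3) (m : Osc →₀ ℕ) (x : ℝ × ℝ) : ℂ :=
  expMon (wordCoeff σ ![x.1 + x.2, x.2, 0]) m *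
    triFun g (-(2 * dot (e (σ 0)) p)) (2 * dot (e (σ 2)) p) x

theorem creationCoeff_add (i : Fin 3) (u c : ℝ) (κ : Osc) :
    creationCoeff i (u + c) κ = cis c ^ (κ.2 + 1) * creationCoeff i u κ := by
  have h : Complex.exp (Complex.I * ((κ.2 : ℂ) + 1) * ((u + c : ℝ) : ℂ)) =
      cis c ^ (κ.2 + 1) * Complex.exp (Complex.I * ((κ.2 : ℂ) + 1) * u) := by
    rw [cis, ← Complex.exp_nat_mul, ← Complex.exp_add]; congr 1; push_cast; ring
  rw [creationCoeff, creationCoeff, h]; ring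

theorem creationCoeff_add_two_pi (i : Fin 3) (u : ℝ) (κ : Osc) :
    creationCoeff i (u + 2 * Real.pi) κ = creationCoeff i u κ := by
  have h : cis (2 * Real.pi) = 1 := by
    rw [← cis_sub_two_pi, sub_self, cis]; simp
  rw [creationCoeff_add, h, one_pow, one_mul]

/-- A common rotation of all the angles is implemented by `e^{icL}`. -/
theorem expMon_wordCoeff_add (σ : Fin 3 → Fin 3) (u : Fin 3 → ℝ) (c : ℝ) (m : Osc →₀ ℕ) :
    expMon (wordCoeff σ (fun k => u k + c)) m = cis c ^ level m * expMon (wordCoeff σ u) m := by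
  rw [expMon_smul_mul]
  congr 1; ext κ
  rw [wordCoeff, wordCoeff, Finset.mul_sum]
  exact Finset.sum_congr rfl fun k _ => creationCoeff_add _ _ _ _

theorem sum_dot_eq_zero (p : Fin 2 → ℂ) {σ : Fin 3 → Fin 3} (hσ : Function.Injective σ) :
    dot (e (σ 0)) p + dot (e (σ 1)) p + dot (e (σ 2)) p = 0 := by
  have h := (Finite.injective_iff_bijective.1 hσ).sum_comp fun k => dot (e k) p
  rw [Fin.sum_univ_three, Fin.sum_univ_three, dot_sum] at h
  exact h

/-- The last letter moves to the front with its angle raised by `2π`. The oscillator part has period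
`2π` and the sines are merely permuted, so only the plane wave notices the move. -/
theorem wordTerm_rotate (g : ℝ) (p : Fin 2 → ℂ) (σ : Fin 3 → Fin 3) (m : Osc →₀ ℕ) (v : Fin 3 → ℝ) :
    wordTerm g p (fun k => σ (k + 1)) m v =
      Complex.exp (4 * Real.pi * Complex.I * dot (e (σ 0)) p) * wordTerm g p σ m (rotateAngles v) := by
  have hr0 : rotateAngles v 0 = v 2 + 2 * Real.pi := rfl
  have hr1 : rotateAngles v 1 = v 0 := rfl
  have hr2 : rotateAngles v 2 = v 1 := rfl
  have h1 : wordCoeff (fun k => σ (k + 1)) v = wordCoeff σ (rotateAngles v) := by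
    ext κ
    simp only [wordCoeff, Fin.sum_univ_three, hr0, hr1, hr2, creationCoeff_add_two_pi]
    rw [show (2 : Fin 3) + 1 = 0 from rfl, show (1 : Fin 3) + 1 = 2 from rfl, zero_add]
    ring
  have s1 : Real.sin ((v 2 + 2 * Real.pi - v 0) / 2) = Real.sin ((v 0 - v 2) / 2) := by
    rw [show (v 2 + 2 * Real.pi - v 0) / 2 = Real.pi - (v 0 - v 2) / 2 by ring, Real.sin_pi_sub]
  have s2 : Real.sin ((v 2 + 2 * Real.pi - v 1) / 2) = Real.sin ((v 1 - v 2) / 2) := by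
    rw [show (v 2 + 2 * Real.pi - v 1) / 2 = Real.pi - (v 1 - v 2) / 2 by ring, Real.sin_pi_sub]
  rw [wordTerm, wordTerm, h1, ← mul_assoc]
  congr 1
  rw [wordFun, wordFun, ← mul_assoc (Complex.exp (4 * Real.pi * Complex.I * _)), ← Complex.exp_add]
  simp only [Fin.sum_univ_three, hr0, hr1, hr2, s1, s2]
  rw [show (2 : Fin 3) + 1 = 0 from rfl, show (1 : Fin 3) + 1 = 2 from rfl, zero_add]
  congr 2
  · push_cast; ring
  · congr 1; ring

/-- The three root vectors add up to zero, so the plane wave depends on differences of angles only;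
the common rotation enters through the level alone. -/
theorem wordTerm_eq (g : ℝ) (p : Fin 2 → ℂ) {σ : Fin 3 → Fin 3} (hσ : Function.Injective σ)
    (m : Osc →₀ ℕ) (u : Fin 3 → ℝ) :
    wordTerm g p σ m u = cis (angleCoords u).1 ^ level m * wordTri g p σ m (angleCoords u).2 := by
  have hd := sum_dot_eq_zero p hσ
  have h1 : u = fun k => (![u 0 - u 1 + (u 1 - u 2), u 1 - u 2, 0] : Fin 3 → ℝ) k + u 2 := by
    ext k; fin_cases k <;> simp
  have h2 : expMon (wordCoeff σ u) m = cis (u 2) ^ level m *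
      expMon (wordCoeff σ ![u 0 - u 1 + (u 1 - u 2), u 1 - u 2, 0]) m := by
    conv_lhs => rw [h1]
    exact expMon_wordCoeff_add σ _ _ m
  change _ = cis (u 2) ^ level m * wordTri g p σ m (u 0 - u 1, u 1 - u 2)
  rw [wordTerm, wordTri, h2, wordFun, triFun, triWeight]
  have h3 : Complex.exp (-(2 * Complex.I * ∑ k, dot (e (σ k)) p * u k)) =
      Complex.exp (Complex.I * (-(2 * dot (e (σ 0)) p) * ((u 0 - u 1 : ℝ) : ℂ) +
        2 * dot (e (σ 2)) p * ((u 1 - u 2 : ℝ) : ℂ))) := by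
    congr 1
    rw [Fin.sum_univ_three]; push_cast
    linear_combination (-2 * Complex.I * u 1) * hd
  rw [h3]
  have h4 : u 0 - u 1 + (u 1 - u 2) = u 0 - u 2 := by ring
  rw [h4, mul_right_comm (2 * Real.sin ((u 0 - u 1) / 2))]
  ring

theorem norm_expMon_wordCoeff_le (σ : Fin 3 → Fin 3) (u : Fin 3 → ℝ) (m : Osc →₀ ℕ) :
    ‖expMon (wordCoeff σ u) m‖ ≤ m.prod fun _ k => (6 : ℝ) ^ k := by
  rw [expMon, Finsupp.prod, Finsupp.prod, norm_prod]
  refine Finset.prod_le_prod (fun _ _ => norm_nonneg _) fun κ _ => ?_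
  rw [smul_eq_mul, norm_mul, norm_inv, norm_pow, Complex.norm_natCast]
  have h1 : ‖wordCoeff σ u κ‖ ≤ 6 := by
    rw [wordCoeff]
    refine (norm_sum_le _ _).trans ((Finset.sum_le_sum fun k _ =>
      norm_creationCoeff_le (σ k) (u k) κ).trans ?_)
    norm_num
  have h2 : ((m κ).factorial : ℝ)⁻¹ ≤ 1 := by
    have : 1 ≤ (m κ).factorial := Nat.factorial_pos _
    exact inv_le_one_of_one_le₀ (by exact_mod_cast this)
  calc _ ≤ 1 * ‖wordCoeff σ u κ‖ ^ m κ := by gcongr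
    _ ≤ 6 ^ m κ := by rw [one_mul]; gcongr

theorem continuous_expMon_wordCoeff (σ : Fin 3 → Fin 3) (m : Osc →₀ ℕ) :
    Continuous fun u : Fin 3 → ℝ => expMon (wordCoeff σ u) m := by
  unfold expMon Finsupp.prod wordCoeff creationCoeff
  fun_prop

theorem integrableOn_wordTri {g : ℝ} (hg0 : 0 < g) (hg1 : g < 2 / 3) (p : Fin 2 → ℂ)
    (σ : Fin 3 → Fin 3) (m : Osc →₀ ℕ) : IntegrableOn (wordTri g p σ m) triangle := by
  refine Integrable.bdd_mul (integrableOn_triFun hg0 hg1 _ _) ?_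
    (Eventually.of_forall fun x => norm_expMon_wordCoeff_le σ _ m)
  have : Continuous fun x : ℝ × ℝ => (![x.1 + x.2, x.2, 0] : Fin 3 → ℝ) := by fun_prop
  exact ((continuous_expMon_wordCoeff σ m).comp this).aestronglyMeasurable

theorem integrableOn_cis_pow_mul_wordTri {g : ℝ} (hg0 : 0 < g) (hg1 : g < 2 / 3) (p : Fin 2 → ℂ)
    (σ : Fin 3 → Fin 3) (m : Osc →₀ ℕ) :
    IntegrableOn (fun x : ℝ × (ℝ × ℝ) => cis x.1 ^ level m * wordTri g p σ m x.2)
      (Ioo 0 (2 * Real.pi) ×ˢ triangle) := by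
  rw [IntegrableOn, Measure.volume_eq_prod, ← Measure.prod_restrict]
  refine Integrable.mul_prod (f := fun c => cis c ^ level m) ?_ (integrableOn_wordTri hg0 hg1 p σ m)
  have h : IntegrableOn (fun c => cis c ^ level m) (Icc 0 (2 * Real.pi)) :=
    (by fun_prop : Continuous fun c => cis c ^ level m).continuousOn.integrableOn_compact isCompact_Icc
  exact h.mono_set Ioo_subset_Icc_self

theorem integrableOn_wordTerm {g : ℝ} (hg0 : 0 < g) (hg1 : g < 2 / 3) (p : Fin 2 → ℂ)
    {σ : Fin 3 → Fin 3} (hσ : Function.Injective σ) (m : Osc →₀ ℕ) :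
    IntegrableOn (wordTerm g p σ m) tube := by
  rw [tube_eq, show wordTerm g p σ m = (fun x : ℝ × (ℝ × ℝ) =>
    cis x.1 ^ level m * wordTri g p σ m x.2) ∘ angleCoords from funext fun u => wordTerm_eq g p hσ m u,
    measurePreserving_angleCoords.integrableOn_comp_preimage angleCoords.measurableEmbedding]
  exact integrableOn_cis_pow_mul_wordTri hg0 hg1 p σ m

theorem level_eq_zero_iff {m : Osc →₀ ℕ} : level m = 0 ↔ m = 0 := by
  constructor
  · intro h
    rw [level, Finsupp.sum, Finset.sum_eq_zero_iff] at h
    ext κ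
    by_contra hκ
    have := h κ (by simpa using hκ)
    simp at this
    exact hκ this
  · rintro rfl; simp [level]

theorem integral_cis_pow (n : ℕ) :
    ∫ c in Ioo 0 (2 * Real.pi), cis c ^ n = if n = 0 then 2 * (Real.pi : ℂ) else 0 := by
  have hpi := Real.pi_pos
  rw [← integral_Ioc_eq_integral_Ioo, ← intervalIntegral.integral_of_le (by positivity)]
  split_ifs with h
  · simp [h]
  · have h1 : ∀ c : ℝ, cis c ^ n = Complex.exp ((n * Complex.I) * c) := by
      intro c; rw [cis, ← Complex.exp_nat_mul]; congr 1; ring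
    simp_rw [h1]
    have hn : ((n : ℂ) * Complex.I) ≠ 0 := mul_ne_zero (by exact_mod_cast h) Complex.I_ne_zero
    rw [integral_exp_mul_complex hn]
    have h2 : Complex.exp (n * Complex.I * ((2 * Real.pi : ℝ) : ℂ)) = 1 := by
      rw [Complex.exp_eq_one_iff]; exact ⟨n, by push_cast; ring⟩
    rw [h2]; simp

/-- The integral over the common rotation vanishes at every positive level. This is what makes the
vacuum an eigenvector. -/
theorem integral_wordTerm {g : ℝ} (p : Fin 2 → ℂ)
    {σ : Fin 3 → Fin 3} (hσ : Function.Injective σ) (m : Osc →₀ ℕ) :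
    ∫ u in tube, wordTerm g p σ m u = if m = 0 then
      2 * Real.pi * triInt g (-(2 * dot (e (σ 0)) p)) (2 * dot (e (σ 2)) p) else 0 := by
  have h1 : ∫ u in tube, wordTerm g p σ m u =
      ∫ x in Ioo 0 (2 * Real.pi) ×ˢ triangle, cis x.1 ^ level m * wordTri g p σ m x.2 := by
    rw [tube_eq]; simp_rw [wordTerm_eq g p hσ m]
    exact measurePreserving_angleCoords.setIntegral_preimage_emb angleCoords.measurableEmbedding
      (fun x : ℝ × (ℝ × ℝ) => cis x.1 ^ level m * wordTri g p σ m x.2) _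
  rw [h1, Measure.volume_eq_prod, setIntegral_prod_mul (fun c => cis c ^ level m), integral_cis_pow]
  simp only [level_eq_zero_iff]
  split_ifs with h
  · rw [triInt]
    congr 1
    simp only [wordTri, h, expMon_zero, one_mul]
  · rw [zero_mul]

theorem coeff_orderedIntegral (g : ℝ) (p : Fin 2 → ℂ) {σ : Fin 3 → Fin 3} (hσ : Function.Injective σ)
    (m : Osc →₀ ℕ) :
    MvPowerSeries.coeff m (orderedIntegral g p σ) = ∫ u in simplex, wordTerm g p σ m u := by
  rw [orderedIntegral, coeff_ofCoeffs, setIntegral_congr_set orderedDomain_ae_eq]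
  refine setIntegral_congr_fun measurableSet_simplex fun u hu => ?_
  obtain ⟨h1, h2⟩ := simplex_strictAnti hu
  exact coeff_vertexProduct g p hσ h1 h2 m

theorem simplex_subset_tube : simplex ⊆ tube := fun u ⟨a, b, c, d⟩ =>
  ⟨a, by linarith, b, c, by linarith⟩

theorem integrableOn_vertexProduct {g : ℝ} (hg0 : 0 < g) (hg1 : g < 2 / 3) (p : Fin 2 → ℂ)
    {σ : Fin 3 → Fin 3} (hσ : Function.Injective σ) (m : Osc →₀ ℕ) :
    IntegrableOn (fun u => MvPowerSeries.coeff m (vertexProduct g p (word σ u))) (orderedDomain 3) := by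
  refine IntegrableOn.congr_set_ae ?_ orderedDomain_ae_eq
  refine ((integrableOn_wordTerm hg0 hg1 p hσ m).mono_set simplex_subset_tube).congr_fun ?_
    measurableSet_simplex
  intro u hu
  obtain ⟨h1, h2⟩ := simplex_strictAnti hu
  exact (coeff_vertexProduct g p hσ h1 h2 m).symm

/-- The sum of the ordered integrals of the three cyclic rotations of a word. -/
theorem orderedIntegral_cyclic {g : ℝ} (hg0 : 0 < g) (hg1 : g < 2 / 3) (p : Fin 2 → ℂ)
    {σ : Fin 3 → Fin 3} (hσ : Function.Injective σ) :
    orderedIntegral g p σ +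
      Complex.exp (-(4 * Real.pi * Complex.I * dot (e (σ 0)) p)) • orderedIntegral g p (fun k => σ (k + 1)) +
      Complex.exp (4 * Real.pi * Complex.I * dot (e (σ 2)) p) • orderedIntegral g p (fun k => σ (k + 2)) =
    (2 * Real.pi * triInt g (-(2 * dot (e (σ 0)) p)) (2 * dot (e (σ 2)) p)) • vacuum := by
  have hd := sum_dot_eq_zero p hσ
  have hσ1 : Function.Injective fun k => σ (k + 1) := hσ.comp (add_left_injective 1)
  have hσ2 : Function.Injective fun k => σ (k + 2) := hσ.comp (add_left_injective 2)
  ext m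
  rw [map_add, map_add, map_smul, map_smul, map_smul, coeff_orderedIntegral g p hσ,
    coeff_orderedIntegral g p hσ1, coeff_orderedIntegral g p hσ2, vacuum, MvPowerSeries.coeff_one]
  have h1 : ∀ v, wordTerm g p (fun k => σ (k + 1)) m v =
      Complex.exp (4 * Real.pi * Complex.I * dot (e (σ 0)) p) * wordTerm g p σ m (rotateAngles v) :=
    wordTerm_rotate g p σ m
  have h2 : ∀ v, wordTerm g p (fun k => σ (k + 2)) m v =
      Complex.exp (-(4 * Real.pi * Complex.I * dot (e (σ 2)) p)) *
        wordTerm g p σ m (rotateAngles (rotateAngles v)) := by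
    intro v
    have h := wordTerm_rotate g p (fun k => σ (k + 1)) m v
    rw [h1, ← mul_assoc, ← Complex.exp_add] at h
    have hf : (fun k => σ (k + 1 + 1)) = fun k => σ (k + 2) := by
      ext k; rw [add_assoc]; rfl
    rw [hf] at h
    rw [h]
    congr 2
    rw [zero_add]
    linear_combination (4 * Real.pi * Complex.I) * hd
  -- Up to phases, the three rotated words are the restrictions of one function to the three
  -- simplices of the tube.
  have h3 := setIntegral_tube (integrableOn_wordTerm hg0 hg1 p hσ m)
  rw [integral_wordTerm p hσ] at h3
  simp_rw [h1, h2, integral_const_mul, smul_eq_mul]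
  rw [← mul_assoc, ← Complex.exp_add, ← mul_assoc, ← Complex.exp_add, neg_add_cancel,
    add_neg_cancel, Complex.exp_zero, one_mul, one_mul, ← h3]
  split_ifs <;> simp

end W3

end

noncomputable section

namespace W3

open MeasureTheory Filter Topology Set

/-! The integral of motion `G₁`. -/

/-- From `w_{i+1} - w_i = -2 e_{i+2}`. The ratios of the `z_j` are thus exactly the phases acquired
by an operator carried around the circle. -/
theorem z_add_one (i : Fin 3) (p : Fin 2 → ℂ) :
    z (i + 1) p = z i p * Complex.exp (-(4 * Real.pi * Complex.I * dot (e (i + 2)) p)) := by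
  have h3 : (√3 : ℂ) * √3 = 3 := by
    rw [← Complex.ofReal_mul, Real.mul_self_sqrt (by norm_num)]; norm_num
  have h0 : (√3 : ℂ) ≠ 0 := by intro h; rw [h] at h3; norm_num at h3
  rw [z, z, ← Complex.exp_add]
  congr 1
  have key : dot (w (i + 1)) p = dot (w i) p - 2 * dot (e (i + 2)) p := by
    fin_cases i <;> simp [w, e, dot, Fin.sum_univ_two] <;> field_simp
    · linear_combination (p 1) * h3
    · linear_combination (-p 1) * h3
    · ring
  rw [key]; ring

theorem z_add_two (i : Fin 3) (p : Fin 2 → ℂ) :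
    z (i + 2) p = z (i + 1) p * Complex.exp (-(4 * Real.pi * Complex.I * dot (e i) p)) := by
  have h := z_add_one (i + 1) p
  rw [show i + 1 + 1 = i + 2 by fin_cases i <;> rfl, show i + 1 + 2 = i by fin_cases i <;> rfl] at h
  exact h

theorem z_eq_z_add_one (i : Fin 3) (p : Fin 2 → ℂ) :
    z i p = z (i + 1) p * Complex.exp (4 * Real.pi * Complex.I * dot (e (i + 2)) p) := by
  rw [z_add_one, mul_assoc, ← Complex.exp_add, neg_add_cancel, Complex.exp_zero, mul_one]

theorem fin_three_add : ∀ i j k : Fin 3, i + 1 + j + 2 + k = i + (k + j) := by decide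

/-- The weights `z_j` are those of the cyclic sum, whichever rotation of the word is taken as the
starting one. The free choice of `i` yields the three forms of the result. -/
theorem nonlocalG_eq {g : ℝ} (hg0 : 0 < g) (hg1 : g < 2 / 3) (p : Fin 2 → ℂ) (i : Fin 3) :
    nonlocalG g p 1 = (z (i + 1) p *
      (2 * Real.pi * triInt g (-(2 * dot (e i) p)) (2 * dot (e (i + 2)) p))) • vacuum := by
  have hσ : Function.Injective fun k : Fin 3 => i + k := add_right_injective i
  have h := orderedIntegral_cyclic hg0 hg1 p hσ
  have hG : nonlocalG g p 1 = ∑ j : Fin 3, z (i + 1 + j) p • orderedIntegral g p (fun k : Fin 3 => i + (k + j)) := by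
    have h1 : nonlocalG g p 1 = ∑ j : Fin 3, z j p • orderedIntegral g p (fun k : Fin 3 => j + 2 + k) := by
      rw [nonlocalG]
      refine Finset.sum_congr rfl fun j _ => ?_
      congr 2
      ext k
      have : Fin.ofNat 3 (k : ℕ) = (k : Fin 3) := by
        apply Fin.ext; exact Nat.mod_eq_of_lt k.2
      rw [this]
    rw [h1, ← Equiv.sum_comp (Equiv.addLeft (i + 1))]
    refine Finset.sum_congr rfl fun j _ => ?_
    simp only [Equiv.coe_addLeft]
    congr 2
    ext1 k
    exact fin_three_add i j k
  simp only [add_zero] at h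
  rw [mul_smul, ← h, hG, Fin.sum_univ_three, smul_add, smul_add, smul_smul, smul_smul]
  have e1 : z (i + 1 + 1) p = z (i + 1) p * Complex.exp (-(4 * Real.pi * Complex.I * dot (e i) p)) := by
    rw [← z_add_two, add_assoc]; rfl
  have e2 : z (i + 1 + 2) p = z (i + 1) p * Complex.exp (4 * Real.pi * Complex.I * dot (e (i + 2)) p) := by
    rw [← z_eq_z_add_one]
    congr 1
    exact (by decide : ∀ i : Fin 3, i + 1 + 2 = i) i
  rw [e1, e2]
  simp only [add_zero]

theorem G1vac_eq {g : ℝ} (hg0 : 0 < g) (hg1 : g < 2 / 3) (p : Fin 2 → ℂ) (i : Fin 3) :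
    G1vac g p = z (i + 1) p *
      (2 * Real.pi * triInt g (-(2 * dot (e i) p)) (2 * dot (e (i + 2)) p)) := by
  rw [G1vac, nonlocalG_eq hg0 hg1 p i, map_smul, vacuum, MvPowerSeries.coeff_one, if_pos rfl,
    smul_eq_mul, mul_one]

theorem nonlocalG_eigen {g : ℝ} (hg0 : 0 < g) (hg1 : g < 2 / 3) (p : Fin 2 → ℂ) :
    nonlocalG g p 1 = G1vac g p • vacuum := by
  rw [G1vac_eq hg0 hg1 p 0, ← nonlocalG_eq hg0 hg1 p 0]

theorem continuous_z (i : Fin 3) : Continuous (z i) := by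
  unfold z; have := continuous_dot; fun_prop

theorem continuous_G1vac {g : ℝ} (hg0 : 0 < g) (hg1 : g < 2 / 3) : Continuous (G1vac g) := by
  have h1 : G1vac g = fun p => z 1 p * (2 * Real.pi * triInt g (-(2 * dot (e 0) p)) (2 * dot (e 2) p)) :=
    funext fun p => G1vac_eq hg0 hg1 p 0
  have h2 : Continuous fun p : Fin 2 → ℂ => triInt g (-(2 * dot (e 0) p)) (2 * dot (e 2) p) :=
    (continuous_triInt hg0 hg1).comp (f := fun p : Fin 2 → ℂ => (-(2 * dot (e 0) p), 2 * dot (e 2) p))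
      (by have := continuous_dot; fun_prop)
  rw [h1]
  have := continuous_z 1
  fun_prop

/-! The triple integral. -/

/-- Weak inequalities suffice, since inverting the power requires only a nonnegative base. The
identity can therefore be used pointwise on the closed intervals of the iterated integral. -/
theorem coulombIntegrand_eq {g : ℝ} (p : Fin 2 → ℂ) {u : Fin 3 → ℝ} (h1 : u 2 ≤ u 1) (h2 : u 1 ≤ u 0)
    (h3 : u 0 ≤ u 2 + 2 * Real.pi) :
    coulombIntegrand g p (u 0) (u 1) (u 2) =
      triFun g (-(2 * dot (e 0) p)) (2 * dot (e 2) p) (u 0 - u 1, u 1 - u 2) := by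
  have hs : ∀ θ : ℝ, 0 ≤ θ → θ ≤ 2 * Real.pi → 0 ≤ 2 * Real.sin (θ / 2) := fun θ h h' => by
    have := Real.sin_nonneg_of_nonneg_of_le_pi (x := θ / 2) (by linarith) (by linarith)
    linarith
  have s1 := hs (u 0 - u 1) (by linarith) (by linarith)
  have s2 := hs (u 0 - u 2) (by linarith) (by linarith)
  have s3 := hs (u 1 - u 2) (by linarith) (by linarith)
  rw [coulombIntegrand, triFun, triWeight, div_eq_mul_inv, ← Complex.ofReal_inv,
    ← Real.rpow_neg (by positivity)]
  have h4 : u 0 - u 1 + (u 1 - u 2) = u 0 - u 2 := by ring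
  simp only [h4]
  rw [mul_right_comm (2 * Real.sin ((u 0 - u 1) / 2))]
  congr 2
  push_cast
  linear_combination (-2 * Complex.I * u 1) * dot_sum p

theorem integrableOn_coulombIntegrand {g : ℝ} (hg0 : 0 < g) (hg1 : g < 2 / 3) (p : Fin 2 → ℂ) :
    IntegrableOn (fun u => coulombIntegrand g p (u 0) (u 1) (u 2)) coulombDomain := by
  refine IntegrableOn.congr_set_ae ?_ coulombDomain_ae_eq
  refine (integrableOn_wordTerm hg0 hg1 p Function.injective_id 0).congr_fun ?_ measurableSet_tube
  rintro u ⟨a, b, c, d, f⟩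
  dsimp only
  rw [coulombIntegrand_eq p c.le d.le f.le, wordTerm_eq g p Function.injective_id]
  have : level 0 = 0 := level_eq_zero_iff.2 rfl
  rw [this, pow_zero, one_mul, wordTri, expMon_zero, one_mul]
  rfl

/-- The variables `s = u₁ - u₃` and `y = u₂ - u₃` are related by a shear to the two successive
differences. -/
theorem triInt_eq_iterated {g : ℝ} (hg0 : 0 < g) (hg1 : g < 2 / 3) (α β : ℂ) :
    triInt g α β = ∫ s in (0 : ℝ)..(2 * Real.pi), ∫ y in (0 : ℝ)..s, triFun g α β (s - y, y) := by
  have hpi := Real.pi_pos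
  have hmp : MeasurePreserving (fun x : ℝ × ℝ => (x.1 - x.2, x.2)) volume volume :=
    measurePreserving_sub_prod volume volume
  have hi : Integrable (triangle.indicator (triFun g α β)) volume :=
    (integrable_indicator_iff measurableSet_triangle).2 (integrableOn_triFun hg0 hg1 α β)
  let E : (ℝ × ℝ) ≃ᵐ (ℝ × ℝ) :=
    { toFun := fun x => (x.1 - x.2, x.2), invFun := fun x => (x.1 + x.2, x.2)
      left_inv := fun x => by simp
      right_inv := fun x => by simp
      measurable_toFun := by dsimp only [Equiv.coe_fn_mk]; fun_prop
      measurable_invFun := by dsimp only [Equiv.coe_fn_symm_mk]; fun_prop }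
  have hemb : MeasurableEmbedding (fun x : ℝ × ℝ => (x.1 - x.2, x.2)) := E.measurableEmbedding
  have h1 := hmp.integral_comp hemb (triangle.indicator (triFun g α β))
  have h2 : Integrable (fun x : ℝ × ℝ => triangle.indicator (triFun g α β) (x.1 - x.2, x.2)) volume :=
    hmp.integrable_comp_of_integrable hi
  rw [triInt, ← integral_indicator measurableSet_triangle, ← h1, Measure.volume_eq_prod,
    integral_prod _ h2, intervalIntegral.integral_of_le (by positivity),
    integral_Ioc_eq_integral_Ioo, ← integral_indicator measurableSet_Ioo]
  congr 1; ext s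
  by_cases hs : s ∈ Ioo 0 (2 * Real.pi)
  · rw [indicator_of_mem hs, intervalIntegral.integral_of_le hs.1.le, integral_Ioc_eq_integral_Ioo,
      ← integral_indicator measurableSet_Ioo]
    congr 1; ext y
    by_cases hy : y ∈ Ioo 0 s
    · rw [indicator_of_mem hy, indicator_of_mem]
      exact ⟨by simp [hy.2], hy.1, by simp [hs.2]⟩
    · rw [indicator_of_notMem hy, indicator_of_notMem]
      rintro ⟨a, b, c⟩
      exact hy ⟨b, by simpa using a⟩
  · rw [indicator_of_notMem hs, ← integral_zero ℝ ℂ]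
    congr 1; ext y
    rw [indicator_of_notMem]
    rintro ⟨a, b, c⟩
    simp at a b c
    exact hs ⟨by linarith, c⟩

/-- The inner double integral does not depend on the base angle `u₃`, whose integration yields `2π`.
-/
theorem coulombIntegral_eq {g : ℝ} (hg0 : 0 < g) (hg1 : g < 2 / 3) (p : Fin 2 → ℂ) :
    coulombIntegral g p = 2 * Real.pi * triInt g (-(2 * dot (e 0) p)) (2 * dot (e 2) p) := by
  have hpi := Real.pi_pos
  have key : ∀ c : ℝ, (∫ u₁ in c..(c + 2 * Real.pi), ∫ u₂ in c..u₁, coulombIntegrand g p u₁ u₂ c) =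
      triInt g (-(2 * dot (e 0) p)) (2 * dot (e 2) p) := by
    intro c
    have h1 := intervalIntegral.integral_comp_add_right (a := 0) (b := 2 * Real.pi)
      (fun u₁ => ∫ u₂ in c..u₁, coulombIntegrand g p u₁ u₂ c) c
    rw [zero_add, add_comm (2 * Real.pi) c] at h1
    rw [← h1, triInt_eq_iterated hg0 hg1]
    refine intervalIntegral.integral_congr fun s hs => ?_
    rw [uIcc_of_le (by positivity)] at hs
    have h2 := intervalIntegral.integral_comp_add_right (a := 0) (b := s)
      (fun u₂ => coulombIntegrand g p (s + c) u₂ c) c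
    rw [zero_add] at h2
    rw [← h2]
    refine intervalIntegral.integral_congr fun y hy => ?_
    rw [uIcc_of_le hs.1] at hy
    have h3 := coulombIntegrand_eq (g := g) p (u := ![s + c, y + c, c])
      (by simp [hy.1]) (by simp [hy.2]) (by simp; linarith [hs.2])
    simpa using h3
  rw [coulombIntegral]
  simp_rw [key]
  rw [intervalIntegral.integral_const]
  simp

theorem G1vac_eq_coulomb {g : ℝ} (hg0 : 0 < g) (hg1 : g < 2 / 3) (p : Fin 2 → ℂ) :
    G1vac g p = z 1 p * coulombIntegral g p := by
  rw [coulombIntegral_eq hg0 hg1, G1vac_eq hg0 hg1 p 0]; rfl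

end W3

end

noncomputable section

namespace W3

open MeasureTheory Filter Topology Set

/-! `G₁` through the hypergeometric integral. -/

theorem qpow_add (g : ℝ) (x y : ℂ) : qpow g (x + y) = qpow g x * qpow g y := by
  rw [qpow, qpow, qpow, ← Complex.exp_add]; ring_nf

theorem qpow_ne_zero (g : ℝ) (x : ℂ) : qpow g x ≠ 0 := Complex.exp_ne_zero _

theorem qpow_neg (g : ℝ) (x : ℂ) : qpow g (-x) = (qpow g x)⁻¹ := by
  rw [qpow, qpow, ← Complex.exp_neg]; ring_nf

theorem circleFactor_eq (g : ℝ) (s : ℂ) :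
    circleFactor (g + s) = (qpow g 1 ^ 2 * Complex.exp (2 * Real.pi * Complex.I * s) - 1) / Complex.I := by
  rw [circleFactor, qpow, ← Complex.exp_nat_mul, ← Complex.exp_add]
  congr 3; push_cast; ring

/-- The linear relation for the triangle integral. -/
theorem triInt_relation {g : ℝ} (hg0 : 0 < g) (hg1 : g < 2 / 3) {a b c : ℂ} (habc : a + b + c = 0)
    (ha : NotPole (g + 2 * a)) (hb : NotPole (g + -(2 * b))) (hc : NotPole (g + 2 * c)) :
    qpow g (3 / 2) * triInt g (2 * a) (-(2 * b)) *
        (1 - qpow g 1 ^ 2 * Complex.exp (-(4 * Real.pi * Complex.I * b))) =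
      circleFactor (g + 2 * a) * circleFactor (g + -(2 * b)) * J g (2 * a) (-(2 * b)) -
        qpow g 1 * Complex.exp (4 * Real.pi * Complex.I * a) *
          (circleFactor (g + 2 * c) * circleFactor (g + -(2 * b)) * J g (2 * c) (-(2 * b))) := by
  have r1 := triInt_add_reflect hg0 hg1 ha hb
  have r2 := triInt_add_reflect hg0 hg1 hc hb
  rw [← r1, ← r2]
  -- After a change of base vertex the second relation contains the same two integrals as the first,
  -- in exchanged roles. The chosen combination eliminates the one with reversed arguments.
  have k1 : triInt g (2 * c) (-(2 * b)) =
      Complex.exp (-(4 * Real.pi * Complex.I * b)) * triInt g (-(2 * a)) (2 * b) := by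
    rw [triInt_rotate]
    congr 2
    · ring
    · linear_combination 2 * habc
    · ring
  have k2 : triInt g (-(2 * c)) (2 * b) =
      Complex.exp (4 * Real.pi * Complex.I * b) * triInt g (2 * a) (-(2 * b)) := by
    rw [triInt_rotate]
    congr 2
    · ring
    · linear_combination (-2) * habc
  rw [k1, neg_neg, k2]
  have x1 : Complex.exp (2 * Real.pi * Complex.I * (2 * a + -(2 * b))) =
      Complex.exp (4 * Real.pi * Complex.I * a) * Complex.exp (-(4 * Real.pi * Complex.I * b)) := by
    rw [← Complex.exp_add]; congr 1; ring
  have x2 : Complex.exp (2 * Real.pi * Complex.I * (2 * c + -(2 * b))) =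
      Complex.exp (-(4 * Real.pi * Complex.I * a)) * Complex.exp (-(4 * Real.pi * Complex.I * b)) *
        Complex.exp (-(4 * Real.pi * Complex.I * b)) := by
    rw [← Complex.exp_add, ← Complex.exp_add]; congr 1
    linear_combination (4 * Real.pi * Complex.I) * habc
  have x3 : Complex.exp (4 * Real.pi * Complex.I * a) * Complex.exp (-(4 * Real.pi * Complex.I * a)) = 1 := by
    rw [← Complex.exp_add, add_neg_cancel, Complex.exp_zero]
  have x4 : Complex.exp (4 * Real.pi * Complex.I * b) * Complex.exp (-(4 * Real.pi * Complex.I * b)) = 1 := by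
    rw [← Complex.exp_add, add_neg_cancel, Complex.exp_zero]
  rw [x1, x2]
  set K := triInt g (2 * a) (-(2 * b))
  set K' := triInt g (-(2 * a)) (2 * b)
  set X := Complex.exp (4 * Real.pi * Complex.I * a)
  set X' := Complex.exp (-(4 * Real.pi * Complex.I * a))
  set Y := Complex.exp (4 * Real.pi * Complex.I * b)
  set Y' := Complex.exp (-(4 * Real.pi * Complex.I * b))
  set Q := qpow g 1
  linear_combination (qpow g (3 / 2) * K * Q ^ 2 * Y') * (X * X' * x4 + x3)

/-- `G₁` through the hypergeometric integral, for generic `p`. -/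
theorem G1vac_eq_J_of_ne {g : ℝ} (hg0 : 0 < g) (hg1 : g < 2 / 3) (p : Fin 2 → ℂ) (i : Fin 3)
    (h1 : p ∈ regularSet g (i + 2) (i + 1)) (h2 : p ∈ regularSet g i (i + 1))
    (hne : qpow g 1 ^ 2 * Complex.exp (-(4 * Real.pi * Complex.I * dot (e (i + 1)) p)) ≠ 1) :
    G1vac g p = -2 * Real.pi * qpow g (-3 / 2) *
        (qpow g 1 * (qpow g 2 * z i p - z (i + 1) p) * Jij g p (i + 2) (i + 1) -
          (qpow g 2 * z (i + 1) p - z (i + 2) p) * Jij g p i (i + 1)) := by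
  have hd : dot (e i) p + dot (e (i + 1)) p + dot (e (i + 2)) p = 0 := by
    have := sum_dot_eq_zero p (σ := fun k : Fin 3 => i + k) (add_right_injective i)
    simpa using this
  have hr := triInt_relation hg0 hg1 hd h2.1 (by simpa [sub_eq_add_neg] using h1.2) h1.1
  have kk : triInt g (-(2 * dot (e i) p)) (2 * dot (e (i + 2)) p) =
      Complex.exp (-(4 * Real.pi * Complex.I * dot (e i) p)) *
        triInt g (2 * dot (e i) p) (-(2 * dot (e (i + 1)) p)) := by
    rw [triInt_comm, triInt_rotate, triInt_comm]
    congr 2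
    · ring
    · ring
    · linear_combination 2 * hd
  rw [G1vac_eq hg0 hg1 p i, kk, z_eq_z_add_one i, z_add_two i, Jij, Jij]
  simp only [circleFactor_eq] at hr
  have q2 : qpow g 2 = qpow g 1 ^ 2 := by
    rw [sq, ← qpow_add]; norm_num
  have q3 : qpow g (-3 / 2) * qpow g (3 / 2) = 1 := by
    rw [← qpow_add, show (-3 / 2 + 3 / 2 : ℂ) = 0 by norm_num, qpow]; simp
  have x1 : ∀ s : ℂ, Complex.exp (2 * Real.pi * Complex.I * (2 * s)) =
      Complex.exp (4 * Real.pi * Complex.I * s) := fun s => by congr 1; ring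
  have x2 : ∀ s : ℂ, Complex.exp (2 * Real.pi * Complex.I * (-(2 * s))) =
      Complex.exp (-(4 * Real.pi * Complex.I * s)) := fun s => by congr 1; ring
  have x3 : Complex.exp (4 * Real.pi * Complex.I * dot (e i) p) *
      Complex.exp (-(4 * Real.pi * Complex.I * dot (e i) p)) = 1 := by
    rw [← Complex.exp_add, add_neg_cancel, Complex.exp_zero]
  simp only [x1, x2] at hr
  rw [q2]
  set Ja := J g (2 * dot (e i) p) (-(2 * dot (e (i + 1)) p))
  set Jc := J g (2 * dot (e (i + 2)) p) (-(2 * dot (e (i + 1)) p))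
  set K := triInt g (2 * dot (e i) p) (-(2 * dot (e (i + 1)) p))
  set X := Complex.exp (4 * Real.pi * Complex.I * dot (e i) p)
  set X' := Complex.exp (-(4 * Real.pi * Complex.I * dot (e i) p))
  set Y' := Complex.exp (-(4 * Real.pi * Complex.I * dot (e (i + 1)) p))
  set W := Complex.exp (4 * Real.pi * Complex.I * dot (e (i + 2)) p)
  set Q := qpow g 1
  set Q3 := qpow g (3 / 2)
  set Q3' := qpow g (-3 / 2)
  have hI : Complex.I ≠ 0 := Complex.I_ne_zero
  have hI2 : ∀ s t : ℂ, s / Complex.I * (t / Complex.I) = -(s * t) := fun s t => by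
    rw [div_mul_div_comm, Complex.I_mul_I, div_neg, div_one]
  rw [hI2, hI2] at hr
  -- The factor `1 - Q² Y'` belongs, up to a constant, to the circle factor of `g - 2 e_{i+1} p`
  -- common to both terms; `hne` permits its cancellation.
  have hr' : Q3 * K = (Q ^ 2 * X - 1) * Ja - Q * X * ((Q ^ 2 * W - 1) * Jc) := by
    have hne' : 1 - Q ^ 2 * Y' ≠ 0 := sub_ne_zero.2 (Ne.symm hne)
    refine mul_right_cancel₀ hne' ?_
    linear_combination hr
  have hK : K = Q3' * ((Q ^ 2 * X - 1) * Ja - Q * X * ((Q ^ 2 * W - 1) * Jc)) := by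
    rw [← hr', ← mul_assoc, q3, one_mul]
  rw [hK]
  linear_combination (2 * Real.pi * z (i + 1) p * Q3' * (Q ^ 2 * Ja - Q * (Q ^ 2 * W - 1) * Jc)) * x3

theorem continuousAt_Jij {g : ℝ} (hg0 : 0 < g) (hg1 : g < 2 / 3) {p : Fin 2 → ℂ} {i j : Fin 3}
    (h : p ∈ regularSet g i j) : ContinuousAt (fun p => Jij g p i j) p :=
  (analyticOnNhd_Jij hg0 hg1 i j p h).continuousAt

/-- On the exceptional set both sides are still continuous, so it suffices to approach `p` along a
direction in which `e_{i+1} p` moves. -/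
theorem G1vac_eq_J {g : ℝ} (hg0 : 0 < g) (hg1 : g < 2 / 3) (p : Fin 2 → ℂ) (i : Fin 3)
    (h1 : p ∈ regularSet g (i + 2) (i + 1)) (h2 : p ∈ regularSet g i (i + 1)) :
    G1vac g p = -2 * Real.pi * qpow g (-3 / 2) *
        (qpow g 1 * (qpow g 2 * z i p - z (i + 1) p) * Jij g p (i + 2) (i + 1) -
          (qpow g 2 * z (i + 1) p - z (i + 2) p) * Jij g p i (i + 1)) := by
  by_cases hne : qpow g 1 ^ 2 * Complex.exp (-(4 * Real.pi * Complex.I * dot (e (i + 1)) p)) = 1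
  swap
  · exact G1vac_eq_J_of_ne hg0 hg1 p i h1 h2 hne
  obtain ⟨v, hv⟩ : ∃ v : Fin 2 → ℂ, dot (e (i + 1)) v = 1 :=
    let ⟨v, _, hv, _⟩ := exists_dual (i + 1) i ((by decide : ∀ i : Fin 3, i + 1 ≠ i) i)
    ⟨v, hv⟩
  let c : ℝ → Fin 2 → ℂ := fun t k => p k + t * v k
  have hc : Continuous c := by fun_prop
  have hc0 : c 0 = p := by ext k; simp [c]
  have ht : Tendsto c (𝓝[>] 0) (𝓝 p) := by
    have := hc.tendsto 0
    rw [hc0] at this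
    exact this.mono_left nhdsWithin_le_nhds
  have hF : ContinuousAt (fun p => -2 * Real.pi * qpow g (-3 / 2) *
        (qpow g 1 * (qpow g 2 * z i p - z (i + 1) p) * Jij g p (i + 2) (i + 1) -
          (qpow g 2 * z (i + 1) p - z (i + 2) p) * Jij g p i (i + 1))) p := by
    have c1 := continuousAt_Jij hg0 hg1 h1
    have c2 := continuousAt_Jij hg0 hg1 h2
    have z1 := (continuous_z i).continuousAt (x := p)
    have z2 := (continuous_z (i + 1)).continuousAt (x := p)
    have z3 := (continuous_z (i + 2)).continuousAt (x := p)
    fun_prop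
  refine tendsto_nhds_unique_of_eventuallyEq
    (((continuous_G1vac hg0 hg1).tendsto p).comp ht) (hF.tendsto.comp ht) ?_
  have o1 := ht.eventually ((isOpen_regularSet g (i + 2) (i + 1)).mem_nhds h1)
  have o2 := ht.eventually ((isOpen_regularSet g i (i + 1)).mem_nhds h2)
  filter_upwards [o1, o2, Ioo_mem_nhdsGT (show (0 : ℝ) < 1 / 2 by norm_num)] with t ht1 ht2 ht3
  refine G1vac_eq_J_of_ne hg0 hg1 _ i ht1 ht2 fun hne' => ?_
  have hdot : dot (e (i + 1)) (c t) = dot (e (i + 1)) p + t := by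
    have : dot (e (i + 1)) (c t) = dot (e (i + 1)) p + t * dot (e (i + 1)) v := by
      simp only [dot, c, Fin.sum_univ_two]; ring
    rw [this, hv, mul_one]
  rw [hdot, show -(4 * Real.pi * Complex.I * (dot (e (i + 1)) p + t)) =
    -(4 * Real.pi * Complex.I * dot (e (i + 1)) p) + -(4 * Real.pi * Complex.I * t) by ring,
    Complex.exp_add, ← mul_assoc, hne, one_mul, Complex.exp_eq_one_iff] at hne'
  obtain ⟨n, hn⟩ := hne'
  have h3 : ((-(2 * t) : ℝ) : ℂ) = ((n : ℝ) : ℂ) := by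
    have hpi : (2 * Real.pi * Complex.I : ℂ) ≠ 0 := Complex.two_pi_I_ne_zero
    refine mul_right_cancel₀ hpi ?_
    push_cast
    linear_combination hn
  have h4 : -(2 * t) = (n : ℝ) := Complex.ofReal_injective h3
  -- With `0 < t < 1/2` the number `-2t` lies strictly between two consecutive integers.
  have h5 : (-1 : ℝ) < n := by rw [← h4]; linarith [ht3.2]
  have h6 : (n : ℝ) < 0 := by rw [← h4]; linarith [ht3.1]
  have h7 : (-1 : ℤ) < n := by exact_mod_cast h5
  have h8 : n < 0 := by exact_mod_cast h6
  omega

end W3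

end

noncomputable section

namespace W3

open MeasureTheory Filter Topology Set

/-! Traces with finite-dimensional weight spaces. -/

theorem diagOp_apply {ι : Type} (f : ι → ℂ) (φ : ι →₀ ℂ) (v : ι) : diagOp f φ v = f v * φ v := by
  classical
  rw [diagOp, Finsupp.lsum_apply, Finsupp.sum_apply, Finsupp.sum]
  simp only [LinearMap.smul_apply, Finsupp.lsingle_apply, Finsupp.smul_apply, Finsupp.single_apply,
    smul_eq_mul, mul_ite, mul_zero, Finset.sum_ite_eq', Finsupp.mem_support_iff]
  split_ifs with h
  · rfl
  · rw [not_not.1 h, mul_zero]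

theorem diagOp_single {ι : Type} (f : ι → ℂ) (v : ι) (a : ℂ) :
    diagOp f (Finsupp.single v a) = f v • Finsupp.single v a := by
  rw [diagOp, Finsupp.lsum_single]; rfl

theorem end_apply {ι : Type} (A : Module.End ℂ (ι →₀ ℂ)) (φ : ι →₀ ℂ) (v : ι) :
    A φ v = φ.sum fun u b => b * A (Finsupp.single u 1) v := by
  conv_lhs => rw [← Finsupp.sum_single φ]
  rw [map_finsuppSum, Finsupp.sum_apply]
  refine Finsupp.sum_congr fun u _ => ?_
  rw [← mul_one (φ u), ← smul_eq_mul, ← Finsupp.smul_single, map_smul, Finsupp.smul_apply]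
  simp

theorem mul_entry {ι : Type} (A B : Module.End ℂ (ι →₀ ℂ)) (u v : ι) :
    (A * B) (Finsupp.single u 1) v =
      (B (Finsupp.single u 1)).sum fun w b => b * A (Finsupp.single w 1) v :=
  end_apply A _ v

/-- Cyclicity of the twisted trace. -/
theorem twisted_trace_cyclic {ι : Type} {τ : ι → ℂ} (h0 : ∀ v, τ v ≠ 0) (hτ : Summable τ) {x : ℂ}
    (hx : x ≠ 0) {A B : Module.End ℂ (ι →₀ ℂ)}
    (hA : ∀ u v, A (Finsupp.single u 1) v ≠ 0 → τ v = x * τ u)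
    (hB : ∀ u v, B (Finsupp.single u 1) v ≠ 0 → τ u = x * τ v)
    (hAB : Summable fun v => τ v * (A * B) (Finsupp.single v 1) v)
    (hBA : Summable fun v => τ v * (B * A) (Finsupp.single v 1) v) :
    ∑' v, τ v * (A * B) (Finsupp.single v 1) v = x * ∑' v, τ v * (B * A) (Finsupp.single v 1) v := by
  classical
  -- A summable family tends to zero along the cofinite filter, and `τ` never vanishes, so each
  -- value is taken finitely often.
  have hfin : ∀ c : ℂ, {v | τ v = c}.Finite := by
    intro c
    by_cases hc : c = 0
    · convert Set.finite_empty (α := ι)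
      exact eq_empty_of_forall_notMem fun v hv => h0 v (hv.trans hc)
    · have h1 := hτ.tendsto_cofinite_zero.eventually_ne (Ne.symm hc)
      rw [eventually_cofinite] at h1
      simpa using h1
  let L : ℂ → Finset ι := fun c => (hfin c).toFinset
  have hL : ∀ c v, v ∈ L c ↔ τ v = c := fun c v => by simp [L]
  have hsum : ∀ F : ι → ℂ, Summable F → ∑' v, F v = ∑' c, ∑ v ∈ L c, F v := by
    intro F hF
    have h1 := (Equiv.sigmaFiberEquiv τ).tsum_eq F
    have h2 : Summable fun s : (y : ℂ) × {v // τ v = y} => F (Equiv.sigmaFiberEquiv τ s) :=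
      (Equiv.sigmaFiberEquiv τ).summable_iff.2 hF
    rw [← h1, h2.tsum_sigma]
    congr 1; ext c
    have : Fintype {v // τ v = c} := (hfin c).fintype
    rw [tsum_fintype]
    exact (Finset.sum_subtype (L c) (hL c) F).symm
  -- `A` maps the weight space of `c` to that of `x c` and `B` maps it back, so this is cyclicity of
  -- the trace for finite matrices.
  have key : ∀ c, ∑ v ∈ L (x * c), (A * B) (Finsupp.single v 1) v = ∑ v ∈ L c, (B * A) (Finsupp.single v 1) v := by
    intro c
    have e1 : ∀ v ∈ L (x * c), (A * B) (Finsupp.single v 1) v =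
        ∑ w ∈ L c, B (Finsupp.single v 1) w * A (Finsupp.single w 1) v := by
      intro v hv
      rw [mul_entry, Finsupp.sum_of_support_subset _ (s := L c) _ _ (by simp)]
      intro w hw
      have := hB v w (by simpa using hw)
      rw [(hL _ _).1 hv] at this
      exact (hL _ _).2 (mul_left_cancel₀ hx this).symm
    have e2 : ∀ w ∈ L c, (B * A) (Finsupp.single w 1) w =
        ∑ v ∈ L (x * c), A (Finsupp.single w 1) v * B (Finsupp.single v 1) w := by
      intro w hw
      rw [mul_entry, Finsupp.sum_of_support_subset _ (s := L (x * c)) _ _ (by simp)]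
      intro v hv
      have := hA w v (by simpa using hv)
      rw [(hL _ _).1 hw] at this
      exact (hL _ _).2 this
    rw [Finset.sum_congr rfl e1, Finset.sum_congr rfl e2, Finset.sum_comm]
    exact Finset.sum_congr rfl fun w _ => Finset.sum_congr rfl fun v _ => mul_comm _ _
  have hpull : ∀ (F : ι → ℂ) c, ∑ v ∈ L c, τ v * F v = c * ∑ v ∈ L c, F v := by
    intro F c
    rw [Finset.mul_sum]
    exact Finset.sum_congr rfl fun v hv => by rw [(hL _ _).1 hv]
  -- The substitution `c ↦ x c` in the sum over weights produces the factor `x`.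
  rw [hsum _ hAB, hsum _ hBA, ← (Equiv.mulLeft₀ x hx).tsum_eq, ← tsum_mul_left]
  congr 1; ext c
  rw [Equiv.mulLeft₀_apply, hpull, hpull, key, mul_assoc]

/-! The weights of the generators. -/

section
variable {g : ℝ} {ι : Type} (π : OscRep g ι)

/-- The operator `A` changes the eigenvalues of `H_m` by `δ_m`. -/
def Shifts (A : Module.End ℂ (ι →₀ ℂ)) (δ : Fin 2 → ℤ) : Prop :=
  ∀ u v, A (Finsupp.single u 1) v ≠ 0 → ∀ m, π.H m v = π.H m u + δ m

theorem Shifts.mul {A B : Module.End ℂ (ι →₀ ℂ)} {δ ε : Fin 2 → ℤ} (hA : Shifts π A δ)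
    (hB : Shifts π B ε) : Shifts π (A * B) (δ + ε) := by
  intro u v h m
  rw [mul_entry] at h
  obtain ⟨w, hw, hw'⟩ := Finset.exists_ne_zero_of_sum_ne_zero h
  rw [hA w v (right_ne_zero_of_mul hw') m, hB u w (left_ne_zero_of_mul hw') m]
  push_cast [Pi.add_apply]; ring

theorem shifts_one : Shifts π 1 0 := by
  classical
  intro u v h m
  rw [Module.End.one_apply, Finsupp.single_apply] at h
  have : u = v := by by_contra h'; simp [h'] at h
  simp [this]

theorem Shifts.smul {A : Module.End ℂ (ι →₀ ℂ)} {δ : Fin 2 → ℤ} (hA : Shifts π A δ) (c : ℂ) :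
    Shifts π (c • A) δ := by
  intro u v h m
  rw [LinearMap.smul_apply, Finsupp.smul_apply, smul_eq_mul] at h
  exact hA u v (right_ne_zero_of_mul h) m

theorem shifts_diagOp (f : ι → ℂ) : Shifts π (diagOp f) 0 := by
  intro u v h m
  rw [diagOp_single, Finsupp.smul_apply, smul_eq_mul] at h
  exact shifts_one π u v (right_ne_zero_of_mul h) m

theorem entry_commutator (m : Fin 2) (A : Module.End ℂ (ι →₀ ℂ)) (u v : ι) :
    (diagOp (π.H m) * A - A * diagOp (π.H m)) (Finsupp.single u 1) v =
      (π.H m v - π.H m u) * A (Finsupp.single u 1) v := by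
  rw [LinearMap.sub_apply, Finsupp.sub_apply, Module.End.mul_apply, Module.End.mul_apply,
    diagOp_apply, diagOp_single, map_smul, Finsupp.smul_apply, smul_eq_mul]
  ring

theorem shifts_ap (l : Fin 2) : Shifts π (π.ap l) (Pi.single l 1) := by
  intro u v h m
  have h1 := entry_commutator π m (π.ap l) u v
  rw [π.H_ap] at h1
  by_cases hm : m = l
  · subst hm
    rw [if_pos rfl] at h1
    rw [Pi.single_eq_same]
    have := mul_right_cancel₀ h ((one_mul _).trans h1)
    push_cast; linear_combination -this
  · rw [if_neg hm] at h1
    rw [Pi.single_eq_of_ne hm]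
    have := (mul_eq_zero.1 h1.symm).resolve_right h
    push_cast; linear_combination this

theorem shifts_am (l : Fin 2) : Shifts π (π.am l) (-Pi.single l 1) := by
  intro u v h m
  have h1 := entry_commutator π m (π.am l) u v
  rw [π.H_am] at h1
  by_cases hm : m = l
  · subst hm
    rw [if_pos rfl, LinearMap.neg_apply, Finsupp.neg_apply] at h1
    have := mul_right_cancel₀ h ((neg_one_mul _).trans h1)
    simp only [Pi.neg_apply, Pi.single_eq_same]
    push_cast; linear_combination -this
  · rw [if_neg hm] at h1
    have := (mul_eq_zero.1 h1.symm).resolve_right h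
    simp only [Pi.neg_apply, Pi.single_eq_of_ne hm]
    push_cast; linear_combination this

/-- The weights of the generators `y₁, y₂, y₃`. -/
def yShift : Fin 3 → Fin 2 → ℤ := ![![-1, 1], ![0, -1], ![1, 0]]

theorem shifts_rhoY (t : ℂ) (s : Fin 3) : Shifts π (rhoY π t s) (yShift s) := by
  fin_cases s
  · have h := (((shifts_diagOp π fun v => qpow g (-(π.H 1 v))).mul π (shifts_am π 0)).mul π
      (shifts_ap π 1)).smul π (qpow g (1 / 2) * t * (qpow g 1 - qpow g (-1)))
    have e : (0 + -Pi.single 0 1 + Pi.single 1 1 : Fin 2 → ℤ) = yShift 0 := by decide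
    rw [e] at h
    exact h
  · have e : (-Pi.single 1 1 : Fin 2 → ℤ) = yShift 1 := by decide
    have h := shifts_am π 1
    rw [e] at h
    exact h
  · have h := (shifts_ap π 0).mul π (shifts_diagOp π fun v => qpow g (π.H 1 v))
    have e : (Pi.single 0 1 + 0 : Fin 2 → ℤ) = yShift 2 := by decide
    rw [e] at h
    exact h

/-- The inverse of `relabel`. -/
def unlabel (bar : Bool) (i r : Fin 3) : Fin 3 :=
  if bar then Equiv.swap (i + 1) (i + 2) (r + i) else r + i

theorem relabel_unlabel : ∀ (bar : Bool) (i r : Fin 3), relabel bar i (unlabel bar i r) = r := by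
  decide

theorem unlabel_relabel : ∀ (bar : Bool) (i r : Fin 3), unlabel bar i (relabel bar i r) = r := by
  decide

theorem unlabel_injective (bar : Bool) (i : Fin 3) : Function.Injective (unlabel bar i) :=
  Function.LeftInverse.injective (relabel_unlabel bar i)

/-- The relation `e₁ + e₂ + e₃ = 0` removes one scalar product and decouples the two modes;
convergence then depends on two imaginary parts only. -/
theorem twist_eq (bar : Bool) (i : Fin 3) (p : Fin 2 → ℂ) (v : ι) :
    twist π bar i p v = Complex.exp (4 * Real.pi * Complex.I *
      (dot (e (unlabel bar i 2)) p * π.H 0 v - dot (e (unlabel bar i 1)) p * π.H 1 v)) := by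
  have h1 : ∑ s : Fin 3, dot (e s) p * rhoH π (relabel bar i s) v =
      ∑ r : Fin 3, dot (e (unlabel bar i r)) p * rhoH π r v := by
    have hb := Finite.injective_iff_bijective.1 (unlabel_injective bar i)
    rw [← hb.sum_comp]
    simp only [relabel_unlabel]
  have h2 := sum_dot_eq_zero p (unlabel_injective bar i)
  rw [twist, h1, Fin.sum_univ_three]
  congr 1
  simp only [rhoH, Matrix.cons_val]
  linear_combination (4 / 3 * Real.pi * Complex.I * (-π.H 0 v + π.H 1 v)) * h2

theorem twist_ne_zero (bar : Bool) (i : Fin 3) (p : Fin 2 → ℂ) (v : ι) : twist π bar i p v ≠ 0 :=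
  Complex.exp_ne_zero _

theorem twist_shift (bar : Bool) (i : Fin 3) (p : Fin 2 → ℂ) {u v : ι} {δ : Fin 2 → ℤ}
    (h : ∀ m, π.H m v = π.H m u + δ m) :
    twist π bar i p v = Complex.exp (4 * Real.pi * Complex.I *
      (dot (e (unlabel bar i 2)) p * δ 0 - dot (e (unlabel bar i 1)) p * δ 1)) * twist π bar i p u := by
  rw [twist_eq, twist_eq, h, h, ← Complex.exp_add]
  ring_nf

end

end W3

end

noncomputable section

namespace W3

open MeasureTheory Filter Topology Set

/-! The first coefficient of the operators `A_i(t)`. -/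

theorem qpow_one_sub (g : ℝ) : qpow g 1 - qpow g (-1) = 2 * Complex.I * Real.sin (Real.pi * g) := by
  rw [qpow, qpow, Complex.ofReal_sin, Complex.sin]
  rw [show Complex.I * Real.pi * g * 1 = ((Real.pi * g : ℝ) : ℂ) * Complex.I by push_cast; ring,
    show Complex.I * Real.pi * g * (-1) = -((Real.pi * g : ℝ) : ℂ) * Complex.I by push_cast; ring]
  linear_combination (Complex.exp (((Real.pi * g : ℝ) : ℂ) * Complex.I) -
    Complex.exp (-((Real.pi * g : ℝ) : ℂ) * Complex.I)) * Complex.I_sq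

theorem sin_pi_mul_pos {g : ℝ} (hg0 : 0 < g) (hg1 : g < 1) : 0 < Real.sin (Real.pi * g) :=
  Real.sin_pos_of_pos_of_lt_pi (by positivity) (by nlinarith [Real.pi_pos])

theorem qpow_one_sub_ne_zero {g : ℝ} (hg0 : 0 < g) (hg1 : g < 1) : qpow g 1 - qpow g (-1) ≠ 0 := by
  rw [qpow_one_sub]
  have := (sin_pi_mul_pos hg0 hg1).ne'
  simp [Complex.I_ne_zero, this, -Complex.ofReal_sin]

/-- Normal ordering of the words of length three. -/
theorem words_normal {R : Type*} [Ring R] [Algebra ℂ R] {a a' b b' k k' : R} {q c : ℂ} (hq : q ≠ 0)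
    (hba : b * a = a * b) (hb'a : b' * a = a * b') (hb'a' : b' * a' = a' * b')
    (hka' : k * a' = a' * k) (hk'a : k' * a = a * k') (hk'a' : k' * a' = a' * k')
    (hkb : k * b = q • (b * k)) (hkb' : k * b' = q⁻¹ • (b' * k)) (hk'b : k' * b = q⁻¹ • (b * k'))
    (hk'b' : k' * b' = q • (b' * k')) (hkk : k * k' = 1) (hkk' : k' * k = 1) :
    a * k * (c • (k' * a' * b)) * b' = c • (a * a' * (b * b')) ∧
    (c • (k' * a' * b)) * b' * (a * k) = c • (a' * a * (b * b')) ∧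
    b' * (a * k) * (c • (k' * a' * b)) = c • (a * a' * (b' * b)) ∧
    (c • (k' * a' * b)) * (a * k) * b' = (c * q⁻¹) • (a' * a * (b * b')) ∧
    b' * (c • (k' * a' * b)) * (a * k) = (c * q⁻¹) • (a' * a * (b' * b)) ∧
    a * k * b' * (c • (k' * a' * b)) = (c * q⁻¹) • (a * a' * (b' * b)) := by
  have ext : ∀ {x y z : R}, x * y = z → ∀ w, x * (y * w) = z * w := fun h w => by rw [← mul_assoc, h]
  refine ⟨?_, ?_, ?_, ?_, ?_, ?_⟩ <;>
  simp only [mul_assoc, smul_mul_assoc, mul_smul_comm, smul_smul, hba, hb'a, hk'a', hkb', hk'b, hk'b',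
    hkk, hkk', ext hba, ext hb'a, ext hb'a', ext hka', ext hk'a, ext hkb, mul_one,
    inv_mul_cancel₀ hq, inv_mul_cancel_right₀ hq]

/-- The quadratic relation between the number operators of two oscillators. -/
theorem number_relation {R : Type*} [Ring R] [Algebra ℂ R] {A A' B B' : R} {q d : ℂ} (hq : q ≠ 0)
    (hA : q • A - q⁻¹ • A' = d⁻¹ • (1 : R)) (hB : q • B - q⁻¹ • B' = d⁻¹ • (1 : R)) :
    A' * B' - q ^ 2 • (A * B') - q ^ 2 • (A' * B) + q ^ 4 • (A * B) = (q ^ 2 / d ^ 2) • (1 : R) := by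
  -- An oscillator relation says that `A' - q² A` is the scalar `-q/d`. The assertion is the product
  -- of two such relations.
  have key : ∀ {A A' : R}, q • A - q⁻¹ • A' = d⁻¹ • (1 : R) → A' = q ^ 2 • A - (q * d⁻¹) • (1 : R) := by
    intro A A' h
    rw [← smul_smul, ← h, smul_sub, smul_smul, smul_smul, mul_inv_cancel₀ hq, one_smul, sq]
    abel
  rw [key hA, key hB]
  simp only [sub_mul, mul_sub, smul_mul_assoc, mul_smul_comm, smul_sub, smul_smul, mul_one, one_mul]
  rw [show q ^ 2 / d ^ 2 = q * d⁻¹ * (q * d⁻¹) by field_simp]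
  match_scalars <;> ring

theorem end_ext {ι : Type} {A B : Module.End ℂ (ι →₀ ℂ)}
    (h : ∀ u v, A (Finsupp.single u 1) v = B (Finsupp.single u 1) v) : A = B := by
  refine Finsupp.lhom_ext fun u c => ?_
  have h1 : A (Finsupp.single u 1) = B (Finsupp.single u 1) := Finsupp.ext (h u)
  rw [← mul_one c, ← smul_eq_mul, ← Finsupp.smul_single, map_smul, map_smul, h1]

section
variable {g : ℝ} {ι : Type} (π : OscRep g ι)

theorem diagOp_mul_of_shifts {A : Module.End ℂ (ι →₀ ℂ)} {δ : Fin 2 → ℤ} (hA : Shifts π A δ)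
    {F : ι → ℂ} {c : ℂ} (hF : ∀ u v, (∀ m, π.H m v = π.H m u + δ m) → F v = c * F u) :
    diagOp F * A = c • (A * diagOp F) := by
  refine end_ext fun u v => ?_
  rw [Module.End.mul_apply, diagOp_apply, LinearMap.smul_apply, Finsupp.smul_apply,
    Module.End.mul_apply, diagOp_single, map_smul, Finsupp.smul_apply, smul_eq_mul, smul_eq_mul]
  by_cases h : A (Finsupp.single u 1) v = 0
  · rw [h]; ring
  · rw [hF u v (hA u v h)]; ring

theorem diagOp_mul_diagOp (F G : ι → ℂ) : diagOp F * diagOp G = diagOp fun v => F v * G v := by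
  refine end_ext fun u v => ?_
  rw [Module.End.mul_apply, diagOp_apply, diagOp_apply, diagOp_apply, mul_assoc]

theorem diagOp_one : diagOp (fun _ : ι => (1 : ℂ)) = 1 := by
  refine end_ext fun u v => ?_
  rw [diagOp_apply, one_mul]; rfl

/-- The coefficient in `ρ_t(y₁)`. -/
def yScale (g : ℝ) (t : ℂ) : ℂ := qpow g (1 / 2) * t * (qpow g 1 - qpow g (-1))

/-- The words of length three in the generators `y₁, y₂, y₃`. -/
theorem rhoY_words (t : ℂ) :
    rhoY π t 2 * rhoY π t 0 * rhoY π t 1 = yScale g t • (π.ap 0 * π.am 0 * (π.ap 1 * π.am 1)) ∧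
    rhoY π t 0 * rhoY π t 1 * rhoY π t 2 = yScale g t • (π.am 0 * π.ap 0 * (π.ap 1 * π.am 1)) ∧
    rhoY π t 1 * rhoY π t 2 * rhoY π t 0 = yScale g t • (π.ap 0 * π.am 0 * (π.am 1 * π.ap 1)) ∧
    rhoY π t 0 * rhoY π t 2 * rhoY π t 1 =
      (yScale g t * (qpow g 1)⁻¹) • (π.am 0 * π.ap 0 * (π.ap 1 * π.am 1)) ∧
    rhoY π t 1 * rhoY π t 0 * rhoY π t 2 =
      (yScale g t * (qpow g 1)⁻¹) • (π.am 0 * π.ap 0 * (π.am 1 * π.ap 1)) ∧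
    rhoY π t 2 * rhoY π t 1 * rhoY π t 0 =
      (yScale g t * (qpow g 1)⁻¹) • (π.ap 0 * π.am 0 * (π.am 1 * π.ap 1)) := by
  have key : ∀ {A : Module.End ℂ (ι →₀ ℂ)} {δ : Fin 2 → ℤ} (_ : Shifts π A δ),
      diagOp (fun v => qpow g (π.H 1 v)) * A = qpow g (δ 1) • (A * diagOp fun v => qpow g (π.H 1 v)) :=
    fun hA => diagOp_mul_of_shifts π hA fun u v h => by rw [h 1, qpow_add, mul_comm]
  have key' : ∀ {A : Module.End ℂ (ι →₀ ℂ)} {δ : Fin 2 → ℤ} (_ : Shifts π A δ),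
      diagOp (fun v => qpow g (-(π.H 1 v))) * A =
        qpow g (-(δ 1 : ℂ)) • (A * diagOp fun v => qpow g (-(π.H 1 v))) :=
    fun hA => diagOp_mul_of_shifts π hA fun u v h => by rw [h 1, neg_add, qpow_add, mul_comm]
  have q0 : qpow g 0 = 1 := by simp [qpow]
  have kk : ∀ F G : ι → ℂ, (∀ v, F v * G v = 1) → diagOp F * diagOp G = 1 := fun F G h => by
    rw [diagOp_mul_diagOp, ← diagOp_one]; congr 1; ext v; exact h v
  have k1 : diagOp (fun v => qpow g (π.H 1 v)) * π.am 0 = π.am 0 * diagOp fun v => qpow g (π.H 1 v) := by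
    simpa [q0] using key (shifts_am π 0)
  have k2 : diagOp (fun v => qpow g (-(π.H 1 v))) * π.ap 0 =
      π.ap 0 * diagOp fun v => qpow g (-(π.H 1 v)) := by simpa [q0] using key' (shifts_ap π 0)
  have k3 : diagOp (fun v => qpow g (-(π.H 1 v))) * π.am 0 =
      π.am 0 * diagOp fun v => qpow g (-(π.H 1 v)) := by simpa [q0] using key' (shifts_am π 0)
  have k4 : diagOp (fun v => qpow g (π.H 1 v)) * π.ap 1 =
      qpow g 1 • (π.ap 1 * diagOp fun v => qpow g (π.H 1 v)) := by simpa using key (shifts_ap π 1)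
  have k5 : diagOp (fun v => qpow g (π.H 1 v)) * π.am 1 =
      (qpow g 1)⁻¹ • (π.am 1 * diagOp fun v => qpow g (π.H 1 v)) := by
    rw [← qpow_neg]; simpa using key (shifts_am π 1)
  have k6 : diagOp (fun v => qpow g (-(π.H 1 v))) * π.ap 1 =
      (qpow g 1)⁻¹ • (π.ap 1 * diagOp fun v => qpow g (-(π.H 1 v))) := by
    rw [← qpow_neg]; simpa using key' (shifts_ap π 1)
  have k7 : diagOp (fun v => qpow g (-(π.H 1 v))) * π.am 1 =
      qpow g 1 • (π.am 1 * diagOp fun v => qpow g (-(π.H 1 v))) := by simpa using key' (shifts_am π 1)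
  exact words_normal (R := Module.End ℂ (ι →₀ ℂ)) (c := yScale g t) (qpow_ne_zero g 1) π.ap_ap.symm.eq
    (π.ap_am 0 1 (by decide)).symm.eq π.am_am.symm.eq k1 k2 k3 k4 k5 k6 k7
    (kk _ _ fun v => by rw [← qpow_add, add_neg_cancel, q0])
    (kk _ _ fun v => by rw [← qpow_add, neg_add_cancel, q0])

theorem yWord_three (bar : Bool) (i : Fin 3) (σ : Fin 3 → Fin 3) :
    yWord π bar i σ = rhoY π (if bar then -1 else 1) (relabel bar i (σ 0)) *
      rhoY π (if bar then -1 else 1) (relabel bar i (σ 1)) *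
      rhoY π (if bar then -1 else 1) (relabel bar i (σ 2)) := by
  simp only [yWord, List.ofFn_succ, List.ofFn_zero, List.prod_cons, List.prod_nil, mul_one, mul_assoc]
  rfl

/-- A word of nonzero total weight changes some eigenvalue of `H_m`, so it has no diagonal matrix
elements. -/
theorem diagTerm_eq_zero (bar : Bool) (i : Fin 3) (p : Fin 2 → ℂ) {σ : Fin 3 → Fin 3}
    (h : yShift (relabel bar i (σ 0)) + yShift (relabel bar i (σ 1)) + yShift (relabel bar i (σ 2)) ≠ 0)
    (v : ι) : diagTerm π bar i p σ v = 0 := by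
  rw [diagTerm, yWord_three]
  by_contra hne
  refine h ?_
  have hs := ((shifts_rhoY π (if bar then -1 else 1) (relabel bar i (σ 0))).mul π
    (shifts_rhoY π (if bar then -1 else 1) (relabel bar i (σ 1)))).mul π
    (shifts_rhoY π (if bar then -1 else 1) (relabel bar i (σ 2)))
  ext m
  have := hs v v (right_ne_zero_of_mul hne) m
  have h2 := left_eq_add.1 this
  exact_mod_cast h2

/-- The twisted trace. -/
def tr (bar : Bool) (i : Fin 3) (p : Fin 2 → ℂ) (A : Module.End ℂ (ι →₀ ℂ)) : ℂ :=
  ∑' v, twist π bar i p v * A (Finsupp.single v 1) v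

/-- The twisted trace converges. -/
def TraceClass (bar : Bool) (i : Fin 3) (p : Fin 2 → ℂ) (A : Module.End ℂ (ι →₀ ℂ)) : Prop :=
  Summable fun v => twist π bar i p v * A (Finsupp.single v 1) v

theorem tr_mul_comm {bar : Bool} {i : Fin 3} {p : Fin 2 → ℂ} (hp : Summable (twist π bar i p))
    {A B : Module.End ℂ (ι →₀ ℂ)} {δ : Fin 2 → ℤ} (hA : Shifts π A δ) (hB : Shifts π B (-δ))
    (hAB : TraceClass π bar i p (A * B)) (hBA : TraceClass π bar i p (B * A)) :
    tr π bar i p (A * B) = Complex.exp (4 * Real.pi * Complex.I *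
      (dot (e (unlabel bar i 2)) p * δ 0 - dot (e (unlabel bar i 1)) p * δ 1)) *
        tr π bar i p (B * A) := by
  refine twisted_trace_cyclic (twist_ne_zero π bar i p) hp (Complex.exp_ne_zero _)
    (fun u v h => twist_shift π bar i p (hA u v h)) (fun u v h => twist_shift π bar i p fun m => ?_)
    hAB hBA
  have := hB u v h m
  rw [this, Pi.neg_apply]; push_cast; ring

/-- The trace of the product of the two number operators. -/
theorem tr_number {bar : Bool} {i : Fin 3} {p : Fin 2 → ℂ} (hp : Summable (twist π bar i p))
    (s11 : TraceClass π bar i p (π.ap 0 * π.am 0 * (π.ap 1 * π.am 1)))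
    (s21 : TraceClass π bar i p (π.am 0 * π.ap 0 * (π.ap 1 * π.am 1)))
    (s12 : TraceClass π bar i p (π.ap 0 * π.am 0 * (π.am 1 * π.ap 1)))
    (s22 : TraceClass π bar i p (π.am 0 * π.ap 0 * (π.am 1 * π.ap 1)))
    {x₁ x₂ : ℂ} (hx₁ : x₁ = Complex.exp (4 * Real.pi * Complex.I * dot (e (unlabel bar i 2)) p))
    (hx₂ : x₂ = Complex.exp (-(4 * Real.pi * Complex.I * dot (e (unlabel bar i 1)) p))) :
    tr π bar i p (π.am 0 * π.ap 0 * (π.ap 1 * π.am 1)) =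
      x₁⁻¹ * tr π bar i p (π.ap 0 * π.am 0 * (π.ap 1 * π.am 1)) ∧
    tr π bar i p (π.ap 0 * π.am 0 * (π.am 1 * π.ap 1)) =
      x₂⁻¹ * tr π bar i p (π.ap 0 * π.am 0 * (π.ap 1 * π.am 1)) ∧
    tr π bar i p (π.am 0 * π.ap 0 * (π.am 1 * π.ap 1)) =
      (x₁ * x₂)⁻¹ * tr π bar i p (π.ap 0 * π.am 0 * (π.ap 1 * π.am 1)) ∧
    (1 - qpow g 1 ^ 2 * x₁) * (1 - qpow g 1 ^ 2 * x₂) *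
      tr π bar i p (π.ap 0 * π.am 0 * (π.ap 1 * π.am 1)) =
      qpow g 1 ^ 2 * x₁ * x₂ / (qpow g 1 - qpow g (-1)) ^ 2 * Z π bar i p := by
  have hx₁0 : x₁ ≠ 0 := by rw [hx₁]; exact Complex.exp_ne_zero _
  have hx₂0 : x₂ ≠ 0 := by rw [hx₂]; exact Complex.exp_ne_zero _
  have c00 := (π.ap_am 0 1 (by decide)).eq
  have c10 := (π.ap_am 1 0 (by decide)).eq
  have cp := π.ap_ap.eq
  have cm := π.am_am.eq
  have e0 : ((Pi.single 0 1 : Fin 2 → ℤ) 0 : ℂ) = 1 ∧ ((Pi.single 0 1 : Fin 2 → ℤ) 1 : ℂ) = 0 := by simp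
  have e1 : ((Pi.single 1 1 : Fin 2 → ℤ) 0 : ℂ) = 0 ∧ ((Pi.single 1 1 : Fin 2 → ℤ) 1 : ℂ) = 1 := by simp
  have f1 : π.ap 0 * (π.am 0 * (π.ap 1 * π.am 1)) = π.ap 0 * π.am 0 * (π.ap 1 * π.am 1) :=
    (mul_assoc _ _ _).symm
  have f2 : π.am 0 * (π.ap 1 * π.am 1) * π.ap 0 = π.am 0 * π.ap 0 * (π.ap 1 * π.am 1) := by
    rw [mul_assoc, mul_assoc (π.ap 1), ← c00, ← mul_assoc (π.ap 1), ← cp]; simp only [mul_assoc]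
  have f3 : π.ap 1 * (π.am 1 * (π.ap 0 * π.am 0)) = π.ap 0 * π.am 0 * (π.ap 1 * π.am 1) := by
    rw [← mul_assoc (π.am 1), ← c00, mul_assoc, ← cm, ← mul_assoc, ← cp, mul_assoc, ← mul_assoc (π.ap 1),
      c10]
    simp only [mul_assoc]
  have f4 : π.am 1 * (π.ap 0 * π.am 0) * π.ap 1 = π.ap 0 * π.am 0 * (π.am 1 * π.ap 1) := by
    rw [← mul_assoc (π.am 1), ← c00, mul_assoc (π.ap 0), ← cm]; simp only [mul_assoc]
  have f5 : π.ap 1 * (π.am 1 * (π.am 0 * π.ap 0)) = π.am 0 * π.ap 0 * (π.ap 1 * π.am 1) := by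
    rw [← mul_assoc (π.am 1), ← cm, mul_assoc, ← c00, ← mul_assoc, c10, mul_assoc, ← mul_assoc (π.ap 1),
      ← cp]
    simp only [mul_assoc]
  have f6 : π.am 1 * (π.am 0 * π.ap 0) * π.ap 1 = π.am 0 * π.ap 0 * (π.am 1 * π.ap 1) := by
    rw [← mul_assoc (π.am 1), ← cm, mul_assoc (π.am 0), ← c00]; simp only [mul_assoc]
  have sh0 : Shifts π (π.am 0 * (π.ap 1 * π.am 1)) (-Pi.single 0 1) := by
    simpa using (shifts_am π 0).mul π ((shifts_ap π 1).mul π (shifts_am π 1))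
  have sh1 : Shifts π (π.am 1 * (π.ap 0 * π.am 0)) (-Pi.single 1 1) := by
    simpa using (shifts_am π 1).mul π ((shifts_ap π 0).mul π (shifts_am π 0))
  have sh2 : Shifts π (π.am 1 * (π.am 0 * π.ap 0)) (-Pi.single 1 1) := by
    simpa using (shifts_am π 1).mul π ((shifts_am π 0).mul π (shifts_ap π 0))
  -- Carrying one raising operator around the trace exchanges the two orders of its mode, at the
  -- price of `x₁` or `x₂`.
  have t1 := tr_mul_comm π hp (shifts_ap π 0) sh0 (by rwa [f1]) (by rwa [f2])
  have t2 := tr_mul_comm π hp (shifts_ap π 1) sh1 (by rwa [f3]) (by rwa [f4])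
  have t3 := tr_mul_comm π hp (shifts_ap π 1) sh2 (by rwa [f5]) (by rwa [f6])
  rw [f1, f2, e0.1, e0.2, mul_one, mul_zero, sub_zero, ← hx₁] at t1
  rw [f3, f4, e1.1, e1.2, mul_one, mul_zero, zero_sub, mul_neg, ← hx₂] at t2
  rw [f5, f6, e1.1, e1.2, mul_one, mul_zero, zero_sub, mul_neg, ← hx₂] at t3
  have r1 : tr π bar i p (π.am 0 * π.ap 0 * (π.ap 1 * π.am 1)) =
      x₁⁻¹ * tr π bar i p (π.ap 0 * π.am 0 * (π.ap 1 * π.am 1)) := by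
    rw [t1, inv_mul_cancel_left₀ hx₁0]
  have r2 : tr π bar i p (π.ap 0 * π.am 0 * (π.am 1 * π.ap 1)) =
      x₂⁻¹ * tr π bar i p (π.ap 0 * π.am 0 * (π.ap 1 * π.am 1)) := by
    rw [t2, inv_mul_cancel_left₀ hx₂0]
  have r3 : tr π bar i p (π.am 0 * π.ap 0 * (π.am 1 * π.ap 1)) =
      (x₁ * x₂)⁻¹ * tr π bar i p (π.ap 0 * π.am 0 * (π.ap 1 * π.am 1)) := by
    rw [t1, t3]; field_simp
  refine ⟨r1, r2, r3, ?_⟩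
  set q := qpow g 1
  set d := q - qpow g (-1)
  have hq : q ≠ 0 := qpow_ne_zero g 1
  have hq' : qpow g (-1) = q⁻¹ := qpow_neg g 1
  have osc : ∀ m, q • (π.ap m * π.am m) - q⁻¹ • (π.am m * π.ap m) =
      d⁻¹ • (1 : Module.End ℂ (ι →₀ ℂ)) := fun m => hq' ▸ π.osc m
  have hop := number_relation (R := Module.End ℂ (ι →₀ ℂ)) hq (osc 0) (osc 1)
  have hsum := (((s22.hasSum.sub (s12.hasSum.mul_left (q ^ 2))).sub (s21.hasSum.mul_left (q ^ 2))).add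
    (s11.hasSum.mul_left (q ^ 4)))
  have hZ : HasSum (fun v => q ^ 2 / d ^ 2 * twist π bar i p v) (q ^ 2 / d ^ 2 * Z π bar i p) :=
    hp.hasSum.mul_left _
  -- The trace of the operator identity `hop`. With `r1`, `r2`, `r3` it becomes a linear equation
  -- for a single unknown trace.
  have heq : q ^ 2 / d ^ 2 * Z π bar i p =
      tr π bar i p (π.am 0 * π.ap 0 * (π.am 1 * π.ap 1)) -
        q ^ 2 * tr π bar i p (π.ap 0 * π.am 0 * (π.am 1 * π.ap 1)) -
        q ^ 2 * tr π bar i p (π.am 0 * π.ap 0 * (π.ap 1 * π.am 1)) +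
        q ^ 4 * tr π bar i p (π.ap 0 * π.am 0 * (π.ap 1 * π.am 1)) := by
    refine hZ.unique (hsum.congr_fun fun v => ?_)
    have h := congrArg (fun A : Module.End ℂ (ι →₀ ℂ) => A (Finsupp.single v 1) v) hop
    simp only [LinearMap.add_apply, LinearMap.sub_apply, LinearMap.smul_apply, Finsupp.add_apply,
      Finsupp.sub_apply, Finsupp.smul_apply, smul_eq_mul, Module.End.one_apply,
      Finsupp.single_eq_same, mul_one] at h
    linear_combination (-twist π bar i p v) * h
  rw [r1, r2, r3] at heq
  have : q ^ 2 * x₁ * x₂ / d ^ 2 * Z π bar i p = x₁ * x₂ * (q ^ 2 / d ^ 2 * Z π bar i p) := by ring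
  rw [this, heq]
  field_simp
  ring

end

end W3

end

/-! ### The first coefficient of `A_i` as a sum over six words. -/

noncomputable section

namespace W3

open MeasureTheory Filter Topology Set

/-- The six words in which every letter occurs once. -/
def permWords : Finset (Fin 3 → Fin 3) :=
  {![2, 0, 1], ![0, 1, 2], ![1, 2, 0], ![0, 2, 1], ![1, 0, 2], ![2, 1, 0]}

/-- The three weights add up to zero and any two of them are independent, so a word of length three
has weight zero only if every letter occurs once. -/
theorem yShift_sum_ne_zero : ∀ τ : Fin 3 → Fin 3, τ ∉ permWords →
    yShift (τ 0) + yShift (τ 1) + yShift (τ 2) ≠ 0 := by decide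

theorem sum_permWords {M : Type*} [AddCommMonoid M] (f : (Fin 3 → Fin 3) → M) :
    ∑ τ ∈ permWords, f τ = f ![2, 0, 1] + (f ![0, 1, 2] + (f ![1, 2, 0] +
      (f ![0, 2, 1] + (f ![1, 0, 2] + f ![2, 1, 0])))) := by
  rw [permWords, Finset.sum_insert (by decide), Finset.sum_insert (by decide),
    Finset.sum_insert (by decide), Finset.sum_insert (by decide), Finset.sum_insert (by decide),
    Finset.sum_singleton]

section
variable {g : ℝ} {ι : Type} (π : OscRep g ι)

theorem aState_eq_sum (bar : Bool) (i : Fin 3) (p : Fin 2 → ℂ) :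
    aState π bar i p 1 = ∑ τ ∈ permWords, aCoeff π bar i p (fun k => unlabel bar i (τ k)) •
      orderedIntegral g p (fun k => unlabel bar i (τ k)) := by
  let E : Equiv.Perm (Fin 3) := ⟨unlabel bar i, relabel bar i, relabel_unlabel bar i, unlabel_relabel bar i⟩
  have h1 : aState π bar i p 1 = ∑ σ : Fin 3 → Fin 3, aCoeff π bar i p σ • orderedIntegral g p σ := rfl
  rw [h1, ← Equiv.sum_comp (Equiv.arrowCongr (Equiv.refl (Fin 3)) E)]
  have h2 : ∀ τ : Fin 3 → Fin 3, Equiv.arrowCongr (Equiv.refl (Fin 3)) E τ =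
      fun k => unlabel bar i (τ k) := fun τ => rfl
  simp only [h2]
  refine (Finset.sum_subset (Finset.subset_univ _) fun τ _ hτ => ?_).symm
  have h3 : aCoeff π bar i p (fun k => unlabel bar i (τ k)) = 0 := by
    rw [aCoeff]
    simp_rw [diagTerm_eq_zero π bar i p (σ := fun k => unlabel bar i (τ k))
      (by simpa only [relabel_unlabel] using yShift_sum_ne_zero τ hτ)]
    rw [tsum_zero, mul_zero]
  rw [h3, zero_smul]

/-- The sign of the spectral parameter in `ρ_i(1)`, `ρ̄_i(1)`. -/
def barSign (bar : Bool) : ℂ := if bar then -1 else 1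

theorem barSign_ne_zero (bar : Bool) : barSign bar ≠ 0 := by cases bar <;> simp [barSign]

theorem diagTerm_unlabel (bar : Bool) (i : Fin 3) (p : Fin 2 → ℂ) (τ : Fin 3 → Fin 3) {c : ℂ}
    {A : Module.End ℂ (ι →₀ ℂ)}
    (h : rhoY π (barSign bar) (τ 0) * rhoY π (barSign bar) (τ 1) * rhoY π (barSign bar) (τ 2) = c • A)
    (v : ι) : diagTerm π bar i p (fun k => unlabel bar i (τ k)) v =
      c * (twist π bar i p v * A (Finsupp.single v 1) v) := by
  rw [diagTerm, yWord_three]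
  simp only [relabel_unlabel]
  rw [show (if bar = true then -1 else 1 : ℂ) = barSign bar from rfl, h, LinearMap.smul_apply,
    Finsupp.smul_apply, smul_eq_mul]
  ring

theorem traceClass_of_summable {bar : Bool} {i : Fin 3} {p : Fin 2 → ℂ} {τ : Fin 3 → Fin 3} {c : ℂ}
    (hc : c ≠ 0) {A : Module.End ℂ (ι →₀ ℂ)}
    (h : rhoY π (barSign bar) (τ 0) * rhoY π (barSign bar) (τ 1) * rhoY π (barSign bar) (τ 2) = c • A)
    (hs : Summable (diagTerm π bar i p fun k => unlabel bar i (τ k))) : TraceClass π bar i p A := by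
  have h1 : (diagTerm π bar i p fun k => unlabel bar i (τ k)) =
      fun v => c * (twist π bar i p v * A (Finsupp.single v 1) v) :=
    funext (diagTerm_unlabel π bar i p τ h)
  rw [h1] at hs
  exact (summable_mul_left_iff hc).1 hs

theorem aCoeff_unlabel {bar : Bool} {i : Fin 3} {p : Fin 2 → ℂ} {τ : Fin 3 → Fin 3} {c : ℂ}
    {A : Module.End ℂ (ι →₀ ℂ)}
    (h : rhoY π (barSign bar) (τ 0) * rhoY π (barSign bar) (τ 1) * rhoY π (barSign bar) (τ 2) = c • A) :
    aCoeff π bar i p (fun k => unlabel bar i (τ k)) = (Z π bar i p)⁻¹ * (c * tr π bar i p A) := by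
  rw [aCoeff, tr, ← tsum_mul_left (a := c)]
  congr 1
  exact tsum_congr fun v => diagTerm_unlabel π bar i p τ h v

/-- The first coefficient of `A_i(t)` (or `Ā_i(t)`). -/
theorem aState_one (hg0 : 0 < g) (hg1 : g < 2 / 3) {bar : Bool} {i : Fin 3} {p : Fin 2 → ℂ}
    (hp : p ∈ pDomain) (hadm : Admissible π bar i p) :
    aState π bar i p 1 = (-(2 * Real.pi * barSign bar *
      Jij g p (unlabel bar i 2) (unlabel bar i 1) / (qpow g 1 - qpow g (-1)))) • vacuum := by
  obtain ⟨hs, hZ, hw⟩ := hadm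
  have hd := qpow_one_sub_ne_zero hg0 (hg1.trans (by norm_num))
  have hc : yScale g (barSign bar) ≠ 0 :=
    mul_ne_zero (mul_ne_zero (qpow_ne_zero _ _) (barSign_ne_zero bar)) hd
  have hq := qpow_ne_zero g 1
  have hc' : yScale g (barSign bar) * (qpow g 1)⁻¹ ≠ 0 := mul_ne_zero hc (inv_ne_zero hq)
  obtain ⟨w1, w2, w3, w4, w5, w6⟩ := rhoY_words π (barSign bar)
  have s11 := traceClass_of_summable π (τ := ![2, 0, 1]) hc w1 (hw 3 _)
  have s21 := traceClass_of_summable π (τ := ![0, 1, 2]) hc w2 (hw 3 _)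
  have s12 := traceClass_of_summable π (τ := ![1, 2, 0]) hc w3 (hw 3 _)
  have s22 := traceClass_of_summable π (τ := ![1, 0, 2]) hc' w5 (hw 3 _)
  obtain ⟨t21, t12, t22, t11⟩ := tr_number π hs s11 s21 s12 s22 rfl rfl
  set A := dot (e (unlabel bar i 0)) p with hA
  set B := dot (e (unlabel bar i 1)) p with hB
  set C := dot (e (unlabel bar i 2)) p with hC
  have hABC : A + B + C = 0 := sum_dot_eq_zero p (unlabel_injective bar i)
  have hreg := pDomain_subset_regularSet g (unlabel bar i 2) (unlabel bar i 1) hp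
  have hstar := triInt_add_reflect hg0 hg1 hreg.1
    (show NotPole (g + -(2 * B)) by simpa [sub_eq_add_neg] using hreg.2)
  rw [neg_neg, ← hC, circleFactor_eq, circleFactor_eq] at hstar
  -- The six words form two cyclic classes of three rotations each, one for either orientation of
  -- the letters.
  have cyc1 := orderedIntegral_cyclic hg0 hg1 p (σ := fun k => unlabel bar i ((![2, 0, 1] : Fin 3 → Fin 3) k))
    ((unlabel_injective bar i).comp (by decide))
  have cyc2 := orderedIntegral_cyclic hg0 hg1 p (σ := fun k => unlabel bar i ((![2, 1, 0] : Fin 3 → Fin 3) k))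
    ((unlabel_injective bar i).comp (by decide))
  have g1 : (fun k : Fin 3 => unlabel bar i ((![2, 0, 1] : Fin 3 → Fin 3) (k + 1))) =
      fun k => unlabel bar i ((![0, 1, 2] : Fin 3 → Fin 3) k) := by ext1 k; fin_cases k <;> rfl
  have g2 : (fun k : Fin 3 => unlabel bar i ((![2, 0, 1] : Fin 3 → Fin 3) (k + 2))) =
      fun k => unlabel bar i ((![1, 2, 0] : Fin 3 → Fin 3) k) := by ext1 k; fin_cases k <;> rfl
  have g3 : (fun k : Fin 3 => unlabel bar i ((![2, 1, 0] : Fin 3 → Fin 3) (k + 1))) =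
      fun k => unlabel bar i ((![1, 0, 2] : Fin 3 → Fin 3) k) := by ext1 k; fin_cases k <;> rfl
  have g4 : (fun k : Fin 3 => unlabel bar i ((![2, 1, 0] : Fin 3 → Fin 3) (k + 2))) =
      fun k => unlabel bar i ((![0, 2, 1] : Fin 3 → Fin 3) k) := by ext1 k; fin_cases k <;> rfl
  rw [g1, g2] at cyc1
  rw [g3, g4] at cyc2
  simp only [Matrix.cons_val, ← hA, ← hB, ← hC] at cyc1 cyc2
  -- A change of base vertex brings the integral of the second class to the arguments for which
  -- `hstar` is stated.
  have k1 : triInt g (-(2 * C)) (2 * A) =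
      (Complex.exp (4 * Real.pi * Complex.I * C))⁻¹ * triInt g (2 * C) (-(2 * B)) := by
    rw [triInt_comm, triInt_rotate, triInt_comm g (2 * C), ← Complex.exp_neg]
    congr 2
    · ring
    · linear_combination 2 * hABC
    · ring
  have x3 : Complex.exp (4 * Real.pi * Complex.I * A) = (Complex.exp (4 * Real.pi * Complex.I * C))⁻¹ *
      Complex.exp (-(4 * Real.pi * Complex.I * B)) := by
    rw [← Complex.exp_neg, ← Complex.exp_add]; congr 1
    linear_combination (4 * Real.pi * Complex.I) * hABC
  have x4 : Complex.exp (4 * Real.pi * Complex.I * B) = (Complex.exp (-(4 * Real.pi * Complex.I * B)))⁻¹ := by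
    rw [← Complex.exp_neg, neg_neg]
  have x5 : Complex.exp (2 * Real.pi * Complex.I * (2 * C + -(2 * B))) =
      Complex.exp (4 * Real.pi * Complex.I * C) * Complex.exp (-(4 * Real.pi * Complex.I * B)) := by
    rw [← Complex.exp_add]; congr 1; ring
  have x6 : Complex.exp (2 * Real.pi * Complex.I * (2 * C)) = Complex.exp (4 * Real.pi * Complex.I * C) := by
    congr 1; ring
  have x7 : Complex.exp (2 * Real.pi * Complex.I * (-(2 * B))) = Complex.exp (-(4 * Real.pi * Complex.I * B)) := by
    congr 1; ring
  rw [Complex.exp_neg (4 * Real.pi * Complex.I * C), x4] at cyc1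
  rw [Complex.exp_neg (4 * Real.pi * Complex.I * C), x3, k1] at cyc2
  rw [x5, x6, x7] at hstar
  rw [aState_eq_sum, sum_permWords, aCoeff_unlabel π (τ := ![2, 0, 1]) w1,
    aCoeff_unlabel π (τ := ![0, 1, 2]) w2, aCoeff_unlabel π (τ := ![1, 2, 0]) w3,
    aCoeff_unlabel π (τ := ![0, 2, 1]) w4, aCoeff_unlabel π (τ := ![1, 0, 2]) w5,
    aCoeff_unlabel π (τ := ![2, 1, 0]) w6, t21, t12, t22]
  have hx₁ : Complex.exp (4 * Real.pi * Complex.I * C) ≠ 0 := Complex.exp_ne_zero _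
  have hx₂ : Complex.exp (-(4 * Real.pi * Complex.I * B)) ≠ 0 := Complex.exp_ne_zero _
  have hy : yScale g (barSign bar) = qpow g (1 / 2) * barSign bar * (qpow g 1 - qpow g (-1)) := rfl
  have hq2 : qpow g (3 / 2) = qpow g (1 / 2) * qpow g 1 := by rw [← qpow_add]; norm_num
  have hq3 : qpow g (1 / 2) * qpow g (1 / 2) = qpow g 1 := by rw [← qpow_add]; norm_num
  have hJ : J g (2 * C) (-(2 * B)) = Jij g p (unlabel bar i 2) (unlabel bar i 1) := rfl
  rw [hJ] at hstar
  generalize Complex.exp (4 * Real.pi * Complex.I * C) = x₁ at *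
  generalize Complex.exp (-(4 * Real.pi * Complex.I * B)) = x₂ at *
  generalize tr π bar i p (π.ap 0 * π.am 0 * (π.ap 1 * π.am 1)) = S at *
  generalize qpow g 1 - qpow g (-1) = d at *
  generalize yScale g (barSign bar) = c at *
  generalize barSign bar = t at *
  generalize Z π bar i p = ζ at *
  generalize triInt g (2 * C) (-(2 * B)) = K at *
  generalize triInt g (-(2 * C)) (2 * B) = K' at *
  generalize Jij g p (unlabel bar i 2) (unlabel bar i 1) = J₀ at *
  have hqh : qpow g (1 / 2) ≠ 0 := qpow_ne_zero _ _
  rw [hq2] at hstar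
  generalize qpow g (1 / 2) = h at *
  generalize qpow g 1 = q at *
  -- Cyclicity of the trace yields the same factors as rotation of the angles, so the coefficients
  -- group into the two cyclic sums.
  have lhs : ∀ v1 v2 v3 v4 v5 v6 : FockHat, (ζ⁻¹ * (c * S)) • v1 + ((ζ⁻¹ * (c * (x₁⁻¹ * S))) • v2 +
      ((ζ⁻¹ * (c * (x₂⁻¹ * S))) • v3 + ((ζ⁻¹ * (c * q⁻¹ * (x₁⁻¹ * S))) • v4 +
      ((ζ⁻¹ * (c * q⁻¹ * ((x₁ * x₂)⁻¹ * S))) • v5 + (ζ⁻¹ * (c * q⁻¹ * (x₂⁻¹ * S))) • v6)))) =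
      (ζ⁻¹ * c * S) • (v1 + x₁⁻¹ • v2 + x₂⁻¹ • v3) +
        (ζ⁻¹ * c * S * q⁻¹ * x₂⁻¹) • (v6 + x₁⁻¹ • v5 + (x₁⁻¹ * x₂) • v4) := by
    intro v1 v2 v3 v4 v5 v6
    match_scalars <;> field_simp
  rw [lhs, cyc1, cyc2, smul_smul, smul_smul, ← add_smul]
  congr 1
  have hI : ∀ s t : ℂ, s / Complex.I * (t / Complex.I) = -(s * t) := fun s t => by
    rw [div_mul_div_comm, Complex.I_mul_I, div_neg, div_one]
  rw [hI] at hstar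
  -- The weights of the two orientations are in the ratio of `hstar`, so that one `J` replaces both
  -- triangle integrals.
  have f1 : K' + q⁻¹ * x₂⁻¹ * (x₁⁻¹ * K) = -(q⁻¹ * (x₁ * x₂)⁻¹ * ((h * q)⁻¹ *
      ((q ^ 2 * x₁ - 1) * (q ^ 2 * x₂ - 1) * J₀))) := by
    have : (h * q)⁻¹ * ((q ^ 2 * x₁ - 1) * (q ^ 2 * x₂ - 1) * J₀) = -(K + q * (x₁ * x₂) * K') := by
      rw [inv_mul_eq_iff_eq_mul₀ (mul_ne_zero hqh hq)]
      linear_combination hstar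
    rw [this]
    field_simp
    ring
  have f2 : ζ⁻¹ * c * S * (2 * Real.pi * K') + ζ⁻¹ * c * S * q⁻¹ * x₂⁻¹ * (2 * Real.pi * (x₁⁻¹ * K)) =
      2 * Real.pi * (ζ⁻¹ * c * S) * (K' + q⁻¹ * x₂⁻¹ * (x₁⁻¹ * K)) := by ring
  -- The factors from the circle integrals are the denominators of the trace, and cancel without any
  -- condition on `p`.
  have f3 : (q ^ 2 * x₁ - 1) * (q ^ 2 * x₂ - 1) * S = q ^ 2 * x₁ * x₂ / d ^ 2 * ζ := by
    rw [← t11]; ring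
  rw [f2, f1]
  have f4 : 2 * Real.pi * (ζ⁻¹ * c * S) * -(q⁻¹ * (x₁ * x₂)⁻¹ * ((h * q)⁻¹ *
      ((q ^ 2 * x₁ - 1) * (q ^ 2 * x₂ - 1) * J₀))) =
      -(2 * Real.pi * ζ⁻¹ * c * q⁻¹ * (x₁ * x₂)⁻¹ * (h * q)⁻¹ * J₀) *
        ((q ^ 2 * x₁ - 1) * (q ^ 2 * x₂ - 1) * S) := by ring
  rw [f4, f3, hy]
  field_simp

end

end W3

end

/-! ### The logarithm of `A_i` to first order, and the eigenvalue `H₁`. -/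

noncomputable section

namespace W3

open MeasureTheory Filter Topology Set

/-- `log (1 + h) = h + O(h²)`, and `h^n` is divisible by `X^n` when `h` has no constant term. -/
theorem coeff_one_logOf {f : PowerSeries ℂ} (hf : PowerSeries.constantCoeff f = 1) :
    PowerSeries.coeff 1 (PowerSeries.logOf f) = PowerSeries.coeff 1 f := by
  have h0 : PowerSeries.constantCoeff (f - 1) = 0 := by rw [map_sub, hf, map_one, sub_self]
  have hs : PowerSeries.HasSubst (f - 1) := PowerSeries.HasSubst.of_constantCoeff_zero' h0
  have h1 : PowerSeries.coeff 1 (f - 1) = PowerSeries.coeff 1 f := by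
    rw [map_sub, PowerSeries.coeff_one, if_neg one_ne_zero, sub_zero]
  rw [PowerSeries.logOf_eq, PowerSeries.coeff_subst' hs, finsum_eq_single _ 1]
  · rw [PowerSeries.coeff_one_log, pow_one, one_smul, h1]
  · intro n hn
    rcases Nat.lt_or_gt_of_ne hn with h | h
    · have : n = 0 := by omega
      subst this
      rw [pow_zero, PowerSeries.coeff_one, if_neg one_ne_zero, smul_zero]
    · have hd : PowerSeries.X ^ n ∣ (f - 1) ^ n := pow_dvd_pow_of_dvd (PowerSeries.X_dvd_iff.2 h0) n
      rw [PowerSeries.X_pow_dvd_iff.1 hd 1 h, smul_zero]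

theorem sRatio_ne_zero {g : ℝ} (hg0 : 0 < g) (hg1 : g < 1) : sRatio g ≠ 0 := by
  refine mul_ne_zero Complex.I_ne_zero (pow_ne_zero _ (mul_ne_zero (inv_ne_zero ?_) ?_))
  · exact_mod_cast hg0.ne'
  · exact Gamma_one_sub_ne_zero hg1

section
variable {g : ℝ} {ι : Type} (π : OscRep g ι)

theorem sRatio_mul_Hvac (hg0 : 0 < g) (hg1 : g < 1) (bar : Bool) (i : Fin 3) (p : Fin 2 → ℂ) :
    sRatio g * Hvac π bar i 1 p = -MvPowerSeries.coeff 0 (aState π bar i p 1) := by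
  have h1 : PowerSeries.constantCoeff (Avac π bar i p) = 1 := by
    rw [← PowerSeries.coeff_zero_eq_constantCoeff_apply, Avac, PowerSeries.coeff_mk, if_pos rfl]
  have hs := sRatio_ne_zero hg0 hg1
  rw [Hvac, coeff_one_logOf h1, Avac, PowerSeries.coeff_mk, if_neg one_ne_zero]
  field_simp

theorem aState_one_eigen (hg0 : 0 < g) (hg1 : g < 2 / 3) {bar : Bool} {i : Fin 3} {p : Fin 2 → ℂ}
    (hp : p ∈ pDomain) (hadm : Admissible π bar i p) :
    aState π bar i p 1 = (-(sRatio g * Hvac π bar i 1 p)) • vacuum := by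
  rw [sRatio_mul_Hvac π hg0 (by linarith), neg_neg, aState_one π hg0 hg1 hp hadm, map_smul, vacuum,
    smul_eq_mul, MvPowerSeries.coeff_zero_one, mul_one]

/-- The sign comes from `i² = -1`: one factor `i` is in `q - q⁻¹ = 2 i sin (πg)`, the other in
`s/t`. -/
theorem Hvac_one (hg0 : 0 < g) (hg1 : g < 2 / 3) {bar : Bool} {i : Fin 3} {p : Fin 2 → ℂ}
    (hp : p ∈ pDomain) (hadm : Admissible π bar i p) :
    Hvac π bar i 1 p = -(barSign bar * (Real.pi * g ^ 3 *
      Jij g p (unlabel bar i 2) (unlabel bar i 1) /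
        (Complex.Gamma (1 - g) ^ 3 * Real.sin (Real.pi * g)))) := by
  have hg1' : g < 1 := by linarith
  have hs := sRatio_ne_zero hg0 hg1'
  refine mul_left_cancel₀ hs ?_
  rw [sRatio_mul_Hvac π hg0 hg1', aState_one π hg0 hg1 hp hadm, map_smul, vacuum, smul_eq_mul,
    MvPowerSeries.coeff_zero_one, qpow_one_sub, sRatio]
  have h1 : (Real.sin (Real.pi * g) : ℂ) ≠ 0 := by exact_mod_cast (sin_pi_mul_pos hg0 hg1').ne'
  have h2 : Complex.Gamma (1 - g) ≠ 0 := Gamma_one_sub_ne_zero hg1'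
  have h3 : (g : ℂ) ≠ 0 := by exact_mod_cast hg0.ne'
  have h4 := Complex.I_ne_zero
  generalize (Real.sin (Real.pi * g) : ℂ) = S at *
  field_simp
  rw [Complex.I_sq]
  ring

end

theorem isAnalyticContinuation_Hvac {g : ℝ} (hg0 : 0 < g) (hg1 : g < 2 / 3) {c : ℂ} {a b : Fin 3} (hab : a ≠ b)
    {f F : (Fin 2 → ℂ) → ℂ} (hf : ∀ p ∈ pDomain, f p = F p) (hF : ∀ p, F p = c * Jij g p a b) :
    IsAnalyticContinuation f F pDomain (regularSet g a b) := by
  obtain rfl : F = fun p => c * Jij g p a b := funext hF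
  exact ⟨isOpen_pDomain, pDomain_nonempty, pDomain_subset_regularSet g a b, isOpen_regularSet g a b,
    isPreconnected_regularSet g hab, fun p hp => analyticAt_const.mul (analyticOnNhd_Jij hg0 hg1 a b p hp),
    fun p hp => (hf p hp).symm⟩

end W3

end

noncomputable section

namespace W3

open MeasureTheory Filter Topology Set

/-! Fock representations of the two oscillator algebras. -/

section
variable {ι : Type}

/-- The monomial operator `v ↦ c(v) f(v)`. -/
def mono (f : ι → ι) (c : ι → ℂ) : Module.End ℂ (ι →₀ ℂ) :=
  Finsupp.lsum ℂ fun v => c v • Finsupp.lsingle (f v)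

theorem mono_single (f : ι → ι) (c : ι → ℂ) (v : ι) (a : ℂ) :
    mono f c (Finsupp.single v a) = Finsupp.single (f v) (c v * a) := by
  rw [mono, Finsupp.lsum_single, LinearMap.smul_apply, Finsupp.lsingle_apply, Finsupp.smul_single,
    smul_eq_mul]

theorem mono_mul (f f' : ι → ι) (c c' : ι → ℂ) :
    mono f c * mono f' c' = mono (f ∘ f') fun v => c (f' v) * c' v := by
  refine Finsupp.lhom_ext fun u a => ?_
  rw [Module.End.mul_apply, mono_single, mono_single, mono_single, mul_assoc]; rfl

/-- The target of a basis vector matters only where its coefficient is nonzero. This disposes of the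
truncated subtraction in `down` at occupation number 0. -/
theorem mono_congr {f f' : ι → ι} {c c' : ι → ℂ} (hc : ∀ v, c v = c' v)
    (hf : ∀ v, c v ≠ 0 → f v = f' v) : mono f c = mono f' c' := by
  refine Finsupp.lhom_ext fun u a => ?_
  rw [mono_single, mono_single, ← hc u]
  by_cases h : c u = 0
  · simp [h]
  · rw [hf u h]

theorem smul_mono (a : ℂ) (f : ι → ι) (c : ι → ℂ) : a • mono f c = mono f fun v => a * c v := by
  refine Finsupp.lhom_ext fun u b => ?_
  rw [LinearMap.smul_apply, mono_single, mono_single, Finsupp.smul_single, smul_eq_mul, mul_assoc]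

theorem mono_sub (f : ι → ι) (c c' : ι → ℂ) : mono f c - mono f c' = mono f fun v => c v - c' v := by
  refine Finsupp.lhom_ext fun u b => ?_
  rw [LinearMap.sub_apply, mono_single, mono_single, mono_single, ← Finsupp.single_sub, sub_mul]

theorem diagOp_eq_mono (F : ι → ℂ) : diagOp F = mono id F := rfl

theorem one_eq_mono : (1 : Module.End ℂ (ι →₀ ℂ)) = mono id fun _ => 1 := by
  refine Finsupp.lhom_ext fun u b => ?_
  rw [mono_single, one_mul]; rfl

theorem diagOp_commutator_mono (F : ι → ℂ) (f : ι → ι) (c : ι → ℂ) :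
    diagOp F * mono f c - mono f c * diagOp F = mono f fun v => (F (f v) - F v) * c v := by
  rw [diagOp_eq_mono, mono_mul, mono_mul, Function.id_comp, Function.comp_id, mono_sub]
  exact mono_congr (fun v => by simp only [id]; ring) fun _ _ => rfl

/-- Monomial operators with bounded coefficients. -/
def IsBoundedMono (A : Module.End ℂ (ι →₀ ℂ)) : Prop :=
  ∃ (f : ι → ι) (c : ι → ℂ) (C : ℝ), A = mono f c ∧ ∀ v, ‖c v‖ ≤ C

theorem IsBoundedMono.mul {A B : Module.End ℂ (ι →₀ ℂ)} (hA : IsBoundedMono A) (hB : IsBoundedMono B) :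
    IsBoundedMono (A * B) := by
  obtain ⟨f, c, C, rfl, hC⟩ := hA
  obtain ⟨f', c', C', rfl, hC'⟩ := hB
  refine ⟨_, _, C * C', mono_mul f f' c c', fun v => ?_⟩
  rw [norm_mul]
  exact mul_le_mul (hC _) (hC' _) (norm_nonneg _) ((norm_nonneg _).trans (hC (f' v)))

theorem IsBoundedMono.smul {A : Module.End ℂ (ι →₀ ℂ)} (hA : IsBoundedMono A) (a : ℂ) :
    IsBoundedMono (a • A) := by
  obtain ⟨f, c, C, rfl, hC⟩ := hA
  refine ⟨_, _, ‖a‖ * C, smul_mono a f c, fun v => ?_⟩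
  rw [norm_mul]
  exact mul_le_mul_of_nonneg_left (hC v) (norm_nonneg _)

theorem isBoundedMono_one : IsBoundedMono (1 : Module.End ℂ (ι →₀ ℂ)) :=
  ⟨id, _, 1, one_eq_mono, fun _ => by simp⟩

theorem isBoundedMono_list_prod {l : List (Module.End ℂ (ι →₀ ℂ))} (h : ∀ A ∈ l, IsBoundedMono A) :
    IsBoundedMono l.prod := by
  induction l with
  | nil => exact isBoundedMono_one
  | cons A l ih =>
    rw [List.prod_cons]
    exact (h A (by simp)).mul (ih fun B hB => h B (by simp [hB]))

/-- Diagonal entries are zero or one of the bounded coefficients, so summability of the twist alone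
makes all the traces converge. -/
theorem IsBoundedMono.exists_norm_le {A : Module.End ℂ (ι →₀ ℂ)} (hA : IsBoundedMono A) :
    ∃ C : ℝ, ∀ v, ‖A (Finsupp.single v 1) v‖ ≤ C := by
  classical
  obtain ⟨f, c, C, rfl, hC⟩ := hA
  refine ⟨C, fun v => ?_⟩
  rw [mono_single, mul_one, Finsupp.single_apply]
  split_ifs
  · exact hC v
  · rw [norm_zero]; exact (norm_nonneg _).trans (hC v)

end

theorem norm_qpow_real (g x : ℝ) : ‖qpow g x‖ = 1 := by
  rw [qpow, show Complex.I * Real.pi * g * x = ((Real.pi * g * x : ℝ) : ℂ) * Complex.I by push_cast; ring,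
    Complex.norm_exp_ofReal_mul_I]

/-- The occupation numbers of two oscillators. -/
def occ : Fin 2 → ℕ × ℕ → ℕ := ![Prod.fst, Prod.snd]

/-- The state with one more quantum. -/
def up : Fin 2 → ℕ × ℕ → ℕ × ℕ := ![fun v => (v.1 + 1, v.2), fun v => (v.1, v.2 + 1)]

/-- The state with one quantum less. -/
def down : Fin 2 → ℕ × ℕ → ℕ × ℕ := ![fun v => (v.1 - 1, v.2), fun v => (v.1, v.2 - 1)]

theorem occ_up (m l : Fin 2) (v : ℕ × ℕ) : occ m (up l v) = occ m v + if m = l then 1 else 0 := by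
  fin_cases m <;> fin_cases l <;> simp [occ, up]

theorem occ_down (m l : Fin 2) (v : ℕ × ℕ) : occ m (down l v) = occ m v - if m = l then 1 else 0 := by
  fin_cases m <;> fin_cases l <;> simp [occ, down]

theorem down_up (m : Fin 2) (v : ℕ × ℕ) : down m (up m v) = v := by
  fin_cases m <;> simp [down, up]

theorem up_down (m : Fin 2) {v : ℕ × ℕ} (h : occ m v ≠ 0) : up m (down m v) = v := by
  fin_cases m <;> simp [down, up, occ] at h ⊢ <;> ext <;> simp <;> omega

theorem up_comm (m l : Fin 2) (v : ℕ × ℕ) : up m (up l v) = up l (up m v) := by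
  fin_cases m <;> fin_cases l <;> simp [up]

theorem down_comm (m l : Fin 2) (v : ℕ × ℕ) : down m (down l v) = down l (down m v) := by
  fin_cases m <;> fin_cases l <;> simp [down]

theorem up_down_comm {m l : Fin 2} (h : m ≠ l) (v : ℕ × ℕ) : up m (down l v) = down l (up m v) := by
  fin_cases m <;> fin_cases l <;> simp [down, up] at h ⊢

/-- The sign attached to a highest (`false`) or lowest (`true`) weight representation. -/
def sgn (s : Bool) : ℤ := if s then 1 else -1

/-- The matrix elements of the lowering operators. -/
def lowerCoeff (g : ℝ) (s : Bool) (n : ℕ) : ℂ :=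
  (1 - qpow g ((2 * sgn s * n : ℤ) : ℂ)) / (qpow g 1 - qpow g (-1)) ^ 2

theorem lowerCoeff_zero (g : ℝ) (s : Bool) : lowerCoeff g s 0 = 0 := by
  simp [lowerCoeff, qpow]

/-- For real `g` one has `|q| = 1`, so the matrix elements stay bounded as `n` grows. -/
theorem norm_lowerCoeff_le (g : ℝ) (s : Bool) (n : ℕ) :
    ‖lowerCoeff g s n‖ ≤ 2 / ‖(qpow g 1 - qpow g (-1)) ^ 2‖ := by
  rw [lowerCoeff, norm_div]
  gcongr
  refine (norm_sub_le _ _).trans ?_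
  have := norm_qpow_real g ((2 * sgn s * n : ℤ) : ℝ)
  rw [Complex.ofReal_intCast] at this
  rw [this, norm_one]; norm_num

/-- The oscillator relation is a first-order recurrence, here solved from the value 0 at `n = 0`.
The first form is for raising by `a⁺` (lowest weight), the second for raising by `a⁻` (highest
weight). -/
theorem lowerCoeff_relation {g : ℝ} (hd : qpow g 1 - qpow g (-1) ≠ 0) (n : ℕ) :
    qpow g 1 * lowerCoeff g true n - qpow g (-1) * lowerCoeff g true (n + 1) =
      (qpow g 1 - qpow g (-1))⁻¹ ∧
    qpow g 1 * lowerCoeff g false (n + 1) - qpow g (-1) * lowerCoeff g false n =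
      (qpow g 1 - qpow g (-1))⁻¹ := by
  have h1 : qpow g 1 * qpow g ((2 * sgn true * n : ℤ) : ℂ) =
      qpow g (-1) * qpow g ((2 * sgn true * (n + 1 : ℕ) : ℤ) : ℂ) := by
    rw [← qpow_add, ← qpow_add]; congr 1; simp [sgn]; ring
  have h2 : qpow g 1 * qpow g ((2 * sgn false * (n + 1 : ℕ) : ℤ) : ℂ) =
      qpow g (-1) * qpow g ((2 * sgn false * n : ℤ) : ℂ) := by
    rw [← qpow_add, ← qpow_add]; congr 1; simp [sgn]; ring
  constructor
  · rw [lowerCoeff, lowerCoeff]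
    refine eq_inv_of_mul_eq_one_left ?_
    field_simp
    linear_combination -h1
  · rw [lowerCoeff, lowerCoeff]
    refine eq_inv_of_mul_eq_one_left ?_
    field_simp
    linear_combination -h2

/-- The operators which increase the occupation numbers. -/
def raiseOp (m : Fin 2) : Module.End ℂ (ℕ × ℕ →₀ ℂ) := mono (up m) fun _ => 1

/-- The operators which decrease the occupation numbers. -/
def lowerOp (g : ℝ) (s : Bool) (m : Fin 2) : Module.End ℂ (ℕ × ℕ →₀ ℂ) :=
  mono (down m) fun v => lowerCoeff g s (occ m v)

theorem isBoundedMono_raiseOp (m : Fin 2) : IsBoundedMono (raiseOp m) :=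
  ⟨_, _, 1, rfl, fun _ => by simp⟩

theorem isBoundedMono_lowerOp (g : ℝ) (s : Bool) (m : Fin 2) : IsBoundedMono (lowerOp g s m) :=
  ⟨_, _, _, rfl, fun _ => norm_lowerCoeff_le g s _⟩

theorem commutator_raiseOp (s : Fin 2 → Bool) (m l : Fin 2) :
    diagOp (fun v => ((sgn (s m) * occ m v : ℤ) : ℂ)) * raiseOp l -
      raiseOp l * diagOp (fun v => ((sgn (s m) * occ m v : ℤ) : ℂ)) =
      if m = l then (sgn (s l) : ℂ) • raiseOp l else 0 := by
  rw [raiseOp, diagOp_commutator_mono]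
  simp only [occ_up]
  split_ifs with h
  · subst h
    rw [smul_mono]
    refine mono_congr (fun v => ?_) fun _ _ => rfl
    push_cast; ring
  · refine Finsupp.lhom_ext fun u b => ?_
    simp [mono_single]

theorem commutator_lowerOp (g : ℝ) (s : Fin 2 → Bool) (m l : Fin 2) :
    diagOp (fun v => ((sgn (s m) * occ m v : ℤ) : ℂ)) * lowerOp g (s l) l -
      lowerOp g (s l) l * diagOp (fun v => ((sgn (s m) * occ m v : ℤ) : ℂ)) =
      if m = l then (-sgn (s l) : ℂ) • lowerOp g (s l) l else 0 := by
  rw [lowerOp, diagOp_commutator_mono]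
  simp only [occ_down]
  split_ifs with h
  · subst h
    rw [smul_mono]
    refine mono_congr (fun v => ?_) fun _ _ => rfl
    -- At occupation number 0 the subtraction is truncated, but the coefficient vanishes there.
    rcases Nat.eq_zero_or_pos (occ m v) with h | h
    · rw [h, lowerCoeff_zero]; ring
    · obtain ⟨n, hn⟩ := Nat.exists_eq_add_of_le' h
      rw [hn]; push_cast [Nat.add_sub_cancel]; ring
  · refine Finsupp.lhom_ext fun u b => ?_
    simp [mono_single]

theorem neg_one_smul_end {ι : Type} (A : Module.End ℂ (ι →₀ ℂ)) : (-1 : ℂ) • A = -A :=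
  neg_one_smul ℂ A

theorem commute_raiseOp (m l : Fin 2) : Commute (raiseOp m) (raiseOp l) := by
  rw [commute_iff_eq, raiseOp, raiseOp, mono_mul, mono_mul]
  exact mono_congr (fun _ => rfl) fun v _ => up_comm m l v

theorem commute_lowerOp (g : ℝ) (s s' : Bool) {m l : Fin 2} (h : m ≠ l) :
    Commute (lowerOp g s m) (lowerOp g s' l) := by
  rw [commute_iff_eq, lowerOp, lowerOp, mono_mul, mono_mul]
  refine mono_congr (fun v => ?_) fun v _ => down_comm m l v
  rw [occ_down, occ_down, if_neg h, if_neg h.symm]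
  exact mul_comm _ _

theorem commute_raiseOp_lowerOp (g : ℝ) (s : Bool) {m l : Fin 2} (h : m ≠ l) :
    Commute (raiseOp m) (lowerOp g s l) := by
  rw [commute_iff_eq, lowerOp, raiseOp, mono_mul, mono_mul]
  refine mono_congr (fun v => ?_) fun v _ => up_down_comm h v
  rw [occ_up, if_neg h.symm, add_zero]
  exact mul_comm _ _

theorem lowerOp_mul_raiseOp (g : ℝ) (s : Bool) (m : Fin 2) :
    lowerOp g s m * raiseOp m = mono id fun v => lowerCoeff g s (occ m v + 1) := by
  rw [lowerOp, raiseOp, mono_mul]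
  refine mono_congr (fun v => ?_) fun v _ => down_up m v
  rw [occ_up, if_pos rfl, mul_one]

theorem raiseOp_mul_lowerOp (g : ℝ) (s : Bool) (m : Fin 2) :
    raiseOp m * lowerOp g s m = mono id fun v => lowerCoeff g s (occ m v) := by
  rw [lowerOp, raiseOp, mono_mul]
  refine mono_congr (fun v => one_mul _) fun v hv => up_down m fun h => hv ?_
  rw [h, lowerCoeff_zero, mul_zero]

/-- The representation in which the mode `m` is of lowest weight (`s m = true`) or of highest
weight (`s m = false`). -/
def fockRep (g : ℝ) (hd : qpow g 1 - qpow g (-1) ≠ 0) (s : Fin 2 → Bool) : OscRep g (ℕ × ℕ) where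
  H m v := ((sgn (s m) * occ m v : ℤ) : ℂ)
  ap m := if s m then raiseOp m else lowerOp g (s m) m
  am m := if s m then lowerOp g (s m) m else raiseOp m
  H_ap m l := by
    cases h : s l
    · have := commutator_lowerOp g s m l
      simpa [h, sgn] using this
    · have := commutator_raiseOp s m l
      simpa [h, sgn] using this
  H_am m l := by
    cases h : s l
    · have := commutator_raiseOp s m l
      simpa [h, sgn, neg_one_smul_end] using this
    · have := commutator_lowerOp g s m l
      simpa [h, sgn, neg_one_smul_end] using this
  osc m := by
    cases h : s m
    · simp only [Bool.false_eq_true, if_false]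
      rw [lowerOp_mul_raiseOp, raiseOp_mul_lowerOp, smul_mono, smul_mono, mono_sub, one_eq_mono, smul_mono]
      refine mono_congr (fun v => ?_) fun _ _ => rfl
      rw [mul_one, (lowerCoeff_relation hd _).2]
    · simp only [if_true]
      rw [lowerOp_mul_raiseOp, raiseOp_mul_lowerOp, smul_mono, smul_mono, mono_sub, one_eq_mono, smul_mono]
      refine mono_congr (fun v => ?_) fun _ _ => rfl
      rw [mul_one, (lowerCoeff_relation hd _).1]
  ap_ap := by
    split_ifs
    · exact commute_raiseOp 0 1
    · exact commute_raiseOp_lowerOp g _ (by decide)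
    · exact (commute_raiseOp_lowerOp g _ (by decide)).symm
    · exact commute_lowerOp g _ _ (by decide)
  am_am := by
    split_ifs
    · exact commute_lowerOp g _ _ (by decide)
    · exact (commute_raiseOp_lowerOp g _ (by decide)).symm
    · exact commute_raiseOp_lowerOp g _ (by decide)
    · exact commute_raiseOp 0 1
  ap_am m l h := by
    split_ifs
    · exact commute_raiseOp_lowerOp g _ h
    · exact commute_raiseOp m l
    · exact commute_lowerOp g _ _ h
    · exact (commute_raiseOp_lowerOp g _ h.symm).symm

section
variable (g : ℝ) (hd : qpow g 1 - qpow g (-1) ≠ 0) (s : Fin 2 → Bool)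

theorem isBoundedMono_rhoY (t : ℂ) (r : Fin 3) : IsBoundedMono (rhoY (fockRep g hd s) t r) := by
  have hp : ∀ m, IsBoundedMono ((fockRep g hd s).ap m) := fun m => by
    simp only [fockRep]; split_ifs
    exacts [isBoundedMono_raiseOp m, isBoundedMono_lowerOp g _ m]
  have hm : ∀ m, IsBoundedMono ((fockRep g hd s).am m) := fun m => by
    simp only [fockRep]; split_ifs
    exacts [isBoundedMono_lowerOp g _ m, isBoundedMono_raiseOp m]
  have hq : ∀ k : ℤ, IsBoundedMono (diagOp fun v => qpow g ((k : ℂ) * (fockRep g hd s).H 1 v)) :=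
    fun k => ⟨id, _, 1, diagOp_eq_mono _, fun v => le_of_eq (by
      have := norm_qpow_real g ((k * (sgn (s 1) * occ 1 v) : ℤ) : ℝ)
      rw [Complex.ofReal_intCast, Int.cast_mul] at this
      exact this)⟩
  fin_cases r
  · have := hq (-1)
    simp only [Int.cast_neg, Int.cast_one, neg_mul, one_mul] at this
    exact ((this.mul (hm 0)).mul (hp 1)).smul _
  · exact hm 1
  · have := hq 1
    simp only [Int.cast_one, one_mul] at this
    exact (hp 0).mul this

/-- The two conditions make the twist a product `X^{n₁} Y^{n₂}` with `|X|, |Y| < 1`. The normalising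
trace is a product of two geometric sums, hence nonzero, and words in the generators are bounded. -/
theorem admissible_fockRep {bar : Bool} {i : Fin 3} {p : Fin 2 → ℂ}
    (h0 : 0 < (sgn (s 0) : ℝ) * (dot (e (unlabel bar i 2)) p).im)
    (h1 : (sgn (s 1) : ℝ) * (dot (e (unlabel bar i 1)) p).im < 0) :
    Admissible (fockRep g hd s) bar i p := by
  set B := dot (e (unlabel bar i 2)) p
  set C := dot (e (unlabel bar i 1)) p
  set X := Complex.exp (4 * Real.pi * Complex.I * (B * sgn (s 0))) with hX
  set Y := Complex.exp (-(4 * Real.pi * Complex.I * (C * sgn (s 1)))) with hY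
  have hX1 : ‖X‖ < 1 := by
    rw [hX, Complex.norm_exp, Real.exp_lt_one_iff]
    have : (4 * Real.pi * Complex.I * (B * sgn (s 0))).re = -(4 * Real.pi * (sgn (s 0) * B.im)) := by
      simp; ring
    rw [this, neg_lt_zero]; positivity
  have hY1 : ‖Y‖ < 1 := by
    rw [hY, Complex.norm_exp, Real.exp_lt_one_iff]
    have : (-(4 * Real.pi * Complex.I * (C * sgn (s 1)))).re = 4 * Real.pi * (sgn (s 1) * C.im) := by
      simp; ring
    rw [this]
    exact mul_neg_of_pos_of_neg (by positivity) h1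
  have htw : twist (fockRep g hd s) bar i p = fun v => X ^ v.1 * Y ^ v.2 := by
    ext v
    rw [twist_eq, hX, hY, ← Complex.exp_nat_mul, ← Complex.exp_nat_mul, ← Complex.exp_add]
    congr 1
    simp only [fockRep, occ, Matrix.cons_val]
    push_cast
    ring
  have sX : Summable fun n : ℕ => ‖X ^ n‖ := by
    simpa [norm_pow] using summable_geometric_of_lt_one (norm_nonneg X) hX1
  have sY : Summable fun n : ℕ => ‖Y ^ n‖ := by
    simpa [norm_pow] using summable_geometric_of_lt_one (norm_nonneg Y) hY1
  have hs : Summable (twist (fockRep g hd s) bar i p) := htw ▸ summable_mul_of_summable_norm sX sY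
  refine ⟨hs, ?_, fun n σ => ?_⟩
  · rw [Z, htw, ← tsum_mul_tsum_of_summable_norm sX sY, tsum_geometric_of_norm_lt_one hX1,
      tsum_geometric_of_norm_lt_one hY1]
    refine mul_ne_zero (inv_ne_zero (sub_ne_zero.2 ?_)) (inv_ne_zero (sub_ne_zero.2 ?_))
    · intro h; rw [← h, norm_one] at hX1; exact lt_irrefl _ hX1
    · intro h; rw [← h, norm_one] at hY1; exact lt_irrefl _ hY1
  · obtain ⟨K, hK⟩ := (isBoundedMono_list_prod (l := List.ofFn fun a =>
      rhoY (fockRep g hd s) (if bar then -1 else 1) (relabel bar i (σ a))) fun A hA => by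
        obtain ⟨a, rfl⟩ := (List.mem_ofFn' _ _).1 hA
        exact isBoundedMono_rhoY g hd s _ _).exists_norm_le
    refine Summable.of_norm_bounded (hs.norm.mul_right K) fun v => ?_
    rw [diagTerm, norm_mul]
    exact mul_le_mul_of_nonneg_left (hK v) (norm_nonneg _)

end

/-- There are representations which can be used on the whole domain. -/
theorem exists_admissible {g : ℝ} (hg0 : 0 < g) (hg1 : g < 1) (bar : Bool) (i : Fin 3) :
    ∃ π : OscRep g (ℕ × ℕ), ∀ p ∈ pDomain, Admissible π bar i p := by
  -- On the domain the imaginary part of `e_i p` is positive for the label 1 only. The highest or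
  -- lowest weight in each mode is chosen by this sign, which does not depend on `p`.
  refine ⟨fockRep g (qpow_one_sub_ne_zero hg0 hg1)
    ![decide (unlabel bar i 2 = 1), !decide (unlabel bar i 1 = 1)], fun p hp =>
      admissible_fockRep g _ _ ?_ ?_⟩
  · by_cases h : unlabel bar i 2 = 1
    · simpa [h, sgn] using im_dot_pos_of_mem hp
    · simpa [h, sgn] using im_dot_neg_of_mem hp h
  · by_cases h : unlabel bar i 1 = 1
    · simpa [h, sgn] using im_dot_pos_of_mem hp
    · simpa [h, sgn] using im_dot_neg_of_mem hp h

end W3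

end

noncomputable section

namespace W3

open MeasureTheory Filter Topology Set

/-! Dixon's theorem. -/

/-- Euler's limit formula, inverted; the factor `n/(n + s)` accounts for its one extra term in the
product. -/
theorem tendsto_Gamma_add_natCast_div {s : ℝ} (hs : 0 < s) :
    Tendsto (fun n : ℕ => Real.Gamma (s + n) / ((n : ℝ) ^ (s - 1) * n.factorial)) atTop (𝓝 1) := by
  have h1 := (Real.GammaSeq_tendsto_Gamma s).inv₀ (Real.Gamma_pos_of_pos hs).ne'
  have h2 := h1.const_mul (Real.Gamma s)
  rw [mul_inv_cancel₀ (Real.Gamma_pos_of_pos hs).ne'] at h2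
  have h3 : Tendsto (fun n : ℕ => (n : ℝ) / (n + s)) atTop (𝓝 1) := tendsto_natCast_div_add_atTop s
  have h4 := h2.mul h3
  rw [mul_one] at h4
  refine h4.congr' ?_
  filter_upwards [eventually_gt_atTop 0] with n hn
  have hn' : (0 : ℝ) < n := by exact_mod_cast hn
  have hG : ∀ m : ℕ, Real.Gamma (s + m) = Real.Gamma s * ∏ j ∈ Finset.range m, (s + j) := by
    intro m
    induction m with
    | zero => simp
    | succ m ih =>
      rw [Finset.prod_range_succ, ← mul_assoc, ← ih, Nat.cast_succ, ← add_assoc,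
        Real.Gamma_add_one (by positivity), mul_comm]
  rw [Real.GammaSeq, Finset.prod_range_succ, hG, Real.rpow_sub_one hn'.ne']
  have hp : ∏ j ∈ Finset.range n, (s + j) ≠ 0 := Finset.prod_ne_zero_iff.2 fun j _ => by positivity
  have hpow : (n : ℝ) ^ s ≠ 0 := (Real.rpow_pos_of_pos hn' s).ne'
  have hf : (n.factorial : ℝ) ≠ 0 := by positivity
  have hns : s + n ≠ 0 := by positivity
  have hns' : n + s ≠ 0 := by positivity
  field_simp
  ring

theorem tendsto_Gamma_ratio {s r : ℝ} (hs : 0 < s) (hr : 0 < r) :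
    Tendsto (fun n : ℕ => Real.Gamma (s + n) / Real.Gamma (r + n) * (n : ℝ) ^ (r - s)) atTop (𝓝 1) := by
  have h := (tendsto_Gamma_add_natCast_div hs).div (tendsto_Gamma_add_natCast_div hr) one_ne_zero
  rw [div_one] at h
  refine h.congr' ?_
  filter_upwards [eventually_gt_atTop 0] with n hn
  have hn' : (0 : ℝ) < n := by exact_mod_cast hn
  have e : (n : ℝ) ^ (r - s) = (n : ℝ) ^ (r - 1) / (n : ℝ) ^ (s - 1) := by
    rw [← Real.rpow_sub hn']; congr 1; ring
  have h1 := (Real.rpow_pos_of_pos hn' (s - 1)).ne'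
  have h2 := (Real.rpow_pos_of_pos hn' (r - 1)).ne'
  have hf : (n.factorial : ℝ) ≠ 0 := by positivity
  have h3 := (Real.Gamma_pos_of_pos (by positivity : 0 < r + n)).ne'
  rw [Pi.div_apply, e]
  field_simp

/-- The terms of the well-poised series `₃F₂(a, b, c; 1 + a - b, 1 + a - c; 1)`. -/
def dixonTerm (b c a : ℝ) (n : ℕ) : ℝ :=
  ∏ j ∈ Finset.range n, (a + j) * (b + j) * (c + j) / ((1 + j) * (1 + a - b + j) * (1 + a - c + j))

/-- The sum of the well-poised series. -/
def dixonValue (b c a : ℝ) : ℝ :=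
  Real.Gamma (1 + a / 2) / Real.Gamma (1 + a / 2 - b) *
    (Real.Gamma (1 + a / 2 - b - c) / Real.Gamma (1 + a / 2 - c)) *
    (Real.Gamma (1 + a - b) / Real.Gamma (1 + a)) *
    (Real.Gamma (1 + a - c) / Real.Gamma (1 + a - b - c))

/-- The conditions on the parameters. -/
structure DixonCond (b c a : ℝ) : Prop where
  a_pos : 0 < a
  b_pos : 0 < b
  c_pos : 0 < c
  ab : 0 < 1 + a - b
  ac : 0 < 1 + a - c
  ab' : 0 < 2 + a - 2 * b
  ac' : 0 < 2 + a - 2 * c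
  abc : 0 < 2 + a - 2 * b - 2 * c
  le : (1 - b) * (1 - c) ≤ a ^ 2

section
variable {b c a : ℝ}

theorem DixonCond.add_two (h : DixonCond b c a) : DixonCond b c (a + 2) := by
  obtain ⟨h1, h2, h3, h4, h5, h6, h7, h8, h9⟩ := h
  exact ⟨by linarith, h2, h3, by linarith, by linarith, by linarith, by linarith, by linarith,
    by nlinarith⟩

theorem DixonCond.add_nat (h : DixonCond b c a) (k : ℕ) : DixonCond b c (a + 2 * k) := by
  induction k with
  | zero => simpa using h
  | succ k ih =>
    have e : a + 2 * ((k + 1 : ℕ) : ℝ) = a + 2 * k + 2 := by push_cast; ring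
    exact e ▸ ih.add_two

theorem dixonTerm_succ (b c a : ℝ) (n : ℕ) : dixonTerm b c a (n + 1) = dixonTerm b c a n *
    ((a + n) * (b + n) * (c + n) / ((1 + n) * (1 + a - b + n) * (1 + a - c + n))) :=
  Finset.prod_range_succ _ _

theorem dixonTerm_pos (h : DixonCond b c a) (n : ℕ) : 0 < dixonTerm b c a n := by
  obtain ⟨h1, h2, h3, h4, h5, -, -, -, -⟩ := h
  exact Finset.prod_pos fun j _ => by positivity

/-- Factor by factor the claim reduces to `(1 - b)(1 - c) ≤ (a + j)² + 2 (a + j)`, which is the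
purpose of the last field of `DixonCond`. -/
theorem dixonTerm_add_two_le (h : DixonCond b c a) (n : ℕ) :
    dixonTerm b c (a + 2) n ≤ dixonTerm b c a n := by
  have h' := h.add_two
  obtain ⟨h1, h2, h3, h4, h5, -, -, -, h9⟩ := h
  obtain ⟨-, -, -, h4', h5', -, -, -, -⟩ := h'
  refine Finset.prod_le_prod (fun j _ => by positivity) fun j _ => ?_
  rw [div_le_div_iff₀ (by positivity) (by positivity)]
  have key : (a + 2 + j) * ((1 + a - b + j) * (1 + a - c + j)) ≤
      (a + j) * ((1 + (a + 2) - b + j) * (1 + (a + 2) - c + j)) := by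
    have hj : (0 : ℝ) ≤ j := j.cast_nonneg
    nlinarith [mul_nonneg h1.le hj]
  have hpos : (0 : ℝ) ≤ (b + j) * (c + j) * (1 + j) := by positivity
  nlinarith [mul_le_mul_of_nonneg_left key hpos]

/-- The ratio of consecutive values of the sum. -/
def dixonRatio (b c a : ℝ) : ℝ :=
  (1 + a - b - c) * (2 + a - b - c) * (2 + a - 2 * b) * (2 + a - 2 * c) * (a + 1) /
    ((2 + a - 2 * b - 2 * c) * ((1 + a - b) * (2 + a - b) * (1 + a - c) * (2 + a - c)))

/-- The polynomial in the telescoping certificate. -/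
def dixonPoly (b c a n : ℝ) : ℝ :=
  (n ^ 2 + (3 * (1 + a) - 2 * (b + c)) * n +
    (-2 + 4 * (b + c) - 2 * (b ^ 2 + c ^ 2) - 6 * b * c + 2 * b * c * (b + c) - a + a * (b + c) -
      a * b * c + 3 * a ^ 2 - 2 * a ^ 2 * (b + c) + 2 * a ^ 3) / a) / (2 + a - 2 * b - 2 * c)

/-- The telescoping certificate. -/
def dixonCert (b c a : ℝ) (n : ℕ) : ℝ :=
  n * dixonPoly b c a n / ((1 + a - b + n) * (1 + a - c + n)) * dixonTerm b c a n

/-- The telescoping equation divided by the terms of the series: an identity of polynomials in `n`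
once denominators are cleared. `dixonPoly` is the quadratic polynomial which solves it. -/
theorem dixonPoly_identity (ha : a ≠ 0) (hE : 2 + a - 2 * b - 2 * c ≠ 0) (n : ℝ) :
    (1 + a - b - c) * (2 + a - b - c) * (2 + a - 2 * b) * (2 + a - 2 * c) /
      (a * (2 + a - 2 * b - 2 * c)) * ((a + n) * (a + n + 1)) =
    (1 + a - b + n) * (2 + a - b + n) * ((1 + a - c + n) * (2 + a - c + n)) +
      ((a + n) * (b + n) * (c + n) * dixonPoly b c a (n + 1) -
        n * dixonPoly b c a n * ((2 + a - b + n) * (2 + a - c + n))) := by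
  have hP : ∀ m, dixonPoly b c a m = (a * m ^ 2 + a * (3 * (1 + a) - 2 * (b + c)) * m +
      (-2 + 4 * (b + c) - 2 * (b ^ 2 + c ^ 2) - 6 * b * c + 2 * b * c * (b + c) - a + a * (b + c) -
      a * b * c + 3 * a ^ 2 - 2 * a ^ 2 * (b + c) + 2 * a ^ 3)) / (a * (2 + a - 2 * b - 2 * c)) := by
    intro m
    rw [dixonPoly, ← div_div _ a]
    congr 1
    rw [add_div, ← mul_div_cancel_left₀ (m ^ 2 + (3 * (1 + a) - 2 * (b + c)) * m) ha]
    ring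
  have key : ∀ {D X Y Z u v w A B : ℝ}, D ≠ 0 → X * Y = Z * D + (u * A - v * B * w) →
      X / D * Y = Z + (u * (A / D) - v * (B / D) * w) := by
    intro D X Y Z u v w A B hD h
    field_simp
    linear_combination h
  rw [hP, hP]
  refine key (mul_ne_zero ha hE) ?_
  ring

theorem dixonTerm_add_two (h : DixonCond b c a) (n : ℕ) :
    dixonTerm b c (a + 2) n = dixonTerm b c a n *
      ((a + n) * (a + n + 1) * ((1 + a - b) * (2 + a - b) * (1 + a - c) * (2 + a - c)) /
        (a * (a + 1) * ((1 + a - b + n) * (2 + a - b + n) * ((1 + a - c + n) * (2 + a - c + n))))) := by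
  obtain ⟨h1, h2, h3, h4, h5, -, -, -, -⟩ := h
  have h6 : 0 < 2 + a - b := by linarith
  have h7 : 0 < 2 + a - c := by linarith
  induction n with
  | zero => simp [dixonTerm]; field_simp
  | succ n ih =>
    rw [dixonTerm_succ, dixonTerm_succ, ih]
    have e1 : 1 + (a + 2) - b + n = 3 + a - b + n := by ring
    have e2 : 1 + (a + 2) - c + n = 3 + a - c + n := by ring
    have e3 : 1 + a - b + (n + 1 : ℕ) = 2 + a - b + n := by push_cast; ring
    have e4 : 1 + a - c + (n + 1 : ℕ) = 2 + a - c + n := by push_cast; ring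
    have e5 : 2 + a - b + (n + 1 : ℕ) = 3 + a - b + n := by push_cast; ring
    have e6 : 2 + a - c + (n + 1 : ℕ) = 3 + a - c + n := by push_cast; ring
    have e7 : a + (n + 1 : ℕ) = a + n + 1 := by push_cast; ring
    rw [e1, e2, e3, e4, e5, e6, e7]
    have p1 : 0 < 1 + a - b + n := by positivity
    have p2 : 0 < 1 + a - c + n := by positivity
    have p3 : 0 < 2 + a - b + n := by positivity
    have p4 : 0 < 2 + a - c + n := by positivity
    have p5 : 0 < 3 + a - b + n := by linarith
    have p6 : 0 < 3 + a - c + n := by linarith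
    have p7 : 0 < 1 + (n : ℝ) := by positivity
    have p8 : 0 < a + 1 := by positivity
    field_simp
    ring

theorem dixon_telescope (h : DixonCond b c a) (n : ℕ) :
    dixonRatio b c a * dixonTerm b c (a + 2) n - dixonTerm b c a n =
      dixonCert b c a (n + 1) - dixonCert b c a n := by
  rw [dixonTerm_add_two h]
  obtain ⟨h1, h2, h3, h4, h5, -, -, h8, -⟩ := h
  have key := dixonPoly_identity (b := b) (c := c) h1.ne' h8.ne' n
  have h6 : 0 < 2 + a - b := by linarith
  have h7 : 0 < 2 + a - c := by linarith
  have e3 : 1 + a - b + (n + 1 : ℕ) = 2 + a - b + n := by push_cast; ring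
  have e4 : 1 + a - c + (n + 1 : ℕ) = 2 + a - c + n := by push_cast; ring
  rw [dixonCert, dixonCert, dixonTerm_succ, dixonRatio, e3, e4, Nat.cast_succ]
  have p1 : 0 < 1 + a - b + n := by positivity
  have p2 : 0 < 1 + a - c + n := by positivity
  have p3 : 0 < 2 + a - b + n := by positivity
  have p4 : 0 < 2 + a - c + n := by positivity
  have p7 : 0 < 1 + (n : ℝ) := by positivity
  have p8 : 0 < a + 1 := by positivity
  generalize dixonTerm b c a n = T
  generalize dixonPoly b c a (n + 1) = P' at *
  generalize dixonPoly b c a n = P at *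
  have lhs : (1 + a - b - c) * (2 + a - b - c) * (2 + a - 2 * b) * (2 + a - 2 * c) * (a + 1) /
      ((2 + a - 2 * b - 2 * c) * ((1 + a - b) * (2 + a - b) * (1 + a - c) * (2 + a - c))) *
      (T * ((a + n) * (a + n + 1) * ((1 + a - b) * (2 + a - b) * (1 + a - c) * (2 + a - c)) /
        (a * (a + 1) * ((1 + a - b + n) * (2 + a - b + n) * ((1 + a - c + n) * (2 + a - c + n)))))) =
      T / ((1 + a - b + n) * (2 + a - b + n) * ((1 + a - c + n) * (2 + a - c + n))) *
      ((1 + a - b - c) * (2 + a - b - c) * (2 + a - 2 * b) * (2 + a - 2 * c) /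
      (a * (2 + a - 2 * b - 2 * c)) * ((a + n) * (a + n + 1))) := by
    field_simp
  rw [lhs, key]
  field_simp
  ring

/-- A quadratic polynomial stands over a product of two linear factors, so the certificate is at
most of the order of `n` times the term. -/
theorem exists_norm_dixonCert_le (h : DixonCond b c a) :
    ∃ C : ℝ, 0 < C ∧ ∀ n : ℕ, |dixonCert b c a n| ≤ C * (n * dixonTerm b c a n) := by
  have hT := dixonTerm_pos h
  obtain ⟨h1, h2, h3, h4, h5, -, -, h8, -⟩ := h
  set p1 := 3 * (1 + a) - 2 * (b + c)
  set p0 := (-2 + 4 * (b + c) - 2 * (b ^ 2 + c ^ 2) - 6 * b * c + 2 * b * c * (b + c) - a + a * (b + c) -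
      a * b * c + 3 * a ^ 2 - 2 * a ^ 2 * (b + c) + 2 * a ^ 3) / a
  refine ⟨(1 + |p1| + |p0|) / (2 + a - 2 * b - 2 * c), by positivity, fun n => ?_⟩
  rcases Nat.eq_zero_or_pos n with rfl | hn
  · simp [dixonCert]
  have hn' : (1 : ℝ) ≤ n := by exact_mod_cast hn
  have hP : dixonPoly b c a n = (n ^ 2 + p1 * n + p0) / (2 + a - 2 * b - 2 * c) := rfl
  have hD : (n : ℝ) ^ 2 ≤ (1 + a - b + n) * (1 + a - c + n) := by nlinarith
  have hD0 : 0 < (1 + a - b + n) * (1 + a - c + n) := by positivity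
  have hN : |(n : ℝ) ^ 2 + p1 * n + p0| ≤ (1 + |p1| + |p0|) * n ^ 2 := by
    refine (abs_add_three _ _ _).trans ?_
    rw [abs_mul, abs_of_nonneg (by positivity : (0 : ℝ) ≤ n ^ 2), abs_of_nonneg (by positivity : (0 : ℝ) ≤ n)]
    have : (n : ℝ) ≤ n ^ 2 := by nlinarith
    nlinarith [mul_le_mul_of_nonneg_left this (abs_nonneg p1),
      mul_le_mul_of_nonneg_left (hn'.trans this) (abs_nonneg p0)]
  rw [dixonCert, hP, abs_mul, abs_of_pos (hT n), abs_div, abs_mul, abs_div, abs_of_pos hD0, abs_of_pos h8,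
    abs_of_nonneg (by positivity : (0 : ℝ) ≤ n), ← mul_assoc]
  refine mul_le_mul_of_nonneg_right ?_ (hT n).le
  rw [div_le_iff₀ hD0]
  have : |(n : ℝ) ^ 2 + p1 * n + p0| ≤ (1 + |p1| + |p0|) * ((1 + a - b + n) * (1 + a - c + n)) :=
    hN.trans (mul_le_mul_of_nonneg_left hD (by positivity))
  calc n * (|(n : ℝ) ^ 2 + p1 * n + p0| / (2 + a - 2 * b - 2 * c))
      ≤ n * ((1 + |p1| + |p0|) * ((1 + a - b + n) * (1 + a - c + n)) / (2 + a - 2 * b - 2 * c)) := by gcongr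
    _ = _ := by ring

theorem summable_dixonTerm_add_two (h : DixonCond b c a) (hs : Summable (dixonTerm b c a)) :
    Summable (dixonTerm b c (a + 2)) :=
  hs.of_nonneg_of_le (fun n => (dixonTerm_pos h.add_two n).le) (dixonTerm_add_two_le h)

/-- The telescoping sum converges, hence so does the certificate. A nonzero limit would force the
terms to be at least a constant over `n`, against summability; no asymptotics of the terms are
needed. -/
theorem tsum_dixonTerm_add_two (h : DixonCond b c a) (hs : Summable (dixonTerm b c a)) :
    dixonRatio b c a * ∑' n, dixonTerm b c (a + 2) n = ∑' n, dixonTerm b c a n := by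
  have hs2 := (summable_dixonTerm_add_two h hs).mul_left (dixonRatio b c a)
  have hsum := (hs2.hasSum.sub hs.hasSum).tendsto_sum_nat
  simp_rw [dixon_telescope h, Finset.sum_range_sub] at hsum
  have h0 : dixonCert b c a 0 = 0 := by simp [dixonCert]
  simp_rw [h0, sub_zero] at hsum
  rw [tsum_mul_left] at hsum
  set L := dixonRatio b c a * ∑' n, dixonTerm b c (a + 2) n - ∑' n, dixonTerm b c a n with hL
  suffices L = 0 by linarith
  by_contra hne
  obtain ⟨C, hC0, hC⟩ := exists_norm_dixonCert_le h
  have hev : ∀ᶠ n : ℕ in atTop, |L| / 2 < |dixonCert b c a n| :=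
    hsum.abs.eventually (lt_mem_nhds (half_lt_self (abs_pos.2 hne)))
  have hbig : Summable fun n : ℕ => |L| / 2 / C * (1 / (n : ℝ)) := by
    refine Summable.of_norm_bounded_eventually_nat hs ?_
    filter_upwards [hev, eventually_gt_atTop 0] with n hn hn0
    have hn' : (0 : ℝ) < n := by exact_mod_cast hn0
    rw [Real.norm_of_nonneg (by positivity)]
    have := hn.le.trans (hC n)
    rw [div_mul_div_comm, mul_one, div_le_iff₀ (by positivity)]
    linarith
  refine Real.not_summable_one_div_natCast ((summable_mul_left_iff ?_).1 hbig)
  positivity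

theorem dixonRatio_mul_value (h : DixonCond b c a) :
    dixonRatio b c a * dixonValue b c (a + 2) = dixonValue b c a := by
  obtain ⟨h1, h2, h3, h4, h5, h6, h7, h8, -⟩ := h
  have h9 : 0 < 1 + a - b - c := by linarith
  have hG : ∀ x : ℝ, 0 < x → Real.Gamma (x + 1) = x * Real.Gamma x := fun x hx => Real.Gamma_add_one hx.ne'
  have hG2 : ∀ x : ℝ, 0 < x → Real.Gamma (x + 2) = (x + 1) * (x * Real.Gamma x) := fun x hx => by
    rw [← hG x hx, ← hG (x + 1) (by linarith)]; ring_nf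
  have g1 := hG (1 + a / 2) (by linarith)
  have g2 := hG (1 + a / 2 - b) (by linarith)
  have g3 := hG (1 + a / 2 - b - c) (by linarith)
  have g4 := hG (1 + a / 2 - c) (by linarith)
  have g5 := hG2 (1 + a - b) (by linarith)
  have g6 := hG2 (1 + a) (by linarith)
  have g7 := hG2 (1 + a - c) (by linarith)
  have g8 := hG2 (1 + a - b - c) (by linarith)
  have p2 := (Real.Gamma_pos_of_pos (by linarith : 0 < 1 + a / 2 - b)).ne'
  have p4 := (Real.Gamma_pos_of_pos (by linarith : 0 < 1 + a / 2 - c)).ne'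
  have p6 := (Real.Gamma_pos_of_pos (by linarith : 0 < 1 + a)).ne'
  have p8 := (Real.Gamma_pos_of_pos h9).ne'
  rw [dixonValue, dixonValue, dixonRatio]
  rw [show 1 + (a + 2) / 2 - b - c = 1 + a / 2 - b - c + 1 by ring,
    show 1 + (a + 2) / 2 - b = 1 + a / 2 - b + 1 by ring,
    show 1 + (a + 2) / 2 - c = 1 + a / 2 - c + 1 by ring,
    show 1 + (a + 2) / 2 = 1 + a / 2 + 1 by ring,
    show 1 + (a + 2) - b - c = 1 + a - b - c + 2 by ring,
    show 1 + (a + 2) - b = 1 + a - b + 2 by ring,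
    show 1 + (a + 2) - c = 1 + a - c + 2 by ring,
    show 1 + (a + 2) = 1 + a + 2 by ring, g1, g2, g3, g4, g5, g6, g7, g8]
  generalize Real.Gamma (1 + a / 2 - b - c) = G3
  generalize Real.Gamma (1 + a / 2 - b) = G2 at *
  generalize Real.Gamma (1 + a / 2 - c) = G4 at *
  generalize Real.Gamma (1 + a / 2) = G1
  generalize Real.Gamma (1 + a - b - c) = G8 at *
  generalize Real.Gamma (1 + a - b) = G5
  generalize Real.Gamma (1 + a - c) = G7
  generalize Real.Gamma (1 + a) = G6 at *
  have q1 : 0 < 1 + a / 2 - b := by linarith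
  have q2 : 0 < 1 + a / 2 - c := by linarith
  have q3 : 0 < 2 + a - b := by linarith
  have q4 : 0 < 2 + a - c := by linarith
  have q5 : 0 < 2 + a - b - c := by linarith
  rw [show 1 + a - b + 1 = 2 + a - b by ring, show 1 + a - c + 1 = 2 + a - c by ring,
    show 1 + a - b - c + 1 = 2 + a - b - c by ring, show 1 + a + 1 = 2 * (1 + a / 2) by ring,
    show 1 + a / 2 - b - c = (2 + a - 2 * b - 2 * c) / 2 by ring,
    show 1 + a / 2 - b = (2 + a - 2 * b) / 2 by ring, show 1 + a / 2 - c = (2 + a - 2 * c) / 2 by ring,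
    show 1 + a = a + 1 by ring, show 1 + a / 2 = (2 + a) / 2 by ring]
  have q6 : 0 < 2 + a := by linarith
  have q7 : 0 < a + 1 := by linarith
  rw [show a + 1 - b - c = 1 + a - b - c by ring, show a + 1 - b = 1 + a - b by ring,
    show a + 1 - c = 1 + a - c by ring]
  have z6 : 2 + a - b * 2 ≠ 0 := (by linarith : 0 < 2 + a - b * 2).ne'
  have z7 : 2 + a - c * 2 ≠ 0 := (by linarith : 0 < 2 + a - c * 2).ne'
  have z8 : 2 + a - b * 2 - c * 2 ≠ 0 := (by linarith : 0 < 2 + a - b * 2 - c * 2).ne'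
  field_simp

/-- The four Gamma quotients grow like `k^b`, `k^{-b}`, `(2k)^{-b}` and `(2k)^b`, and these powers
cancel. -/
theorem tendsto_dixonValue (h : DixonCond b c a) :
    Tendsto (fun k : ℕ => dixonValue b c (a + 2 * k)) atTop (𝓝 1) := by
  obtain ⟨h1, h2, h3, h4, h5, h6, h7, h8, -⟩ := h
  have t1 := tendsto_Gamma_ratio (by linarith : 0 < 1 + a / 2) (by linarith : 0 < 1 + a / 2 - b)
  have t2 := tendsto_Gamma_ratio (by linarith : 0 < 1 + a / 2 - b - c) (by linarith : 0 < 1 + a / 2 - c)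
  have hd : Tendsto (fun k : ℕ => 2 * k) atTop atTop := tendsto_id.const_mul_atTop' (by norm_num)
  have t3 := (tendsto_Gamma_ratio (by linarith : 0 < 1 + a - b) (by linarith : 0 < 1 + a)).comp hd
  have t4 := (tendsto_Gamma_ratio (by linarith : 0 < 1 + a - c) (by linarith : 0 < 1 + a - b - c)).comp hd
  have t := ((t1.mul t2).mul t3).mul t4
  simp only [mul_one] at t
  refine t.congr' ?_
  filter_upwards [eventually_gt_atTop 0] with k hk
  have hk' : (0 : ℝ) < k := by exact_mod_cast hk
  have e1 : 1 + a / 2 - b - (1 + a / 2) = -b := by ring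
  have e2 : 1 + a / 2 - c - (1 + a / 2 - b - c) = b := by ring
  have e3 : 1 + a - (1 + a - b) = b := by ring
  have e4 : 1 + a - b - c - (1 + a - c) = -b := by ring
  simp only [Function.comp, e1, e2, e3, e4, Nat.cast_mul, Nat.cast_ofNat]
  rw [Real.rpow_neg hk'.le, Real.rpow_neg (by positivity), dixonValue]
  rw [show 1 + (a + 2 * k) / 2 - b - c = 1 + a / 2 - b - c + k by ring,
    show 1 + (a + 2 * k) / 2 - b = 1 + a / 2 - b + k by ring,
    show 1 + (a + 2 * k) / 2 - c = 1 + a / 2 - c + k by ring,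
    show 1 + (a + 2 * k) / 2 = 1 + a / 2 + k by ring,
    show 1 + (a + 2 * k) - b - c = 1 + a - b - c + 2 * k by ring,
    show 1 + (a + 2 * k) - b = 1 + a - b + 2 * k by ring,
    show 1 + (a + 2 * k) - c = 1 + a - c + 2 * k by ring,
    show 1 + (a + 2 * k) = 1 + a + 2 * k by ring]
  have r1 := (Real.rpow_pos_of_pos hk' b).ne'
  have r2 := (Real.rpow_pos_of_pos (by positivity : 0 < 2 * (k : ℝ)) b).ne'
  field_simp

/-- The series at `a` dominates all the later ones. Every term with `n ≥ 1` tends to zero, because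
each of its factors is of order `1/a`; the leading 1 remains. -/
theorem tendsto_tsum_dixonTerm (h : DixonCond b c a) (hs : Summable (dixonTerm b c a)) :
    Tendsto (fun k : ℕ => ∑' n, dixonTerm b c (a + 2 * k) n) atTop (𝓝 1) := by
  have hle : ∀ (k n : ℕ), dixonTerm b c (a + 2 * k) n ≤ dixonTerm b c a n := by
    intro k n
    induction k with
    | zero => simp
    | succ k ih =>
      have e : a + 2 * ((k + 1 : ℕ) : ℝ) = a + 2 * k + 2 := by push_cast; ring
      exact e ▸ (dixonTerm_add_two_le (h.add_nat k) n).trans ih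
  have h1 : (∑' n : ℕ, if n = 0 then (1 : ℝ) else 0) = 1 := by
    rw [tsum_ite_eq]
  rw [← h1]
  refine tendsto_tsum_of_dominated_convergence hs (fun n => ?_) (Eventually.of_forall fun k n => ?_)
  · rcases Nat.eq_zero_or_pos n with rfl | hn
    · simp [dixonTerm]
    · rw [if_neg hn.ne']
      have hK : Tendsto (fun k : ℕ => a + 2 * (k : ℝ)) atTop atTop :=
        tendsto_atTop_add_const_left _ _ (tendsto_natCast_atTop_atTop.const_mul_atTop two_pos)
      have hlim : ∀ j : ℕ, Tendsto (fun x : ℝ => (x + j) * (b + j) * (c + j) /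
          ((1 + j) * (1 + x - b + j) * (1 + x - c + j))) atTop (𝓝 0) := by
        intro j
        have l1 : Tendsto (fun x : ℝ => 1 + x - b + j) atTop atTop := by
          refine (tendsto_atTop_add_const_right _ (1 - b + j) tendsto_id).congr fun x => ?_
          simp only [id]; ring
        have l2 : Tendsto (fun x : ℝ => 1 + x - c + j) atTop atTop := by
          refine (tendsto_atTop_add_const_right _ (1 - c + j) tendsto_id).congr fun x => ?_
          simp only [id]; ring
        have i1 := tendsto_inv_atTop_zero.comp l1
        have i2 := tendsto_inv_atTop_zero.comp l2
        have := (i2.add ((i1.mul i2).mul_const (b - 1))).mul_const ((b + j) * (c + j) / (1 + j))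
        simp only [mul_zero, zero_mul, add_zero] at this
        refine this.congr' ?_
        filter_upwards [l1.eventually_gt_atTop 0, l2.eventually_gt_atTop 0] with x h1 h2
        simp only [Function.comp]
        have : (0 : ℝ) < 1 + j := by positivity
        field_simp
        ring
      have hp := tendsto_finsetProd (Finset.range n) fun j _ => (hlim j).comp hK
      rw [Finset.prod_const, Finset.card_range, zero_pow hn.ne'] at hp
      exact hp
  · rw [Real.norm_of_nonneg (dixonTerm_pos (h.add_nat k) n).le]
    exact hle k n

/-- Dixon's theorem. -/
theorem tsum_dixonTerm (h : DixonCond b c a) (hs : Summable (dixonTerm b c a)) :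
    ∑' n, dixonTerm b c a n = dixonValue b c a := by
  -- The sum and the closed form obey the same recurrence in `a → a + 2`, so their quotient is
  -- constant along the sequence, and both tend to 1.
  have hk : ∀ k : ℕ, Summable (dixonTerm b c (a + 2 * k)) ∧
      (∑' n, dixonTerm b c (a + 2 * k) n) * dixonValue b c a =
        (∑' n, dixonTerm b c a n) * dixonValue b c (a + 2 * k) := by
    intro k
    induction k with
    | zero => exact ⟨by simpa using hs, by simp⟩
    | succ k ih =>
      have e : a + 2 * ((k + 1 : ℕ) : ℝ) = a + 2 * k + 2 := by push_cast; ring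
      have hc := h.add_nat k
      rw [e]
      refine ⟨summable_dixonTerm_add_two hc ih.1, ?_⟩
      have h1 := ih.2
      rw [← tsum_dixonTerm_add_two hc ih.1, ← dixonRatio_mul_value hc] at h1
      have hr : dixonRatio b c (a + 2 * k) ≠ 0 := by
        obtain ⟨h1, h2, h3, h4, h5, h6, h7, h8, -⟩ := hc
        rw [dixonRatio]
        have q1 : 0 < 1 + (a + 2 * k) - b - c := by linarith
        have q5 : 0 < 2 + (a + 2 * k) - b - c := by linarith
        have q3 : 0 < 2 + (a + 2 * k) - b := by linarith
        have q4 : 0 < 2 + (a + 2 * k) - c := by linarith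
        positivity
      exact mul_left_cancel₀ hr (by linear_combination h1)
  have l1 := (tendsto_tsum_dixonTerm h hs).mul_const (dixonValue b c a)
  have l2 := (tendsto_dixonValue h).const_mul (∑' n, dixonTerm b c a n)
  simp_rw [(hk _).2] at l1
  have := tendsto_nhds_unique l1 l2
  linarith

end

end W3

end

noncomputable section

namespace W3

open MeasureTheory Filter Topology Set

/-! The case `p = (p, 0)`. -/

/-- The value of `J(p, 2p)`. -/
def dixonJ (g : ℝ) (p : ℂ) : ℂ :=
  Complex.Gamma (1 - g) ^ 2 * Complex.Gamma (1 - 3 * g / 2) / (2 * Complex.Gamma (1 - g / 2)) *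
    (Complex.Gamma (g + p) * Complex.Gamma (g / 2 + p) /
      (Complex.Gamma (1 - g + p) * Complex.Gamma (1 - g / 2 + p)))

/-- The series is well-poised with `a = g + 2p`, `b = g + p`, `c = g`, since `1 + a - b = 1 + p` and
`1 + a - c = 1 + 2p`. -/
theorem threeFTwoTerm_eq_dixonTerm {g p : ℝ} (hp : 0 < p) (n : ℕ) :
    threeFTwoTerm g (g + p) (g + (2 * p : ℂ)) (1 + p) (1 + (2 * p : ℂ)) n =
      (dixonTerm (g + p) g (g + 2 * p) n : ℂ) := by
  induction n with
  | zero => simp [threeFTwoTerm, dixonTerm]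
  | succ n ih =>
    rw [dixonTerm_succ, Complex.ofReal_mul, ← ih, threeFTwoTerm, threeFTwoTerm]
    have h1 : (1 + p + n : ℂ) ≠ 0 := by
      exact_mod_cast (by positivity : (0 : ℝ) < 1 + p + n).ne'
    have h2 : (1 + 2 * p + n : ℂ) ≠ 0 := by
      exact_mod_cast (by positivity : (0 : ℝ) < 1 + 2 * p + n).ne'
    have h3 : ((n : ℂ) + 1) ≠ 0 := by exact_mod_cast n.succ_ne_zero
    have e1 : 1 + (g + 2 * p) - (g + p) + n = 1 + p + n := by ring
    have e2 : 1 + (g + 2 * p) - g + n = 1 + 2 * p + n := by ring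
    rw [e1, e2]
    simp only [ascPochhammer_succ_eval, Nat.factorial_succ]
    push_cast
    rw [div_mul_div_comm]
    congr 1 <;> ring

/-- For these parameters the convergence condition `2 + a - 2b - 2c > 0` reads `2 - 3g > 0`. The
bound `p > 1/2` gives `a > 1`, which secures the auxiliary inequality of `DixonCond`. -/
theorem J_two_mul_of_real {g : ℝ} (hg0 : 0 < g) (hg1 : g < 2 / 3) {p : ℝ} (hp : 1 / 2 < p) :
    J g p (2 * p) = dixonJ g p := by
  have hx : -g < (p : ℂ).re := by rw [Complex.ofReal_re]; linarith
  have hy : -g < (2 * p : ℂ).re := by simp; linarith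
  have hcond : DixonCond (g + p) g (g + 2 * p) :=
    ⟨by linarith, by linarith, hg0, by linarith, by linarith, by linarith, by linarith, by linarith,
      by nlinarith⟩
  obtain ⟨hs, hJ⟩ := hasSum_threeFTwoTerm hg0 hg1 hx hy
  have hterm := threeFTwoTerm_eq_dixonTerm (g := g) (by linarith : 0 < p)
  have hs' : Summable (dixonTerm (g + p) g (g + 2 * p)) :=
    Complex.summable_ofReal.1 ((summable_congr hterm).1 hs)
  simp_rw [hterm] at hJ
  rw [← jIntegral_eq_J hg0 hg1 hx hy, hJ, ← Complex.ofReal_tsum, tsum_dixonTerm hcond hs', dixonValue,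
    dixonJ]
  rw [show 1 + (g + 2 * p) / 2 - (g + p) - g = 1 - 3 * g / 2 by ring,
    show 1 + (g + 2 * p) / 2 - (g + p) = 1 - g / 2 by ring,
    show 1 + (g + 2 * p) / 2 - g = 1 - g / 2 + p by ring,
    show 1 + (g + 2 * p) / 2 = g / 2 + p + 1 by ring,
    show 1 + (g + 2 * p) - (g + p) - g = 1 - g + p by ring,
    show 1 + (g + 2 * p) - (g + p) = 1 + p by ring,
    show 1 + (g + 2 * p) - g = 1 + 2 * p by ring,
    show 1 + (g + 2 * p) = g + 2 * p + 1 by ring,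
    Real.Gamma_add_one (by linarith : g / 2 + p ≠ 0), Real.Gamma_add_one (by linarith : g + 2 * p ≠ 0)]
  push_cast [← Complex.Gamma_ofReal]
  have hG : ∀ s : ℝ, 0 < s → Complex.Gamma s ≠ 0 := fun s h => by
    rw [Complex.Gamma_ofReal]; exact_mod_cast (Real.Gamma_pos_of_pos h).ne'
  have n1 := hG (1 + p) (by linarith)
  have n2 := hG (1 + 2 * p) (by linarith)
  have n3 := hG (g + 2 * p) (by linarith)
  have n4 := hG (1 - g / 2) (by linarith)
  have n5 := hG (1 - g / 2 + p) (by linarith)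
  have n6 := hG (1 - g + p) (by linarith)
  have n7 : (g + 2 * p : ℂ) ≠ 0 := by exact_mod_cast (by linarith : 0 < g + 2 * p).ne'
  push_cast at n1 n2 n3 n4 n5 n6
  rw [show (g / 2 + p : ℂ) * Complex.Gamma (g / 2 + p) =
    (g + 2 * p : ℂ) * Complex.Gamma (g / 2 + p) / 2 by ring]
  generalize Complex.Gamma (1 + p) = G1 at *
  generalize Complex.Gamma (1 + 2 * p) = G2 at *
  generalize Complex.Gamma (g + 2 * p) = G3 at *
  generalize Complex.Gamma (1 - g / 2) = G4 at *
  generalize Complex.Gamma (1 - g / 2 + p) = G5 at *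
  generalize Complex.Gamma (1 - g + p) = G6 at *
  generalize (g + 2 * p : ℂ) = r at *
  field_simp

/-- The domain of analyticity of `dixonJ`. -/
def dixonDomain (g : ℝ) : Set ℂ := {p | NotPole (g + p) ∧ NotPole (g / 2 + p)}

theorem isOpen_dixonDomain (g : ℝ) : IsOpen (dixonDomain g) :=
  (isOpen_notPole.preimage (by fun_prop : Continuous fun p : ℂ => (g : ℂ) + p)).inter
    (isOpen_notPole.preimage (by fun_prop : Continuous fun p : ℂ => (g / 2 : ℂ) + p))

theorem isPreconnected_dixonDomain (g : ℝ) : IsPreconnected (dixonDomain g) := by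
  have h := isPreconnected_compl_countable
    ((countable_not_notPole (g : ℂ)).union (countable_not_notPole (g / 2 : ℂ)))
  rw [compl_union, compl_ofPred, compl_ofPred] at h
  simp only [not_not] at h
  exact h

theorem differentiable_inv_Gamma_add (c : ℂ) : Differentiable ℂ fun p => (Complex.Gamma (c + p))⁻¹ :=
  Complex.differentiable_one_div_Gamma.comp (f := fun p => c + p) (by fun_prop)

theorem analyticOnNhd_dixonJ (g : ℝ) : AnalyticOnNhd ℂ (dixonJ g) (dixonDomain g) := by
  refine DifferentiableOn.analyticOnNhd (fun p hp => DifferentiableAt.differentiableWithinAt ?_)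
    (isOpen_dixonDomain g)
  unfold dixonJ
  simp only [div_eq_mul_inv (_ * _) (_ * _), mul_inv (Complex.Gamma (1 - g + _))]
  refine (differentiableAt_const _).mul (DifferentiableAt.mul (DifferentiableAt.mul ?_ ?_) ?_)
  · exact (Complex.differentiableAt_Gamma _ hp.1).comp p (f := fun p => (g : ℂ) + p) (by fun_prop)
  · exact (Complex.differentiableAt_Gamma _ hp.2).comp p (f := fun p => (g / 2 : ℂ) + p) (by fun_prop)
  · exact ((differentiable_inv_Gamma_add _).mul (differentiable_inv_Gamma_add _)) p

/-- The identity theorem on a connected set, starting from real points that accumulate at 1. -/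
theorem J_two_mul {g : ℝ} (hg0 : 0 < g) (hg1 : g < 2 / 3) {p : ℂ} (h1 : NotPole (g + p))
    (h2 : NotPole (g + 2 * p)) : J g p (2 * p) = dixonJ g p := by
  set U : Set ℂ := {p | NotPole (g + p) ∧ NotPole (g + 2 * p)} with hU
  have hsub : U ⊆ dixonDomain g := fun p hp => ⟨hp.1, fun n hn => hp.2 (2 * n) (by
    push_cast; linear_combination 2 * hn)⟩
  have hUc : IsPreconnected U := by
    have hc : {p : ℂ | ¬ NotPole (g + 2 * p)}.Countable :=
      (countable_not_notPole (g : ℂ)).preimage (mul_right_injective₀ (two_ne_zero (α := ℂ)))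
    have h := isPreconnected_compl_countable ((countable_not_notPole (g : ℂ)).union hc)
    rw [compl_union, compl_ofPred, compl_ofPred] at h
    simp only [not_not] at h
    exact h
  have hJ : AnalyticOnNhd ℂ (fun p => J g p (2 * p)) U := fun p hp =>
    (analyticOnNhd_J hg0 hg1 (p, 2 * p) hp).comp (f := fun p : ℂ => (p, 2 * p)) (by fun_prop)
  have hone : (1 : ℂ) ∈ U :=
    ⟨notPole_of_re_pos (by simp; linarith), notPole_of_re_pos (by simp; linarith)⟩
  have hfreq : ∃ᶠ p in 𝓝[≠] (1 : ℂ), J g p (2 * p) = dixonJ g p := by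
    have ht : Tendsto (fun x : ℝ => (x : ℂ)) (𝓝[≠] 1) (𝓝[≠] 1) := by
      refine tendsto_nhdsWithin_of_tendsto_nhds_of_eventually_within _ ?_ ?_
      · exact (Complex.continuous_ofReal.tendsto' 1 1 (by simp)).mono_left nhdsWithin_le_nhds
      · filter_upwards [self_mem_nhdsWithin] with x hx
        simpa using hx
    refine ht.frequently (Eventually.frequently ?_)
    filter_upwards [mem_nhdsWithin_of_mem_nhds (lt_mem_nhds (by norm_num : (1 / 2 : ℝ) < 1))] with x hx
    exact J_two_mul_of_real hg0 hg1 hx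
  exact hJ.eqOn_of_preconnected_of_frequently_eq ((analyticOnNhd_dixonJ g).mono hsub) hUc hone hfreq ⟨h1, h2⟩

theorem two_mul_dot_horizontal (p : ℂ) : 2 * dot (e 0) ![p, 0] = p ∧ -(2 * dot (e 1) ![p, 0]) = 2 * p ∧
    2 * dot (e 2) ![p, 0] = p := by
  simp [dot, e]

/-- The closed form has fewer excluded points than `J(p, 2p)`: of the points with `g + 2p = -n`, the
factor `Γ(g/2 + p)` has poles only at those with even `n`. Hence the continuation reaches further
than the one obtained from `J`. -/
theorem isAnalyticContinuation_Hvac_horizontal {g : ℝ} (hg0 : 0 < g) (hg1 : g < 2 / 3) {ι : Type}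
    (π : OscRep g ι) (hadm : ∀ p ∈ pDomain, Admissible π false 0 p) :
    IsAnalyticContinuation (fun p : ℂ => Hvac π false 0 1 ![p, 0])
        (fun p => -(Real.pi / (2 * Real.sin (Real.pi * g))) *
          (g ^ 3 * Complex.Gamma (1 - 3 * g / 2) /
            (Complex.Gamma (1 - g / 2) * Complex.Gamma (1 - g))) *
          (Complex.Gamma (g + p) * Complex.Gamma (g / 2 + p) /
            (Complex.Gamma (1 - g + p) * Complex.Gamma (1 - g / 2 + p))))
        {p | p.im < 0} {p | NotPole (g + p) ∧ NotPole (g / 2 + p)} := by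
  have hS : (Real.sin (Real.pi * g) : ℂ) ≠ 0 := by
    exact_mod_cast (sin_pi_mul_pos hg0 (by linarith : g < 1)).ne'
  have n1 : Complex.Gamma (1 - g) ≠ 0 := Gamma_one_sub_ne_zero (by linarith : g < 1)
  have hform : ∀ p : ℂ, -(Real.pi / (2 * Real.sin (Real.pi * g))) *
      (g ^ 3 * Complex.Gamma (1 - 3 * g / 2) / (Complex.Gamma (1 - g / 2) * Complex.Gamma (1 - g))) *
      (Complex.Gamma (g + p) * Complex.Gamma (g / 2 + p) /
        (Complex.Gamma (1 - g + p) * Complex.Gamma (1 - g / 2 + p))) =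
      -(Real.pi * g ^ 3 / (Complex.Gamma (1 - g) ^ 3 * Real.sin (Real.pi * g))) * dixonJ g p := by
    intro p
    rw [dixonJ]
    generalize Complex.Gamma (g + p) * Complex.Gamma (g / 2 + p) /
        (Complex.Gamma (1 - g + p) * Complex.Gamma (1 - g / 2 + p)) = R
    generalize (Real.sin (Real.pi * g) : ℂ) = S at *
    field_simp
  refine ⟨isOpen_lt Complex.continuous_im continuous_const, ⟨-Complex.I, by simp⟩, fun p hp => ?_,
    isOpen_dixonDomain g, isPreconnected_dixonDomain g, ?_, fun p hp => ?_⟩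
  · have hp' : p.im ≠ 0 := ne_of_lt hp
    exact ⟨notPole_of_im_ne_zero (by simpa using hp'), notPole_of_im_ne_zero (by simpa using hp')⟩
  · simp_rw [hform]
    exact fun p hp => analyticAt_const.mul (analyticOnNhd_dixonJ g p hp)
  · have hp' : p.im ≠ 0 := ne_of_lt hp
    have hmem := vec_mem_pDomain hp
    have hJ : Jij g ![p, 0] 2 1 = dixonJ g p := by
      obtain ⟨-, e1, e2⟩ := two_mul_dot_horizontal p
      rw [Jij, e1, e2, J_two_mul hg0 hg1 (notPole_of_im_ne_zero (by simpa using hp'))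
        (notPole_of_im_ne_zero (by simpa using hp'))]
    simp only []
    rw [hform, Hvac_one π hg0 hg1 hmem (hadm _ hmem), show unlabel false 0 2 = 2 by decide,
      show unlabel false 0 1 = 1 by decide, hJ, barSign]
    simp only [Bool.false_eq_true, if_false]
    ring

theorem z_horizontal (p : ℂ) : z 0 ![p, 0] = Complex.exp (2 * Real.pi * Complex.I * p) ∧
    z 1 ![p, 0] = 1 ∧ z 2 ![p, 0] = Complex.exp (-(2 * Real.pi * Complex.I * p)) := by
  simp [z, dot, w]

/-- At `(p, 0)` the two values of `J` in the formula for `G₁` coincide. Their joint coefficient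
factorises into two sines, the ones that occur in the reflection formula. -/
theorem circle_sin_product (g : ℝ) (p : ℂ) : -2 * Real.pi * qpow g (-3 / 2) *
    (qpow g 1 * (qpow g 2 * z 0 ![p, 0] - z 1 ![p, 0]) - (qpow g 2 * z 1 ![p, 0] - z 2 ![p, 0])) =
    8 * Real.pi * Complex.sin (Real.pi * (g / 2 + p)) * Complex.sin (Real.pi * (g + p)) := by
  obtain ⟨z0, z1, z2⟩ := z_horizontal p
  set a := Complex.exp (Complex.I * Real.pi * g / 2) with ha
  set b := Complex.exp (Complex.I * Real.pi * p) with hb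
  have ha0 : a ≠ 0 := Complex.exp_ne_zero _
  have hb0 : b ≠ 0 := Complex.exp_ne_zero _
  have q1 : qpow g 1 = a ^ 2 := by rw [qpow, ha, ← Complex.exp_nat_mul]; congr 1; push_cast; ring
  have q2 : qpow g 2 = a ^ 4 := by rw [qpow, ha, ← Complex.exp_nat_mul]; congr 1; push_cast; ring
  have q3 : qpow g (-3 / 2) = (a ^ 3)⁻¹ := by
    rw [qpow, ha, ← Complex.exp_nat_mul, ← Complex.exp_neg]; congr 1; push_cast; ring
  have y0 : Complex.exp (2 * Real.pi * Complex.I * p) = b ^ 2 := by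
    rw [hb, ← Complex.exp_nat_mul]; congr 1; push_cast; ring
  have y2 : Complex.exp (-(2 * Real.pi * Complex.I * p)) = (b ^ 2)⁻¹ := by rw [Complex.exp_neg, y0]
  have s1 : Complex.sin (Real.pi * (g / 2 + p)) = ((a * b)⁻¹ - a * b) * Complex.I / 2 := by
    rw [Complex.sin, ha, hb, ← Complex.exp_add, ← Complex.exp_neg]; congr 4 <;> ring
  have s2 : Complex.sin (Real.pi * (g + p)) = ((a ^ 2 * b)⁻¹ - a ^ 2 * b) * Complex.I / 2 := by
    rw [Complex.sin, ← q1, qpow, hb, ← Complex.exp_add, ← Complex.exp_neg]; congr 4 <;> ring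
  rw [z0, z1, z2, q1, q2, q3, y0, y2, s1, s2]
  field_simp
  linear_combination -8 * (1 - a ^ 2 * b ^ 2) * (1 - a ^ 4 * b ^ 2) * Complex.I_sq

/-- The vacuum eigenvalue of `G₁` at `p = (p, 0)`. -/
theorem G1vac_horizontal {g : ℝ} (hg0 : 0 < g) (hg1 : g < 2 / 3) (p : ℂ) : G1vac g ![p, 0] =
      4 * Real.pi ^ 3 * Complex.Gamma (1 - g) ^ 2 * Complex.Gamma (1 - 3 * g / 2) /
        (Complex.Gamma (1 - g / 2) * Complex.Gamma (1 - g + p) * Complex.Gamma (1 - g - p) *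
          Complex.Gamma (1 - g / 2 + p) * Complex.Gamma (1 - g / 2 - p)) := by
  -- Both sides are continuous for all `p`, because `1/Γ` is entire, so real `p`, where poles may
  -- occur in `J`, can be left out.
  have hdense : Dense {p : ℂ | p.im ≠ 0} := (dense_compl_singleton (0 : ℝ)).preimage Complex.isOpenMap_im
  have hc1 : Continuous fun p : ℂ => G1vac g ![p, 0] := (continuous_G1vac hg0 hg1).comp (by fun_prop)
  have hG : ∀ c : ℂ, Continuous fun p => (Complex.Gamma (c + p))⁻¹ := fun c =>
    (differentiable_inv_Gamma_add c).continuous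
  have hG' : ∀ c : ℂ, Continuous fun p => (Complex.Gamma (c - p))⁻¹ := fun c => by
    simp only [sub_eq_add_neg]
    exact (hG c).comp continuous_neg
  have hc2 : Continuous fun p : ℂ =>
      4 * Real.pi ^ 3 * Complex.Gamma (1 - g) ^ 2 * Complex.Gamma (1 - 3 * g / 2) /
        (Complex.Gamma (1 - g / 2) * Complex.Gamma (1 - g + p) * Complex.Gamma (1 - g - p) *
          Complex.Gamma (1 - g / 2 + p) * Complex.Gamma (1 - g / 2 - p)) := by
    simp only [div_eq_mul_inv (_ * _), mul_inv]
    have := hG (1 - g); have := hG (1 - g / 2); have := hG' (1 - g); have := hG' (1 - g / 2)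
    fun_prop
  refine congrFun (Continuous.ext_on hdense hc1 hc2 fun p hp => ?_) p
  have hp' : p.im ≠ 0 := hp
  obtain ⟨e0, e1, e2⟩ := two_mul_dot_horizontal p
  have m1 : NotPole (g + p) := notPole_of_im_ne_zero (by simpa using hp')
  have m2 : NotPole (g + 2 * p) := notPole_of_im_ne_zero (by simpa using hp')
  have j0 : Jij g ![p, 0] 0 1 = dixonJ g p := by rw [Jij, e0, e1, J_two_mul hg0 hg1 m1 m2]
  have j2 : Jij g ![p, 0] 2 1 = dixonJ g p := by rw [Jij, e2, e1, J_two_mul hg0 hg1 m1 m2]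
  have h := G1vac_eq_J hg0 hg1 ![p, 0] 0
    (show _ ∧ _ from ⟨by rw [zero_add, e2]; exact m1, by rw [zero_add, sub_eq_add_neg, e1]; exact m2⟩)
    (show _ ∧ _ from ⟨by rw [e0]; exact m1, by rw [zero_add, sub_eq_add_neg, e1]; exact m2⟩)
  rw [zero_add, zero_add, j0, j2, ← sub_mul, ← mul_assoc, circle_sin_product] at h
  rw [h, dixonJ]
  -- Euler's reflection formula turns each product of a sine with a Gamma function of the numerator
  -- into a reciprocal Gamma function.
  have r1 := Complex.Gamma_mul_Gamma_one_sub (g / 2 + p)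
  have r2 := Complex.Gamma_mul_Gamma_one_sub (g + p)
  have hs : ∀ c : ℝ, Complex.sin (Real.pi * (c + p)) ≠ 0 := by
    intro c hc
    obtain ⟨k, hk⟩ := Complex.sin_eq_zero_iff.1 hc
    have hpi : (Real.pi : ℂ) ≠ 0 := by exact_mod_cast Real.pi_ne_zero
    have : (c : ℂ) + p = k := mul_left_cancel₀ hpi (by rw [hk, mul_comm])
    have := congrArg Complex.im this
    simp at this
    exact hp' this
  have s1 := hs (g / 2)
  have s2 := hs g
  push_cast at s1
  rw [show 1 - ((g : ℂ) / 2 + p) = 1 - g / 2 - p by ring, eq_div_iff s1] at r1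
  rw [show 1 - ((g : ℂ) + p) = 1 - g - p by ring, eq_div_iff s2] at r2
  have hn : ∀ c : ℂ, (c.im ≠ 0) → Complex.Gamma c ≠ 0 := fun c hc =>
    Complex.Gamma_ne_zero (notPole_of_im_ne_zero hc)
  have n1 := hn (1 - g / 2 - p) (by simpa using hp')
  have n2 := hn (1 - g - p) (by simpa using hp')
  have n3 := hn (1 - g / 2 + p) (by simpa using hp')
  have n4 := hn (1 - g + p) (by simpa using hp')
  have n5 : Complex.Gamma (1 - g / 2) ≠ 0 := by
    have := Gamma_one_sub_ne_zero (show g / 2 < 1 by linarith)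
    push_cast at this; exact this
  generalize Complex.Gamma (1 - g / 2 - p) = A at *
  generalize Complex.Gamma (1 - g - p) = B at *
  generalize Complex.Gamma (g / 2 + p) = A' at *
  generalize Complex.Gamma (g + p) = B' at *
  generalize Complex.sin (Real.pi * (g / 2 + p)) = S at *
  generalize Complex.sin (Real.pi * (g + p)) = S' at *
  generalize Complex.Gamma (1 - g / 2 + p) = C at *
  generalize Complex.Gamma (1 - g + p) = C' at *
  generalize Complex.Gamma (1 - g / 2) = D at *
  generalize Complex.Gamma (1 - 3 * g / 2) = E
  generalize Complex.Gamma (1 - g) = F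
  field_simp
  linear_combination 8 * F ^ 2 * E * ((A' * A * S) * r2 + Real.pi * r1)

end W3

end

/-! ### The theorem, assembled from the preceding parts. -/

theorem mainTheorem9 (g : ℝ) (hg0 : 0 < g) (hg1 : g < 2 / 3) :
    -- the vertex operator products and the integrals which define `G₁` and `A_i(t)` to first order
    (∀ (p : Fin 2 → ℂ) (σ : Fin 3 → Fin 3), Function.Bijective σ →
      (∀ u : Fin 3 → ℝ, StrictAnti u → (∀ a, u a ∈ Set.Ioo 0 (2 * Real.pi)) →
        W3.ProductConverges g p (W3.word σ u)) ∧
      ∀ m : W3.Osc →₀ ℕ, MeasureTheory.IntegrableOn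
        (fun u => MvPowerSeries.coeff m (W3.vertexProduct g p (W3.word σ u)))
        (W3.orderedDomain 3)) ∧
    -- the vacuum is an eigenvector of `G₁`; the eigenvalue is a Coulomb-type triple integral
    (∀ p : Fin 2 → ℂ,
      W3.nonlocalG g p 1 = W3.G1vac g p • W3.vacuum ∧
      MeasureTheory.IntegrableOn (fun u => W3.coulombIntegrand g p (u 0) (u 1) (u 2))
        W3.coulombDomain ∧
      W3.G1vac g p = W3.z 1 p * W3.coulombIntegral g p) ∧
    -- the hypergeometric integral
    (∀ x y : ℂ, -g < x.re → -g < y.re →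
      MeasureTheory.IntegrableOn (W3.jIntegrand g x y) W3.unitSquare ∧
      Summable (W3.threeFTwoTerm g (g + x) (g + y) (1 + x) (1 + y)) ∧
      W3.jIntegral g x y =
        Complex.Gamma (g + x) * Complex.Gamma (g + y) * Complex.Gamma (1 - g) ^ 2 /
          (Complex.Gamma (1 + x) * Complex.Gamma (1 + y)) *
          ∑' n, W3.threeFTwoTerm g (g + x) (g + y) (1 + x) (1 + y) n) ∧
    W3.IsAnalyticContinuation (E := ℂ × ℂ) (fun v => W3.jIntegral g v.1 v.2)
      (fun v => W3.J g v.1 v.2) {v | -g < v.1.re ∧ -g < v.2.re}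
      {v | W3.NotPole (g + v.1) ∧ W3.NotPole (g + v.2)} ∧
    -- `G₁` through the hypergeometric integral, in three forms
    (∀ (p : Fin 2 → ℂ) (i : Fin 3), p ∈ W3.regularSet g (i + 2) (i + 1) →
      p ∈ W3.regularSet g i (i + 1) →
      W3.G1vac g p = -2 * Real.pi * W3.qpow g (-3 / 2) *
        (W3.qpow g 1 * (W3.qpow g 2 * W3.z i p - W3.z (i + 1) p) * W3.Jij g p (i + 2) (i + 1) -
          (W3.qpow g 2 * W3.z (i + 1) p - W3.z (i + 2) p) * W3.Jij g p i (i + 1))) ∧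
    -- the representations used in the definition of `A_i(t)`, `Ā_i(t)` exist
    (∀ (bar : Bool) (i : Fin 3), ∃ π : W3.OscRep g (ℕ × ℕ), ∀ p ∈ W3.pDomain,
      W3.Admissible π bar i p) ∧
    -- the vacuum is an eigenvector of the first coefficient of `A_i(t)`, `Ā_i(t)`
    (∀ (ι : Type) (π : W3.OscRep g ι) (bar : Bool) (i : Fin 3), ∀ p ∈ W3.pDomain,
      W3.Admissible π bar i p →
      W3.aState π bar i p 1 = (-(W3.sRatio g * W3.Hvac π bar i 1 p)) • W3.vacuum) ∧
    -- `H₁^{(i)(vac)}` on the domain of the traces and its analytic continuation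
    (∀ (ι : Type) (π : W3.OscRep g ι) (i : Fin 3),
      (∀ p ∈ W3.pDomain, W3.Admissible π false i p →
        W3.Hvac π false i 1 p = -(Real.pi * g ^ 3 * W3.Jij g p (i + 2) (i + 1) /
          (Complex.Gamma (1 - g) ^ 3 * Real.sin (Real.pi * g)))) ∧
      ((∀ p ∈ W3.pDomain, W3.Admissible π false i p) →
        W3.IsAnalyticContinuation (W3.Hvac π false i 1)
          (fun p => -(Real.pi * g ^ 3 * W3.Jij g p (i + 2) (i + 1) /
            (Complex.Gamma (1 - g) ^ 3 * Real.sin (Real.pi * g))))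
          W3.pDomain (W3.regularSet g (i + 2) (i + 1)))) ∧
    -- `H̄₁^{(i)(vac)}` on the domain of the traces and its analytic continuation
    (∀ (ι : Type) (π : W3.OscRep g ι) (i : Fin 3),
      (∀ p ∈ W3.pDomain, W3.Admissible π true i p →
        W3.Hvac π true i 1 p = Real.pi * g ^ 3 * W3.Jij g p (i + 1) (i + 2) /
          (Complex.Gamma (1 - g) ^ 3 * Real.sin (Real.pi * g))) ∧
      ((∀ p ∈ W3.pDomain, W3.Admissible π true i p) →
        W3.IsAnalyticContinuation (W3.Hvac π true i 1)
          (fun p => Real.pi * g ^ 3 * W3.Jij g p (i + 1) (i + 2) /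
            (Complex.Gamma (1 - g) ^ 3 * Real.sin (Real.pi * g)))
          W3.pDomain (W3.regularSet g (i + 1) (i + 2)))) ∧
    -- the case `p = (p, 0)`
    (∀ p : ℂ, W3.G1vac g ![p, 0] =
      4 * Real.pi ^ 3 * Complex.Gamma (1 - g) ^ 2 * Complex.Gamma (1 - 3 * g / 2) /
        (Complex.Gamma (1 - g / 2) * Complex.Gamma (1 - g + p) * Complex.Gamma (1 - g - p) *
          Complex.Gamma (1 - g / 2 + p) * Complex.Gamma (1 - g / 2 - p))) ∧
    (∀ (ι : Type) (π : W3.OscRep g ι), (∀ p ∈ W3.pDomain, W3.Admissible π false 0 p) →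
      W3.IsAnalyticContinuation (fun p : ℂ => W3.Hvac π false 0 1 ![p, 0])
        (fun p => -(Real.pi / (2 * Real.sin (Real.pi * g))) *
          (g ^ 3 * Complex.Gamma (1 - 3 * g / 2) /
            (Complex.Gamma (1 - g / 2) * Complex.Gamma (1 - g))) *
          (Complex.Gamma (g + p) * Complex.Gamma (g / 2 + p) /
            (Complex.Gamma (1 - g + p) * Complex.Gamma (1 - g / 2 + p))))
        {p | p.im < 0} {p | W3.NotPole (g + p) ∧ W3.NotPole (g / 2 + p)}) := by
  have hg1' : g < 1 := by linarith
  refine ⟨fun p σ hσ => ⟨fun u hu hu' => W3.productConverges g p hσ.injective hu hu',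
      W3.integrableOn_vertexProduct hg0 hg1 p hσ.injective⟩,
    fun p => ⟨W3.nonlocalG_eigen hg0 hg1 p, W3.integrableOn_coulombIntegrand hg0 hg1 p,
      W3.G1vac_eq_coulomb hg0 hg1 p⟩,
    fun x y hx hy => ⟨W3.integrableOn_jIntegrand hg0 hg1 hx hy, W3.hasSum_threeFTwoTerm hg0 hg1 hx hy⟩,
    W3.isAnalyticContinuation_J hg0 hg1, fun p i h1 h2 => W3.G1vac_eq_J hg0 hg1 p i h1 h2,
    W3.exists_admissible hg0 hg1',
    fun ι π bar i p hp hadm => W3.aState_one_eigen π hg0 hg1 hp hadm, ?_, ?_,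
    W3.G1vac_horizontal hg0 hg1,
    fun ι π hadm => W3.isAnalyticContinuation_Hvac_horizontal hg0 hg1 π hadm⟩
  · intro ι π i
    have key : ∀ p ∈ W3.pDomain, W3.Admissible π false i p →
        W3.Hvac π false i 1 p = -(Real.pi * g ^ 3 * W3.Jij g p (i + 2) (i + 1) /
          (Complex.Gamma (1 - g) ^ 3 * Real.sin (Real.pi * g))) := fun p hp hadm => by
      have e : ∀ i : Fin 3, W3.unlabel false i 2 = i + 2 ∧ W3.unlabel false i 1 = i + 1 := by decide
      rw [W3.Hvac_one π hg0 hg1 hp hadm, (e i).1, (e i).2, W3.barSign, if_neg Bool.false_ne_true, one_mul]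
    have hne : ∀ i : Fin 3, i + 2 ≠ i + 1 := by decide
    exact ⟨key, fun hadm => W3.isAnalyticContinuation_Hvac hg0 hg1 (hne i)
      (c := -(Real.pi * g ^ 3 / (Complex.Gamma (1 - g) ^ 3 * Real.sin (Real.pi * g))))
      (fun p hp => key p hp (hadm p hp)) fun p => by ring⟩
  · intro ι π i
    have key : ∀ p ∈ W3.pDomain, W3.Admissible π true i p →
        W3.Hvac π true i 1 p = Real.pi * g ^ 3 * W3.Jij g p (i + 1) (i + 2) /
          (Complex.Gamma (1 - g) ^ 3 * Real.sin (Real.pi * g)) := fun p hp hadm => by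
      -- The transposition in `ρ̄_i` interchanges the two letters and thus the indices of `J`; the
      -- replacement of `t` by `-t` reverses the sign.
      have e : ∀ i : Fin 3, W3.unlabel true i 2 = i + 1 ∧ W3.unlabel true i 1 = i + 2 := by decide
      rw [W3.Hvac_one π hg0 hg1 hp hadm, (e i).1, (e i).2, W3.barSign, if_pos rfl, neg_one_mul, neg_neg]
    have hne : ∀ i : Fin 3, i + 1 ≠ i + 2 := by decide
    exact ⟨key, fun hadm => W3.isAnalyticContinuation_Hvac hg0 hg1 (hne i)
      (c := Real.pi * g ^ 3 / (Complex.Gamma (1 - g) ^ 3 * Real.sin (Real.pi * g)))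
      (fun p hp => key p hp (hadm p hp)) fun p => by ring⟩
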